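/- **Setting.** Let $\mathfrak n=\mathfrak n_1\oplus\dots\oplus\mathfrak n_\lambda$ be a stratified real Lie algebra ($[\mathfrak n_1,\mathfrak n_j]=\mathfrak n_{j+1}$ for $1\le j<\lambda$, $[\mathfrak n_1,\mathfrak n_\lambda]=0$) of finite dimension $n$, with an inner product on $\mathfrak n_1$. Let $N$ be the connected, simply connected Lie group of $\mathfrak n$, identified with $\mathfrak n$ by its exponential map (so $N=\mathfrak n$ with the Baker--Campbell--Hausdorff product and identity $0$), with the left-invariant sub-Riemannian structure $(D,g)$ given by $\mathfrak n_1$ and its inner product; $N$ is a Carnot group. Let $Z_1,\dots,Z_n$ be a basis of $\mathfrak n$ with $Z_i\in\mathfrak n_{w_i}$, let $z_1,\dots,z_n$ be the corresponding exponential coordinates, $\partial_i=\partial/\partial z_i$, and $\delta_s(z_1,\dots,z_n)=(s^{w_1}z_1,\dots,s^{w_n}z_n)$. For an absolutely continuous horizontal loop $\gamma:[0,1]\to N$ based at $0$, let $\ell(\gamma)=\int_0^1|\dot\gamma|_g\,dt$, and for a two-form $\alpha$ on $N$ let $\int_{\mathrm{disk}(\gamma)}\alpha$ be its integral over the radial disk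 $(s,t)\mapsto\delta_s(\gamma(t))$, $(s,t)\in[0,1]^2$. Let $G$ be a (finite-dimensional) Lie group with Lie algebra $\mathfrak g$ and any norm on $\mathfrak g$, and let $\pi:P\to N$ be a smooth principal $G$-bundle with connection $\omega$ and curvature $\Omega=d\omega+\frac12[\omega,\omega]$. For a loop $\gamma$ at $0$ and $p\in P_0=\pi^{-1}(0)$, the horizontal lift of $\gamma$ starting at $p$ ends at $p\cdot\mathrm{Hol}^\omega_p(\gamma)$. For $q \in P$ put $\Omega_{ij}(q)=\Omega_q(h\partial_i,h\partial_j)$, where $h$ denotes the $\omega$-horizontal lift to $q$, and for an equivariant $\varphi:P\to\mathfrak g$ put $\nabla^\omega_X\varphi=d\varphi(hX)$. Fix $p\in P_0$. For $x\in N$ let $s\mapsto\rho_x(s)$, $s \in [0,1]$, be the $\omega$-horizontal lift of the ray $s\mapsto\delta_s(x)$ with $\rho_x(0)=p$. Define, for an equivariant $\varphi$ and $m\ge 0$, $$\varphi^{(m)}(x)=\frac1{m!}\frac{d^m}{ds^m}\varphi(\rho_x(s))\Big|_{s=0},\qquad \varphi^{(m)}=0\ \text{ for } m<0,$$ $$\Omega^{(m)}=\frac12\sum_{i,j}\Omega_{ij}^{(m-w_i-w_j)}\,dz_i\wedge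 dz_j,\qquad \mathrm{Tay}^\omega_p(\Omega;k)=\sum_{m=0}^k\Omega^{(m)},$$ which are $\mathfrak g$-valued forms on $N$. Let $m_\Omega\in\{2,3,\dots,\infty\}$ be the largest $m$ such that $\Omega^{(j)}=0$ for all $j<m$, and let $F^k_p(\gamma)=\int_{\mathrm{disk}(\gamma)}\mathrm{Tay}^\omega_p(\Omega;k)$. **Theorem.** Let $k\ge0$ be an integer with $k<2m_\Omega$. 1. $\mathrm{Tay}^\omega_p(\Omega;k)$ is built from the iterated covariant derivatives of $\Omega$ at $p$: $$\mathrm{Tay}^\omega_p(\Omega;k)=\frac12\sum_{i,j}\ \sum_{\mu:\ w(\mu)+w_i+w_j\le k}\frac{z_\mu}{r(\mu)!}\,(\nabla^\omega_{\mu}\Omega_{ij})(p)\,dz_i\wedge dz_j ,$$ where $\mu=(\mu_1,\dots,\mu_r)$ runs over the finite (possibly empty) sequences in $\{1,\dots,n\}$, $r(\mu)=r$, $w(\mu)=\sum_a w_{\mu_a}$, $z_\mu=\prod_a z_{\mu_a}$ and $\nabla^\omega_\mu=\nabla^\omega_{\partial_{\mu_1}}\cdots\nabla^\omega_{\partial_{\mu_r}}$.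 2. $\mathrm{Hol}^\omega_p=\exp\left(-F^k_p+O(\ell^{k+1})\right)$: there are $\varepsilon>0$ and $C$ such that for every absolutely continuous horizontal loop $\gamma$ based at $0$ with $\ell(\gamma)<\varepsilon$ there is $R\in\mathfrak g$ with $\|R\|\le C\,\ell(\gamma)^{k+1}$ and $\mathrm{Hol}^\omega_p(\gamma)=\exp(-F^k_p(\gamma)+R)$. -/

import Mathlib

open Set MeasureTheory
open scoped Manifold ContDiff

noncomputable section

/-! ### Carnot groups in exponential coordinates -/

/-- A stratified real Lie algebra `𝔫 = 𝔫₁ ⊕ ⋯ ⊕ 𝔫_λ` with underlying vector space `V`: a Lie bracket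
on `V` and layers `layer j = 𝔫ⱼ` with `[𝔫₁, 𝔫ⱼ] = 𝔫ⱼ₊₁`, where `𝔫ⱼ = 0` unless `1 ≤ j ≤ λ`. -/
structure StratifiedLieAlgebra (V : Type*) [NormedAddCommGroup V] [InnerProductSpace ℝ V] where
  bracket : V →ₗ[ℝ] V →ₗ[ℝ] V
  bracket_self : ∀ x, bracket x x = 0
  jacobi : ∀ x y z,
    bracket x (bracket y z) + bracket y (bracket z x) + bracket z (bracket x y) = 0
  step : ℕ
  layer : ℕ → Submodule ℝ V
  isInternal : DirectSum.IsInternal layer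
  layer_zero : layer 0 = ⊥
  layer_of_gt : ∀ j, step < j → layer j = ⊥
  span_bracket : ∀ j, 1 ≤ j →
    Submodule.span ℝ {z | ∃ x ∈ layer 1, ∃ y ∈ layer j, bracket x y = z} = layer (j + 1)

/-- A basis `Z₁, …, Zₙ` of `𝔫` adapted to the stratification, `Zᵢ ∈ 𝔫_{wᵢ}`. -/
structure AdaptedBasis {V : Type*} [NormedAddCommGroup V] [InnerProductSpace ℝ V]
    (𝔫 : StratifiedLieAlgebra V) (n : ℕ) where
  basis : Module.Basis (Fin n) ℝ V
  weight : Fin n → ℕ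
  mem_layer : ∀ i, basis i ∈ 𝔫.layer (weight i)

namespace StratifiedLieAlgebra

variable {V : Type*} [NormedAddCommGroup V] [InnerProductSpace ℝ V] (𝔫 : StratifiedLieAlgebra V)

/-- The right-nested bracket `[x₁, [x₂, [⋯, x_k]⋯]]` of a word. -/
def nestedBracket : List V → V
  | [] => 0
  | [x] => x
  | x :: y :: l => 𝔫.bracket x (nestedBracket (y :: l))

/-- The group law of the Carnot group. The connected, simply connected Lie group `N` with Lie
algebra `𝔫` is realized, through its exponential map, as the space `V` itself with the
Baker-Campbell-Hausdorff product, here given by Dynkin's formula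
`∑ₙ (-1)ⁿ⁻¹/n ∑ [x^{r₁} y^{s₁} ⋯ x^{rₙ} y^{sₙ}] / (∑ (rᵢ + sᵢ) ∏ rᵢ! sᵢ!)`, over `rᵢ + sᵢ > 0`.
Words longer than the step have a vanishing bracket, so the sum is finite. The identity is `0`, the
inverse of `x` is `-x`, and `exp` is the identity map. -/
def mul (x y : V) : V :=
  ∑ n ∈ Finset.Icc 1 𝔫.step,
    ∑ r ∈ Fintype.piFinset fun _ : Fin n =>
        (Finset.range (𝔫.step + 1) ×ˢ Finset.range (𝔫.step + 1)).filter fun q => 0 < q.1 + q.2,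
      ((-1 : ℝ) ^ (n - 1) /
          ((n : ℝ) * ((∑ i, ((r i).1 + (r i).2) : ℕ) : ℝ) *
            ∏ i, (((r i).1.factorial : ℝ) * ((r i).2.factorial : ℝ)))) •
        𝔫.nestedBracket
          (List.ofFn fun i => List.replicate (r i).1 x ++ List.replicate (r i).2 y).flatten

/-- Left translation to the identity of a tangent vector `v` at `x`: the image of `v` under the
differential at `x` of `y ↦ x⁻¹ * y`. -/
def leftTriv (x v : V) : V := fderiv ℝ (fun y => 𝔫.mul (-x) y) x v

/-- A loop `γ : [0,1] → N` based at the identity which is absolutely continuous and horizontal for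
the left-invariant distribution `D` spanned by `𝔫₁`. -/
structure IsHorizontalLoop (γ : ℝ → V) : Prop where
  absolutelyContinuous : AbsolutelyContinuousOnInterval γ 0 1
  source : γ 0 = 0
  target : γ 1 = 0
  horizontal : ∀ᵐ t ∂volume.restrict (Icc (0 : ℝ) 1), 𝔫.leftTriv (γ t) (deriv γ t) ∈ 𝔫.layer 1

/-- The sub-Riemannian length `ℓ(γ) = ∫₀¹ |γ'(t)|_g dt` of a horizontal curve; `g` is the
left-invariant metric on `D` that is given on `𝔫₁` by the restriction of the inner product of `V`
(every inner product on `𝔫₁` is such a restriction). -/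
def length (γ : ℝ → V) : ℝ := ∫ t in (0 : ℝ)..1, ‖𝔫.leftTriv (γ t) (deriv γ t)‖

end StratifiedLieAlgebra

/-- The dilation `δ_s`, in exponential coordinates `z ↦ (s^{w₁} z₁, …, s^{wₙ} zₙ)`. -/
def AdaptedBasis.dilation {V : Type*} [NormedAddCommGroup V] [InnerProductSpace ℝ V]
    {𝔫 : StratifiedLieAlgebra V} {n : ℕ} (Z : AdaptedBasis 𝔫 n) (s : ℝ) (x : V) : V :=
  ∑ i, (s ^ Z.weight i * Z.basis.repr x i) • Z.basis i

/-- The integral `∫_{disk(γ)} α` of a two-form `α` on `N` over the radial disk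
`disk(γ)(s,t) = δ_s(γ(t))`, `(s,t) ∈ [0,1]²`. -/
def AdaptedBasis.diskIntegral {V : Type*} [NormedAddCommGroup V] [InnerProductSpace ℝ V]
    {𝔫 : StratifiedLieAlgebra V} {n : ℕ} (Z : AdaptedBasis 𝔫 n)
    {F : Type*} [NormedAddCommGroup F] [NormedSpace ℝ F] (α : V → V → V → F) (γ : ℝ → V) : F :=
  ∫ t in (0 : ℝ)..1, ∫ s in (0 : ℝ)..1,
    α (Z.dilation s (γ t)) (deriv (fun s' => Z.dilation s' (γ t)) s)
      (deriv (fun t' => Z.dilation s (γ t')) t)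

/-- The two-form `½ ∑ᵢⱼ cᵢⱼ^{(m - wᵢ - wⱼ)} dzᵢ ∧ dzⱼ` on `N`, for given families `cᵢⱼ^{(r)}` of
functions, with `cᵢⱼ^{(r)} = 0` for `r < 0`. -/
def AdaptedBasis.twoFormComponent {V : Type*} [NormedAddCommGroup V] [InnerProductSpace ℝ V]
    {𝔫 : StratifiedLieAlgebra V} {n : ℕ} (Z : AdaptedBasis 𝔫 n)
    {F : Type*} [NormedAddCommGroup F] [NormedSpace ℝ F]
    (c : Fin n → Fin n → ℕ → V → F) (m : ℕ) (x u v : V) : F :=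
  (2⁻¹ : ℝ) • ∑ i, ∑ j,
    if Z.weight i + Z.weight j ≤ m then
      (Z.basis.repr u i * Z.basis.repr v j - Z.basis.repr u j * Z.basis.repr v i) •
        c i j (m - (Z.weight i + Z.weight j)) x
    else 0

/-! ### Lie groups. The Lie algebra `𝔤 = T₁G` is the model space `EG` of `G`. -/

section LieGroups

variable {EG : Type*} [NormedAddCommGroup EG] [NormedSpace ℝ EG]
  (G : Type*) [TopologicalSpace G] [ChartedSpace EG G] [Group G]

/-- The bracket of the Lie algebra of `G`. -/
def lieBr (A B : EG) : EG :=
  let A' : GroupLieAlgebra 𝓘(ℝ, EG) G := A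
  let B' : GroupLieAlgebra 𝓘(ℝ, EG) G := B
  (⁅A', B'⁆ : GroupLieAlgebra 𝓘(ℝ, EG) G)

variable {G}

/-- The adjoint representation: `Ad a` is the differential at `1` of `x ↦ a x a⁻¹`. -/
def lieAd (a : G) : EG →L[ℝ] EG :=
  mfderiv 𝓘(ℝ, EG) 𝓘(ℝ, EG) (fun x : G => a * x * a⁻¹) 1

variable (G)

open Classical in
/-- The exponential map of `G`: the value at time `1` of the integral curve through `1` of the
left-invariant vector field of `A` (which exists, is unique, and is a one-parameter subgroup). -/
def lieExp (A : EG) : G :=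
  if h : ∃ c : ℝ → G, c 0 = 1 ∧
      IsMIntegralCurve (I := 𝓘(ℝ, EG)) c
        (mulInvariantVectorField (A : GroupLieAlgebra 𝓘(ℝ, EG) G))
  then h.choose 1 else 1

end LieGroups

/-! ### Principal bundles and connections -/

/-- A smooth principal `G`-bundle `π : P → N` over the manifold `N = V`: a smooth right action of `G`
on `P` (written `MulOpposite.op a • p` for `p · a`) and `G`-equivariant local trivializations
`π⁻¹(U) ≅ U × G`. -/
structure SmoothPrincipalBundle (V : Type*) [NormedAddCommGroup V] [NormedSpace ℝ V]
    {EG : Type*} [NormedAddCommGroup EG] [NormedSpace ℝ EG]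
    (G : Type*) [TopologicalSpace G] [ChartedSpace EG G] [Group G]
    {EP : Type*} [NormedAddCommGroup EP] [NormedSpace ℝ EP]
    (P : Type*) [TopologicalSpace P] [ChartedSpace EP P] [MulAction Gᵐᵒᵖ P] where
  proj : P → V
  contMDiff_proj : ContMDiff 𝓘(ℝ, EP) 𝓘(ℝ, V) ∞ proj
  contMDiff_act : ContMDiff (𝓘(ℝ, EP).prod 𝓘(ℝ, EG)) 𝓘(ℝ, EP) ∞
    fun q : P × G => MulOpposite.op q.2 • q.1
  locally_trivial : ∀ x : V, ∃ (U : Set V) (e : OpenPartialHomeomorph P (V × G)),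
    IsOpen U ∧ x ∈ U ∧ e.source = proj ⁻¹' U ∧ e.target = U ×ˢ univ ∧
    ContMDiffOn 𝓘(ℝ, EP) (𝓘(ℝ, V).prod 𝓘(ℝ, EG)) ∞ e e.source ∧
    ContMDiffOn (𝓘(ℝ, V).prod 𝓘(ℝ, EG)) 𝓘(ℝ, EP) ∞ e.symm e.target ∧
    (∀ p ∈ e.source, (e p).1 = proj p) ∧
    ∀ p ∈ e.source, ∀ a : G, e (MulOpposite.op a • p) = (proj p, (e p).2 * a)

variable {V : Type*} [NormedAddCommGroup V] [InnerProductSpace ℝ V]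
  {EG : Type*} [NormedAddCommGroup EG] [NormedSpace ℝ EG]
  {G : Type*} [TopologicalSpace G] [ChartedSpace EG G] [Group G]
  {EP : Type*} [NormedAddCommGroup EP] [NormedSpace ℝ EP]
  {P : Type*} [TopologicalSpace P] [ChartedSpace EP P] [MulAction Gᵐᵒᵖ P]

/-- A connection `ω` on a principal bundle: a smooth `𝔤`-valued one-form on `P` that returns `A` on
the fundamental vector field of `A ∈ 𝔤` and satisfies `R_a^* ω = Ad(a⁻¹) ω`. -/
structure PrincipalConnection [IsManifold 𝓘(ℝ, EP) ∞ P]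
    (B : SmoothPrincipalBundle V (EG := EG) G (EP := EP) P) where
  form : ∀ p : P, TangentSpace 𝓘(ℝ, EP) p →L[ℝ] EG
  smooth : ContMDiff 𝓘(ℝ, EP).tangent 𝓘(ℝ, EG) ∞
    fun v : TangentBundle 𝓘(ℝ, EP) P => form v.1 v.2
  fundamental : ∀ (p : P) (A : EG),
    form (MulOpposite.op (1 : G) • p)
      (mfderiv 𝓘(ℝ, EG) 𝓘(ℝ, EP) (fun a : G => MulOpposite.op a • p) 1 A) = A
  equivariant : ∀ (a : G) (p : P) (v : TangentSpace 𝓘(ℝ, EP) p),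
    form (MulOpposite.op a • p)
      (mfderiv 𝓘(ℝ, EP) 𝓘(ℝ, EP) (fun q : P => MulOpposite.op a • q) p v) =
      lieAd a⁻¹ (form p v)

/-- Absolutely continuous curves `[0,1] → P` in a manifold: continuous, and absolutely continuous in
every chart. -/
def ACCurve (ρ : ℝ → P) : Prop :=
  ContinuousOn ρ (Icc 0 1) ∧
    ∀ (q : P) (a b : ℝ), 0 ≤ a → a ≤ b → b ≤ 1 →
      (∀ t ∈ Icc a b, ρ t ∈ (chartAt EP q).source) →
      AbsolutelyContinuousOnInterval (fun t => chartAt EP q (ρ t)) a b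

namespace PrincipalConnection

variable [IsManifold 𝓘(ℝ, EP) ∞ P] {B : SmoothPrincipalBundle V (EG := EG) G (EP := EP) P}
  (conn : PrincipalConnection B)

/-- `ρ : [0,1] → P` is the `ω`-horizontal lift of the curve `γ : [0,1] → N` starting at `p`. -/
structure IsHorizontalLift (γ : ℝ → V) (p : P) (ρ : ℝ → P) : Prop where
  absolutelyContinuous : ACCurve (EP := EP) ρ
  source : ρ 0 = p
  proj_eq : ∀ t ∈ Icc (0 : ℝ) 1, B.proj (ρ t) = γ t
  horizontal : ∀ᵐ t ∂volume.restrict (Icc (0 : ℝ) 1),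
    ∃ L : TangentSpace 𝓘(ℝ, ℝ) t →L[ℝ] TangentSpace 𝓘(ℝ, EP) (ρ t),
      HasMFDerivAt 𝓘(ℝ, ℝ) 𝓘(ℝ, EP) ρ t L ∧ conn.form (ρ t) (L (1 : ℝ)) = 0

open Classical in
/-- The horizontal lift to `p` of a curve `γ : [0,1] → N`. -/
def curveLift (γ : ℝ → V) (p : P) : ℝ → P :=
  if h : ∃ ρ, conn.IsHorizontalLift γ p ρ then h.choose else fun _ => p

open Classical in
/-- The holonomy `Hol_p^ω(γ)` of a loop `γ`: the horizontal lift of `γ` to `p` ends at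
`p · Hol_p^ω(γ)`. -/
def holonomy (p : P) (γ : ℝ → V) : G :=
  if h : ∃ a : G, conn.curveLift γ p 1 = MulOpposite.op a • p then h.choose else 1

open Classical in
/-- The horizontal lift of a tangent vector `v` of `N` to `q ∈ P`. -/
def vectorLift (q : P) (v : V) : TangentSpace 𝓘(ℝ, EP) q :=
  if h : ∃ u : TangentSpace 𝓘(ℝ, EP) q,
      mfderiv 𝓘(ℝ, EP) 𝓘(ℝ, V) B.proj q u = v ∧ conn.form q u = 0
  then h.choose else 0

/-- The connection form read in the preferred chart of `P` at `q`, as a one-form on the model space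
of `P`. -/
def formInChart (q : P) (y : EP) : EP →L[ℝ] EG :=
  (conn.form ((extChartAt 𝓘(ℝ, EP) q).symm y)).comp
    (mfderiv 𝓘(ℝ, EP) 𝓘(ℝ, EP) (extChartAt 𝓘(ℝ, EP) q).symm y)

/-- The curvature `Ω = dω + ½ [ω, ω]`, that is `Ω(u,v) = dω(u,v) + [ω(u), ω(v)]` for `u, v ∈ T_q P`.
The exterior derivative at `q` is taken in the preferred chart at `q`, which is the one that
identifies `T_q P` with the model space. -/
def curvature (q : P) (u v : TangentSpace 𝓘(ℝ, EP) q) : EG :=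
  extDeriv (fun y => ContinuousAlternatingMap.ofSubsingleton ℝ EP EG (0 : Fin 1)
      (conn.formInChart q y)) (extChartAt 𝓘(ℝ, EP) q q) ![(u : EP), (v : EP)] +
    lieBr G (conn.form q u) (conn.form q v)

/-- The covariant derivative `∇^ω_v f` of a section of `Ad(P)`, seen as an equivariant function
`f : P → 𝔤`, along the constant-coefficient vector field `v`: the derivative of `f` along the
horizontal lift of `v`. -/
def covDeriv (v : V) (f : P → EG) (q : P) : EG :=
  mfderiv 𝓘(ℝ, EP) 𝓘(ℝ, EG) f q (conn.vectorLift q v)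

/-- The iterated covariant derivative `∇^{ω,j}_{v₁, …, v_j} f` along constant-coefficient vector
fields, which are parallel for the connection with `∇ ∂ᵢ = 0`. -/
def iterCovDeriv (l : List V) (f : P → EG) : P → EG := l.foldr conn.covDeriv f

variable {𝔫 : StratifiedLieAlgebra V} {n : ℕ} (Z : AdaptedBasis 𝔫 n)

/-- The coefficients `Ωᵢⱼ = Ω(∂ᵢ, ∂ⱼ)` in `Ω = ½ ∑ Ωᵢⱼ dzᵢ ∧ dzⱼ`, as equivariant functions on
`P`. -/
def curvatureCoeff (i j : Fin n) (q : P) : EG :=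
  conn.curvature q (conn.vectorLift q (Z.basis i)) (conn.vectorLift q (Z.basis j))

/-- The weighted component `f^{(m)}(x) = (1/m!) (d/ds)^m f(δ_s^ω(ζ⁻¹(x, p)))` at `s = 0`, for `p` over
the identity. Here `s ↦ δ_s^ω(ζ⁻¹(x, p))` is the horizontal curve over the ray `s ↦ δ_s(x)` that tends
to `p` as `s ↓ 0`. -/
def weightedComponent (p : P) (f : P → EG) (m : ℕ) (x : V) : EG :=
  ((m.factorial : ℝ)⁻¹) • iteratedDerivWithin m
    (fun s : ℝ => f (conn.curveLift (fun s' => Z.dilation s' x) p s)) (Icc 0 1) 0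

/-- The weight-`m` polynomial built from the iterated covariant derivatives of `f` at `p`:
`∑_{w(μ) = m} (z_μ / j(μ)!) (∇^ω_μ f)(p)`, over multi-indices `μ = (μ₁, …, μ_j)`; all weights are
positive, so `j ≤ m`. -/
def covariantComponent (p : P) (f : P → EG) (m : ℕ) (x : V) : EG :=
  ∑ j ∈ Finset.range (m + 1),
    ∑ μ ∈ (Finset.univ : Finset (Fin j → Fin n)).filter fun μ => ∑ a, Z.weight (μ a) = m,
      ((∏ a, Z.basis.repr x (μ a)) / (j.factorial : ℝ)) •
        conn.iterCovDeriv (List.ofFn fun a => Z.basis (μ a)) f p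

/-- The weighted component `Ω^{(m)}` of the curvature, a `𝔤`-valued two-form on `N`. -/
def curvatureComponent (p : P) (m : ℕ) (x u v : V) : EG :=
  Z.twoFormComponent (fun i j => conn.weightedComponent Z p (conn.curvatureCoeff Z i j)) m x u v

/-- The weighted Taylor polynomial `Tay_p^ω(Ω; k) = ∑_{m ≤ k} Ω^{(m)}` (the components with `m < 2`
vanish). -/
def curvatureTaylor (p : P) (k : ℕ) (x u v : V) : EG :=
  ∑ m ∈ Finset.range (k + 1), conn.curvatureComponent Z p m x u v

/-- The polynomial two-form of weight `≤ k` built from the iterated covariant derivatives of `Ω` at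
`p`. -/
def covariantTaylor (p : P) (k : ℕ) (x u v : V) : EG :=
  ∑ m ∈ Finset.range (k + 1), Z.twoFormComponent
    (fun i j => conn.covariantComponent Z p (conn.curvatureCoeff Z i j)) m x u v

/-- The weight `m_Ω ∈ {0, 1, …, ∞}` of the curvature at `p`: the largest `m` such that all components
of `Ω` of weight `< m` vanish. -/
def curvatureWeight (p : P) : ℕ∞ :=
  sSup {m : ℕ∞ | ∀ j : ℕ, (j : ℕ∞) < m → ∀ x u v, conn.curvatureComponent Z p j x u v = 0}

/-- The functional `F_p^k(γ) = ∫_{disk(γ)} Tay_p^ω(Ω; k)`. -/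
def taylorFunctional (p : P) (k : ℕ) (γ : ℝ → V) : EG :=
  Z.diskIntegral (conn.curvatureTaylor Z p k) γ

end PrincipalConnection

end

set_option linter.unusedSectionVars false

/-! ### Absolutely continuous curves in finite-dimensional spaces -/

section AbsolutelyContinuous

variable {E F : Type*} [NormedAddCommGroup E] [NormedSpace ℝ E]
  [NormedAddCommGroup F] [NormedSpace ℝ F] {f : ℝ → E} {a b c : ℝ}

/-! The proof takes place in the radial gauge. Let E be the generator of the dilations. Parallel
transport of p along the rays s ↦ δ_s(x) gives a smooth local section σ through p, and A = σ^*ω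
satisfies A(E) = 0 near 0 (`exists_radial_gauge`). Since σ is horizontal over the rays, the
components Ωᵢⱼ^{(m)} are the weighted Taylor components at 0 of the coefficients Fᵢⱼ of F = dA +
b(A, A), where b is an antisymmetric bilinear map (`curvatureCoeff_sec`, `weightedComponent_eq`).

Contract F with E. The quadratic term contains A(E) = 0 and drops out, and Cartan's formula gives
L_E A = ι_E F. Integration along a ray yields A_j(x) = ∫₀¹ ∑ᵢ wᵢ xᵢ s^(wᵢ + w_j - 1) Fᵢⱼ(δ_s x) ds
(`apply_basis_eq_radialIntegral`). This has two consequences. First, the integral of A along a short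
loop is exactly the integral of F over its radial disk, although F is not closed in general
(`diskIntegral_eq`). Second, if Fᵢⱼ vanishes to weighted order M - wᵢ - w_j, then A_j vanishes to
weighted order M - w_j (`vanishesTo_apply_basis`). Here M is m_Ω, or any large integer if m_Ω is
infinite, and k < 2M.

Part 1. In the gauge a covariant derivative is ∂ᵢ minus a zeroth-order term linear in Aᵢ. A
derivative along Zᵢ lowers the vanishing order by wᵢ, whereas the zeroth-order term changes it by M
- wᵢ. Hence iterated covariant and iterated ordinary derivatives of Fᵢⱼ along μ differ by a function
of order 2M - wᵢ - w_j - w(μ), and they agree at 0 as long as wᵢ + w_j + w(μ) < 2M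
(`iterate_localCovDeriv_apply_zero`). With ordinary derivatives the formula is the weighted Taylor
formula `taylorComponent_eq_sum`.

Part 2. By the ball-box estimate (`exists_ballBox`), a horizontal loop of length ℓ has coordinates
O(ℓ^{w_j}) and velocities O(|γ'| ℓ^{w_j - 1}), so that ∫ |A(γ')| = O(ℓ^M). The holonomy solves a
control system on G driven by -A(γ'), and its logarithm is -∫ A(γ') up to the square of ∫ |A(γ')|
(`exists_holonomy_eq_lieExp`). That error is O(ℓ^{2M}), which O(ℓ^{k+1}) absorbs. Finally -∫ A(γ')
is minus the disk integral of F, and replacing F by its Taylor polynomial of weight k costs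
O(ℓ^{k+1}), again by the ball-box estimate.

The analytic groundwork handles curves that are merely absolutely continuous: existence and
uniqueness of lifts come from a Picard iteration with integrable controls, while smoothness of the
radial gauge and of the logarithm comes from the inverse function theorem in spaces of continuous
functions. -/

theorem AbsolutelyContinuousOnInterval.comp_lipschitzOnWith {K : NNReal} {φ : E → F}
    (hf : AbsolutelyContinuousOnInterval f a b) (hφ : LipschitzOnWith K φ (f '' uIcc a b)) :
    AbsolutelyContinuousOnInterval (fun t => φ (f t)) a b := by
  rw [absolutelyContinuousOnInterval_iff] at hf ⊢
  intro ε hε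
  obtain ⟨δ, hδ, h⟩ := hf (ε / (K + 1)) (by positivity)
  refine ⟨δ, hδ, fun I hI hs => ?_⟩
  have h1 := h I hI hs
  calc ∑ i ∈ Finset.range I.1, dist (φ (f (I.2 i).1)) (φ (f (I.2 i).2))
      ≤ ∑ i ∈ Finset.range I.1, K * dist (f (I.2 i).1) (f (I.2 i).2) :=
        Finset.sum_le_sum fun i hi => hφ.dist_le_mul _ (mem_image_of_mem _ (hI.1 i hi).1) _
          (mem_image_of_mem _ (hI.1 i hi).2)
    _ = K * ∑ i ∈ Finset.range I.1, dist (f (I.2 i).1) (f (I.2 i).2) := by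
        rw [Finset.mul_sum]
    _ ≤ K * (ε / (K + 1)) := by gcongr
    _ < ε := by
        rw [mul_div_assoc', div_lt_iff₀ (by positivity)]
        nlinarith [K.2]

/-- The image of the interval is compact, and a C¹ map is Lipschitz on compact subsets of its open
domain. -/
theorem AbsolutelyContinuousOnInterval.comp_contDiffOn {φ : E → F} {O : Set E} (hO : IsOpen O)
    (hφ : ContDiffOn ℝ 1 φ O) (hf : AbsolutelyContinuousOnInterval f a b)
    (hm : ∀ t ∈ uIcc a b, f t ∈ O) :
    AbsolutelyContinuousOnInterval (fun t => φ (f t)) a b := by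
  have hc : IsCompact (f '' uIcc a b) := isCompact_uIcc.image_of_continuousOn hf.continuousOn
  have hsub : f '' uIcc a b ⊆ O := by rintro _ ⟨t, ht, rfl⟩; exact hm t ht
  obtain ⟨K, hK⟩ := LocallyLipschitzOn.exists_lipschitzOnWith_of_compact hc
    (f := φ) (by
      intro x hx
      obtain ⟨K, s, hs, h⟩ := ((hφ.contDiffAt (hO.mem_nhds (hsub hx))).exists_lipschitzOnWith)
      exact ⟨K, s, mem_nhdsWithin_of_mem_nhds hs, h⟩)
  exact hf.comp_lipschitzOnWith hK

theorem AbsolutelyContinuousOnInterval.clm_comp (L : E →L[ℝ] F)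
    (hf : AbsolutelyContinuousOnInterval f a b) :
    AbsolutelyContinuousOnInterval (fun t => L (f t)) a b :=
  hf.comp_lipschitzOnWith (L.lipschitz.lipschitzOnWith)

theorem AbsolutelyContinuousOnInterval.finset_sum {ι : Type*} (s : Finset ι) {g : ι → ℝ → E}
    (hg : ∀ i ∈ s, AbsolutelyContinuousOnInterval (g i) a b) :
    AbsolutelyContinuousOnInterval (fun t => ∑ i ∈ s, g i t) a b := by
  classical
  induction s using Finset.induction_on with
  | empty =>
    simpa using ((LipschitzWith.const (0 : E)).lipschitzOnWith (s := uIcc a b)).absolutelyContinuousOnInterval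
  | insert i s hi ih =>
    simp only [Finset.sum_insert hi]
    exact (hg i (by simp)).add (ih fun j hj => hg j (by simp [hj]))

variable [FiniteDimensional ℝ E]

theorem absolutelyContinuousOnInterval_of_coord {ι : Type*} [Fintype ι] (B : Module.Basis ι ℝ E)
    (h : ∀ i, AbsolutelyContinuousOnInterval (fun t => B.repr (f t) i) a b) :
    AbsolutelyContinuousOnInterval f a b := by
  have : f = fun t => ∑ i, B.repr (f t) i • B i := by
    funext t; exact (B.sum_repr (f t)).symm
  rw [this]
  exact AbsolutelyContinuousOnInterval.finset_sum _ fun i _ =>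
    (h i).clm_comp (ContinuousLinearMap.toSpanSingleton ℝ (B i))

theorem AbsolutelyContinuousOnInterval.coord {ι : Type*} [Finite ι] (B : Module.Basis ι ℝ E)
    (hf : AbsolutelyContinuousOnInterval f a b) (i : ι) :
    AbsolutelyContinuousOnInterval (fun t => B.repr (f t) i) a b :=
  hf.clm_comp (LinearMap.toContinuousLinearMap (B.coord i))

/-- Here and below, coordinates in a basis reduce Lebesgue differentiation and the fundamental
theorem of calculus to the scalar case. -/
theorem AbsolutelyContinuousOnInterval.ae_differentiableAt_of_finiteDimensional
    (hf : AbsolutelyContinuousOnInterval f a b) :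
    ∀ᵐ t, t ∈ uIcc a b → DifferentiableAt ℝ f t := by
  let B := Module.finBasis ℝ E
  have h : ∀ i, ∀ᵐ t, t ∈ uIcc a b → DifferentiableAt ℝ (fun t => B.repr (f t) i) t :=
    fun i => (hf.coord B i).ae_differentiableAt
  filter_upwards [ae_all_iff.2 h] with t ht hmem
  have : f = fun t => ∑ i, B.repr (f t) i • B i := by
    funext t; exact (B.sum_repr (f t)).symm
  rw [this]
  exact DifferentiableAt.fun_sum fun i _ => (ht i hmem).smul_const _

theorem AbsolutelyContinuousOnInterval.deriv_ae_eq_sum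
    {ι : Type*} [Fintype ι] (B : Module.Basis ι ℝ E)
    (hf : AbsolutelyContinuousOnInterval f a b) :
    ∀ᵐ t, t ∈ uIcc a b → deriv f t = ∑ i, deriv (fun t => B.repr (f t) i) t • B i := by
  filter_upwards [hf.ae_differentiableAt_of_finiteDimensional] with t ht hmem
  rw [← B.sum_repr (deriv f t)]
  refine Finset.sum_congr rfl fun i _ => ?_
  congr 1
  have := ((LinearMap.toContinuousLinearMap (B.coord i)).hasFDerivAt.comp_hasDerivAt t
    (ht hmem).hasDerivAt).deriv
  simpa [Function.comp_def] using this.symm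

theorem AbsolutelyContinuousOnInterval.intervalIntegrable_deriv_of_finiteDimensional
    (hf : AbsolutelyContinuousOnInterval f a b) :
    IntervalIntegrable (deriv f) volume a b := by
  let B := Module.finBasis ℝ E
  have h : IntervalIntegrable (fun t => ∑ i, deriv (fun t => B.repr (f t) i) t • B i)
      volume a b := by
    rw [intervalIntegrable_iff]
    refine integrable_finsetSum _ fun i _ => ?_
    have := (hf.coord B i).intervalIntegrable_deriv
    rw [intervalIntegrable_iff] at this
    exact this.smul_const _
  refine h.congr_ae ?_
  rw [Filter.EventuallyEq, ae_restrict_iff' measurableSet_uIoc]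
  filter_upwards [hf.deriv_ae_eq_sum B] with t ht hm
  exact (ht (uIoc_subset_uIcc hm)).symm

theorem AbsolutelyContinuousOnInterval.integral_deriv_eq_sub_of_finiteDimensional
    (hf : AbsolutelyContinuousOnInterval f a b) :
    ∫ t in a..b, deriv f t = f b - f a := by
  let B := Module.finBasis ℝ E
  apply B.ext_elem
  intro i
  have hc := (LinearMap.toContinuousLinearMap (B.coord i)).intervalIntegral_comp_comm
    hf.intervalIntegrable_deriv_of_finiteDimensional
  have h2 := (hf.coord B i).integral_deriv_eq_sub
  simp only [map_sub, Finsupp.sub_apply]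
  have h3 : ∫ t in a..b, deriv (fun t => B.repr (f t) i) t =
      ∫ t in a..b, (LinearMap.toContinuousLinearMap (B.coord i)) (deriv f t) := by
    apply intervalIntegral.integral_congr_ae
    filter_upwards [hf.ae_differentiableAt_of_finiteDimensional] with t ht hm
    have := ((LinearMap.toContinuousLinearMap (B.coord i)).hasFDerivAt.comp_hasDerivAt t
      (ht (uIoc_subset_uIcc hm)).hasDerivAt).deriv
    simpa [Function.comp_def] using this
  rw [h3, hc] at h2
  simpa using h2

theorem absolutelyContinuousOnInterval_of_integral {g : ℝ → E}
    (hg : IntervalIntegrable g volume a b) {y : E} (hc : c ∈ uIcc a b)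
    (hf : ∀ t ∈ uIcc a b, f t = y + ∫ s in c..t, g s) :
    AbsolutelyContinuousOnInterval f a b := by
  let B := Module.finBasis ℝ E
  refine absolutelyContinuousOnInterval_of_coord B fun i => ?_
  have hgi : IntervalIntegrable (fun t => B.repr (g t) i) volume a b := by
    rw [intervalIntegrable_iff] at hg ⊢
    exact (LinearMap.toContinuousLinearMap (B.coord i)).integrable_comp hg
  have h1 := hgi.absolutelyContinuousOnInterval_intervalIntegral hc
  have h2 : AbsolutelyContinuousOnInterval
      (fun t => B.repr y i + ∫ s in c..t, B.repr (g s) i) a b :=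
    ((LipschitzWith.const (B.repr y i)).lipschitzOnWith
      (s := uIcc a b)).absolutelyContinuousOnInterval.add h1
  have heq : ∀ t ∈ uIcc a b, B.repr y i + ∫ s in c..t, B.repr (g s) i = B.repr (f t) i := by
    intro t ht
    rw [hf t ht]
    have hsub : uIcc c t ⊆ uIcc a b := uIcc_subset_uIcc hc ht
    have := (LinearMap.toContinuousLinearMap (B.coord i)).intervalIntegral_comp_comm
      (hg.mono_set hsub)
    simp only [LinearMap.coe_toContinuousLinearMap', Module.Basis.coord_apply] at this
    rw [this]; simp
  rw [absolutelyContinuousOnInterval_iff] at h2 ⊢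
  intro ε hε
  obtain ⟨δ, hδ, h⟩ := h2 ε hε
  refine ⟨δ, hδ, fun I hI hs => ?_⟩
  convert h I hI hs using 2 with j hj
  have hj' := hI.1 j hj
  simp only [heq _ hj'.1, heq _ hj'.2]

theorem AbsolutelyContinuousOnInterval.congr {X : Type*} [PseudoMetricSpace X] {f g : ℝ → X}
    (hf : AbsolutelyContinuousOnInterval f a b) (h : ∀ t ∈ uIcc a b, g t = f t) :
    AbsolutelyContinuousOnInterval g a b := by
  rw [absolutelyContinuousOnInterval_iff] at hf ⊢
  intro ε hε
  obtain ⟨δ, hδ, h'⟩ := hf ε hε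
  refine ⟨δ, hδ, fun I hI hs => ?_⟩
  convert h' I hI hs using 2 with j hj
  have hj' := hI.1 j hj
  simp only [h _ hj'.1, h _ hj'.2]

/-- Both pieces are primitives of the same function `deriv f`, so `f` is a primitive of it on the
whole interval. -/
theorem AbsolutelyContinuousOnInterval.trans (hab : a ≤ b) (hbc : b ≤ c)
    (h₁ : AbsolutelyContinuousOnInterval f a b) (h₂ : AbsolutelyContinuousOnInterval f b c) :
    AbsolutelyContinuousOnInterval f a c := by
  have i1 := h₁.intervalIntegrable_deriv_of_finiteDimensional
  have i2 := h₂.intervalIntegrable_deriv_of_finiteDimensional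
  refine absolutelyContinuousOnInterval_of_integral (c := a) (y := f a) (i1.trans i2)
    left_mem_uIcc fun t ht => ?_
  rw [uIcc_of_le (hab.trans hbc)] at ht
  rcases le_total t b with htb | htb
  · have : AbsolutelyContinuousOnInterval f a t := h₁.mono (by
      rw [uIcc_of_le ht.1, uIcc_of_le hab]; exact Icc_subset_Icc le_rfl htb)
    rw [this.integral_deriv_eq_sub_of_finiteDimensional]; abel
  · have h3 : AbsolutelyContinuousOnInterval f b t := h₂.mono (by
      rw [uIcc_of_le htb, uIcc_of_le hbc]; exact Icc_subset_Icc le_rfl ht.2)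
    rw [← intervalIntegral.integral_add_adjacent_intervals i1
      h3.intervalIntegrable_deriv_of_finiteDimensional,
      h₁.integral_deriv_eq_sub_of_finiteDimensional,
      h3.integral_deriv_eq_sub_of_finiteDimensional]; abel

theorem AbsolutelyContinuousOnInterval.prodMk [FiniteDimensional ℝ F] {g : ℝ → F}
    (hf : AbsolutelyContinuousOnInterval f a b) (hg : AbsolutelyContinuousOnInterval g a b) :
    AbsolutelyContinuousOnInterval (fun t => (f t, g t)) a b := by
  have h1 := hf.clm_comp (ContinuousLinearMap.inl ℝ E F)
  have h2 := hg.clm_comp (ContinuousLinearMap.inr ℝ E F)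
  refine (h1.add h2).congr fun t _ => by simp

end AbsolutelyContinuous

/-! ### Superposition operators and smooth dependence of solutions on parameters -/

section Superposition

open Filter Topology

variable {K : Type*} [TopologicalSpace K] [CompactSpace K]
  {E F : Type*} [NormedAddCommGroup E] [NormedSpace ℝ E] [FiniteDimensional ℝ E]
  [NormedAddCommGroup F] [NormedSpace ℝ F]

/-- The derivative of `f` is uniformly continuous on a ball containing all the values involved, so
the mean value inequality on segments is uniform in the point of `K`. The candidate `T` is an
argument so that it can be supplied in a form suited to induction. -/
theorem hasFDerivAt_superposition {f : E → F} (hf : ContDiff ℝ 1 f) (u : C(K, E))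
    {T : C(K, E) →L[ℝ] C(K, F)} (hT : ∀ h t, T h t = fderiv ℝ f (u t) (h t)) :
    HasFDerivAt (fun v : C(K, E) => (ContinuousMap.mk f hf.continuous).comp v) T u := by
  rw [hasFDerivAt_iff_isLittleO, Asymptotics.isLittleO_iff]
  intro ε hε
  have hcont : Continuous (fderiv ℝ f) := hf.continuous_fderiv one_ne_zero
  have hcpt : IsCompact (Metric.closedBall (0 : E) (‖u‖ + 1)) := isCompact_closedBall _ _
  obtain ⟨δ, hδ, hδ'⟩ := Metric.uniformContinuousOn_iff.1
    (hcpt.uniformContinuousOn_of_continuous hcont.continuousOn) ε hε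
  have : Metric.ball u (min δ 1) ∈ 𝓝 u := Metric.ball_mem_nhds _ (by positivity)
  filter_upwards [this] with v hv
  rw [mem_ball_iff_norm] at hv
  rw [ContinuousMap.norm_le _ (by positivity)]
  intro t
  have hut : ‖u t‖ ≤ ‖u‖ := u.norm_coe_le_norm t
  have hvt : ‖v t - u t‖ ≤ ‖v - u‖ := (v - u).norm_coe_le_norm t
  simp only [ContinuousMap.sub_apply, ContinuousMap.comp_apply, ContinuousMap.coe_mk, hT]
  refine le_trans ?_ (mul_le_mul_of_nonneg_left hvt hε.le)
  have hconv : Convex ℝ (segment ℝ (u t) (v t)) := convex_segment _ _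
  refine hconv.norm_image_sub_le_of_norm_hasFDerivWithin_le'
    (f' := fderiv ℝ f) (fun x _ => (hf.differentiable one_ne_zero x).hasFDerivAt.hasFDerivWithinAt)
    (fun x hx => ?_) (left_mem_segment ℝ _ _) (right_mem_segment ℝ _ _)
  have hxu : ‖x - u t‖ ≤ ‖v t - u t‖ := by
    have := norm_sub_le_of_mem_segment hx
    rwa [norm_sub_rev (v t)]  at *
  have hx1 : ‖x‖ ≤ ‖u‖ + 1 := by
    have h1 : ‖x‖ ≤ ‖x - u t‖ + ‖u t‖ := by simpa using norm_add_le (x - u t) (u t)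
    linarith [hv.le.trans (min_le_right δ 1)]
  have := hδ' x (by simpa using hx1) (u t) (by simp; linarith) (by
    rw [dist_eq_norm]; linarith [hv.trans_le (min_le_left δ 1)])
  rw [dist_eq_norm] at this
  exact this.le

/-- The derivative at `u` is h ↦ ∑ᵢ (∂ᵢf ∘ u) hᵢ. Its coefficients are superposition operators of
the partial derivatives, so induction on the order applies with `f` varying. -/
theorem contDiff_superposition {f : E → F} (hf : ContDiff ℝ ∞ f) :
    ContDiff ℝ ∞ (fun v : C(K, E) => (ContinuousMap.mk f hf.continuous).comp v) := by
  let B := Module.finBasis ℝ E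
  let M : C(K, ℝ) →L[ℝ] C(K, F) →L[ℝ] C(K, F) :=
    LinearMap.mkContinuous₂ (LinearMap.mk₂ ℝ (fun (g : C(K, ℝ)) (h : C(K, F)) => g • h)
      (fun _ _ _ => add_smul _ _ _) (fun c g h => by ext t; simp [mul_smul])
      (fun _ _ _ => smul_add _ _ _) (fun c g h => by ext t; exact smul_comm (g t) c (h t))) 1 (fun g h => by
        rw [ContinuousMap.norm_le _ (by positivity)]
        intro t
        simp only [LinearMap.mk₂_apply, ContinuousMap.smul_apply', norm_smul, one_mul]
        exact mul_le_mul (g.norm_coe_le_norm t) (h.norm_coe_le_norm t) (norm_nonneg _)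
          (norm_nonneg _))
  let P : Fin (Module.finrank ℝ E) → C(K, E) →L[ℝ] C(K, ℝ) := fun i =>
    (LinearMap.toContinuousLinearMap (B.coord i)).compLeftContinuous ℝ K
  have hM : ∀ n : ℕ, ContDiff ℝ n (fun g : C(K, F) => M.flip g) := fun n =>
    IsBoundedLinearMap.contDiff (by exact ContinuousLinearMap.isBoundedLinearMap M.flip)
  rw [contDiff_infty]
  intro n
  induction n generalizing f with
  | zero =>
    rw [Nat.cast_zero, contDiff_zero]
    exact ContinuousMap.continuous_postcomp _
  | succ n ih =>
    have hdi : ∀ i, ContDiff ℝ ∞ fun y => fderiv ℝ f y (B i) := fun i =>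
      (hf.fderiv_right (m := ∞) (by simp)).clm_apply contDiff_const
    rw [Nat.cast_succ, contDiff_succ_iff_hasFDerivAt]
    refine ⟨fun u => ∑ i, ((M.flip ((ContinuousMap.mk _ (hdi i).continuous).comp u)).comp (P i)),
      ?_, fun u => ?_⟩
    · refine ContDiff.sum fun i _ => ContDiff.clm_comp ?_ contDiff_const
      exact (hM n).comp (ih (hdi i))
    · refine hasFDerivAt_superposition (hf.of_le (by exact_mod_cast le_top)) u fun h t => ?_
      conv_rhs => rw [← B.sum_repr (h t), map_sum]
      simp [M, P]

/-- The indefinite integral from `t₀`, as an operator on continuous functions on `[a, b]`. -/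
noncomputable def primitiveCLM (E : Type*) [NormedAddCommGroup E] [NormedSpace ℝ E]
    {a b t₀ : ℝ} (h₀ : t₀ ∈ Icc a b) : C(Icc a b, E) →L[ℝ] C(Icc a b, E) :=
  LinearMap.mkContinuous
    { toFun := fun u => ⟨fun t => ∫ s in t₀..t, IccExtend (h₀.1.trans h₀.2) u s,
        (intervalIntegral.continuous_primitive
          (fun _ _ => (u.continuous.Icc_extend' (h := h₀.1.trans h₀.2)).intervalIntegrable _ _)
          t₀).comp continuous_subtype_val⟩
      map_add' := fun u v => by
        ext t
        simp only [ContinuousMap.coe_mk, ContinuousMap.add_apply]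
        rw [← intervalIntegral.integral_add
          ((u.continuous.Icc_extend' (h := h₀.1.trans h₀.2)).intervalIntegrable _ _)
          ((v.continuous.Icc_extend' (h := h₀.1.trans h₀.2)).intervalIntegrable _ _)]
        rfl
      map_smul' := fun c u => by
        ext t
        simp only [ContinuousMap.coe_mk, ContinuousMap.smul_apply, RingHom.id_apply]
        rw [← intervalIntegral.integral_smul]
        rfl }
    (b - a) (fun u => by
      have hab : a ≤ b := h₀.1.trans h₀.2
      rw [ContinuousMap.norm_le _ (mul_nonneg (by linarith) (norm_nonneg _))]
      intro t
      have := intervalIntegral.norm_integral_le_of_norm_le_const (a := t₀) (b := t)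
        (f := IccExtend hab u) (C := ‖u‖) (fun s _ => u.norm_coe_le_norm _)
      refine this.trans ?_
      rw [mul_comm]
      gcongr
      rw [abs_sub_le_iff]
      constructor <;> linarith [h₀.1, h₀.2, t.2.1, t.2.2])

theorem primitiveCLM_apply {a b t₀ : ℝ} (h₀ : t₀ ∈ Icc a b) (u : C(Icc a b, F)) (t : Icc a b) :
    primitiveCLM F h₀ u t = ∫ s in t₀..t, IccExtend (h₀.1.trans h₀.2) u s := rfl

/-- A family of ordinary differential equations depending smoothly on a parameter, trivial for the
parameter `0`, has solutions on a given interval that depend smoothly on small parameters. -/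
theorem exists_contDiffOn_solution {X Y : Type*} [NormedAddCommGroup X] [NormedSpace ℝ X]
    [FiniteDimensional ℝ X] [NormedAddCommGroup Y] [NormedSpace ℝ Y] [FiniteDimensional ℝ Y]
    {a b t₀ : ℝ} (h₀ : t₀ ∈ Icc a b) {f : X × ℝ × Y → Y} (hf : ContDiff ℝ ∞ f)
    (hf0 : ∀ s y, f (0, s, y) = 0) (y₀ : Y) :
    ∃ U : Set X, IsOpen U ∧ (0 : X) ∈ U ∧ ∃ S : X → ℝ → Y,
      (∀ x, Continuous (S x)) ∧ (∀ t, S 0 t = y₀) ∧ (∀ t ∈ Icc a b, ContDiffOn ℝ ∞ (S · t) U) ∧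
      (∀ ε > 0, ∀ᶠ x in 𝓝 0, ∀ t ∈ Icc a b, ‖S x t - y₀‖ < ε) ∧
      ∀ x ∈ U, ∀ t ∈ Icc a b, S x t = y₀ + ∫ s in t₀..t, f (x, s, S x s) := by
  have hab : a ≤ b := h₀.1.trans h₀.2
  let K := Icc a b
  let W : X × C(K, Y) → C(K, X × ℝ × Y) := fun w =>
    (ContinuousMap.const K w.1).prodMk (ContinuousMap.prodMk ⟨Subtype.val, by fun_prop⟩ w.2)
  let N : C(K, X × ℝ × Y) → C(K, Y) := fun v => (ContinuousMap.mk f hf.continuous).comp v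
  have hN : ContDiff ℝ ∞ N := contDiff_superposition hf
  have hW : ContDiff ℝ ∞ W := by
    let L1 : X →L[ℝ] X × ℝ × Y := ContinuousLinearMap.inl ℝ X (ℝ × Y)
    let L2 : Y →L[ℝ] X × ℝ × Y :=
      (ContinuousLinearMap.inr ℝ X (ℝ × Y)).comp (ContinuousLinearMap.inr ℝ ℝ Y)
    let L : X × C(K, Y) →L[ℝ] C(K, X × ℝ × Y) :=
      ((L1.compLeftContinuous ℝ K).comp
        (ContinuousLinearMap.const ℝ K)).comp (ContinuousLinearMap.fst ℝ X C(K, Y)) +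
      (L2.compLeftContinuous ℝ K).comp (ContinuousLinearMap.snd ℝ X C(K, Y))
    have : W = fun w => L w + W (0, 0) := by
      funext w
      ext t <;> simp [W, L, L1, L2]
    rw [this]
    exact L.contDiff.add contDiff_const
  -- A solution with parameter x is a preimage of (x, c₀) under Φ, so the inverse function theorem
  -- at (0, c₀) yields all of them at once.
  let Φ : X × C(K, Y) → X × C(K, Y) := fun w => (w.1, w.2 - primitiveCLM Y h₀ (N (W w)))
  have hΦ : ContDiff ℝ ∞ Φ := contDiff_fst.prodMk
    (contDiff_snd.sub ((primitiveCLM Y h₀).contDiff.comp (hN.comp hW)))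
  let c₀ : C(K, Y) := ContinuousMap.const K y₀
  have hΦ0 : ∀ u : C(K, Y), Φ (0, u) = (0, u) := by
    intro u
    have : N (W (0, u)) = 0 := by ext t; simp [N, W, hf0]
    simp [Φ, this]
  have hd : Differentiable ℝ Φ := hΦ.differentiable (by simp)
  let D := fderiv ℝ Φ (0, c₀)
  have hDinr : ∀ h, D (0, h) = (0, h) := by
    intro h
    have h1 : HasFDerivAt (fun u : C(K, Y) => Φ (0, u))
        (D.comp (ContinuousLinearMap.inr ℝ X C(K, Y))) c₀ :=
      (hd (0, c₀)).hasFDerivAt.comp c₀ (hasFDerivAt_prodMk_right 0 c₀)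
    have h2 : HasFDerivAt (fun u : C(K, Y) => Φ (0, u)) (ContinuousLinearMap.inr ℝ X C(K, Y)) c₀ := by
      simp_rw [hΦ0]
      exact hasFDerivAt_prodMk_right 0 c₀
    simpa using DFunLike.congr_fun (h1.unique h2) h
  have hDfst : ∀ w, (D w).1 = w.1 := by
    intro w
    have h1 : HasFDerivAt (fun w => (Φ w).1) ((ContinuousLinearMap.fst ℝ X C(K, Y)).comp D)
      (0, c₀) := ((hd (0, c₀)).hasFDerivAt).fst
    have h2 : HasFDerivAt (fun w => (Φ w).1) (ContinuousLinearMap.fst ℝ X C(K, Y)) (0, c₀) :=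
      hasFDerivAt_fst
    simpa using DFunLike.congr_fun (h1.unique h2) w
  let Bl : X →L[ℝ] C(K, Y) :=
    (ContinuousLinearMap.snd ℝ X C(K, Y)).comp (D.comp (ContinuousLinearMap.inl ℝ X C(K, Y)))
  -- Triviality of the equation at parameter 0 makes the differential block triangular with identity
  -- blocks. Its inverse is explicit, whatever the off-diagonal block is.
  have hDeq : ∀ w, D w = (w.1, w.2 + Bl w.1) := by
    intro w
    have : D w = D (w.1, 0) + D (0, w.2) := by rw [← map_add]; simp
    ext1
    · simp [hDfst]
    · rw [this, hDinr]
      simp [Bl, add_comm]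
  let De : (X × C(K, Y)) ≃L[ℝ] (X × C(K, Y)) :=
    ContinuousLinearEquiv.equivOfInverse D
      ((ContinuousLinearMap.fst ℝ X C(K, Y)).prod
        (ContinuousLinearMap.snd ℝ X C(K, Y) - Bl.comp (ContinuousLinearMap.fst ℝ X C(K, Y))))
      (fun w => by simp [hDeq]) (fun w => by simp [hDeq])
  have hDe : HasFDerivAt Φ (De : (X × C(K, Y)) →L[ℝ] (X × C(K, Y))) (0, c₀) :=
    (hd (0, c₀)).hasFDerivAt
  let e := hΦ.contDiffAt.toOpenPartialHomeomorph Φ hDe (by simp)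
  have hecoe : ∀ w, e w = Φ w := fun w => rfl
  have hp : (0, c₀) ∈ e.source :=
    hΦ.contDiffAt.mem_toOpenPartialHomeomorph_source hDe (by simp)
  -- Smoothness of the inverse is needed on an open set and not only at the base point, hence the
  -- restriction to points with invertible differential.
  let Inv : Set (X × C(K, Y)) := {w | fderiv ℝ Φ w ∈ range
    ((↑) : ((X × C(K, Y)) ≃L[ℝ] (X × C(K, Y))) → ((X × C(K, Y)) →L[ℝ] (X × C(K, Y))))}
  have hInv : IsOpen Inv :=
    (ContinuousLinearEquiv.isOpen (𝕜 := ℝ)).preimage (hΦ.continuous_fderiv (by simp))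
  let O := e.target ∩ e.symm ⁻¹' Inv
  have hO : IsOpen O := e.symm.isOpen_inter_preimage hInv
  have hsym0 : e.symm (0, c₀) = (0, c₀) := by
    have := e.left_inv hp
    rwa [hecoe, hΦ0] at this
  have hO0 : (0, c₀) ∈ O := by
    refine ⟨?_, ?_⟩
    · have := e.map_source hp
      rwa [hecoe, hΦ0] at this
    · change e.symm (0, c₀) ∈ Inv
      rw [hsym0]
      exact ⟨De, rfl⟩
  let ι : X → X × C(K, Y) := fun x => (x, c₀)
  have hι : ContDiff ℝ ∞ ι := contDiff_id.prodMk contDiff_const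
  let U := ι ⁻¹' O
  have hU : IsOpen U := hO.preimage hι.continuous
  let S : X → C(K, Y) := fun x => (e.symm (ι x)).2
  have hS : ContDiffOn ℝ ∞ S U := by
    intro x hx
    obtain ⟨g, hg⟩ := hx.2
    have h1 : ContDiffAt ℝ ∞ e.symm (ι x) := e.contDiffAt_symm hx.1
      (f₀' := g) (by rw [hg]; exact (hd _).hasFDerivAt) hΦ.contDiffAt
    exact ((contDiff_snd.contDiffAt.comp _ h1).comp x hι.contDiffAt).contDiffWithinAt
  have hSolve : ∀ x ∈ U, S x = c₀ + primitiveCLM Y h₀ (N (W (x, S x))) := by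
    intro x hx
    have h1 : Φ (e.symm (ι x)) = ι x := e.right_inv hx.1
    have h2 : (e.symm (ι x)).1 = x := congrArg Prod.fst h1
    have h3 : (e.symm (ι x)).2 - primitiveCLM Y h₀ (N (W (e.symm (ι x)))) = c₀ :=
      congrArg Prod.snd h1
    have h4 : e.symm (ι x) = (x, S x) := Prod.ext h2 rfl
    rw [h4] at h3
    exact (sub_eq_iff_eq_add.1 h3)
  have hS0 : S 0 = c₀ := congrArg Prod.snd hsym0
  refine ⟨U, hU, hO0, fun x => IccExtend hab (S x), fun x => (S x).continuous.Icc_extend',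
    fun t => ?_, fun t ht => ?_, fun ε hε => ?_, fun x hx t ht => ?_⟩
  · simp [IccExtend, hS0, c₀]
  · have : (fun x => IccExtend hab (S x) t) = fun x => ContinuousMap.evalCLM ℝ (⟨t, ht⟩ : K) (S x) := by
      funext x; simp [IccExtend_of_mem hab _ ht]
    rw [this]
    exact (ContinuousMap.evalCLM ℝ (⟨t, ht⟩ : K)).contDiff.comp_contDiffOn hS
  · have hc : ContinuousAt S 0 := (hS.continuousOn).continuousAt (hU.mem_nhds hO0)
    have := hc.tendsto.eventually (Metric.ball_mem_nhds (S 0) hε)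
    filter_upwards [this] with x hx t ht
    rw [hS0, dist_eq_norm] at hx
    rw [IccExtend_of_mem hab _ ht]
    exact ((S x - c₀).norm_coe_le_norm ⟨t, ht⟩).trans_lt hx
  · change IccExtend hab (S x) t = y₀ + ∫ s in t₀..t, f (x, s, IccExtend hab (S x) s)
    rw [IccExtend_of_mem hab _ ht]
    have := DFunLike.congr_fun (hSolve x hx) ⟨t, ht⟩
    rw [this, ContinuousMap.add_apply, primitiveCLM_apply]
    simp only [c₀, ContinuousMap.const_apply, add_right_inj]
    refine intervalIntegral.integral_congr fun s hs => ?_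
    have hs' : s ∈ Icc a b := (uIcc_subset_Icc h₀ ht) hs
    simp only [IccExtend_of_mem hab _ hs']
    rfl

end Superposition

/-! ### Linear control systems with integrable controls -/

section Control

variable {E F : Type*} [NormedAddCommGroup E] [NormedSpace ℝ E] [CompleteSpace E]
  [NormedAddCommGroup F] [NormedSpace ℝ F]
  {R : E → F →L[ℝ] E} {K : NNReal} {u : ℝ → F} {a b t₀ : ℝ}

theorem intervalIntegrable_control (hR : Continuous R)
    (hu : IntervalIntegrable u volume a b) {z : ℝ → E} (hz : ContinuousOn z (uIcc a b)) :
    IntervalIntegrable (fun s => R (z s) (u s)) volume a b := by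
  rw [intervalIntegrable_iff] at hu ⊢
  have hRz : ContinuousOn (fun s => R (z s)) (uIcc a b) := hR.comp_continuousOn hz
  obtain ⟨M, hM⟩ := isCompact_uIcc.exists_bound_of_continuousOn hRz
  have hmeas : AEStronglyMeasurable (fun s => R (z s)) (volume.restrict (uIoc a b)) :=
    (hRz.mono uIoc_subset_uIcc).aestronglyMeasurable measurableSet_uIoc
  refine Integrable.mono' (hu.norm.const_mul M)
    ((ContinuousLinearMap.apply ℝ E (E := F)).flip.aestronglyMeasurable_comp₂ hmeas hu.1) ?_
  rw [ae_restrict_iff' measurableSet_uIoc]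
  refine Filter.Eventually.of_forall fun s hs => ?_
  exact (R (z s)).le_of_opNorm_le (hM s (uIoc_subset_uIcc hs)) (u s)

/-- This is the Picard estimate. The control enters only through its L¹ norm, so smallness of that
norm makes the integral operator a contraction for the supremum norm; no boundedness of the control
is needed. -/
theorem norm_integral_control_sub_le (hR : LipschitzWith K R)
    (hab : a ≤ b) (h₀ : t₀ ∈ Icc a b) (hu : IntervalIntegrable u volume a b)
    {z w : ℝ → E} (hz : ContinuousOn z (Icc a b)) (hw : ContinuousOn w (Icc a b)) {δ : ℝ}
    (hδ : ∀ s ∈ Icc a b, ‖z s - w s‖ ≤ δ) {t : ℝ} (ht : t ∈ Icc a b) :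
    ‖(∫ s in t₀..t, R (z s) (u s)) - ∫ s in t₀..t, R (w s) (u s)‖ ≤
      (K * ∫ s in a..b, ‖u s‖) * δ := by
  have hsub : uIcc t₀ t ⊆ uIcc a b := by
    rw [uIcc_of_le hab]; exact uIcc_subset_Icc h₀ ht
  have hu' := hu.mono_set hsub
  have hIcc : uIcc a b = Icc a b := uIcc_of_le hab
  rw [← intervalIntegral.integral_sub
    (intervalIntegrable_control hR.continuous hu' (hz.mono (hIcc ▸ hsub)))
    (intervalIntegrable_control hR.continuous hu' (hw.mono (hIcc ▸ hsub)))]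
  have hδ0 : 0 ≤ δ := (norm_nonneg _).trans (hδ _ h₀)
  have hsub' : uIoc t₀ t ⊆ Ioc a b := by
    rw [← uIoc_of_le hab]; exact uIoc_subset_uIoc_of_uIcc_subset_uIcc hsub
  have hun : IntegrableOn (fun s => ‖u s‖) (Ioc a b) := by
    have := hu.norm
    rwa [intervalIntegrable_iff, uIoc_of_le hab] at this
  refine (intervalIntegral.norm_integral_le_integral_norm_uIoc).trans ?_
  calc ∫ s in uIoc t₀ t, ‖R (z s) (u s) - R (w s) (u s)‖
      ≤ ∫ s in uIoc t₀ t, (K * δ) * ‖u s‖ := by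
        refine integral_mono_of_nonneg (Filter.Eventually.of_forall fun _ => norm_nonneg _)
          ((hun.mono_set hsub').const_mul _) ?_
        rw [Filter.EventuallyLE, ae_restrict_iff' measurableSet_uIoc]
        refine Filter.Eventually.of_forall fun s hs => ?_
        have hs' : s ∈ Icc a b := Ioc_subset_Icc_self (hsub' hs)
        rw [← sub_apply]
        refine ContinuousLinearMap.le_of_opNorm_le _ ?_ _
        have := hR.dist_le_mul (z s) (w s)
        rw [dist_eq_norm, dist_eq_norm] at this
        exact this.trans (by gcongr; exact hδ s hs')
    _ ≤ ∫ s in Ioc a b, (K * δ) * ‖u s‖ :=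
        setIntegral_mono_set (hun.const_mul _)
          (Filter.Eventually.of_forall fun s => by positivity) hsub'.eventuallyLE
    _ = (K * ∫ s in a..b, ‖u s‖) * δ := by
        rw [integral_const_mul, intervalIntegral.integral_of_le hab]; ring

theorem control_solution_unique (hR : LipschitzWith K R)
    (hab : a ≤ b) (h₀ : t₀ ∈ Icc a b) (hu : IntervalIntegrable u volume a b)
    (hsmall : K * ∫ s in a..b, ‖u s‖ < 1) {c : E}
    {z w : ℝ → E} (hz : ContinuousOn z (Icc a b)) (hw : ContinuousOn w (Icc a b))
    (hz' : ∀ t ∈ Icc a b, z t = c + ∫ s in t₀..t, R (z s) (u s))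
    (hw' : ∀ t ∈ Icc a b, w t = c + ∫ s in t₀..t, R (w s) (u s)) :
    ∀ t ∈ Icc a b, z t = w t := by
  -- At a maximum of the distance the Picard estimate bounds the distance by a factor less than 1
  -- times itself.
  obtain ⟨t₁, ht₁, hmax⟩ := isCompact_Icc.exists_isMaxOn (nonempty_Icc.2 hab)
    (hz.sub hw).norm
  have h1 := norm_integral_control_sub_le hR hab h₀ hu hz hw (fun s hs => hmax hs) ht₁
  have h2 : z t₁ - w t₁ = (∫ s in t₀..t₁, R (z s) (u s)) - ∫ s in t₀..t₁, R (w s) (u s) := by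
    rw [hz' _ ht₁, hw' _ ht₁]; abel
  rw [← h2] at h1
  have h3 : ‖z t₁ - w t₁‖ ≤ 0 := by
    have h1' : ‖z t₁ - w t₁‖ ≤ (K * ∫ s in a..b, ‖u s‖) * ‖z t₁ - w t₁‖ := h1
    nlinarith [norm_nonneg (z t₁ - w t₁)]
  intro t ht
  have h4 : ‖z t - w t‖ ≤ ‖z t₁ - w t₁‖ := hmax ht
  exact sub_eq_zero.1 (norm_le_zero_iff.1 (h4.trans h3))

theorem exists_control_solution (hR : LipschitzWith K R)
    (hab : a ≤ b) (h₀ : t₀ ∈ Icc a b) (hu : IntervalIntegrable u volume a b)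
    (hsmall : K * ∫ s in a..b, ‖u s‖ < 1) (c : E) :
    ∃ z : ℝ → E, Continuous z ∧ ∀ t ∈ Icc a b, z t = c + ∫ s in t₀..t, R (z s) (u s) := by
  have hIcc : uIcc a b = Icc a b := uIcc_of_le hab
  have hint : ∀ v : C(Icc a b, E),
      IntervalIntegrable (fun s => R (IccExtend hab v s) (u s)) volume a b := fun v =>
    intervalIntegrable_control hR.continuous hu v.continuous.Icc_extend'.continuousOn
  let T : C(Icc a b, E) → C(Icc a b, E) := fun v =>
    ⟨fun t => c + ∫ s in t₀..t, R (IccExtend hab v s) (u s), by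
      have h1 := intervalIntegral.continuousOn_primitive_interval' (hint v)
        (a := t₀) (by rwa [hIcc])
      rw [hIcc, continuousOn_iff_continuous_domRestrict] at h1
      exact continuous_const.add h1⟩
  have hint0 : 0 ≤ ∫ s in a..b, ‖u s‖ := intervalIntegral.integral_nonneg hab fun _ _ => norm_nonneg _
  let q : NNReal := ⟨K * ∫ s in a..b, ‖u s‖, by positivity⟩
  have hT : ContractingWith q T := by
    refine ⟨by exact_mod_cast hsmall, LipschitzWith.of_dist_le_mul fun v w => ?_⟩
    rw [ContinuousMap.dist_le (by positivity)]
    intro t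
    have h1 := norm_integral_control_sub_le hR hab h₀ hu (z := IccExtend hab v)
      (w := IccExtend hab w) v.continuous.Icc_extend'.continuousOn
      w.continuous.Icc_extend'.continuousOn (δ := dist v w) (fun s hs => by
        rw [IccExtend_of_mem hab _ hs, IccExtend_of_mem hab _ hs, ← dist_eq_norm]
        exact ContinuousMap.dist_apply_le_dist _) t.2
    simp only [T, ContinuousMap.coe_mk, dist_eq_norm, add_sub_add_left_eq_sub]
    rw [dist_eq_norm] at h1
    exact h1
  have : Nonempty C(Icc a b, E) := ⟨0⟩
  let v := hT.fixedPoint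
  have hv : T v = v := hT.fixedPoint_isFixedPt
  refine ⟨IccExtend hab v, v.continuous.Icc_extend', fun t ht => ?_⟩
  rw [IccExtend_of_mem hab _ ht]
  exact (DFunLike.congr_fun hv ⟨t, ht⟩).symm

end Control

/-! ### The ball-box estimate for horizontal loops -/

section BallBox

variable {V : Type*} [NormedAddCommGroup V] [InnerProductSpace ℝ V] {𝔫 : StratifiedLieAlgebra V}

/-! ### The grading of the Lie bracket. -/

namespace StratifiedLieAlgebra

theorem bracket_skew (x y : V) : 𝔫.bracket x y = -𝔫.bracket y x := by
  have h := 𝔫.bracket_self (x + y)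
  simp only [map_add, LinearMap.add_apply, 𝔫.bracket_self, zero_add, add_zero] at h
  exact eq_neg_of_add_eq_zero_right h

/-- Only brackets with the first layer are controlled by the axioms. Induction on `i` writes an
element of layer i + 1 as a combination of brackets [a, b] with a in the first layer, and the Jacobi
identity moves a outside. -/
theorem bracket_mem_layer {i : ℕ} : ∀ {j : ℕ} {x y : V}, x ∈ 𝔫.layer i → y ∈ 𝔫.layer j →
    𝔫.bracket x y ∈ 𝔫.layer (i + j) := by
  have hone : ∀ {j : ℕ} {x y : V}, x ∈ 𝔫.layer 1 → y ∈ 𝔫.layer j →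
      𝔫.bracket x y ∈ 𝔫.layer (j + 1) := by
    intro j x y hx hy
    rcases Nat.eq_zero_or_pos j with rfl | hj
    · rw [𝔫.layer_zero, Submodule.mem_bot] at hy
      simp [hy]
    · rw [← 𝔫.span_bracket j hj]
      exact Submodule.subset_span ⟨x, hx, y, hy, rfl⟩
  induction i with
  | zero =>
    intro j x y hx _
    rw [𝔫.layer_zero, Submodule.mem_bot] at hx
    simp [hx]
  | succ i ih =>
    intro j x y hx hy
    rcases Nat.eq_zero_or_pos i with rfl | hi
    · have := hone hx hy
      rwa [add_comm] at this
    rw [← 𝔫.span_bracket i hi] at hx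
    induction hx using Submodule.span_induction with
    | mem x hx =>
      obtain ⟨a, ha, b, hb, rfl⟩ := hx
      have h1 := 𝔫.jacobi a b y
      have h2 : 𝔫.bracket (𝔫.bracket a b) y =
          𝔫.bracket a (𝔫.bracket b y) - 𝔫.bracket b (𝔫.bracket a y) := by
        rw [bracket_skew (𝔫.bracket a b) y, bracket_skew a y, map_neg, sub_neg_eq_add]
        exact (eq_neg_of_add_eq_zero_left h1).symm
      rw [h2]
      refine Submodule.sub_mem _ ?_ ?_
      · have := hone ha (ih hb hy)
        convert this using 1
        congr 1; ring
      · have := ih hb (hone ha hy)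
        convert this using 1
        congr 1; ring
    | zero => simp
    | add x y _ _ hx hy => simpa using Submodule.add_mem _ hx hy
    | smul c x _ hx => simpa using Submodule.smul_mem _ c hx

end StratifiedLieAlgebra

namespace AdaptedBasis

variable {n : ℕ} (Z : AdaptedBasis 𝔫 n)

theorem one_le_weight (i : Fin n) : 1 ≤ Z.weight i := by
  by_contra h
  have h0 : Z.weight i = 0 := by omega
  have := Z.mem_layer i
  rw [h0, 𝔫.layer_zero, Submodule.mem_bot] at this
  exact Z.basis.ne_zero i this

theorem weight_le_step (i : Fin n) : Z.weight i ≤ 𝔫.step := by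
  by_contra h
  have := Z.mem_layer i
  rw [𝔫.layer_of_gt _ (by omega), Submodule.mem_bot] at this
  exact Z.basis.ne_zero i this

/-- The expansion of `x` in the adapted basis is also a decomposition along the layers, and such a
decomposition is unique. -/
theorem repr_eq_zero_of_mem_layer {j : ℕ} {x : V} (hx : x ∈ 𝔫.layer j) {k : Fin n}
    (hk : Z.weight k ≠ j) : Z.basis.repr x k = 0 := by
  classical
  let d₁ : DirectSum ℕ fun i => 𝔫.layer i := DirectSum.of (fun i => 𝔫.layer i) j ⟨x, hx⟩
  let d₂ : DirectSum ℕ fun i => 𝔫.layer i := ∑ i, DirectSum.of (fun i => 𝔫.layer i) (Z.weight i)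
    ⟨Z.basis.repr x i • Z.basis i, Submodule.smul_mem _ _ (Z.mem_layer i)⟩
  have h : d₁ = d₂ := by
    apply 𝔫.isInternal.injective
    simp only [d₁, d₂, map_sum, DirectSum.coeAddMonoidHom_of]
    exact (Z.basis.sum_repr x).symm
  have h1 := congrArg (fun d => ((d (Z.weight k) : 𝔫.layer (Z.weight k)) : V)) h
  simp only [d₁, d₂] at h1
  rw [DirectSum.of_eq_of_ne _ _ _ hk] at h1
  have h2 : ((∑ i, DirectSum.of (fun i => 𝔫.layer i) (Z.weight i)
      ⟨Z.basis.repr x i • Z.basis i, Submodule.smul_mem _ _ (Z.mem_layer i)⟩ :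
        DirectSum ℕ fun i => 𝔫.layer i) (Z.weight k) : V) =
      ∑ i, (if Z.weight i = Z.weight k then Z.basis.repr x i else 0) • Z.basis i := by
    rw [DirectSum.sum_apply, AddSubmonoidClass.coe_finsetSum]
    refine Finset.sum_congr rfl fun i _ => ?_
    rw [DirectSum.coe_of_apply]
    split_ifs <;> simp
  rw [h2] at h1
  have h3 := congrArg (fun v => Z.basis.repr v k) h1
  simp only [ZeroMemClass.coe_zero, map_zero, Finsupp.coe_zero, Pi.zero_apply,
    Z.basis.repr_sum_self, if_true] at h3
  exact h3.symm

/-- The coordinates of `x` of weight at most `J` satisfy `|xₖ| ≤ a ρ ^ (wₖ - d)`. -/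
def BoxBound (J d : ℕ) (a ρ : ℝ) (x : V) : Prop :=
  ∀ k, Z.weight k ≤ J → |Z.basis.repr x k| ≤ a * ρ ^ (Z.weight k - d)

variable {Z} {J d d₁ d₂ : ℕ} {a b ρ : ℝ} {x y v : V}

theorem BoxBound.mono {b : ℝ} (h : Z.BoxBound J d a ρ x) (hab : a ≤ b) (hρ : 0 ≤ ρ) :
    Z.BoxBound J d b ρ x :=
  fun k hk => (h k hk).trans (by gcongr)

theorem BoxBound.of_le {J' : ℕ} (h : Z.BoxBound J d a ρ x) (hJ : J' ≤ J) :
    Z.BoxBound J' d a ρ x :=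
  fun k hk => h k (hk.trans hJ)

theorem BoxBound.add (hx : Z.BoxBound J d a ρ x) (hy : Z.BoxBound J d b ρ y) :
    Z.BoxBound J d (a + b) ρ (x + y) := fun k hk => by
  simp only [map_add, Finsupp.add_apply]
  refine (abs_add_le _ _).trans ?_
  rw [add_mul]
  exact add_le_add (hx k hk) (hy k hk)

theorem BoxBound.neg (hx : Z.BoxBound J d a ρ x) : Z.BoxBound J d a ρ (-x) := fun k hk => by
  simpa using hx k hk

theorem BoxBound.smul (c : ℝ) (hx : Z.BoxBound J d a ρ x) :
    Z.BoxBound J d (|c| * a) ρ (c • x) := fun k hk => by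
  simp only [map_smul, Finsupp.smul_apply, smul_eq_mul, abs_mul, mul_assoc]
  gcongr
  exact hx k hk

theorem boxBound_zero (ha : 0 ≤ a) (hρ : 0 ≤ ρ) : Z.BoxBound J d a ρ 0 := fun k _ => by
  simp only [map_zero, Finsupp.coe_zero, Pi.zero_apply, abs_zero]
  positivity

theorem boxBound_sum {ι : Type*} (s : Finset ι) {f : ι → V} {c : ι → ℝ} (hρ : 0 ≤ ρ)
    (h : ∀ i ∈ s, Z.BoxBound J d (c i) ρ (f i)) :
    Z.BoxBound J d (∑ i ∈ s, c i) ρ (∑ i ∈ s, f i) := by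
  classical
  induction s using Finset.induction_on with
  | empty => simpa using boxBound_zero le_rfl hρ
  | insert i s hi ih =>
    rw [Finset.sum_insert hi, Finset.sum_insert hi]
    exact (h i (by simp)).add (ih fun j hj => h j (by simp [hj]))

variable (Z) in
theorem repr_bracket (x y : V) (k : Fin n) : Z.basis.repr (𝔫.bracket x y) k =
    ∑ i, ∑ j, Z.basis.repr x i * Z.basis.repr y j *
      Z.basis.repr (𝔫.bracket (Z.basis i) (Z.basis j)) k := by
  conv_lhs => rw [← Z.basis.sum_repr x, ← Z.basis.sum_repr y]
  simp only [map_sum, LinearMap.sum_apply, map_smul, LinearMap.smul_apply, Finsupp.coe_finsetSum,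
    Finset.sum_apply, Finsupp.smul_apply, smul_eq_mul]
  rw [Finset.sum_comm]
  refine Finset.sum_congr rfl fun i _ => ?_
  rw [Finset.mul_sum]
  refine Finset.sum_congr rfl fun j _ => ?_
  ring

variable (Z) in
-- Weights add under the bracket and are at least 1, so a coordinate of [x, y] of weight at most J +
-- 1 sees only coordinates of x and y of weight at most J. This gain of one weight drives the
-- ball-box induction. The index d is 0 for positions and 1 for velocities.
theorem exists_boxBound_bracket : ∃ K : ℝ, 0 ≤ K ∧ ∀ {J d₁ d₂ : ℕ} {a b ρ : ℝ} {x y : V},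
    d₁ ≤ 1 → d₂ ≤ 1 → 0 ≤ a → 0 ≤ b → 0 ≤ ρ →
    Z.BoxBound J d₁ a ρ x → Z.BoxBound J d₂ b ρ y →
    Z.BoxBound (J + 1) (d₁ + d₂) (K * (a * b)) ρ (𝔫.bracket x y) := by
  let K : ℝ := ∑ k, ∑ i, ∑ j, |Z.basis.repr (𝔫.bracket (Z.basis i) (Z.basis j)) k|
  have hK0 : ∀ k, 0 ≤ ∑ i, ∑ j, |Z.basis.repr (𝔫.bracket (Z.basis i) (Z.basis j)) k| := fun k =>
    Finset.sum_nonneg fun i _ => Finset.sum_nonneg fun j _ => abs_nonneg _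
  refine ⟨K, Finset.sum_nonneg fun k _ => hK0 k, ?_⟩
  intro J d₁ d₂ a b ρ x y hd₁ hd₂ ha hb hρ hx hy k hk
  rw [repr_bracket Z]
  have key : ∀ i j, |Z.basis.repr x i * Z.basis.repr y j *
      Z.basis.repr (𝔫.bracket (Z.basis i) (Z.basis j)) k| ≤
      |Z.basis.repr (𝔫.bracket (Z.basis i) (Z.basis j)) k| *
        (a * b * ρ ^ (Z.weight k - (d₁ + d₂))) := by
    intro i j
    by_cases hw : Z.weight k = Z.weight i + Z.weight j
    · have hi := Z.one_le_weight i
      have hj := Z.one_le_weight j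
      rw [abs_mul, abs_mul, mul_comm]
      refine mul_le_mul_of_nonneg_left ?_ (abs_nonneg _)
      calc |Z.basis.repr x i| * |Z.basis.repr y j|
          ≤ (a * ρ ^ (Z.weight i - d₁)) * (b * ρ ^ (Z.weight j - d₂)) :=
            mul_le_mul (hx i (by omega)) (hy j (by omega)) (abs_nonneg _) (by positivity)
        _ = a * b * ρ ^ (Z.weight k - (d₁ + d₂)) := by
            -- The truncated subtractions add up because each dᵢ is at most 1, hence at most any
            -- weight.
            have : Z.weight k - (d₁ + d₂) = (Z.weight i - d₁) + (Z.weight j - d₂) := by omega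
            rw [this, pow_add]; ring
    · rw [Z.repr_eq_zero_of_mem_layer
        (StratifiedLieAlgebra.bracket_mem_layer (Z.mem_layer i) (Z.mem_layer j)) hw]
      simp
  calc _ ≤ ∑ i, ∑ j, |Z.basis.repr (𝔫.bracket (Z.basis i) (Z.basis j)) k| *
        (a * b * ρ ^ (Z.weight k - (d₁ + d₂))) :=
        (Finset.abs_sum_le_sum_abs _ _).trans (Finset.sum_le_sum fun i _ =>
          (Finset.abs_sum_le_sum_abs _ _).trans (Finset.sum_le_sum fun j _ => key i j))
    _ = (∑ i, ∑ j, |Z.basis.repr (𝔫.bracket (Z.basis i) (Z.basis j)) k|) *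
        (a * b * ρ ^ (Z.weight k - (d₁ + d₂))) := by simp only [Finset.sum_mul]
    _ ≤ K * (a * b * ρ ^ (Z.weight k - (d₁ + d₂))) := by
        gcongr
        exact Finset.single_le_sum (f := fun k => ∑ i, ∑ j,
          |Z.basis.repr (𝔫.bracket (Z.basis i) (Z.basis j)) k|) (fun k _ => hK0 k)
          (Finset.mem_univ k)
    _ = _ := by ring

end AdaptedBasis

/-! ### Dynkin's formula and the left trivialization. -/

namespace StratifiedLieAlgebra

variable (𝔫)

/-- The value of a letter: `false` stands for `x` and `true` for `y`. -/
def letter (x y : V) (β : Bool) : V := if β then y else x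

/-- The derivative in the direction `v` of the nested bracket of a word, as a function of `y`. -/
def nestedBracketDeriv (x y v : V) : List Bool → V
  | [] => 0
  | [β] => letter 0 v β
  | β :: β' :: l => 𝔫.bracket (letter 0 v β) (𝔫.nestedBracket ((β' :: l).map (letter x y))) +
      𝔫.bracket (letter x y β) (nestedBracketDeriv x y v (β' :: l))

/-- The word of a multi-index in Dynkin's formula. -/
def dynkinWord {m : ℕ} (r : Fin m → ℕ × ℕ) : List Bool :=
  (List.ofFn fun i => List.replicate (r i).1 false ++ List.replicate (r i).2 true).flatten

theorem map_dynkinWord {m : ℕ} (r : Fin m → ℕ × ℕ) (x y : V) :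
    (List.ofFn fun i => List.replicate (r i).1 x ++ List.replicate (r i).2 y).flatten =
      (dynkinWord r).map (letter x y) := by
  simp [dynkinWord, List.map_flatten, List.map_ofFn, Function.comp_def, letter]

theorem length_dynkinWord {m : ℕ} (r : Fin m → ℕ × ℕ) :
    (dynkinWord r).length = ∑ i, ((r i).1 + (r i).2) := by
  simp [dynkinWord, List.length_flatten, List.map_ofFn, Function.comp_def, List.sum_ofFn]

variable [FiniteDimensional ℝ V]

/-- The bracket as a continuous bilinear map. -/
noncomputable def bracketCLM : V →L[ℝ] V →L[ℝ] V :=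
  LinearMap.toContinuousLinearMap
    ((LinearMap.toContinuousLinearMap (𝕜 := ℝ) (E := V) (F' := V)).toLinearMap ∘ₗ 𝔫.bracket)

theorem bracketCLM_apply (x y : V) : 𝔫.bracketCLM x y = 𝔫.bracket x y := rfl

theorem continuous_nestedBracket_word {X : Type*} [TopologicalSpace X] {f g : X → V}
    (hf : Continuous f) (hg : Continuous g) (l : List Bool) :
    Continuous fun p => 𝔫.nestedBracket (l.map (letter (f p) (g p))) := by
  have hl : ∀ β, Continuous fun p => letter (f p) (g p) β := by
    intro β; cases β <;> simpa [letter]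
  induction l with
  | nil => exact continuous_const
  | cons β l ih =>
    cases l with
    | nil => exact hl β
    | cons β' l =>
      exact (𝔫.bracketCLM.continuous.comp (hl β)).clm_apply ih

theorem continuous_nestedBracketDeriv {X : Type*} [TopologicalSpace X] {f g h : X → V}
    (hf : Continuous f) (hg : Continuous g) (hh : Continuous h) (l : List Bool) :
    Continuous fun p => 𝔫.nestedBracketDeriv (f p) (g p) (h p) l := by
  have hl : ∀ {f g : X → V}, Continuous f → Continuous g → ∀ β,
      Continuous fun p => letter (f p) (g p) β := by
    intro f g hf hg β; cases β <;> simpa [letter]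
  induction l with
  | nil => exact continuous_const
  | cons β l ih =>
    cases l with
    | nil => exact hl continuous_const hh β
    | cons β' l =>
      exact ((𝔫.bracketCLM.continuous.comp (hl continuous_const hh β)).clm_apply
        (𝔫.continuous_nestedBracket_word hf hg (β' :: l))).add
        ((𝔫.bracketCLM.continuous.comp (hl hf hg β)).clm_apply ih)

theorem contDiff_nestedBracket_word (x : V) (l : List Bool) :
    ContDiff ℝ 1 fun y => 𝔫.nestedBracket (l.map (letter x y)) := by
  have hl : ∀ β, ContDiff ℝ 1 fun y => letter x y β := by
    intro β
    cases β
    · exact contDiff_const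
    · exact contDiff_id
  induction l with
  | nil => exact contDiff_const
  | cons β l ih =>
    cases l with
    | nil => exact hl β
    | cons β' l => exact (𝔫.bracketCLM.contDiff.comp (hl β)).clm_apply ih

theorem hasDerivAt_nestedBracket_word (x y v : V) (l : List Bool) :
    HasDerivAt (fun t : ℝ => 𝔫.nestedBracket (l.map (letter x (y + t • v))))
      (𝔫.nestedBracketDeriv x y v l) 0 := by
  have hl : ∀ β, HasDerivAt (fun t : ℝ => letter x (y + t • v) β) (letter 0 v β) 0 := by
    intro β
    cases β
    · simpa [letter] using hasDerivAt_const (0 : ℝ) x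
    · simpa [letter] using ((hasDerivAt_id (0 : ℝ)).smul_const v).const_add y
  induction l with
  | nil => exact hasDerivAt_const _ _
  | cons β l ih =>
    cases l with
    | nil => exact hl β
    | cons β' l =>
      have h1 := (𝔫.bracketCLM.hasFDerivAt.comp_hasDerivAt (0 : ℝ) (hl β)).clm_apply ih
      simpa [nestedBracketDeriv, nestedBracket, bracketCLM_apply, Function.comp_def] using h1

/-- The coefficients of Dynkin's formula. -/
noncomputable def dynkinCoeff {m : ℕ} (r : Fin m → ℕ × ℕ) : ℝ :=
  (-1 : ℝ) ^ (m - 1) / ((m : ℝ) * ((∑ i, ((r i).1 + (r i).2) : ℕ) : ℝ) *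
    ∏ i, (((r i).1.factorial : ℝ) * ((r i).2.factorial : ℝ)))

/-- The multi-indices of length `m` in Dynkin's formula. -/
def dynkinIndex (m : ℕ) : Finset (Fin m → ℕ × ℕ) :=
  Fintype.piFinset fun _ : Fin m =>
    (Finset.range (𝔫.step + 1) ×ˢ Finset.range (𝔫.step + 1)).filter fun q => 0 < q.1 + q.2

theorem mul_eq_sum (x y : V) : 𝔫.mul x y = ∑ m ∈ Finset.Icc 1 𝔫.step, ∑ r ∈ 𝔫.dynkinIndex m,
    dynkinCoeff r • 𝔫.nestedBracket ((dynkinWord r).map (letter x y)) := by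
  simp only [mul, map_dynkinWord]
  rfl

/-- The product is a finite sum of nested brackets of words, differentiable in `y`; its differential
in the direction `v` is read off along the line x + tv. -/
theorem leftTriv_eq_sum (x v : V) : 𝔫.leftTriv x v = ∑ m ∈ Finset.Icc 1 𝔫.step,
    ∑ r ∈ 𝔫.dynkinIndex m,
      dynkinCoeff r • 𝔫.nestedBracketDeriv (-x) x v (dynkinWord r) := by
  have hd : DifferentiableAt ℝ (fun y => 𝔫.mul (-x) y) x := by
    simp only [mul_eq_sum]
    exact (ContDiff.sum fun m _ => ContDiff.sum fun r _ =>
      (𝔫.contDiff_nestedBracket_word (-x) (dynkinWord r)).const_smul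
        (dynkinCoeff r)).differentiable one_ne_zero x
  have h1 : HasDerivAt (fun t : ℝ => 𝔫.mul (-x) (x + t • v)) (𝔫.leftTriv x v) 0 := by
    have h2 : HasDerivAt (fun t : ℝ => x + t • v) v 0 := by
      simpa using ((hasDerivAt_id (0 : ℝ)).smul_const v).const_add x
    have h3 : HasFDerivAt (fun y => 𝔫.mul (-x) y) (fderiv ℝ (fun y => 𝔫.mul (-x) y) x)
        (x + (0 : ℝ) • v) := by simpa using hd.hasFDerivAt
    exact h3.comp_hasDerivAt (0 : ℝ) h2
  have h2 : HasDerivAt (fun t : ℝ => 𝔫.mul (-x) (x + t • v)) (∑ m ∈ Finset.Icc 1 𝔫.step,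
      ∑ r ∈ 𝔫.dynkinIndex m,
        dynkinCoeff r • 𝔫.nestedBracketDeriv (-x) x v (dynkinWord r)) 0 := by
    simp only [mul_eq_sum]
    exact HasDerivAt.fun_sum fun m _ => HasDerivAt.fun_sum fun r _ =>
      (𝔫.hasDerivAt_nestedBracket_word (-x) x v (dynkinWord r)).const_smul (dynkinCoeff r)
  exact h1.unique h2

theorem continuous_leftTriv : Continuous fun p : V × V => 𝔫.leftTriv p.1 p.2 := by
  simp only [leftTriv_eq_sum]
  exact continuous_finsetSum _ fun m _ => continuous_finsetSum _ fun r _ =>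
    (𝔫.continuous_nestedBracketDeriv continuous_fst.neg continuous_fst continuous_snd
      (dynkinWord r)).const_smul (dynkinCoeff r)

/-- The one-letter words contribute precisely `v`. Everything else in the left trivialization is a
genuine bracket, which is what gains a weight. -/
theorem leftTriv_sub_eq_sum (h : 1 ≤ 𝔫.step) (x v : V) : 𝔫.leftTriv x v - v =
    ∑ m ∈ Finset.Icc 1 𝔫.step, ∑ r ∈ 𝔫.dynkinIndex m, if 2 ≤ (dynkinWord r).length then
      dynkinCoeff r • 𝔫.nestedBracketDeriv (-x) x v (dynkinWord r) else 0 := by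
  rw [sub_eq_iff_eq_add', leftTriv_eq_sum, ← sub_eq_iff_eq_add, ← Finset.sum_sub_distrib]
  simp only [← Finset.sum_sub_distrib]
  have hpos : ∀ {m : ℕ} {r : Fin m → ℕ × ℕ}, r ∈ 𝔫.dynkinIndex m → ∀ i, 1 ≤ (r i).1 + (r i).2 := by
    intro m r hr i
    have := Fintype.mem_piFinset.1 hr i
    simp only [Finset.mem_filter] at this
    exact this.2
  rw [Finset.sum_eq_single_of_mem 1 (by simp [h])]
  -- The index (0, 1) is the word y, with coefficient 1 and derivative v. The only other one-letter
  -- word, x = (1, 0), does not depend on y.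
  · rw [Finset.sum_eq_single_of_mem (fun _ => ((0, 1) : ℕ × ℕ))]
    · have hw : dynkinWord (fun _ : Fin 1 => ((0, 1) : ℕ × ℕ)) = [true] := by simp [dynkinWord]
      simp [hw, dynkinCoeff, nestedBracketDeriv, letter]
    · simp only [dynkinIndex, Fintype.mem_piFinset, Finset.mem_filter, Finset.mem_product,
        Finset.mem_range]
      intro _; omega
    · intro r hr hne
      split_ifs with hlen
      · simp
      · rw [length_dynkinWord] at hlen
        simp only [Finset.univ_unique, Fin.default_eq_zero, Finset.sum_singleton] at hlen
        have h1 := hpos hr 0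
        have h2 : r 0 ≠ (0, 1) := fun h => hne (by funext i; rw [Subsingleton.elim i 0, h])
        have h3 : r 0 = (1, 0) := by
          rcases hr0 : r 0 with ⟨p, q⟩
          rw [hr0] at h1 h2 hlen
          simp only [ne_eq, Prod.mk.injEq] at h2 ⊢
          simp only at h1 hlen
          omega
        have hw : dynkinWord r = [false] := by simp [dynkinWord, h3]
        simp [hw, nestedBracketDeriv, letter]
  · intro m hm hne
    refine Finset.sum_eq_zero fun r hr => ?_
    have : 2 ≤ (dynkinWord r).length := by
      rw [length_dynkinWord]
      have h1 : ∑ i : Fin m, 1 ≤ ∑ i, ((r i).1 + (r i).2) :=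
        Finset.sum_le_sum fun i _ => hpos hr i
      simp only [Finset.sum_const, Finset.card_univ, Fintype.card_fin, smul_eq_mul, mul_one] at h1
      have := (Finset.mem_Icc.1 hm).1
      omega
    simp [this]

end StratifiedLieAlgebra

/-! ### Weighted bounds for words and for the left trivialization. -/

namespace AdaptedBasis

variable {n : ℕ} (Z : AdaptedBasis 𝔫 n)

/-- Each term of the derivative of a word contains the letter `v` exactly once, so the bound is
linear in `b` and has velocity type. From two letters on, every term is an outer bracket and one
more weight is controlled. -/
theorem exists_boxBound_word (l : List Bool) {a : ℝ} (ha : 0 ≤ a) :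
    ∃ C : ℝ, 0 ≤ C ∧ ∀ {J : ℕ} {ρ b : ℝ} {x y v : V}, 0 ≤ ρ → 0 ≤ b →
      Z.BoxBound J 0 a ρ x → Z.BoxBound J 0 a ρ y → Z.BoxBound J 1 b ρ v →
      Z.BoxBound J 0 C ρ (𝔫.nestedBracket (l.map (StratifiedLieAlgebra.letter x y))) ∧
      Z.BoxBound J 1 (C * b) ρ (𝔫.nestedBracketDeriv x y v l) ∧
      (2 ≤ l.length → Z.BoxBound (J + 1) 1 (C * b) ρ (𝔫.nestedBracketDeriv x y v l)) := by
  obtain ⟨K, hK, hbr⟩ := Z.exists_boxBound_bracket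
  induction l with
  | nil =>
    refine ⟨0, le_rfl, fun hρ hb _ _ _ => ⟨boxBound_zero le_rfl hρ,
      boxBound_zero (by simp) hρ, fun h => by simp at h⟩⟩
  | cons β l ih =>
    cases l with
    | nil =>
      refine ⟨max a 1, by positivity, fun {J ρ b x y v} hρ hb hx hy hv =>
        ⟨?_, ?_, fun h => by simp at h⟩⟩
      · cases β
        · exact hx.mono (le_max_left _ _) hρ
        · exact hy.mono (le_max_left _ _) hρ
      · cases β
        · exact boxBound_zero (by positivity) hρ
        · exact hv.mono (le_mul_of_one_le_left hb (le_max_right _ _)) hρ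
    | cons β' l =>
      obtain ⟨C, hC, hl⟩ := ih
      refine ⟨K * (a * C) + K * C, by positivity, fun {J ρ b x y v} hρ hb hx hy hv => ?_⟩
      obtain ⟨h1, h2, -⟩ := hl hρ hb hx hy hv
      have hlet : Z.BoxBound J 0 a ρ (StratifiedLieAlgebra.letter x y β) := by
        cases β
        · exact hx
        · exact hy
      have hletv : Z.BoxBound J 1 b ρ (StratifiedLieAlgebra.letter 0 v β) := by
        cases β
        · exact boxBound_zero hb hρ
        · exact hv
      have hd : Z.BoxBound (J + 1) 1 ((K * (a * C) + K * C) * b) ρ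
          (𝔫.nestedBracketDeriv x y v (β :: β' :: l)) := by
        have e1 := hbr (d₁ := 1) (d₂ := 0) le_rfl zero_le_one hb hC hρ hletv h1
        have e2 := hbr (d₁ := 0) (d₂ := 1) zero_le_one le_rfl ha (mul_nonneg hC hb) hρ hlet h2
        refine (e1.add e2).mono (le_of_eq (by ring)) hρ
      refine ⟨?_, hd.of_le (Nat.le_succ J), fun _ => hd⟩
      have e := hbr (d₁ := 0) (d₂ := 0) zero_le_one zero_le_one ha hC hρ hlet h1
      exact (e.of_le (Nat.le_succ J)).mono (le_add_of_nonneg_right (by positivity)) hρ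

variable [FiniteDimensional ℝ V]

theorem exists_boxBound_leftTriv_sub {a : ℝ} (ha : 0 ≤ a) :
    ∃ C : ℝ, 0 ≤ C ∧ ∀ {J : ℕ} {ρ b : ℝ} {x v : V}, 0 ≤ ρ → 0 ≤ b →
      Z.BoxBound J 0 a ρ x → Z.BoxBound J 1 b ρ v →
      Z.BoxBound (J + 1) 1 (C * b) ρ (𝔫.leftTriv x v - v) := by
  choose C hC hword using fun l => Z.exists_boxBound_word l ha
  refine ⟨∑ m ∈ Finset.Icc 1 𝔫.step, ∑ r ∈ 𝔫.dynkinIndex m,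
    |StratifiedLieAlgebra.dynkinCoeff r| * C (StratifiedLieAlgebra.dynkinWord r),
    Finset.sum_nonneg fun m _ => Finset.sum_nonneg fun r _ => mul_nonneg (abs_nonneg _) (hC _),
    fun {J ρ b x v} hρ hb hx hv => ?_⟩
  intro k
  have hstep : 1 ≤ 𝔫.step := (Z.one_le_weight k).trans (Z.weight_le_step k)
  revert k
  change Z.BoxBound (J + 1) 1 _ ρ _
  rw [𝔫.leftTriv_sub_eq_sum hstep, Finset.sum_mul]
  refine boxBound_sum _ hρ fun m _ => ?_
  rw [Finset.sum_mul]
  refine boxBound_sum _ hρ fun r _ => ?_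
  split_ifs with hlen
  · rw [mul_assoc]
    exact ((hword _ hρ hb hx.neg hx hv).2.2 hlen).smul _
  · exact boxBound_zero (mul_nonneg (mul_nonneg (abs_nonneg _) (hC _)) hb) hρ

end AdaptedBasis

namespace StratifiedLieAlgebra.IsHorizontalLoop

variable [FiniteDimensional ℝ V] {γ : ℝ → V}

theorem intervalIntegrable_deriv (hγ : 𝔫.IsHorizontalLoop γ) :
    IntervalIntegrable (deriv γ) volume 0 1 :=
  hγ.absolutelyContinuous.intervalIntegrable_deriv_of_finiteDimensional

theorem intervalIntegrable_leftTriv (hγ : 𝔫.IsHorizontalLoop γ) :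
    IntervalIntegrable (fun t => 𝔫.leftTriv (γ t) (deriv γ t)) volume 0 1 := by
  have hR : Continuous fun x => fderiv ℝ (fun y => 𝔫.mul (-x) y) x := by
    rw [continuous_clm_apply]
    intro v
    have h := 𝔫.continuous_leftTriv.comp (continuous_id.prodMk (continuous_const (y := v)))
    simp only [leftTriv, Function.comp_def, id] at h
    exact h
  have h := intervalIntegrable_control hR hγ.intervalIntegrable_deriv
    hγ.absolutelyContinuous.continuousOn
  simpa only [leftTriv] using h

theorem length_nonneg (γ : ℝ → V) : 0 ≤ 𝔫.length γ :=
  intervalIntegral.integral_nonneg zero_le_one fun _ _ => norm_nonneg _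

end StratifiedLieAlgebra.IsHorizontalLoop

/-! ### The induction on the weight. -/

namespace AdaptedBasis

variable [FiniteDimensional ℝ V] {n : ℕ} (Z : AdaptedBasis 𝔫 n)

theorem exists_abs_repr_le : ∃ C : ℝ, 0 ≤ C ∧ ∀ x k, |Z.basis.repr x k| ≤ C * ‖x‖ := by
  refine ⟨∑ k, ‖LinearMap.toContinuousLinearMap (Z.basis.coord k)‖,
    Finset.sum_nonneg fun k _ => norm_nonneg _, fun x k => ?_⟩
  refine ((LinearMap.toContinuousLinearMap (Z.basis.coord k)).le_opNorm x).trans ?_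
  gcongr
  exact Finset.single_le_sum (f := fun k => ‖LinearMap.toContinuousLinearMap (Z.basis.coord k)‖)
    (fun k _ => norm_nonneg _) (Finset.mem_univ k)

/-- The left-trivialized velocity lies in the first layer, so only its coordinates of weight 1
survive. The velocity itself differs from it by brackets, whose coordinates of weight at most J + 1
are controlled by those of weight at most J of the curve and its velocity. Integration from the base
point then turns the velocity bound into a position bound with one more power of the length. -/
theorem exists_boxBound_horizontal (J : ℕ) : ∃ C : ℝ, 0 ≤ C ∧ ∀ γ, 𝔫.IsHorizontalLoop γ →
    (∀ t ∈ Icc (0 : ℝ) 1, Z.BoxBound J 0 C (𝔫.length γ) (γ t)) ∧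
    ∀ᵐ t ∂volume.restrict (Icc (0 : ℝ) 1),
      Z.BoxBound J 1 (C * ‖𝔫.leftTriv (γ t) (deriv γ t)‖) (𝔫.length γ) (deriv γ t) := by
  obtain ⟨C₀, hC₀, hrepr⟩ := Z.exists_abs_repr_le
  induction J with
  | zero =>
    refine ⟨0, le_rfl, fun γ _ => ⟨fun t _ k hk => ?_, Filter.Eventually.of_forall fun t k hk => ?_⟩⟩
    all_goals have := Z.one_le_weight k; omega
  | succ J ih =>
    obtain ⟨C, hC, hJ⟩ := ih
    obtain ⟨C', hC', hsub⟩ := Z.exists_boxBound_leftTriv_sub hC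
    -- C₀ accounts for the horizontal velocity and C' * C for the bracket correction.
    refine ⟨C₀ + C' * C, by positivity, fun γ hγ => ?_⟩
    obtain ⟨h1, h2⟩ := hJ γ hγ
    have hℓ : 0 ≤ 𝔫.length γ := StratifiedLieAlgebra.IsHorizontalLoop.length_nonneg γ
    have hd : ∀ᵐ t ∂volume.restrict (Icc (0 : ℝ) 1),
        Z.BoxBound (J + 1) 1 ((C₀ + C' * C) * ‖𝔫.leftTriv (γ t) (deriv γ t)‖) (𝔫.length γ)
          (deriv γ t) := by
      filter_upwards [h2, hγ.horizontal, ae_restrict_mem measurableSet_Icc] with t ht hhor hmem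
      have e1 := hsub hℓ (mul_nonneg hC (norm_nonneg _)) (h1 t hmem) ht
      have e2 : Z.BoxBound (J + 1) 1 (C₀ * ‖𝔫.leftTriv (γ t) (deriv γ t)‖) (𝔫.length γ)
          (𝔫.leftTriv (γ t) (deriv γ t)) := by
        intro k hk
        by_cases hw : Z.weight k = 1
        · simpa [hw] using hrepr (𝔫.leftTriv (γ t) (deriv γ t)) k
        · rw [Z.repr_eq_zero_of_mem_layer hhor hw, abs_zero]
          positivity
      have e3 := e2.add e1.neg
      have : 𝔫.leftTriv (γ t) (deriv γ t) + -(𝔫.leftTriv (γ t) (deriv γ t) - deriv γ t) =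
          deriv γ t := by abel
      rw [this] at e3
      exact e3.mono (le_of_eq (by ring)) hℓ
    refine ⟨fun t ht k hk => ?_, hd⟩
    have hac : AbsolutelyContinuousOnInterval (fun s => Z.basis.repr (γ s) k) 0 t :=
      (hγ.absolutelyContinuous.coord Z.basis k).mono (by
        rw [uIcc_of_le ht.1, uIcc_of_le zero_le_one]; exact Icc_subset_Icc le_rfl ht.2)
    have hFTC := hac.integral_deriv_eq_sub
    simp only [hγ.source, map_zero, Finsupp.coe_zero, Pi.zero_apply, sub_zero] at hFTC
    rw [← hFTC]
    have hint : IntervalIntegrable (fun s => (C₀ + C' * C) * ‖𝔫.leftTriv (γ s) (deriv γ s)‖ *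
        𝔫.length γ ^ (Z.weight k - 1)) volume 0 1 :=
      (hγ.intervalIntegrable_leftTriv.norm.const_mul _).mul_const _
    have hsubset : uIcc (0 : ℝ) t ⊆ uIcc 0 1 := by
      rw [uIcc_of_le ht.1, uIcc_of_le zero_le_one]; exact Icc_subset_Icc le_rfl ht.2
    rw [← Real.norm_eq_abs]
    calc ‖∫ s in (0 : ℝ)..t, deriv (fun s => Z.basis.repr (γ s) k) s‖
        ≤ ∫ s in (0 : ℝ)..t, (C₀ + C' * C) * ‖𝔫.leftTriv (γ s) (deriv γ s)‖ *
            𝔫.length γ ^ (Z.weight k - 1) := by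
          refine intervalIntegral.norm_integral_le_of_norm_le ht.1 ?_ (hint.mono_set hsubset)
          have hd' := (ae_restrict_iff' measurableSet_Icc).1 hd
          filter_upwards [hd', hγ.absolutelyContinuous.ae_differentiableAt_of_finiteDimensional]
            with s hs hdiff hmem
          have hs1 : s ∈ Icc (0 : ℝ) 1 := ⟨hmem.1.le, hmem.2.trans ht.2⟩
          have hder : deriv (fun s => Z.basis.repr (γ s) k) s = Z.basis.repr (deriv γ s) k := by
            have := ((LinearMap.toContinuousLinearMap (Z.basis.coord k)).hasFDerivAt.comp_hasDerivAt
              s (hdiff (by rwa [uIcc_of_le zero_le_one])).hasDerivAt).deriv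
            simpa [Function.comp_def] using this
          rw [hder, Real.norm_eq_abs]
          exact hs hs1 k hk
      _ ≤ ∫ s in (0 : ℝ)..1, (C₀ + C' * C) * ‖𝔫.leftTriv (γ s) (deriv γ s)‖ *
            𝔫.length γ ^ (Z.weight k - 1) :=
          intervalIntegral.integral_mono_interval le_rfl ht.1 ht.2
            (Filter.Eventually.of_forall fun s => by simp only [Pi.zero_apply]; positivity) hint
      _ = (C₀ + C' * C) * (𝔫.length γ * 𝔫.length γ ^ (Z.weight k - 1)) := by
          rw [intervalIntegral.integral_mul_const, intervalIntegral.integral_const_mul]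
          rw [StratifiedLieAlgebra.length, mul_assoc]
      _ = (C₀ + C' * C) * 𝔫.length γ ^ (Z.weight k - 0) := by
          rw [← pow_succ', Nat.sub_add_cancel (Z.one_le_weight k), Nat.sub_zero]

/-- **Ball-box estimate** for horizontal loops and their velocities. -/
theorem exists_ballBox : ∃ C : ℝ, 1 ≤ C ∧ ∀ γ, 𝔫.IsHorizontalLoop γ →
    (∀ t ∈ Icc (0 : ℝ) 1, ∀ k, |Z.basis.repr (γ t) k| ≤ (C * 𝔫.length γ) ^ Z.weight k) ∧
    ∀ᵐ t ∂volume.restrict (Icc (0 : ℝ) 1), ∀ k, |Z.basis.repr (deriv γ t) k| ≤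
      C * ‖𝔫.leftTriv (γ t) (deriv γ t)‖ * (C * 𝔫.length γ) ^ (Z.weight k - 1) := by
  obtain ⟨C, hC, h⟩ := Z.exists_boxBound_horizontal 𝔫.step
  -- A constant at least 1 is bounded by its powers, so it can be moved inside (Cℓ)^w.
  refine ⟨max C 1, le_max_right _ _, fun γ hγ => ?_⟩
  have hℓ : 0 ≤ 𝔫.length γ := StratifiedLieAlgebra.IsHorizontalLoop.length_nonneg γ
  obtain ⟨h1, h2⟩ := h γ hγ
  refine ⟨fun t ht k => ?_, ?_⟩
  · refine (h1 t ht k (Z.weight_le_step k)).trans ?_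
    rw [Nat.sub_zero, mul_pow]
    gcongr
    exact (le_max_left C 1).trans
      (le_self_pow₀ (le_max_right _ _) (by have := Z.one_le_weight k; omega))
  · filter_upwards [h2] with t ht k
    refine (ht k (Z.weight_le_step k)).trans ?_
    gcongr
    · exact le_max_left _ _
    · exact le_mul_of_one_le_left hℓ (le_max_right _ _)

end AdaptedBasis

end BallBox

/-! ### Directional derivatives of smooth functions -/

section DirectionalDerivative

open Filter Topology

variable {E F F' F'' : Type*} [NormedAddCommGroup E] [NormedSpace ℝ E]
  [NormedAddCommGroup F] [NormedSpace ℝ F] [NormedAddCommGroup F'] [NormedSpace ℝ F']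
  [NormedAddCommGroup F''] [NormedSpace ℝ F'']

/-- The derivative of `f` along the constant vector field `a`. -/
noncomputable def dirDeriv (a : E) (f : E → F) (x : E) : F := fderiv ℝ f x a

/-- Iterated directional derivatives. -/
noncomputable def iterDirDeriv (l : List E) (f : E → F) : E → F := l.foldr dirDeriv f

variable {f g : E → F}

theorem ContDiff.dirDeriv (hf : ContDiff ℝ ∞ f) (a : E) : ContDiff ℝ ∞ (dirDeriv a f) :=
  (hf.fderiv_right (m := ∞) (by simp)).clm_apply contDiff_const

theorem ContDiff.iterDirDeriv (hf : ContDiff ℝ ∞ f) (l : List E) :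
    ContDiff ℝ ∞ (iterDirDeriv l f) := by
  induction l with
  | nil => exact hf
  | cons a l ih => exact ih.dirDeriv a

theorem ContDiff.dirDeriv_iterate (hf : ContDiff ℝ ∞ f) (a : E) (m : ℕ) :
    ContDiff ℝ ∞ ((_root_.dirDeriv a)^[m] f) := by
  induction m with
  | zero => exact hf
  | succ m ih => rw [Function.iterate_succ_apply']; exact ih.dirDeriv a

theorem dirDeriv_comm (hf : ContDiff ℝ ∞ f) (a b : E) :
    dirDeriv a (dirDeriv b f) = dirDeriv b (dirDeriv a f) := by
  funext x
  have hd : DifferentiableAt ℝ (fderiv ℝ f) x :=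
    (hf.fderiv_right (m := ∞) (by simp)).differentiable (by simp) x
  have key : ∀ a b : E, dirDeriv a (dirDeriv b f) x = fderiv ℝ (fderiv ℝ f) x a b := by
    intro a b
    have h1 : HasFDerivAt (dirDeriv b f)
        ((ContinuousLinearMap.apply ℝ F b).comp (fderiv ℝ (fderiv ℝ f) x)) x :=
      (ContinuousLinearMap.apply ℝ F b).hasFDerivAt.comp x hd.hasFDerivAt
    change fderiv ℝ (dirDeriv b f) x a = _
    rw [h1.fderiv]; rfl
  have hs : IsSymmSndFDerivAt ℝ f x :=
    (hf.contDiffAt (x := x)).isSymmSndFDerivAt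
      (by rw [minSmoothness_of_isRCLikeNormedField]; exact WithTop.coe_le_coe.2 le_top)
  rw [key, key]
  exact hs a b

theorem dirDeriv_iterate_comm (hf : ContDiff ℝ ∞ f) (a b : E) (m : ℕ) :
    dirDeriv a ((dirDeriv b)^[m] f) = (dirDeriv b)^[m] (dirDeriv a f) := by
  induction m with
  | zero => rfl
  | succ m ih =>
    rw [Function.iterate_succ_apply', Function.iterate_succ_apply',
      dirDeriv_comm (hf.dirDeriv_iterate b m), ih]

theorem iteratedDeriv_comp_line (hf : ContDiff ℝ ∞ f) {c : ℝ → E} {a : E}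
    (hc : ∀ s, HasDerivAt c a s) (m : ℕ) :
    iteratedDeriv m (fun s => f (c s)) = fun s => (dirDeriv a)^[m] f (c s) := by
  induction m generalizing f with
  | zero => rfl
  | succ m ih =>
    rw [iteratedDeriv_succ']
    have : deriv (fun s => f (c s)) = fun s => dirDeriv a f (c s) := by
      funext s
      exact ((hf.differentiable (by simp) (c s)).hasFDerivAt.comp_hasDerivAt s (hc s)).deriv
    rw [this, ih (hf.dirDeriv a)]
    rfl

/-- Only germs at a point matter for Taylor expansions. Multiplication by a bump function replaces
objects defined on a gauge domain or a chart by globally smooth ones; the compact support also gives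
global bounds and Lipschitz constants. -/
theorem exists_contDiff_eventuallyEq [FiniteDimensional ℝ E] {U : Set E} (hU : IsOpen U)
    (hf : ContDiffOn ℝ ∞ f U) {c : E} (hc : c ∈ U) :
    ∃ g : E → F, ContDiff ℝ ∞ g ∧ HasCompactSupport g ∧ g =ᶠ[𝓝 c] f := by
  obtain ⟨r, hr, hrU⟩ := Metric.nhds_basis_closedBall.mem_iff.1 (hU.mem_nhds hc)
  let φ : ContDiffBump c := ⟨r / 2, r, by positivity, by linarith⟩
  refine ⟨fun x => φ x • f x, ?_, ?_, ?_⟩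
  · rw [contDiff_iff_contDiffAt]
    intro x
    by_cases hx : x ∈ U
    · exact φ.contDiff.contDiffAt.smul (hf.contDiffAt (hU.mem_nhds hx))
    · have h0 : (fun x => φ x • f x) =ᶠ[𝓝 x] fun _ => 0 := by
        have : x ∉ tsupport φ := by
          rw [φ.tsupport_eq]
          exact fun h => hx (hrU h)
        filter_upwards [(isClosed_tsupport φ).isOpen_compl.mem_nhds this] with y hy
        rw [image_eq_zero_of_notMem_tsupport hy, zero_smul]
      exact contDiffAt_const.congr_of_eventuallyEq h0
  · exact φ.hasCompactSupport.smul_right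
  · filter_upwards [φ.eventuallyEq_one] with x hx
    rw [hx]; simp

theorem isBigO_pow_pow_of_le {m n : ℕ} (h : m ≤ n) :
    (fun s : ℝ => s ^ n) =O[𝓝 0] fun s => s ^ m := by
  rcases h.eq_or_lt with rfl | h
  · exact Asymptotics.isBigO_refl _ _
  · exact (Asymptotics.isLittleO_pow_pow h).isBigO

theorem eq_zero_of_isBigO_pow {c : F} {j M : ℕ} (hj : j < M)
    (h : (fun s : ℝ => s ^ j • c) =O[𝓝[>] 0] fun s => s ^ M) : c = 0 := by
  have h1 : (fun s : ℝ => s ^ j • c) =o[𝓝[>] 0] fun s => s ^ j := by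
    refine h.trans_isLittleO ?_
    exact (Asymptotics.isLittleO_pow_pow hj).mono nhdsWithin_le_nhds
  have h2 : (fun _ : ℝ => c) =o[𝓝[>] 0] fun _ => (1 : ℝ) := by
    rw [Asymptotics.isLittleO_iff] at h1 ⊢
    intro ε hε
    filter_upwards [h1 hε, self_mem_nhdsWithin] with s hs hs0
    have hs0 : 0 < s := hs0
    rw [norm_smul, mul_comm] at hs
    have : 0 < ‖s ^ j‖ := norm_pos_iff.2 (pow_ne_zero _ hs0.ne')
    rw [norm_one, mul_one]
    exact le_of_mul_le_mul_right hs this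
  rwa [Asymptotics.isLittleO_one_iff, tendsto_const_nhds_iff] at h2

theorem taylorWithinEval_Icc_eq {h : ℝ → F} (hh : ContDiff ℝ ∞ h) (m : ℕ) (s : ℝ) :
    taylorWithinEval h m (Icc 0 1) 0 s =
      ∑ j ∈ Finset.range (m + 1), (s ^ j * (j.factorial : ℝ)⁻¹) • iteratedDeriv j h 0 := by
  rw [taylor_within_apply]
  refine Finset.sum_congr rfl fun j _ => ?_
  rw [iteratedDerivWithin_eq_iteratedDeriv (uniqueDiffOn_Icc zero_lt_one)
    (hh.of_le (by exact_mod_cast le_top)).contDiffAt (left_mem_Icc.2 zero_le_one), sub_zero,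
    mul_comm]

theorem taylor_isBigO_nhdsGT {h : ℝ → F} (hh : ContDiff ℝ ∞ h) (m : ℕ) :
    (fun s => h s - ∑ j ∈ Finset.range m, (s ^ j * (j.factorial : ℝ)⁻¹) • iteratedDeriv j h 0)
      =O[𝓝[>] 0] fun s => s ^ m := by
  cases m with
  | zero =>
    simp only [Finset.range_zero, Finset.sum_empty, sub_zero, pow_zero]
    exact (hh.continuous.tendsto 0).isBigO_one ℝ |>.mono nhdsWithin_le_nhds
  | succ m =>
    obtain ⟨C, hC⟩ := exists_taylor_mean_remainder_bound (f := h) (n := m) zero_le_one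
      (hh.of_le (by exact_mod_cast le_top)).contDiffOn
    refine Asymptotics.IsBigO.of_bound C ?_
    filter_upwards [Ioc_mem_nhdsGT (zero_lt_one' ℝ)] with s hs
    have := hC s ⟨hs.1.le, hs.2⟩
    rw [taylorWithinEval_Icc_eq hh, sub_zero] at this
    rwa [Real.norm_of_nonneg (pow_nonneg hs.1.le _)]

/-- If the first j derivatives vanish, then Taylor's formula of order j + 1 leaves a single term of
degree j, which cannot be O(s^{j+1}) unless its coefficient is zero. -/
theorem isBigO_pow_iff_iteratedDeriv_eq_zero {h : ℝ → F} (hh : ContDiff ℝ ∞ h) (M : ℕ) :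
    h =O[𝓝[>] 0] (fun s => s ^ M) ↔ ∀ j < M, iteratedDeriv j h 0 = 0 := by
  constructor
  · intro hO j
    induction j using Nat.strong_induction_on with
    | _ j ih =>
      intro hj
      have h1 := taylor_isBigO_nhdsGT hh (j + 1)
      have hz : ∀ s : ℝ, ∑ i ∈ Finset.range j,
          (s ^ i * (i.factorial : ℝ)⁻¹) • iteratedDeriv i h 0 = 0 := fun s =>
        Finset.sum_eq_zero fun i hi => by
          rw [ih i (Finset.mem_range.1 hi) ((Finset.mem_range.1 hi).trans hj), smul_zero]
      simp only [Finset.sum_range_succ, hz, zero_add] at h1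
      have h2 : h =O[𝓝[>] 0] fun s : ℝ => s ^ (j + 1) :=
        hO.trans ((isBigO_pow_pow_of_le hj).mono nhdsWithin_le_nhds)
      have h3 := h2.sub h1
      simp only [sub_sub_cancel, mul_smul] at h3
      have := eq_zero_of_isBigO_pow (Nat.lt_succ_self j) h3
      exact (smul_eq_zero_iff_right (by positivity)).1 this
  · intro h0
    refine (taylor_isBigO_nhdsGT hh M).congr_left fun s => ?_
    rw [Finset.sum_eq_zero fun j hj => by rw [h0 j (Finset.mem_range.1 hj), smul_zero], sub_zero]

end DirectionalDerivative

/-! ### Weighted Taylor expansions -/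

section WeightedTaylor

open Filter Topology

variable {V : Type*} [NormedAddCommGroup V] [InnerProductSpace ℝ V] [FiniteDimensional ℝ V]
  {𝔫 : StratifiedLieAlgebra V} {n : ℕ} (Z : AdaptedBasis 𝔫 n)
  {F F' F'' : Type*} [NormedAddCommGroup F] [NormedSpace ℝ F]
  [NormedAddCommGroup F'] [NormedSpace ℝ F'] [NormedAddCommGroup F''] [NormedSpace ℝ F'']

namespace AdaptedBasis

/-- The coordinate `x ↦ xᵢ`, as a continuous linear form. -/
noncomputable def coordCLM (i : Fin n) : V →L[ℝ] ℝ :=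
  LinearMap.toContinuousLinearMap (Z.basis.coord i)

@[simp]
theorem coordCLM_apply (i : Fin n) (x : V) : Z.coordCLM i x = Z.basis.repr x i := rfl

theorem repr_dilation (s : ℝ) (x : V) (i : Fin n) :
    Z.basis.repr (Z.dilation s x) i = s ^ Z.weight i * Z.basis.repr x i := by
  rw [dilation, Z.basis.repr_sum_self]

theorem dilation_zero_right (s : ℝ) : Z.dilation s 0 = 0 := by simp [dilation]

theorem dilation_zero_left (x : V) : Z.dilation 0 x = 0 := by
  refine Finset.sum_eq_zero fun i _ => ?_
  rw [zero_pow (by have := Z.one_le_weight i; omega), zero_mul, zero_smul]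

theorem dilation_one (x : V) : Z.dilation 1 x = x := by
  simp [dilation, Z.basis.sum_repr]

theorem dilation_dilation (s r : ℝ) (x : V) :
    Z.dilation s (Z.dilation r x) = Z.dilation (s * r) x := by
  apply Z.basis.ext_elem
  intro i
  rw [repr_dilation, repr_dilation, repr_dilation, mul_pow, mul_assoc]

theorem contDiff_repr (i : Fin n) : ContDiff ℝ ∞ fun x => Z.basis.repr x i :=
  (Z.coordCLM i).contDiff

theorem contDiff_dilation : ContDiff ℝ ∞ fun p : ℝ × V => Z.dilation p.1 p.2 :=
  ContDiff.sum fun i _ => ((contDiff_fst.pow _).mul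
    ((Z.contDiff_repr i).comp contDiff_snd)).smul contDiff_const

/-- The velocity `∂_s δ_s(x)` of the ray through `x`. -/
noncomputable def rayVelocity (s : ℝ) (x : V) : V :=
  ∑ i, ((Z.weight i : ℝ) * s ^ (Z.weight i - 1) * Z.basis.repr x i) • Z.basis i

theorem repr_rayVelocity (s : ℝ) (x : V) (i : Fin n) : Z.basis.repr (Z.rayVelocity s x) i =
    (Z.weight i : ℝ) * s ^ (Z.weight i - 1) * Z.basis.repr x i := by
  rw [rayVelocity, Z.basis.repr_sum_self]

theorem contDiff_rayVelocity : ContDiff ℝ ∞ fun p : ℝ × V => Z.rayVelocity p.1 p.2 :=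
  ContDiff.sum fun i _ => ((contDiff_const.mul (contDiff_fst.pow _)).mul
    ((Z.contDiff_repr i).comp contDiff_snd)).smul contDiff_const

theorem hasDerivAt_dilation (s : ℝ) (x : V) :
    HasDerivAt (fun s => Z.dilation s x) (Z.rayVelocity s x) s :=
  HasDerivAt.fun_sum fun i _ =>
    ((hasDerivAt_pow (Z.weight i) s).mul_const (Z.basis.repr x i)).smul_const (Z.basis i)

/-- The dilation as a continuous linear map. -/
noncomputable def dilationCLM (s : ℝ) : V →L[ℝ] V :=
  ∑ i, (s ^ Z.weight i) • (Z.coordCLM i).smulRight (Z.basis i)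

theorem dilationCLM_apply (s : ℝ) (x : V) : Z.dilationCLM s x = Z.dilation s x := by
  simp [dilationCLM, dilation, smul_smul]

theorem dilation_basis (s : ℝ) (i : Fin n) :
    Z.dilation s (Z.basis i) = s ^ Z.weight i • Z.basis i := by
  apply Z.basis.ext_elem
  intro j
  rw [repr_dilation]
  simp only [map_smul, Z.basis.repr_self, Finsupp.smul_apply, Finsupp.single_apply, smul_eq_mul]
  split_ifs with h
  · rw [h]
  · simp

theorem tendsto_dilation (x : V) : Tendsto (fun s => Z.dilation s x) (𝓝[>] 0) (𝓝 0) := by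
  have h := (Z.hasDerivAt_dilation 0 x).continuousAt.tendsto
  rw [Z.dilation_zero_left] at h
  exact h.mono_left nhdsWithin_le_nhds

/-- The function `u` vanishes to weighted order `m` at the origin. -/
def VanishesTo (m : ℕ) (u : V → F) : Prop :=
  ∀ x, (fun s => u (Z.dilation s x)) =O[𝓝[>] 0] fun s : ℝ => s ^ m

/-- The weighted Taylor component of degree `m`. -/
noncomputable def taylorComponent (u : V → F) (m : ℕ) (x : V) : F :=
  ((m.factorial : ℝ)⁻¹) • iteratedDeriv m (fun s => u (Z.dilation s x)) 0

variable {Z} {m m' : ℕ} {u v : V → F}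

theorem VanishesTo.of_le (h : Z.VanishesTo m u) (hm : m' ≤ m) : Z.VanishesTo m' u := fun x =>
  (h x).trans ((isBigO_pow_pow_of_le hm).mono nhdsWithin_le_nhds)

theorem VanishesTo.add (hu : Z.VanishesTo m u) (hv : Z.VanishesTo m v) :
    Z.VanishesTo m fun x => u x + v x := fun x => (hu x).add (hv x)

theorem VanishesTo.congr (hu : Z.VanishesTo m u) (h : v =ᶠ[𝓝 0] u) : Z.VanishesTo m v := fun x =>
  (hu x).congr' ((Z.tendsto_dilation x).eventually h.symm) EventuallyEq.rfl

theorem vanishesTo_zero (hu : ContinuousAt u 0) : Z.VanishesTo 0 u := fun x => by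
  simp only [pow_zero]
  exact (hu.tendsto.comp (Z.tendsto_dilation x)).isBigO_one ℝ

theorem VanishesTo.bilin (B : F →L[ℝ] F' →L[ℝ] F'') {v : V → F'} (hu : Z.VanishesTo m u)
    (hv : Z.VanishesTo m' v) : Z.VanishesTo (m + m') fun x => B (u x) (v x) := fun x => by
  have h1 : (fun s => B (u (Z.dilation s x)) (v (Z.dilation s x))) =O[𝓝[>] 0]
      fun s => ‖u (Z.dilation s x)‖ * ‖v (Z.dilation s x)‖ :=
    Asymptotics.IsBigO.of_bound ‖B‖ (Eventually.of_forall fun s => by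
      rw [norm_mul, norm_norm, norm_norm, ← mul_assoc]
      exact B.le_opNorm₂ _ _)
  refine h1.trans ?_
  simp only [pow_add]
  exact (hu x).norm_left.mul (hv x).norm_left

theorem VanishesTo.apply_zero (hu : Z.VanishesTo m u) (hm : 0 < m) : u 0 = 0 := by
  have := hu 0
  simp only [Z.dilation_zero_right] at this
  refine eq_zero_of_isBigO_pow (j := 0) hm ?_
  simpa using this

theorem contDiff_comp_dilation (hu : ContDiff ℝ ∞ u) (x : V) :
    ContDiff ℝ ∞ fun s => u (Z.dilation s x) :=
  hu.comp (Z.contDiff_dilation.comp (contDiff_id.prodMk contDiff_const))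

theorem vanishesTo_iff (hu : ContDiff ℝ ∞ u) :
    Z.VanishesTo m u ↔ ∀ j < m, ∀ x, Z.taylorComponent u j x = 0 := by
  have h : ∀ j x, Z.taylorComponent u j x = 0 ↔
      iteratedDeriv j (fun s => u (Z.dilation s x)) 0 = 0 := fun j x =>
    smul_eq_zero_iff_right (by positivity)
  simp only [h, VanishesTo, isBigO_pow_iff_iteratedDeriv_eq_zero (contDiff_comp_dilation hu _)]
  exact ⟨fun H j hj x => H x j hj, fun H x j hj => H j hj x⟩

theorem iteratedDeriv_dilation (hu : ContDiff ℝ ∞ u) (j : ℕ) (s : ℝ) (x : V) :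
    iteratedDeriv j (fun s => u (Z.dilation s x)) s =
      (_root_.dirDeriv ((1 : ℝ), (0 : V)))^[j] (fun p : ℝ × V => u (Z.dilation p.1 p.2)) (s, x) :=
  congrFun (iteratedDeriv_comp_line (f := fun p : ℝ × V => u (Z.dilation p.1 p.2))
    (hu.comp Z.contDiff_dilation) (c := fun s => (s, x)) (a := ((1 : ℝ), (0 : V)))
    (fun s => (hasDerivAt_id s).prodMk (hasDerivAt_const s x)) j) s

/-- Put G(s, x) = u(δ_s x). Then ∂_{xᵢ}G = s^{wᵢ} (∂ᵢu)(δ_s x). The s-derivatives of G of order less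
than m vanish on s = 0 for every x, hence so do their xᵢ-derivatives, and mixed derivatives commute.
So s^{wᵢ} (∂ᵢu)(δ_s x) is O(s^m), and the factor s^{wᵢ} is divided out. -/
theorem VanishesTo.dirDeriv (hu : ContDiff ℝ ∞ u) (h : Z.VanishesTo m u) (i : Fin n) :
    Z.VanishesTo (m - Z.weight i) (dirDeriv (Z.basis i) u) := by
  let G : ℝ × V → F := fun p => u (Z.dilation p.1 p.2)
  have hG : ContDiff ℝ ∞ G := hu.comp Z.contDiff_dilation
  have h0 : ∀ j < m, ∀ x, (_root_.dirDeriv ((1 : ℝ), (0 : V)))^[j] G (0, x) = 0 := by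
    intro j hj x
    rw [← iteratedDeriv_dilation hu]
    exact (isBigO_pow_iff_iteratedDeriv_eq_zero (contDiff_comp_dilation hu _) m).1 (h x) j hj
  have hb : ∀ s x, _root_.dirDeriv ((0 : ℝ), Z.basis i) G (s, x) =
      s ^ Z.weight i • _root_.dirDeriv (Z.basis i) u (Z.dilation s x) := by
    intro s x
    have h1 : HasDerivAt (fun t : ℝ => ((s, x) : ℝ × V) + t • ((0 : ℝ), Z.basis i))
        ((0 : ℝ), Z.basis i) 0 := by
      simpa using ((hasDerivAt_id (0 : ℝ)).smul_const ((0 : ℝ), Z.basis i)).const_add (s, x)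
    have h2 := (show HasFDerivAt G (fderiv ℝ G (s, x)) ((s, x) + (0 : ℝ) • ((0 : ℝ), Z.basis i)) by
      simpa using (hG.differentiable (by simp) (s, x)).hasFDerivAt).comp_hasDerivAt (0 : ℝ) h1
    have h3 : HasDerivAt (fun t : ℝ => Z.dilation s x + t • Z.dilation s (Z.basis i))
        (Z.dilation s (Z.basis i)) 0 := by
      simpa using ((hasDerivAt_id (0 : ℝ)).smul_const (Z.dilation s (Z.basis i))).const_add
        (Z.dilation s x)
    have h4 := (show HasFDerivAt u (fderiv ℝ u (Z.dilation s x))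
      (Z.dilation s x + (0 : ℝ) • Z.dilation s (Z.basis i)) by
      simpa using (hu.differentiable (by simp) (Z.dilation s x)).hasFDerivAt).comp_hasDerivAt
        (0 : ℝ) h3
    have h5 : (G ∘ fun t : ℝ => ((s, x) : ℝ × V) + t • ((0 : ℝ), Z.basis i)) =
        u ∘ fun t : ℝ => Z.dilation s x + t • Z.dilation s (Z.basis i) := by
      funext t
      simp [G, ← dilationCLM_apply]
    rw [h5] at h2
    have h6 := h2.unique h4
    rw [dilation_basis, map_smul] at h6
    exact h6
  intro x
  have h1 : ∀ j < m, iteratedDeriv j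
      (fun s => s ^ Z.weight i • _root_.dirDeriv (Z.basis i) u (Z.dilation s x)) 0 = 0 := by
    intro j hj
    have h2 : (fun s => s ^ Z.weight i • _root_.dirDeriv (Z.basis i) u (Z.dilation s x)) =
        fun s => _root_.dirDeriv ((0 : ℝ), Z.basis i) G (s, x) := funext fun s => (hb s x).symm
    rw [h2, iteratedDeriv_comp_line (hG.dirDeriv _) (c := fun s => (s, x))
      (a := ((1 : ℝ), (0 : V))) (fun s => (hasDerivAt_id s).prodMk (hasDerivAt_const s x)) j]
    simp only
    rw [← dirDeriv_iterate_comm hG]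
    have h3 : HasDerivAt (fun t : ℝ => (((0 : ℝ), x) : ℝ × V) + t • ((0 : ℝ), Z.basis i))
        ((0 : ℝ), Z.basis i) 0 := by
      simpa using ((hasDerivAt_id (0 : ℝ)).smul_const ((0 : ℝ), Z.basis i)).const_add ((0 : ℝ), x)
    have h4 := (show HasFDerivAt ((_root_.dirDeriv ((1 : ℝ), (0 : V)))^[j] G)
      (fderiv ℝ ((_root_.dirDeriv ((1 : ℝ), (0 : V)))^[j] G) (0, x))
      ((0, x) + (0 : ℝ) • ((0 : ℝ), Z.basis i)) by
      simpa using ((hG.dirDeriv_iterate _ j).differentiable (by simp)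
        (0, x)).hasFDerivAt).comp_hasDerivAt (0 : ℝ) h3
    have h5 : ((_root_.dirDeriv ((1 : ℝ), (0 : V)))^[j] G ∘
        fun t : ℝ => (((0 : ℝ), x) : ℝ × V) + t • ((0 : ℝ), Z.basis i)) = fun _ => 0 := by
      funext t
      simpa using h0 j hj (x + t • Z.basis i)
    rw [h5] at h4
    exact h4.unique (hasDerivAt_const _ _)
  have hsm : ContDiff ℝ ∞
      (fun s => s ^ Z.weight i • _root_.dirDeriv (Z.basis i) u (Z.dilation s x)) :=
    (contDiff_id.pow (Z.weight i)).smul (contDiff_comp_dilation (hu.dirDeriv (Z.basis i)) x)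
  have h2 := (isBigO_pow_iff_iteratedDeriv_eq_zero hsm m).2 h1
  -- If the weight exceeds m, the truncated order is 0 and continuity suffices.
  rcases le_total (Z.weight i) m with hwm | hwm
  · obtain ⟨C, hC⟩ := h2.bound
    refine Asymptotics.IsBigO.of_bound C ?_
    filter_upwards [hC, self_mem_nhdsWithin] with s hs hs0
    have hs0' : 0 < s := hs0
    have hp : 0 < s ^ Z.weight i := by positivity
    simp only [norm_smul, Real.norm_of_nonneg hp.le] at hs
    rw [← Nat.sub_add_cancel hwm, pow_add, norm_mul, Real.norm_of_nonneg hp.le, ← mul_assoc,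
      mul_comm (s ^ Z.weight i)] at hs
    exact le_of_mul_le_mul_right hs hp
  · rw [Nat.sub_eq_zero_of_le hwm]
    exact vanishesTo_zero (hu.dirDeriv (Z.basis i)).continuous.continuousAt x

theorem taylorComponent_dilation (hu : ContDiff ℝ ∞ u) (ρ : ℝ) (x : V) :
    Z.taylorComponent u m (Z.dilation ρ x) = ρ ^ m • Z.taylorComponent u m x := by
  have h := iteratedDeriv_comp_const_smul (n := m)
    ((contDiff_comp_dilation (Z := Z) hu x).of_le (by exact_mod_cast le_top)) ρ
  have h1 : (fun s => u (Z.dilation s (Z.dilation ρ x))) =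
      fun s => (fun s => u (Z.dilation s x)) (ρ * s) := by
    funext s
    rw [dilation_dilation, mul_comm]
  rw [taylorComponent, taylorComponent, h1]
  have h2 := congrFun h 0
  simp only [mul_zero] at h2
  rw [h2, smul_comm]

/-- Weighted Taylor expansion with a uniform remainder estimate. -/
theorem exists_taylor_remainder_bound (hu : ContDiff ℝ ∞ u) (m : ℕ) : ∃ C : ℝ, 0 ≤ C ∧
    ∀ ρ ∈ Icc (0 : ℝ) 1, ∀ x, (∀ i, |Z.basis.repr x i| ≤ ρ ^ Z.weight i) →
      ‖u x - ∑ j ∈ Finset.range m, Z.taylorComponent u j x‖ ≤ C * ρ ^ m := by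
  let Box : Set V := {y | ∀ i, |Z.basis.repr y i| ≤ 1}
  have hBox : IsCompact Box := by
    have h1 : Box = Z.basis.equivFun.symm '' (Set.univ.pi fun _ => Icc (-1 : ℝ) 1) := by
      ext y
      constructor
      · intro hy
        exact ⟨Z.basis.equivFun y, fun i _ => abs_le.1 (by simpa using hy i), by simp⟩
      · rintro ⟨c, hc, rfl⟩ i
        have h2 : Z.basis.repr (Z.basis.equivFun.symm c) i = c i := by
          rw [← Module.Basis.equivFun_apply, LinearEquiv.apply_symm_apply]
        rw [h2]
        exact abs_le.2 (hc i (mem_univ i))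
    rw [h1]
    exact (isCompact_univ_pi fun _ => isCompact_Icc).image
      (LinearMap.continuous_of_finiteDimensional Z.basis.equivFun.symm.toLinearMap)
  let G : ℝ × V → F := fun p => u (Z.dilation p.1 p.2)
  have hG : ContDiff ℝ ∞ G := hu.comp Z.contDiff_dilation
  obtain ⟨C, hC⟩ := ((isCompact_Icc (a := (0 : ℝ)) (b := 1)).prod hBox).exists_bound_of_continuousOn
    (hG.dirDeriv_iterate ((1 : ℝ), (0 : V)) m).continuous.continuousOn
  refine ⟨|C|, abs_nonneg _, fun ρ hρ x hx => ?_⟩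
  -- Any point of the box of size ρ is δ_ρ(y) with y in the compact unit box. The estimate is then
  -- Taylor's formula in the single variable s, evaluated at s = ρ, uniformly in y.
  obtain ⟨y, hy, rfl⟩ : ∃ y ∈ Box, Z.dilation ρ y = x := by
    rcases hρ.1.eq_or_lt with rfl | h0
    · refine ⟨0, fun i => by simp, ?_⟩
      rw [dilation_zero_right]
      apply Z.basis.ext_elem
      intro i
      have := hx i
      rw [zero_pow (by have := Z.one_le_weight i; omega)] at this
      simpa using (abs_nonpos_iff.1 this).symm
    · refine ⟨Z.dilation ρ⁻¹ x, fun i => ?_, ?_⟩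
      · rw [repr_dilation, abs_mul, abs_pow, abs_inv, abs_of_pos h0, inv_pow,
          inv_mul_le_iff₀ (by positivity), mul_one]
        exact hx i
      · rw [dilation_dilation, mul_inv_cancel₀ h0.ne', dilation_one]
  simp only [taylorComponent_dilation hu]
  cases m with
  | zero =>
    simp only [Finset.range_zero, Finset.sum_empty, sub_zero, pow_zero, mul_one]
    exact (hC (ρ, y) ⟨hρ, hy⟩).trans (le_abs_self C)
  | succ m =>
    have h1 := taylor_mean_remainder_bound (f := fun s => u (Z.dilation s y)) (n := m)
      (C := C) zero_le_one
      ((contDiff_comp_dilation hu y).of_le (by exact_mod_cast le_top)).contDiffOn hρ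
      (fun s hs => by
        rw [iteratedDerivWithin_eq_iteratedDeriv (uniqueDiffOn_Icc zero_lt_one)
          ((contDiff_comp_dilation hu y).of_le (by exact_mod_cast le_top)).contDiffAt hs,
          iteratedDeriv_dilation hu]
        exact hC (s, y) ⟨hs, hy⟩)
    rw [taylorWithinEval_Icc_eq (contDiff_comp_dilation hu y)] at h1
    have h2 : ∑ j ∈ Finset.range (m + 1), ρ ^ j • Z.taylorComponent u j y =
        ∑ j ∈ Finset.range (m + 1), (ρ ^ j * (j.factorial : ℝ)⁻¹) •
          iteratedDeriv j (fun s => u (Z.dilation s y)) 0 := by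
      refine Finset.sum_congr rfl fun j _ => ?_
      rw [taylorComponent, smul_smul]
    rw [h2]
    refine h1.trans ?_
    rw [sub_zero]
    have hf : (1 : ℝ) ≤ m.factorial := by exact_mod_cast Nat.succ_le_of_lt m.factorial_pos
    refine div_le_of_le_mul₀ (by positivity) (by have := hρ.1; positivity) ?_
    have h0 := pow_nonneg hρ.1 (m + 1)
    calc C * ρ ^ (m + 1) ≤ |C| * ρ ^ (m + 1) := by gcongr; exact le_abs_self C
      _ ≤ |C| * ρ ^ (m + 1) * m.factorial := le_mul_of_one_le_right (by positivity) hf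

variable (Z)

theorem dirDeriv_eq_sum (y : V) (u : V → F) (z : V) :
    _root_.dirDeriv y u z = ∑ i, Z.basis.repr y i • _root_.dirDeriv (Z.basis i) u z := by
  simp only [_root_.dirDeriv]
  conv_lhs => rw [← Z.basis.sum_repr y]
  simp only [map_sum, map_smul]

theorem dirDeriv_iterate_eq_sum (hu : ContDiff ℝ ∞ u) (y z : V) (j : ℕ) :
    (_root_.dirDeriv y)^[j] u z = ∑ μ : Fin j → Fin n, (∏ a, Z.basis.repr y (μ a)) •
      iterDirDeriv (List.ofFn fun a => Z.basis (μ a)) u z := by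
  induction j generalizing z with
  | zero => simp [iterDirDeriv]
  | succ j ih =>
    rw [Function.iterate_succ_apply', dirDeriv_eq_sum Z, funext ih,
      ← (Fin.consEquiv fun _ : Fin (j + 1) => Fin n).sum_comp, Fintype.sum_prod_type]
    refine Finset.sum_congr rfl fun i _ => ?_
    have hd : ∀ μ : Fin j → Fin n, Differentiable ℝ
        (iterDirDeriv (List.ofFn fun a => Z.basis (μ a)) u) := fun μ =>
      (hu.iterDirDeriv _).differentiable (by simp)
    rw [_root_.dirDeriv, fderiv_fun_sum fun μ _ => (hd μ z).fun_const_smul _, sum_apply,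
      Finset.smul_sum]
    refine Finset.sum_congr rfl fun μ _ => ?_
    rw [fderiv_fun_const_smul (hd μ z), _root_.smul_apply, smul_smul]
    simp [Fin.consEquiv, Fin.prod_univ_succ, List.ofFn_succ, iterDirDeriv, _root_.dirDeriv]

/-- The weighted Taylor components in terms of iterated directional derivatives. -/
theorem taylorComponent_eq_sum (hu : ContDiff ℝ ∞ u) (m : ℕ) (x : V) :
    Z.taylorComponent u m x = ∑ j ∈ Finset.range (m + 1),
      ∑ μ ∈ (Finset.univ : Finset (Fin j → Fin n)).filter fun μ => ∑ a, Z.weight (μ a) = m,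
        ((∏ a, Z.basis.repr x (μ a)) / (j.factorial : ℝ)) •
          iterDirDeriv (List.ofFn fun a => Z.basis (μ a)) u 0 := by
  let c : (j : ℕ) → (Fin j → Fin n) → F := fun j μ =>
    ((∏ a, Z.basis.repr x (μ a)) / (j.factorial : ℝ)) •
      iterDirDeriv (List.ofFn fun a => Z.basis (μ a)) u 0
  -- The ordinary Taylor polynomial of degree m of u at 0, evaluated at δ_s(x), sorted by powers of
  -- s. Weights are at least 1, so δ_s(x) = O(s) and the neglected derivatives of order m + 1
  -- contribute O(s^{m+1}). Hence u(δ_s x) and q have the same coefficient of s^m.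
  let q : ℝ → F := fun s => ∑ j ∈ Finset.range (m + 1), ∑ μ : Fin j → Fin n,
    s ^ (∑ a, Z.weight (μ a)) • c j μ
  have hmono : ∀ (k : ℕ) (e : F), ContDiff ℝ ∞ fun s : ℝ => s ^ k • e := fun k e =>
    (contDiff_id.pow k).smul contDiff_const
  have hq : ContDiff ℝ ∞ q := ContDiff.sum fun j _ => ContDiff.sum fun μ _ => hmono _ _
  have hqs : ∀ s, q s = ∑ j ∈ Finset.range (m + 1), ((1 : ℝ) ^ j * (j.factorial : ℝ)⁻¹) •
      (_root_.dirDeriv (Z.dilation s x))^[j] u ((0 : ℝ) • Z.dilation s x) := by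
    intro s
    refine Finset.sum_congr rfl fun j _ => ?_
    rw [dirDeriv_iterate_eq_sum Z hu, Finset.smul_sum]
    refine Finset.sum_congr rfl fun μ _ => ?_
    simp only [c, repr_dilation, Finset.prod_mul_distrib, Finset.prod_pow_eq_pow_sum, smul_smul,
      zero_smul]
    congr 1
    rw [one_pow]
    ring
  have hline : ∀ s, ∀ τ : ℝ, HasDerivAt (fun τ : ℝ => τ • Z.dilation s x) (Z.dilation s x) τ :=
    fun s τ => by simpa using (hasDerivAt_id τ).smul_const (Z.dilation s x)
  have hφ : ∀ s, ContDiff ℝ ∞ fun τ : ℝ => u (τ • Z.dilation s x) := fun s =>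
    hu.comp (contDiff_id.smul contDiff_const)
  -- a uniform bound for the derivatives of order `m + 1` along the segments
  obtain ⟨C, hC0, hC⟩ : ∃ C : ℝ, 0 ≤ C ∧ ∀ s ∈ Icc (0 : ℝ) 1, ∀ τ ∈ Icc (0 : ℝ) 1,
      ‖(_root_.dirDeriv (Z.dilation s x))^[m + 1] u (τ • Z.dilation s x)‖ ≤ C * s ^ (m + 1) := by
    have hb : ∀ μ : Fin (m + 1) → Fin n, ∃ K : ℝ, ∀ p ∈ Icc (0 : ℝ) 1 ×ˢ Icc (0 : ℝ) 1,
        ‖iterDirDeriv (List.ofFn fun a => Z.basis (μ a)) u (p.2 • Z.dilation p.1 x)‖ ≤ K := by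
      intro μ
      refine (isCompact_Icc.prod isCompact_Icc).exists_bound_of_continuousOn ?_
      refine ((hu.iterDirDeriv _).continuous.comp (continuous_snd.smul ?_)).continuousOn
      exact Z.contDiff_dilation.continuous.comp (continuous_fst.prodMk continuous_const)
    choose K hK using hb
    have hK0 : ∀ μ, 0 ≤ K μ := fun μ => (norm_nonneg _).trans
      (hK μ (0, 0) ⟨left_mem_Icc.2 zero_le_one, left_mem_Icc.2 zero_le_one⟩)
    refine ⟨∑ μ, (∏ a, |Z.basis.repr x (μ a)|) * K μ, Finset.sum_nonneg fun μ _ =>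
      mul_nonneg (Finset.prod_nonneg fun _ _ => abs_nonneg _) (hK0 μ), fun s hs τ hτ => ?_⟩
    rw [dirDeriv_iterate_eq_sum Z hu, Finset.sum_mul]
    refine (norm_sum_le _ _).trans (Finset.sum_le_sum fun μ _ => ?_)
    rw [norm_smul, Real.norm_eq_abs, Finset.abs_prod]
    have h1 : ∏ a, |Z.basis.repr (Z.dilation s x) (μ a)| ≤
        (∏ a, |Z.basis.repr x (μ a)|) * s ^ (m + 1) := by
      calc ∏ a, |Z.basis.repr (Z.dilation s x) (μ a)|
          ≤ ∏ a, |Z.basis.repr x (μ a)| * s := by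
            refine Finset.prod_le_prod (fun _ _ => abs_nonneg _) fun a _ => ?_
            rw [repr_dilation, abs_mul, abs_pow, abs_of_nonneg hs.1, mul_comm]
            gcongr
            exact pow_le_of_le_one hs.1 hs.2 (by have := Z.one_le_weight (μ a); omega)
        _ = _ := by simp [Finset.prod_mul_distrib]
    calc _ ≤ ((∏ a, |Z.basis.repr x (μ a)|) * s ^ (m + 1)) * K μ :=
          mul_le_mul h1 (hK μ (s, τ) ⟨hs, hτ⟩) (norm_nonneg _)
            (mul_nonneg (Finset.prod_nonneg fun _ _ => abs_nonneg _) (pow_nonneg hs.1 _))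
      _ = _ := by ring
  have hO : (fun s => u (Z.dilation s x) - q s) =O[𝓝[>] 0] fun s => s ^ (m + 1) := by
    refine Asymptotics.IsBigO.of_bound C ?_
    filter_upwards [Ioc_mem_nhdsGT (zero_lt_one' ℝ)] with s hs
    have hs' : s ∈ Icc (0 : ℝ) 1 := ⟨hs.1.le, hs.2⟩
    have h1 := taylor_mean_remainder_bound (f := fun τ : ℝ => u (τ • Z.dilation s x)) (n := m)
      (C := C * s ^ (m + 1)) zero_le_one
      ((hφ s).of_le (by exact_mod_cast le_top)).contDiffOn (right_mem_Icc.2 zero_le_one)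
      (fun τ hτ => by
        rw [iteratedDerivWithin_eq_iteratedDeriv (uniqueDiffOn_Icc zero_lt_one)
          ((hφ s).of_le (by exact_mod_cast le_top)).contDiffAt hτ,
          iteratedDeriv_comp_line hu (hline s)]
        exact hC s hs' τ hτ)
    rw [taylorWithinEval_Icc_eq (hφ s)] at h1
    simp only [iteratedDeriv_comp_line hu (hline s)] at h1
    rw [← hqs, one_smul, sub_zero, one_pow, mul_one] at h1
    rw [Real.norm_of_nonneg (pow_nonneg hs'.1 _)]
    refine h1.trans (div_le_self (mul_nonneg hC0 (pow_nonneg hs'.1 _)) ?_)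
    exact_mod_cast Nat.succ_le_of_lt m.factorial_pos
  have h0 := (isBigO_pow_iff_iteratedDeriv_eq_zero ((contDiff_comp_dilation hu x).sub hq)
    (m + 1)).1 hO m (Nat.lt_succ_self m)
  have hle : ∀ {f : ℝ → F}, ContDiff ℝ ∞ f → ContDiffAt ℝ m f 0 := fun hf =>
    (hf.of_le (by exact_mod_cast le_top)).contDiffAt
  have h0' : iteratedDeriv m (fun s => u (Z.dilation s x) - q s) 0 = 0 := h0
  rw [iteratedDeriv_fun_sub (hle (contDiff_comp_dilation hu x)) (hle hq), sub_eq_zero] at h0'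
  have h2 : iteratedDeriv m q 0 = (m.factorial : ℝ) • ∑ j ∈ Finset.range (m + 1),
      ∑ μ ∈ (Finset.univ : Finset (Fin j → Fin n)).filter (fun μ => ∑ a, Z.weight (μ a) = m),
        c j μ := by
    rw [iteratedDeriv_fun_sum fun j _ => hle (ContDiff.sum fun μ _ => hmono _ _), Finset.smul_sum]
    refine Finset.sum_congr rfl fun j _ => ?_
    rw [iteratedDeriv_fun_sum fun μ _ => hle (hmono _ _), Finset.smul_sum, Finset.sum_filter]
    refine Finset.sum_congr rfl fun μ _ => ?_
    have h3 : iteratedDeriv m (fun s : ℝ => s ^ (∑ a, Z.weight (μ a)) • c j μ) 0 =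
        iteratedDeriv m (fun s : ℝ => s ^ (∑ a, Z.weight (μ a))) 0 • c j μ :=
      iteratedDeriv_smul_const (f := fun s : ℝ => s ^ (∑ a, Z.weight (μ a)))
        (contDiff_id.pow _).contDiffAt _
    rw [h3, iteratedDeriv_fun_pow_zero]
    by_cases h4 : ∑ a, Z.weight (μ a) = m
    · rw [if_pos h4, if_pos h4.symm, h4]
    · rw [if_neg h4, if_neg (Ne.symm h4), Nat.cast_zero, zero_smul]
  rw [taylorComponent, h0', h2, smul_smul, inv_mul_cancel₀ (by positivity), one_smul]

end AdaptedBasis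

end WeightedTaylor

/-! ### A Lie group in the preferred chart at the identity -/

section LieGroupChart

open Filter Topology

variable {EG : Type*} [NormedAddCommGroup EG] [NormedSpace ℝ EG]
  (G : Type*) [TopologicalSpace G] [ChartedSpace EG G] [Group G]

/-- The inverse of the preferred chart at the identity. -/
noncomputable def chartInv (z : EG) : G := (extChartAt 𝓘(ℝ, EG) (1 : G)).symm z

/-- The coordinates of the identity. -/
noncomputable def chartOne : EG := extChartAt 𝓘(ℝ, EG) (1 : G) 1

/-- The range of the preferred chart at the identity. -/
def chartDomain : Set EG := (extChartAt 𝓘(ℝ, EG) (1 : G)).target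

variable {G} in
/-- The preferred chart at the identity. -/
noncomputable def chartCoord (a : G) : EG := extChartAt 𝓘(ℝ, EG) (1 : G) a

/-- Multiplication read in the chart. -/
noncomputable def chartMul (p : EG × EG) : EG :=
  chartCoord (chartInv G p.1 * chartInv G p.2)

/-- The differential of right translation at the identity, in the chart. -/
noncomputable def chartRight (z : EG) : EG →L[ℝ] EG :=
  fderiv ℝ (fun y => chartMul G (y, z)) (chartOne G)

/-- The differential of left translation at the identity, in the chart. -/
noncomputable def chartLeft (z : EG) : EG →L[ℝ] EG :=
  fderiv ℝ (fun y => chartMul G (z, y)) (chartOne G)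

/-- The operators `Ad(a⁻¹)`, in the chart. -/
noncomputable def chartAd (z : EG) : EG →L[ℝ] EG := lieAd (chartInv G z)⁻¹

variable {G}

theorem isOpen_chartDomain : IsOpen (chartDomain (EG := EG) G) := isOpen_extChartAt_target _

theorem chartOne_mem : chartOne G ∈ chartDomain (EG := EG) G := mem_extChartAt_target _

theorem chartDomain_mem_nhds : chartDomain (EG := EG) G ∈ 𝓝 (chartOne G) :=
  isOpen_chartDomain.mem_nhds chartOne_mem

@[simp]
theorem chartInv_chartOne : chartInv G (chartOne (EG := EG) G) = 1 := extChartAt_to_inv _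

theorem chartCoord_one : chartCoord (1 : G) = chartOne (EG := EG) G := rfl

theorem chartCoord_chartInv {z : EG} (hz : z ∈ chartDomain G) : chartCoord (chartInv G z) = z :=
  (extChartAt 𝓘(ℝ, EG) (1 : G)).right_inv hz

theorem chartInv_chartCoord {a : G} (ha : a ∈ (extChartAt 𝓘(ℝ, EG) (1 : G)).source) :
    chartInv G (chartCoord a : EG) = a := (extChartAt 𝓘(ℝ, EG) (1 : G)).left_inv ha

theorem chartInv_mem_source {z : EG} (hz : z ∈ chartDomain G) :
    chartInv G z ∈ (extChartAt 𝓘(ℝ, EG) (1 : G)).source :=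
  (extChartAt 𝓘(ℝ, EG) (1 : G)).map_target hz

variable [LieGroup 𝓘(ℝ, EG) ∞ G]

theorem contMDiffOn_chartInv :
    ContMDiffOn 𝓘(ℝ, EG) 𝓘(ℝ, EG) ∞ (chartInv G) (chartDomain (EG := EG) G) :=
  haveI := LieGroup.toContMDiffMul (I := 𝓘(ℝ, EG)) (n := ∞) (G := G)
  haveI : IsManifold 𝓘(ℝ, EG) ∞ G := ContMDiffMul.toIsManifold
  contMDiffOn_extChartAt_symm (1 : G)

theorem contMDiffOn_chartCoord : ContMDiffOn 𝓘(ℝ, EG) 𝓘(ℝ, EG) ∞ (chartCoord (G := G) (EG := EG))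
    (extChartAt 𝓘(ℝ, EG) (1 : G)).source :=
  haveI : IsManifold 𝓘(ℝ, EG) ∞ G := ContMDiffMul.toIsManifold
  fun a ha => (contMDiffAt_extChartAt' (by simpa using ha)).contMDiffWithinAt

theorem contMDiffAt_chartInv {z : EG} (hz : z ∈ chartDomain G) :
    ContMDiffAt 𝓘(ℝ, EG) 𝓘(ℝ, EG) ∞ (chartInv G) z :=
  contMDiffOn_chartInv.contMDiffAt (isOpen_chartDomain.mem_nhds hz)

theorem contMDiffAt_chartCoord {a : G} (ha : a ∈ (extChartAt 𝓘(ℝ, EG) (1 : G)).source) :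
    ContMDiffAt 𝓘(ℝ, EG) 𝓘(ℝ, EG) ∞ (chartCoord (G := G) (EG := EG)) a :=
  contMDiffOn_chartCoord.contMDiffAt ((isOpen_extChartAt_source _).mem_nhds ha)

theorem contDiffAt_chartMul {y z : EG} (hy : y ∈ chartDomain G) (hz : z ∈ chartDomain G)
    (h : chartInv G y * chartInv G z ∈ (extChartAt 𝓘(ℝ, EG) (1 : G)).source) :
    ContDiffAt ℝ ∞ (chartMul (EG := EG) G) (y, z) := by
  rw [← contMDiffAt_iff_contDiffAt]
  have h1 : ContMDiffAt 𝓘(ℝ, EG × EG) 𝓘(ℝ, EG) ∞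
      (fun p : EG × EG => chartInv G p.1 * chartInv G p.2) (y, z) := by
    refine ContMDiffAt.mul ?_ ?_
    · exact ContMDiffAt.comp (y, z) (contMDiffAt_chartInv hy)
        (contDiff_fst.contDiffAt.contMDiffAt)
    · exact ContMDiffAt.comp (y, z) (contMDiffAt_chartInv hz)
        (contDiff_snd.contDiffAt.contMDiffAt)
  exact ContMDiffAt.comp (y, z) (contMDiffAt_chartCoord h) h1

theorem chartMul_right {z : EG} (hz : z ∈ chartDomain G) : chartMul G (chartOne G, z) = z := by
  simp [chartMul, chartCoord_chartInv hz]

theorem chartMul_left {z : EG} (hz : z ∈ chartDomain G) : chartMul G (z, chartOne G) = z := by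
  simp [chartMul, chartCoord_chartInv hz]

theorem contDiffAt_chartMul_right {z : EG} (hz : z ∈ chartDomain G) :
    ContDiffAt ℝ ∞ (chartMul (EG := EG) G) (chartOne G, z) :=
  contDiffAt_chartMul chartOne_mem hz (by simpa using chartInv_mem_source hz)

theorem contDiffAt_chartMul_left {z : EG} (hz : z ∈ chartDomain G) :
    ContDiffAt ℝ ∞ (chartMul (EG := EG) G) (z, chartOne G) :=
  contDiffAt_chartMul hz chartOne_mem (by simpa using chartInv_mem_source hz)

theorem hasFDerivAt_chartMul_right {z : EG} (hz : z ∈ chartDomain G) :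
    HasFDerivAt (fun y => chartMul G (y, z)) (chartRight G z) (chartOne G) := by
  refine DifferentiableAt.hasFDerivAt ?_
  have h1 := (contDiffAt_chartMul_right hz).differentiableAt (by simp)
  exact DifferentiableAt.comp (g := chartMul G) (chartOne G) h1
    (differentiableAt_id.prodMk (differentiableAt_const z))

theorem hasFDerivAt_chartMul_left {z : EG} (hz : z ∈ chartDomain G) :
    HasFDerivAt (fun y => chartMul G (z, y)) (chartLeft G z) (chartOne G) := by
  refine DifferentiableAt.hasFDerivAt ?_
  have h1 := (contDiffAt_chartMul_left hz).differentiableAt (by simp)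
  exact DifferentiableAt.comp (g := chartMul G) (chartOne G) h1
    ((differentiableAt_const z).prodMk differentiableAt_id)

theorem chartRight_eq {z : EG} (hz : z ∈ chartDomain G) : chartRight G z =
    (fderiv ℝ (chartMul G) (chartOne G, z)).comp (ContinuousLinearMap.inl ℝ EG EG) := by
  have h1 := ((contDiffAt_chartMul_right hz).differentiableAt (by simp)).hasFDerivAt
  exact (HasFDerivAt.comp (chartOne G) h1 (hasFDerivAt_prodMk_left (𝕜 := ℝ) (chartOne G : EG) z)).fderiv

theorem chartLeft_eq {z : EG} (hz : z ∈ chartDomain G) : chartLeft G z =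
    (fderiv ℝ (chartMul G) (z, chartOne G)).comp (ContinuousLinearMap.inr ℝ EG EG) := by
  have h1 := ((contDiffAt_chartMul_left hz).differentiableAt (by simp)).hasFDerivAt
  exact (HasFDerivAt.comp (chartOne G) h1 (hasFDerivAt_prodMk_right z (chartOne G))).fderiv

theorem contDiffOn_chartRight : ContDiffOn ℝ ∞ (chartRight G) (chartDomain (EG := EG) G) := by
  intro z hz
  have h1 : ContDiffAt ℝ ∞ (fun z => (fderiv ℝ (chartMul G) (chartOne G, z)).comp
      (ContinuousLinearMap.inl ℝ EG EG)) z :=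
    (((contDiffAt_chartMul_right hz).fderiv_right (m := ∞) (by simp)).comp z
      (contDiffAt_const.prodMk contDiffAt_id)).clm_comp contDiffAt_const
  refine (h1.congr_of_eventuallyEq ?_).contDiffWithinAt
  filter_upwards [isOpen_chartDomain.mem_nhds hz] with y hy using chartRight_eq hy

theorem contDiffOn_chartLeft : ContDiffOn ℝ ∞ (chartLeft G) (chartDomain (EG := EG) G) := by
  intro z hz
  have h1 : ContDiffAt ℝ ∞ (fun z => (fderiv ℝ (chartMul G) (z, chartOne G)).comp
      (ContinuousLinearMap.inr ℝ EG EG)) z :=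
    (((contDiffAt_chartMul_left hz).fderiv_right (m := ∞) (by simp)).comp z
      (contDiffAt_id.prodMk contDiffAt_const)).clm_comp contDiffAt_const
  refine (h1.congr_of_eventuallyEq ?_).contDiffWithinAt
  filter_upwards [isOpen_chartDomain.mem_nhds hz] with y hy using chartLeft_eq hy

theorem chartRight_one : chartRight G (chartOne G) = ContinuousLinearMap.id ℝ EG := by
  refine ((hasFDerivAt_id (chartOne G)).congr_of_eventuallyEq ?_).fderiv
  filter_upwards [chartDomain_mem_nhds] with y hy using chartMul_left hy

theorem chartLeft_one : chartLeft G (chartOne G) = ContinuousLinearMap.id ℝ EG := by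
  refine ((hasFDerivAt_id (chartOne G)).congr_of_eventuallyEq ?_).fderiv
  filter_upwards [chartDomain_mem_nhds] with y hy using chartMul_right hy

/-- The operators `Ad` are the differentials of the conjugations, read in the chart. -/
theorem lieAd_eq_fderiv (a : G) : lieAd a =
    fderiv ℝ (fun y => chartCoord (a * chartInv G y * a⁻¹)) (chartOne (EG := EG) G) := by
  have hd : MDifferentiableAt 𝓘(ℝ, EG) 𝓘(ℝ, EG) (fun x : G => a * x * a⁻¹) 1 := by
    refine ContMDiffAt.mdifferentiableAt (n := ∞) ?_ (by simp)
    exact (contMDiffAt_const.mul contMDiffAt_id).mul contMDiffAt_const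
  have h1 : a * 1 * a⁻¹ = 1 := by simp
  have h2 : (writtenInExtChartAt 𝓘(ℝ, EG) 𝓘(ℝ, EG) (1 : G) fun x : G => a * x * a⁻¹) =
      fun y => chartCoord (a * chartInv G y * a⁻¹) := by
    rw [writtenInExtChartAt, h1]
    rfl
  refine hd.mfderiv.trans ?_
  rw [h2, ModelWithCorners.range_eq_univ, fderivWithin_univ]
  rfl

/-- Conjugation read in the chart is jointly smooth, and the operators are its partial differentials
at the identity. -/
theorem exists_contDiffAt_chartAd {z : EG} (hz : z ∈ chartDomain G) :
    ContDiffAt ℝ ∞ (chartAd G) z := by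
  let N : EG × EG → EG := fun p =>
    chartCoord ((chartInv G p.1)⁻¹ * chartInv G p.2 * (chartInv G p.1)⁻¹⁻¹)
  have hN : ContDiffAt ℝ ∞ N (z, chartOne G) := by
    rw [← contMDiffAt_iff_contDiffAt]
    have h1 : ContMDiffAt 𝓘(ℝ, EG × EG) 𝓘(ℝ, EG) ∞ (fun p : EG × EG => chartInv G p.1)
        (z, chartOne G) := ContMDiffAt.comp (z, chartOne G) (contMDiffAt_chartInv hz)
        (contDiff_fst.contDiffAt.contMDiffAt)
    have h2 : ContMDiffAt 𝓘(ℝ, EG × EG) 𝓘(ℝ, EG) ∞ (fun p : EG × EG => chartInv G p.2)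
        (z, chartOne G) := ContMDiffAt.comp (z, chartOne G) (contMDiffAt_chartInv chartOne_mem)
        (contDiff_snd.contDiffAt.contMDiffAt)
    refine ContMDiffAt.comp (z, chartOne G) (contMDiffAt_chartCoord ?_)
      ((h1.inv.mul h2).mul h1.inv.inv)
    simp
  have h1 : ContDiffAt ℝ ∞ (fun z => (fderiv ℝ N (z, chartOne G)).comp
      (ContinuousLinearMap.inr ℝ EG EG)) z :=
    ((hN.fderiv_right (m := ∞) (by simp)).comp z
      (contDiffAt_id.prodMk contDiffAt_const)).clm_comp contDiffAt_const
  refine h1.congr_of_eventuallyEq ?_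
  have h2 : ∀ᶠ p in 𝓝 (z, chartOne G), ContDiffAt ℝ 1 N p :=
    (hN.of_le (by simp)).eventually (by simp)
  have h3 : Tendsto (fun y => (y, chartOne (EG := EG) G)) (𝓝 z) (𝓝 (z, chartOne G)) :=
    (continuous_id.prodMk continuous_const).tendsto z
  filter_upwards [h3.eventually h2] with y hy
  rw [chartAd, lieAd_eq_fderiv]
  exact (HasFDerivAt.comp (chartOne G) (hy.differentiableAt (by simp)).hasFDerivAt
    (hasFDerivAt_prodMk_right y (chartOne G))).fderiv

theorem lieAd_one : lieAd (1 : G) = ContinuousLinearMap.id ℝ EG := by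
  rw [lieAd_eq_fderiv]
  refine ((hasFDerivAt_id (chartOne G)).congr_of_eventuallyEq ?_).fderiv
  filter_upwards [chartDomain_mem_nhds] with y hy
  simp [chartCoord_chartInv hy]

theorem chartAd_one : chartAd G (chartOne G) = ContinuousLinearMap.id ℝ EG := by
  rw [chartAd, chartInv_chartOne, inv_one, lieAd_one]

/-- The tangent space at the identity is identified with the model space through this very chart. -/
theorem mfderiv_chartInv_chartOne :
    mfderiv 𝓘(ℝ, EG) 𝓘(ℝ, EG) (chartInv G) (chartOne G : EG) = ContinuousLinearMap.id ℝ EG := by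
  have hd : MDifferentiableAt 𝓘(ℝ, EG) 𝓘(ℝ, EG) (chartInv G) (chartOne (EG := EG) G) :=
    (contMDiffAt_chartInv chartOne_mem).mdifferentiableAt (by simp)
  have h1 : chartInv G (chartOne G : EG) = 1 := chartInv_chartOne
  refine hd.mfderiv.trans ?_
  rw [ModelWithCorners.range_eq_univ, fderivWithin_univ, writtenInExtChartAt, h1]
  refine ((hasFDerivAt_id (chartOne G)).congr_of_eventuallyEq ?_).fderiv
  filter_upwards [chartDomain_mem_nhds] with y hy using chartCoord_chartInv hy

theorem mdifferentiableAt_chartInv {z : EG} (hz : z ∈ chartDomain G) :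
    MDifferentiableAt 𝓘(ℝ, EG) 𝓘(ℝ, EG) (chartInv G) z :=
  (contMDiffAt_chartInv hz).mdifferentiableAt (by simp)

/-- `χ(μ(z, y)) = χ(z) χ(y)` for `y` close to the identity. -/
theorem chartInv_chartMul_left {z : EG} (hz : z ∈ chartDomain G) :
    ∀ᶠ y in 𝓝 (chartOne G), chartInv G (chartMul G (z, y)) = chartInv G z * chartInv G y := by
  have h1 : ContinuousAt (fun y => chartInv G z * chartInv G y) (chartOne (EG := EG) G) :=
    (contMDiffAt_const.mul (contMDiffAt_chartInv chartOne_mem)).continuousAt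
  have h2 : chartInv G z * chartInv G (chartOne G : EG) ∈ (extChartAt 𝓘(ℝ, EG) (1 : G)).source := by
    simpa using chartInv_mem_source hz
  filter_upwards [h1.preimage_mem_nhds ((isOpen_extChartAt_source _).mem_nhds h2)] with y hy
  exact chartInv_chartCoord hy

theorem chartInv_chartMul_right {z : EG} (hz : z ∈ chartDomain G) :
    ∀ᶠ y in 𝓝 (chartOne G), chartInv G (chartMul G (y, z)) = chartInv G y * chartInv G z := by
  have h1 : ContinuousAt (fun y => chartInv G y * chartInv G z) (chartOne (EG := EG) G) :=
    ((contMDiffAt_chartInv chartOne_mem).mul contMDiffAt_const).continuousAt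
  have h2 : chartInv G (chartOne G : EG) * chartInv G z ∈ (extChartAt 𝓘(ℝ, EG) (1 : G)).source := by
    simpa using chartInv_mem_source hz
  filter_upwards [h1.preimage_mem_nhds ((isOpen_extChartAt_source _).mem_nhds h2)] with y hy
  exact chartInv_chartCoord hy

/-- Differentiate χ(μ(z, y)) = χ(z)χ(y) in y at the identity. Thus z ↦ `chartLeft G z X` is the
left-invariant field of X in the chart. -/
theorem mfderiv_chartInv_chartLeft {z : EG} (hz : z ∈ chartDomain G) (X : EG) :
    (mfderiv 𝓘(ℝ, EG) 𝓘(ℝ, EG) (chartInv G) z : EG →L[ℝ] EG) (chartLeft G z X) =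
      (mfderiv 𝓘(ℝ, EG) 𝓘(ℝ, EG) (fun x : G => chartInv G z * x) 1 : EG →L[ℝ] EG) X := by
  let D : EG →L[ℝ] EG := mfderiv 𝓘(ℝ, EG) 𝓘(ℝ, EG) (chartInv G) z
  let D' : EG →L[ℝ] EG := mfderiv 𝓘(ℝ, EG) 𝓘(ℝ, EG) (fun x : G => chartInv G z * x) 1
  have h1 : HasMFDerivAt 𝓘(ℝ, EG) 𝓘(ℝ, EG) (chartInv G) (chartMul G (z, chartOne G)) D := by
    rw [chartMul_left hz]
    exact (mdifferentiableAt_chartInv hz).hasMFDerivAt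
  have h2 : HasMFDerivAt 𝓘(ℝ, EG) 𝓘(ℝ, EG) (fun y => chartInv G (chartMul G (z, y))) (chartOne G)
      (D.comp (chartLeft G z : EG →L[ℝ] EG) : EG →L[ℝ] EG) :=
    HasMFDerivAt.comp (chartOne G) h1 (hasFDerivAt_chartMul_left hz).hasMFDerivAt
  have h3 : HasMFDerivAt 𝓘(ℝ, EG) 𝓘(ℝ, EG) (fun x : G => chartInv G z * x)
      (chartInv G (chartOne (EG := EG) G)) D' := by
    rw [chartInv_chartOne]
    exact ((contMDiffAt_const.mul contMDiffAt_id).mdifferentiableAt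
      (n := ∞) (by simp)).hasMFDerivAt
  have h4 : HasMFDerivAt 𝓘(ℝ, EG) 𝓘(ℝ, EG) (chartInv G) (chartOne G : EG)
      (ContinuousLinearMap.id ℝ EG) := by
    have := (mdifferentiableAt_chartInv (G := G) (EG := EG) chartOne_mem).hasMFDerivAt
    rwa [mfderiv_chartInv_chartOne] at this
  have h5 : HasMFDerivAt 𝓘(ℝ, EG) 𝓘(ℝ, EG) (fun y => chartInv G z * chartInv G y) (chartOne G)
      (D'.comp (ContinuousLinearMap.id ℝ EG) : EG →L[ℝ] EG) := HasMFDerivAt.comp (chartOne G) h3 h4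
  have h6 := h5.congr_of_eventuallyEq (chartInv_chartMul_left hz)
  exact congrArg (fun A : EG →L[ℝ] EG => A X) (hasMFDerivAt_unique h2 h6)

/-! ### The exponential map and its local inverse. -/

section Exponential

variable [FiniteDimensional ℝ EG] [T2Space G]

/-- An integral curve of a left-invariant field, defined on a symmetric interval, computes the
exponential map. -/
theorem lieExp_eq_of_isMIntegralCurveOn {X : EG} {c : ℝ → G} (h0 : c 0 = 1)
    (hc : IsMIntegralCurveOn (I := 𝓘(ℝ, EG)) c
      (mulInvariantVectorField (X : GroupLieAlgebra 𝓘(ℝ, EG) G)) (Ioo (-2) 2)) :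
    lieExp G X = c 1 := by
  have : LieGroup 𝓘(ℝ, EG) (minSmoothness ℝ 3) G := by
    rw [minSmoothness_of_isRCLikeNormedField]
    exact LieGroup.of_le (n := ∞) (WithTop.coe_le_coe.2 le_top)
  have : IsManifold 𝓘(ℝ, EG) ∞ G := ContMDiffMul.toIsManifold
  have : IsManifold 𝓘(ℝ, EG) 1 G := IsManifold.of_le (n := ∞) (by simp)
  set v := mulInvariantVectorField (I := 𝓘(ℝ, EG)) (G := G)
    (X : GroupLieAlgebra 𝓘(ℝ, EG) G) with hv_def
  have hv : ContMDiff 𝓘(ℝ, EG) 𝓘(ℝ, EG).tangent 1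
      (fun x => (⟨x, v x⟩ : TangentBundle 𝓘(ℝ, EG) G)) :=
    (contMDiff_mulInvariantVectorField (I := 𝓘(ℝ, EG)) (G := G)
      (X : GroupLieAlgebra 𝓘(ℝ, EG) G)).of_le (by
        rw [minSmoothness_of_isRCLikeNormedField]; exact one_le_two)
  have htrans : ∀ g x : G, (mfderiv 𝓘(ℝ, EG) 𝓘(ℝ, EG) (fun y : G => g * y) x : EG →L[ℝ] EG) (v x) =
      v (g * x) := by
    intro g x
    let D : EG →L[ℝ] EG := mfderiv 𝓘(ℝ, EG) 𝓘(ℝ, EG) (fun y : G => g * y) x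
    let D' : EG →L[ℝ] EG := mfderiv 𝓘(ℝ, EG) 𝓘(ℝ, EG) (fun y : G => x * y) 1
    let D'' : EG →L[ℝ] EG := mfderiv 𝓘(ℝ, EG) 𝓘(ℝ, EG) (fun y : G => g * x * y) 1
    have hs : ∀ a b : G, MDifferentiableAt 𝓘(ℝ, EG) 𝓘(ℝ, EG) (fun y : G => a * y) b := fun a b =>
      (contMDiffAt_const.mul contMDiffAt_id).mdifferentiableAt (n := ∞) (by simp)
    have h1 : HasMFDerivAt 𝓘(ℝ, EG) 𝓘(ℝ, EG) (fun y : G => g * y) (x * 1) D := by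
      rw [mul_one]; exact (hs g x).hasMFDerivAt
    have h2 : HasMFDerivAt 𝓘(ℝ, EG) 𝓘(ℝ, EG) (fun y : G => g * (x * y)) 1 (D.comp D' : EG →L[ℝ] EG) :=
      HasMFDerivAt.comp (1 : G) h1 (hs x 1).hasMFDerivAt
    have h3 : HasMFDerivAt 𝓘(ℝ, EG) 𝓘(ℝ, EG) (fun y : G => g * (x * y)) 1 D'' := by
      exact (hs (g * x) 1).hasMFDerivAt.congr_of_eventuallyEq
        (Eventually.of_forall fun y => (mul_assoc g x y).symm)
    exact congrArg (fun A : EG →L[ℝ] EG => A X) (hasMFDerivAt_unique h2 h3)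
  -- Left translates of c are integral curves through every point, all defined on the same interval.
  -- This uniform time of existence makes the field complete.
  have hlocal : ∀ x : G, ∃ γ : ℝ → G, γ 0 = x ∧ IsMIntegralCurveOn γ v (Ioo (-2) 2) := by
    intro x
    refine ⟨fun t => x * c t, by simp [h0], fun t ht => ?_⟩
    have hs : MDifferentiableAt 𝓘(ℝ, EG) 𝓘(ℝ, EG) (fun y : G => x * y) (c t) :=
      (contMDiffAt_const.mul contMDiffAt_id).mdifferentiableAt (n := ∞) (by simp)
    have h1 := HasMFDerivAt.comp_hasMFDerivWithinAt t hs.hasMFDerivAt (hc t ht)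
    refine h1.congr_mfderiv ?_
    ext
    have e1 : ((1 : ℝ) • v (c t)) = v (c t) := one_smul ℝ (v (c t))
    exact (congrArg (mfderiv 𝓘(ℝ, EG) 𝓘(ℝ, EG) (fun y : G => x * y) (c t)) e1).trans
      ((htrans x (c t)).trans (one_smul ℝ (v (x * c t))).symm)
  obtain ⟨γ, hγ0, hγ⟩ := exists_isMIntegralCurve_of_isMIntegralCurveOn hv two_pos hlocal 1
  have hex : ∃ c : ℝ → G, c 0 = 1 ∧ IsMIntegralCurve (I := 𝓘(ℝ, EG)) c v := ⟨γ, hγ0, hγ⟩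
  rw [lieExp, dif_pos hex]
  -- The exponential is defined by a choice of integral curve; uniqueness on a Hausdorff group
  -- identifies the chosen curve with c.
  exact isMIntegralCurveOn_Ioo_eqOn_of_contMDiff_boundaryless (t₀ := 0) (by norm_num) hv
    (hex.choose_spec.2.isMIntegralCurveOn _) hc (by rw [hex.choose_spec.1, h0])
    (by norm_num : (1 : ℝ) ∈ Ioo (-2 : ℝ) 2)

/-- A logarithm near the identity. -/
theorem exists_chart_log : ∃ (log : EG → EG) (C : ℝ), ∀ᶠ z in 𝓝 (chartOne G),
    lieExp G (log z) = chartInv G z ∧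
      ‖log z - (z - chartOne G)‖ ≤ C * ‖z - chartOne G‖ ^ 2 := by
  set c : EG := chartOne G with hc_def
  obtain ⟨L, hL, hLc, hLe⟩ := exists_contDiff_eventuallyEq isOpen_chartDomain
    (contDiffOn_chartLeft (G := G) (EG := EG)) chartOne_mem
  obtain ⟨r, hr, hball⟩ := Metric.eventually_nhds_iff.1 (hLe.and chartDomain_mem_nhds)
  obtain ⟨K, hK⟩ := hLc.exists_bound_of_continuous hL.continuous
  have hK0 : 0 ≤ K := (norm_nonneg _).trans (hK c)
  obtain ⟨K', hK'⟩ := (hL.of_le (by simp) : ContDiff ℝ 1 L).lipschitzWith_of_hasCompactSupport hLc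
    (by simp)
  have hLc1 : L c = ContinuousLinearMap.id ℝ EG := hLe.self_of_nhds.trans chartLeft_one
  -- The left-invariant field of X is treated as a field with parameter X, vanishing for X = 0, so
  -- its flow from the identity exists up to time 2 for small X and is smooth in X.
  obtain ⟨U, hU, hU0, S, hScont, -, hSsmooth, hSsmall, hSeq⟩ := exists_contDiffOn_solution
    (X := EG) (t₀ := 0) (a := -2) (b := 2) (by norm_num : (0 : ℝ) ∈ Icc (-2 : ℝ) 2)
    (f := fun q : EG × ℝ × EG => L q.2.2 q.1)
    ((hL.comp (contDiff_snd.comp contDiff_snd)).clm_apply contDiff_fst) (fun s y => by simp) c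
  have hint : ∀ X, ∀ a b : ℝ, IntervalIntegrable (fun s => L (S X s) X) volume a b := fun X a b =>
    ((hL.continuous.comp (hScont X)).clm_apply continuous_const).intervalIntegrable _ _
  -- the solution is the exponential map
  have hexp : ∀ᶠ X in 𝓝 (0 : EG), lieExp G X = chartInv G (S X 1) := by
    filter_upwards [hU.mem_nhds hU0, hSsmall r hr] with X hXU hXr
    have hmem : ∀ t ∈ Icc (-2 : ℝ) 2, L (S X t) = chartLeft G (S X t) ∧
        S X t ∈ chartDomain (EG := EG) G := fun t ht => hball (by
      rw [dist_eq_norm]; exact hXr t ht)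
    refine (lieExp_eq_of_isMIntegralCurveOn (c := fun t => chartInv G (S X t)) ?_ ?_)
    · rw [hSeq X hXU 0 (by norm_num), intervalIntegral.integral_same, add_zero]
      exact chartInv_chartOne
    · intro t ht
      have hd : HasDerivAt (S X) (L (S X t) X) t := by
        have h1 : HasDerivAt (fun t => c + ∫ s in (0 : ℝ)..t, L (S X s) X) (L (S X t) X) t :=
          (intervalIntegral.integral_hasDerivAt_right (hint X 0 t)
            ((hL.continuous.comp (hScont X)).clm_apply
              continuous_const).stronglyMeasurable.stronglyMeasurableAtFilter
            ((hL.continuous.comp (hScont X)).clm_apply continuous_const).continuousAt).const_add c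
        refine h1.congr_of_eventuallyEq ?_
        filter_upwards [Ioo_mem_nhds ht.1 ht.2] with s hs
          using hSeq X hXU s (Ioo_subset_Icc_self hs)
      rw [(hmem t (Ioo_subset_Icc_self ht)).1] at hd
      have h2 := (HasMFDerivAt.comp t
        (mdifferentiableAt_chartInv (hmem t (Ioo_subset_Icc_self ht)).2).hasMFDerivAt
        hd.hasFDerivAt.hasMFDerivAt).hasMFDerivWithinAt (s := Ioo (-2) 2)
      refine h2.congr_mfderiv ?_
      ext
      have e1 : ((1 : ℝ) • chartLeft G (S X t) X) = chartLeft G (S X t) X := one_smul ℝ _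
      exact (congrArg (mfderiv 𝓘(ℝ, EG) 𝓘(ℝ, EG) (chartInv G) (S X t)) e1).trans
        ((mfderiv_chartInv_chartLeft (hmem t (Ioo_subset_Icc_self ht)).2 X).trans
          (one_smul ℝ (mulInvariantVectorField (I := 𝓘(ℝ, EG)) (G := G)
            (X : GroupLieAlgebra 𝓘(ℝ, EG) G) (chartInv G (S X t)))).symm)
  -- second order estimate
  have hquad : ∀ X ∈ U, ‖S X 1 - c - X‖ ≤ K' * K * ‖X‖ ^ 2 := by
    intro X hX
    have h1 : ∀ t ∈ Icc (0 : ℝ) 1, ‖S X t - c‖ ≤ K * ‖X‖ := by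
      intro t ht
      rw [hSeq X hX t ⟨by linarith [ht.1], by linarith [ht.2]⟩, add_sub_cancel_left]
      refine (intervalIntegral.norm_integral_le_of_norm_le_const (C := K * ‖X‖) fun s _ =>
        (L (S X s)).le_of_opNorm_le (hK _) X).trans ?_
      rw [sub_zero, abs_of_nonneg ht.1]
      exact mul_le_of_le_one_right (by positivity) ht.2
    have h2 : S X 1 - c - X = ∫ s in (0 : ℝ)..1, (L (S X s) X - X) := by
      rw [intervalIntegral.integral_sub (hint X 0 1) intervalIntegrable_const,
        hSeq X hX 1 (by norm_num)]
      simp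
    rw [h2]
    refine (intervalIntegral.norm_integral_le_of_norm_le_const (C := K' * K * ‖X‖ ^ 2)
      fun s hs => ?_).trans (by simp)
    rw [uIoc_of_le zero_le_one] at hs
    have h3 : L (S X s) X - X = (L (S X s) - L c) X := by simp [hLc1]
    rw [h3]
    calc ‖(L (S X s) - L c) X‖ ≤ ‖L (S X s) - L c‖ * ‖X‖ := ContinuousLinearMap.le_opNorm _ _
      _ ≤ (K' * ‖S X s - c‖) * ‖X‖ := by
        gcongr
        exact hK'.norm_sub_le _ _
      _ ≤ (K' * (K * ‖X‖)) * ‖X‖ := by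
        gcongr
        exact h1 s ⟨hs.1.le, hs.2⟩
      _ = _ := by ring
  have hS0 : S 0 1 = c := by
    have h1 := hquad 0 hU0
    simpa [sub_eq_zero] using h1
  have hderiv : HasFDerivAt (fun X => S X 1) (ContinuousLinearMap.id ℝ EG) 0 := by
    refine HasFDerivAt.of_isLittleO ?_
    refine Asymptotics.IsBigO.trans_isLittleO (g := fun X : EG => ‖X‖ ^ 2) ?_ ?_
    · refine Asymptotics.IsBigO.of_bound (K' * K) ?_
      filter_upwards [hU.mem_nhds hU0] with X hX
      simpa [hS0] using hquad X hX
    · simpa using (Asymptotics.isLittleO_norm_pow_id (E' := EG) one_lt_two)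
  -- The quadratic estimate gives the derivative at 0 and smoothness makes it strict, so the inverse
  -- function theorem supplies the logarithm.
  have hstrict : HasStrictFDerivAt (fun X => S X 1)
      ((ContinuousLinearEquiv.refl ℝ EG : EG ≃L[ℝ] EG) : EG →L[ℝ] EG) 0 :=
    ((hSsmooth 1 (by norm_num)).contDiffAt (hU.mem_nhds hU0)).hasStrictFDerivAt' hderiv (by simp)
  let log := hstrict.localInverse (fun X => S X 1) (ContinuousLinearEquiv.refl ℝ EG) 0
  have hlog : HasStrictFDerivAt log (ContinuousLinearMap.id ℝ EG) c := by
    have := hstrict.to_localInverse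
    simpa [hS0] using this
  have hlogc : log c = 0 := by
    have := hstrict.localInverse_apply_image
    rwa [hS0] at this
  have hlogt : Tendsto log (𝓝 c) (𝓝 0) := by
    have := hlog.continuousAt.tendsto
    rwa [hlogc] at this
  have hright : ∀ᶠ z in 𝓝 c, S (log z) 1 = z := by
    have := hstrict.eventually_right_inverse
    rwa [hS0] at this
  obtain ⟨K'', hK''⟩ := hlog.hasFDerivAt.isBigO_sub.bound
  refine ⟨log, K' * K * K'' ^ 2, ?_⟩
  filter_upwards [hright, hlogt.eventually hexp, hlogt.eventually (hU.mem_nhds hU0), hK'']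
    with z hz1 hz2 hz3 hz4
  refine ⟨by rw [hz2, hz1], ?_⟩
  have h1 := hquad _ hz3
  rw [hz1, norm_sub_rev] at h1
  rw [hlogc, sub_zero] at hz4
  calc _ ≤ K' * K * ‖log z‖ ^ 2 := h1
    _ ≤ K' * K * (K'' * ‖z - c‖) ^ 2 := by gcongr
    _ = _ := by ring

end Exponential

end LieGroupChart

/-! ### Principal bundles: the identity component, gauges -/

section PrincipalBundle

open Filter Topology

variable {V : Type*} [NormedAddCommGroup V] [InnerProductSpace ℝ V]
  {EG : Type*} [NormedAddCommGroup EG] [NormedSpace ℝ EG]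
  {G : Type*} [TopologicalSpace G] [ChartedSpace EG G] [Group G] [LieGroup 𝓘(ℝ, EG) ∞ G]
  {EP : Type*} [NormedAddCommGroup EP] [NormedSpace ℝ EP]
  {P : Type*} [TopologicalSpace P] [ChartedSpace EP P] [MulAction Gᵐᵒᵖ P]

namespace SmoothPrincipalBundle

variable (B : SmoothPrincipalBundle V (EG := EG) G (EP := EP) P)

theorem contMDiff_smul_left (B : SmoothPrincipalBundle V (EG := EG) G (EP := EP) P) (a : G) :
    ContMDiff 𝓘(ℝ, EP) 𝓘(ℝ, EP) ∞ fun q : P => MulOpposite.op a • q :=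
  B.contMDiff_act.comp (contMDiff_id.prodMk contMDiff_const)

theorem contMDiff_smul_right (B : SmoothPrincipalBundle V (EG := EG) G (EP := EP) P)
    (q : P) :
    ContMDiff 𝓘(ℝ, EG) 𝓘(ℝ, EP) ∞ fun a : G => MulOpposite.op a • q :=
  B.contMDiff_act.comp (contMDiff_const.prodMk contMDiff_id)

theorem op_smul_op_smul (a b : G) (q : P) :
    MulOpposite.op a • MulOpposite.op b • q = MulOpposite.op (b * a) • q := by
  rw [smul_smul, MulOpposite.op_mul]

theorem eq_one_of_smul_eq (B : SmoothPrincipalBundle V (EG := EG) G (EP := EP) P)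
    {a : G} {q : P} (h : MulOpposite.op a • q = q) : a = 1 := by
  obtain ⟨U, e, -, hx, hs, -, -, -, -, he⟩ := B.locally_trivial (B.proj q)
  have hq : q ∈ e.source := by rw [hs]; exact hx
  have h1 := he q hq a
  have h2 := he q hq 1
  rw [h] at h1
  rw [MulOpposite.op_one, one_smul] at h2
  have h3 := congrArg Prod.snd (h1.symm.trans h2)
  simpa using h3

theorem smul_left_injective (B : SmoothPrincipalBundle V (EG := EG) G (EP := EP) P)
    {a b : G} {q : P} (h : MulOpposite.op a • q = MulOpposite.op b • q) :
    a = b := by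
  have h1 : MulOpposite.op (a * b⁻¹) • q = q := by
    rw [← op_smul_op_smul, h, op_smul_op_smul, mul_inv_cancel, MulOpposite.op_one, one_smul]
  exact mul_inv_eq_one.1 (B.eq_one_of_smul_eq h1)

/-- The identity component preserves the fibres. -/
theorem proj_smul {a : G} (ha : a ∈ connectedComponent (1 : G)) (q : P) :
    B.proj (MulOpposite.op a • q) = B.proj q := by
  have : IsTopologicalGroup G := topologicalGroup_of_lieGroup 𝓘(ℝ, EG) ∞
  -- A trivialization describes the point `op a • q` only if this point already lies in its source,
  -- so invariance of the fibre is proved by showing that this set of group elements is clopen. This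
  -- is why the identity component appears throughout.
  let H : Set G := {a | B.proj (MulOpposite.op a • q) = B.proj q}
  have hcont : Continuous fun a : G => MulOpposite.op a • q := (B.contMDiff_smul_right q).continuous
  have hclosed : IsClosed H :=
    isClosed_eq (B.contMDiff_proj.continuous.comp hcont) continuous_const
  have hopen : IsOpen H := by
    rw [isOpen_iff_mem_nhds]
    intro a ha
    obtain ⟨U, e, -, hx, hs, -, -, -, hp, he⟩ :=
      B.locally_trivial (B.proj (MulOpposite.op a • q))
    have hq : MulOpposite.op a • q ∈ e.source := by rw [hs]; exact hx
    filter_upwards [hcont.continuousAt.preimage_mem_nhds (e.open_source.mem_nhds hq)] with b hb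
    have h1 : MulOpposite.op b • q = MulOpposite.op (a⁻¹ * b) • MulOpposite.op a • q := by
      rw [op_smul_op_smul, mul_inv_cancel_left]
    have h2 := he _ hq (a⁻¹ * b)
    rw [← h1] at h2
    have h3 := hp _ hb
    rw [h2] at h3
    exact h3.symm.trans ha
  have h1 : (1 : G) ∈ H := by simp [H]
  exact IsClopen.connectedComponent_subset ⟨hclosed, hopen⟩ h1 ha

/-- A gauge: a local section `σ` together with the projection `τ` to the structure group. -/
structure Gauge where
  dom : Set V
  sec : V → P
  toGroup : P → G
  isOpen_dom : IsOpen dom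
  contMDiffOn_sec : ContMDiffOn 𝓘(ℝ, V) 𝓘(ℝ, EP) ∞ sec dom
  contMDiffOn_toGroup : ContMDiffOn 𝓘(ℝ, EP) 𝓘(ℝ, EG) ∞ toGroup (B.proj ⁻¹' dom)
  proj_sec : ∀ x ∈ dom, B.proj (sec x) = x
  toGroup_sec : ∀ x ∈ dom, toGroup (sec x) = 1
  eq_smul_sec : ∀ q, B.proj q ∈ dom → toGroup q ∈ connectedComponent (1 : G) →
    q = MulOpposite.op (toGroup q) • sec (B.proj q)
  toGroup_smul : ∀ q, B.proj q ∈ dom → ∀ a ∈ connectedComponent (1 : G),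
    toGroup (MulOpposite.op a • q) = toGroup q * a

/-- Fixing the fibre coordinate of q in a trivialization gives a section through q. The domain does
not depend on q, which matters when lifts are continued from a starting point not known in advance.
-/
theorem exists_gauge (x₀ : V) : ∃ U : Set V, IsOpen U ∧ x₀ ∈ U ∧
    ∀ q, B.proj q ∈ U → ∃ g : B.Gauge, g.dom = U ∧ g.sec (B.proj q) = q := by
  obtain ⟨U, e, hU, hx, hs, ht, hsm, hsm', hp, he⟩ := B.locally_trivial x₀
  refine ⟨U, hU, hx, fun q hq => ?_⟩
  have hmem : ∀ {q}, B.proj q ∈ U → q ∈ e.source := fun h => by rw [hs]; exact h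
  have htar : ∀ {x : V} (a : G), x ∈ U → (x, a) ∈ e.target := fun a h => by
    rw [ht]; exact ⟨h, mem_univ _⟩
  let a₀ := (e q).2
  have hsec : ∀ x ∈ U, B.proj (e.symm (x, a₀)) = x := fun x hx => by
    rw [← hp _ (e.map_target (htar a₀ hx)), e.right_inv (htar a₀ hx)]
  have hsec2 : ∀ x ∈ U, e (e.symm (x, a₀)) = (x, a₀) := fun x hx => e.right_inv (htar a₀ hx)
  refine ⟨⟨U, fun x => e.symm (x, a₀), fun q => a₀⁻¹ * (e q).2, hU, ?_, ?_, hsec,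
    fun x hx => ?_, fun q' hq' ha => ?_, fun q' hq' a ha => ?_⟩, rfl, ?_⟩
  · exact hsm'.comp (contMDiffOn_id.prodMk contMDiffOn_const) fun x hx => htar a₀ hx
  · rw [hs] at hsm
    exact contMDiffOn_const.mul (contMDiff_snd.comp_contMDiffOn hsm)
  · rw [hsec2 x hx, inv_mul_cancel]
  · have h1 := hsec _ hq'
    have h2 : B.proj (e.symm (B.proj q', a₀)) ∈ U := by rw [h1]; exact hq'
    have h3 : B.proj (MulOpposite.op (a₀⁻¹ * (e q').2) • e.symm (B.proj q', a₀)) ∈ U := by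
      rw [B.proj_smul ha]; exact h2
    refine e.injOn (hmem hq') (hmem h3) ?_
    rw [he _ (hmem h2), h1, hsec2 _ hq', mul_inv_cancel_left, ← hp _ (hmem hq')]
  · rw [he _ (hmem hq'), mul_assoc]
  · rw [← hp _ (hmem hq)]
    exact e.left_inv (hmem hq)

namespace Gauge

variable {B} (g : B.Gauge)

/-- The parametrization `(x, z) ↦ σ(x) · χ(z)` of a neighbourhood of the section. -/
noncomputable def param (p : V × EG) : P := MulOpposite.op (chartInv G p.2) • g.sec p.1

theorem param_apply (x : V) (z : EG) : g.param (x, z) = MulOpposite.op (chartInv G z) • g.sec x :=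
  rfl

theorem param_chartOne (x : V) : g.param (x, chartOne G) = g.sec x := by
  rw [param_apply, chartInv_chartOne, MulOpposite.op_one, one_smul]

theorem contMDiffAt_param {x : V} {z : EG} (hx : x ∈ g.dom) (hz : z ∈ chartDomain G) :
    ContMDiffAt 𝓘(ℝ, V × EG) 𝓘(ℝ, EP) ∞ g.param (x, z) := by
  have h1 : ContMDiffAt 𝓘(ℝ, V × EG) 𝓘(ℝ, EP) ∞ (fun p : V × EG => g.sec p.1) (x, z) :=
    ContMDiffAt.comp (x, z) (g.contMDiffOn_sec.contMDiffAt (g.isOpen_dom.mem_nhds hx))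
      contDiff_fst.contDiffAt.contMDiffAt
  have h2 : ContMDiffAt 𝓘(ℝ, V × EG) 𝓘(ℝ, EG) ∞ (fun p : V × EG => chartInv G p.2) (x, z) :=
    ContMDiffAt.comp (x, z) (contMDiffAt_chartInv hz) contDiff_snd.contDiffAt.contMDiffAt
  exact B.contMDiff_act.contMDiffAt.comp (x, z) (h1.prodMk h2)

theorem isOpen_prod : IsOpen (g.dom ×ˢ chartDomain (EG := EG) G) :=
  g.isOpen_dom.prod isOpen_chartDomain

theorem contMDiffOn_param : ContMDiffOn 𝓘(ℝ, V × EG) 𝓘(ℝ, EP) ∞ g.param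
    (g.dom ×ˢ chartDomain (EG := EG) G) :=
  fun _ hp => (g.contMDiffAt_param hp.1 hp.2).contMDiffWithinAt

/-- Changing the section by a function with values in the identity component. -/
noncomputable def modify {U : Set V} (hU : IsOpen U) (hUd : U ⊆ g.dom) (h : V → G)
    (hh : ContMDiffOn 𝓘(ℝ, V) 𝓘(ℝ, EG) ∞ h U) (h1 : ∀ x ∈ U, h x ∈ connectedComponent (1 : G)) :
    B.Gauge where
  dom := U
  sec x := MulOpposite.op (h x) • g.sec x
  toGroup q := (h (B.proj q))⁻¹ * g.toGroup q
  isOpen_dom := hU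
  contMDiffOn_sec := B.contMDiff_act.comp_contMDiffOn ((g.contMDiffOn_sec.mono hUd).prodMk hh)
  contMDiffOn_toGroup := (hh.comp B.contMDiff_proj.contMDiffOn fun q hq => hq).inv.mul
    (g.contMDiffOn_toGroup.mono (preimage_mono hUd))
  proj_sec x hx := by rw [B.proj_smul (h1 x hx), g.proj_sec x (hUd hx)]
  toGroup_sec x hx := by
    have h2 := g.proj_sec x (hUd hx)
    rw [B.proj_smul (h1 x hx), h2,
      g.toGroup_smul _ (by rw [h2]; exact hUd hx) _ (h1 x hx), g.toGroup_sec x (hUd hx), one_mul,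
      inv_mul_cancel]
  eq_smul_sec q hq ha := by
    have : IsTopologicalGroup G := topologicalGroup_of_lieGroup 𝓘(ℝ, EG) ∞
    have h2 : g.toGroup q ∈ connectedComponent (1 : G) := by
      have := mul_mem_connectedComponent_one (h1 _ hq) ha
      rwa [mul_inv_cancel_left] at this
    rw [op_smul_op_smul, mul_inv_cancel_left]
    exact g.eq_smul_sec q (hUd hq) h2
  toGroup_smul q hq a ha := by
    rw [B.proj_smul ha, g.toGroup_smul q (hUd hq) a ha, mul_assoc]

end Gauge

end SmoothPrincipalBundle

/-- A ball around the identity in the chart, with values in the identity component. -/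
theorem exists_ball_chartInv_mem_connectedComponent : ∃ r > 0,
    Metric.ball (chartOne G) r ⊆ chartDomain (EG := EG) G ∧
      ∀ z ∈ Metric.ball (chartOne (EG := EG) G) r, chartInv G z ∈ connectedComponent (1 : G) := by
  obtain ⟨r, hr, hsub⟩ := Metric.mem_nhds_iff.1 (chartDomain_mem_nhds (G := G) (EG := EG))
  refine ⟨r, hr, hsub, fun z hz => ?_⟩
  have h1 : IsPreconnected (chartInv G '' Metric.ball (chartOne (EG := EG) G) r) :=
    ((convex_ball _ _).isPreconnected).image _
      (contMDiffOn_chartInv.continuousOn.mono hsub)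
  have h2 : (1 : G) ∈ chartInv G '' Metric.ball (chartOne (EG := EG) G) r :=
    ⟨_, Metric.mem_ball_self hr, chartInv_chartOne⟩
  exact h1.subset_connectedComponent h2 ⟨z, hz, rfl⟩

namespace PrincipalConnection

variable [IsManifold 𝓘(ℝ, EP) ∞ P] {B : SmoothPrincipalBundle V (EG := EG) G (EP := EP) P}
  (conn : PrincipalConnection B)

/-- The connection form at `q`, with `T_q P` identified with the model space. -/
noncomputable def formAt (q : P) : EP →L[ℝ] EG := conn.form q

/-- The pullback `f^* ω` of the connection form by a map from a vector space. -/
noncomputable def pullback {E : Type*} [NormedAddCommGroup E] [NormedSpace ℝ E] (f : E → P)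
    (x : E) : E →L[ℝ] EG :=
  (conn.formAt (f x)).comp (mfderiv 𝓘(ℝ, E) 𝓘(ℝ, EP) f x : E →L[ℝ] EP)

theorem contDiffOn_pullback {E : Type*} [NormedAddCommGroup E] [NormedSpace ℝ E]
    [FiniteDimensional ℝ E] {f : E → P} {U : Set E} (hU : IsOpen U)
    (hf : ContMDiffOn 𝓘(ℝ, E) 𝓘(ℝ, EP) ∞ f U) : ContDiffOn ℝ ∞ (conn.pullback f) U := by
  rw [contDiffOn_clm_apply]
  intro v
  have h1 : ContMDiffOn 𝓘(ℝ, E) 𝓘(ℝ, E).tangent ∞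
      (fun x : E => (⟨x, v⟩ : TangentBundle 𝓘(ℝ, E) E)) U :=
    contMDiffOn_vectorSpace_iff_contDiffOn.2 (contDiffOn_const (c := v))
  have h2 := hf.contMDiffOn_tangentMapWithin (m := ∞) (by simp) hU.uniqueMDiffOn
  have h3 := conn.smooth.comp_contMDiffOn (h2.comp h1 fun x hx => hx)
  rw [← contMDiffOn_iff_contDiffOn]
  refine h3.congr fun x hx => ?_
  simp only [Function.comp_apply, tangentMapWithin, pullback, formAt,
    mfderivWithin_of_mem_nhds (hU.mem_nhds hx)]
  rfl

theorem formAt_smul {a : G} {q : P} {D : EP →L[ℝ] EP}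
    (hD : HasMFDerivAt 𝓘(ℝ, EP) 𝓘(ℝ, EP) (fun q : P => MulOpposite.op a • q) q D) (w : EP) :
    conn.formAt (MulOpposite.op a • q) (D w) = lieAd a⁻¹ (conn.formAt q w) := by
  have h := conn.equivariant a q w
  rw [hD.mfderiv] at h
  exact h

theorem formAt_fundamental {q : P} {D : EG →L[ℝ] EP}
    (hD : HasMFDerivAt 𝓘(ℝ, EG) 𝓘(ℝ, EP) (fun a : G => MulOpposite.op a • q) 1 D) (A : EG) :
    conn.formAt q (D A) = A := by
  have h := conn.fundamental q A
  rw [hD.mfderiv] at h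
  have h2 : MulOpposite.op (1 : G) • q = q := by simp
  have h3 : conn.formAt (MulOpposite.op (1 : G) • q) (D A) = A := h
  rwa [h2] at h3

theorem pullback_eq {E : Type*} [NormedAddCommGroup E] [NormedSpace ℝ E] {f : E → P}
    {x : E} {D : E →L[ℝ] EP} (hf : HasMFDerivAt 𝓘(ℝ, E) 𝓘(ℝ, EP) f x D) :
    conn.pullback f x = (conn.formAt (f x)).comp D := by
  rw [pullback, hf.mfderiv]

/-- The local connection form `A = σ^* ω` in a gauge. -/
noncomputable def gaugeForm (g : B.Gauge) : V → V →L[ℝ] EG := conn.pullback g.sec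

theorem contDiffOn_gaugeForm [FiniteDimensional ℝ V] (g : B.Gauge) :
    ContDiffOn ℝ ∞ (conn.gaugeForm g) g.dom :=
  conn.contDiffOn_pullback g.isOpen_dom g.contMDiffOn_sec

/-- The connection form in the parametrization given by a gauge. -/
theorem pullback_param (g : B.Gauge) {x : V} {z : EG} (hx : x ∈ g.dom) (hz : z ∈ chartDomain G)
    (v : V) (ξ : EG) : conn.pullback g.param (x, z) (v, chartRight G z ξ) =
      chartAd G z (conn.gaugeForm g x v + ξ) := by
  let D : V × EG →L[ℝ] EP := mfderiv 𝓘(ℝ, V × EG) 𝓘(ℝ, EP) g.param (x, z)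
  have hD : HasMFDerivAt 𝓘(ℝ, V × EG) 𝓘(ℝ, EP) g.param (x, z) D :=
    ((g.contMDiffAt_param hx hz).mdifferentiableAt (by simp)).hasMFDerivAt
  let R : EP →L[ℝ] EP := mfderiv 𝓘(ℝ, EP) 𝓘(ℝ, EP)
    (fun q : P => MulOpposite.op (chartInv G z) • q) (g.sec x)
  have hR : HasMFDerivAt 𝓘(ℝ, EP) 𝓘(ℝ, EP) (fun q : P => MulOpposite.op (chartInv G z) • q)
      (g.sec x) R :=
    ((B.contMDiff_smul_left _).contMDiffAt.mdifferentiableAt (by simp)).hasMFDerivAt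
  let S : V →L[ℝ] EP := mfderiv 𝓘(ℝ, V) 𝓘(ℝ, EP) g.sec x
  have hS : HasMFDerivAt 𝓘(ℝ, V) 𝓘(ℝ, EP) g.sec x S :=
    ((g.contMDiffOn_sec.contMDiffAt (g.isOpen_dom.mem_nhds hx)).mdifferentiableAt
      (by simp)).hasMFDerivAt
  let Q : EG →L[ℝ] EP := mfderiv 𝓘(ℝ, EG) 𝓘(ℝ, EP) (fun a : G => MulOpposite.op a • g.sec x) 1
  have hQ : HasMFDerivAt 𝓘(ℝ, EG) 𝓘(ℝ, EP) (fun a : G => MulOpposite.op a • g.sec x) 1 Q :=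
    ((B.contMDiff_smul_right _).contMDiffAt.mdifferentiableAt (by simp)).hasMFDerivAt
  -- the derivative in the direction of the base
  have h1 : HasMFDerivAt 𝓘(ℝ, V) 𝓘(ℝ, EP) (fun x => g.param (x, z)) x
      (D.comp (ContinuousLinearMap.inl ℝ V EG) : V →L[ℝ] EP) :=
    HasMFDerivAt.comp (g := g.param) x hD (hasFDerivAt_prodMk_left (𝕜 := ℝ) x z).hasMFDerivAt
  have h2 : HasMFDerivAt 𝓘(ℝ, V) 𝓘(ℝ, EP) (fun x => g.param (x, z)) x (R.comp S : V →L[ℝ] EP) :=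
    HasMFDerivAt.comp x hR hS
  have h3 : ∀ v, D (v, 0) = R (S v) := fun v =>
    congrArg (fun A : V →L[ℝ] EP => A v) (hasMFDerivAt_unique h1 h2)
  -- the derivative in the direction of the fibre
  have h4 : HasMFDerivAt 𝓘(ℝ, EG) 𝓘(ℝ, EP) (fun y => g.param (x, chartMul G (y, z))) (chartOne G)
      (D.comp ((ContinuousLinearMap.inr ℝ V EG).comp (chartRight G z)) : EG →L[ℝ] EP) := by
    have h5 : HasMFDerivAt 𝓘(ℝ, V × EG) 𝓘(ℝ, EP) g.param (x, chartMul G (chartOne G, z)) D := by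
      rw [chartMul_right hz]; exact hD
    exact HasMFDerivAt.comp (g := g.param) (chartOne G) h5
      ((hasFDerivAt_prodMk_right (𝕜 := ℝ) x _).comp (chartOne G)
        (hasFDerivAt_chartMul_right hz)).hasMFDerivAt
  have h6 : HasMFDerivAt 𝓘(ℝ, EG) 𝓘(ℝ, EP)
      (fun y : EG => MulOpposite.op (chartInv G z) • MulOpposite.op (chartInv G y) • g.sec x)
      (chartOne G) (R.comp Q : EG →L[ℝ] EP) := by
    have h7 : HasMFDerivAt 𝓘(ℝ, EG) 𝓘(ℝ, EP)
        (fun y : EG => MulOpposite.op (chartInv G y) • g.sec x) (chartOne G) Q := by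
      have h8 : HasMFDerivAt 𝓘(ℝ, EG) 𝓘(ℝ, EG) (chartInv G) (chartOne G : EG)
          (ContinuousLinearMap.id ℝ EG) := by
        have := (mdifferentiableAt_chartInv (G := G) (EG := EG) chartOne_mem).hasMFDerivAt
        rwa [mfderiv_chartInv_chartOne] at this
      have h9 : HasMFDerivAt 𝓘(ℝ, EG) 𝓘(ℝ, EP) (fun a : G => MulOpposite.op a • g.sec x)
          (chartInv G (chartOne G : EG)) Q := by
        rw [chartInv_chartOne]; exact hQ
      exact HasMFDerivAt.comp (chartOne G) h9 h8
    have h10 : HasMFDerivAt 𝓘(ℝ, EP) 𝓘(ℝ, EP) (fun q : P => MulOpposite.op (chartInv G z) • q)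
        (MulOpposite.op (chartInv G (chartOne G : EG)) • g.sec x) R := by
      rw [chartInv_chartOne, MulOpposite.op_one, one_smul]; exact hR
    exact HasMFDerivAt.comp (chartOne G) h10 h7
  -- Moving along the fibre by χ(y)χ(z) amounts to moving the section by χ(y) and then acting by
  -- χ(z). This is why right translation appears.
  have h11 := h6.congr_of_eventuallyEq (f₁ := fun y => g.param (x, chartMul G (y, z))) (by
    filter_upwards [chartInv_chartMul_right hz] with y hy
    rw [SmoothPrincipalBundle.Gauge.param_apply, hy, SmoothPrincipalBundle.op_smul_op_smul])
  have h12 : ∀ ξ, D (0, chartRight G z ξ) = R (Q ξ) := fun ξ =>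
    congrArg (fun A : EG →L[ℝ] EP => A ξ) (hasMFDerivAt_unique h4 h11)
  have h13 : conn.pullback g.param (x, z) (v, chartRight G z ξ) =
      conn.formAt (MulOpposite.op (chartInv G z) • g.sec x) (D (v, chartRight G z ξ)) := rfl
  have h14 : ((v, chartRight G z ξ) : V × EG) = (v, 0) + (0, chartRight G z ξ) := by simp
  have h15 : conn.gaugeForm g x v = conn.formAt (g.sec x) (S v) := rfl
  rw [h13, h14, map_add, h3, h12, ← map_add, conn.formAt_smul hR, map_add,
    conn.formAt_fundamental hQ, h15, chartAd]

end PrincipalConnection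

end PrincipalBundle

/-! ### Horizontal lifts -/

section IntervalInduction

/-- A transitive relation between the end points of an interval that holds locally holds globally. -/
theorem interval_induction {Q : ℝ → ℝ → Prop} {a b : ℝ} (hab : a ≤ b)
    (htrans : ∀ x y z, a ≤ x → x ≤ y → y ≤ z → z ≤ b → Q x y → Q y z → Q x z)
    (hloc : ∀ t ∈ Icc a b, ∃ ε > 0, ∀ x ∈ Icc a b, ∀ y ∈ Icc a b, x ≤ y → |x - t| < ε →
      |y - t| < ε → Q x y) : Q a b := by
  choose! ε hε hQ using hloc
  -- By compactness there is a finite subdivision each of whose intervals lies in one of the good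
  -- balls.
  obtain ⟨t, ht0, htm, ⟨m, hm⟩, ht⟩ := exists_monotone_Icc_subset_open_cover_Icc hab
    (c := fun s : Icc a b => Metric.ball s (ε s)) (fun s => Metric.isOpen_ball)
    (fun s _ => mem_iUnion.2 ⟨s, Metric.mem_ball_self (hε s s.2)⟩)
  have key : ∀ n, Q a (t n) := by
    intro n
    induction n with
    | zero =>
      have ha : a ∈ Icc a b := left_mem_Icc.2 hab
      rw [ht0]
      exact hQ a ha a ha a ha le_rfl (by simpa using hε a ha) (by simpa using hε a ha)
    | succ n ih =>
      have hle : t n ≤ t (n + 1) := htm n.le_succ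
      refine htrans a (t n) (t (n + 1)) le_rfl (t n).2.1 hle (t (n + 1)).2.2 ih ?_
      obtain ⟨s, hs⟩ := ht n
      exact hQ s s.2 _ (t n).2 _ (t (n + 1)).2 hle (hs (left_mem_Icc.2 hle))
        (hs (right_mem_Icc.2 hle))
  have := key m
  rwa [hm m le_rfl] at this

theorem IntervalIntegrable.continuousOn_clm_apply {E F : Type*} [NormedAddCommGroup E]
    [NormedSpace ℝ E] [NormedAddCommGroup F] [NormedSpace ℝ F] {A : ℝ → E →L[ℝ] F} {u : ℝ → E}
    {a b : ℝ} (hu : IntervalIntegrable u volume a b) (hA : ContinuousOn A (uIcc a b)) :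
    IntervalIntegrable (fun s => A s (u s)) volume a b := by
  rw [intervalIntegrable_iff] at hu ⊢
  obtain ⟨M, hM⟩ := isCompact_uIcc.exists_bound_of_continuousOn hA
  have hmeas : AEStronglyMeasurable A (volume.restrict (uIoc a b)) :=
    (hA.mono uIoc_subset_uIcc).aestronglyMeasurable measurableSet_uIoc
  refine Integrable.mono' (hu.norm.const_mul M)
    ((ContinuousLinearMap.apply ℝ F (E := E)).flip.aestronglyMeasurable_comp₂ hmeas hu.1) ?_
  rw [ae_restrict_iff' measurableSet_uIoc]
  refine Filter.Eventually.of_forall fun s hs => ?_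
  exact (A s).le_of_opNorm_le (hM s (uIoc_subset_uIcc hs)) (u s)

theorem exists_integral_norm_lt {F : Type*} [NormedAddCommGroup F] {u : ℝ → F} {a b t η : ℝ}
    (hab : a ≤ b) (ht : t ∈ Icc a b)
    (hu : IntervalIntegrable u volume a b) (hη : 0 < η) : ∃ ε > 0, ∀ x ∈ Icc a b, ∀ y ∈ Icc a b,
      x ≤ y → |x - t| < ε → |y - t| < ε → ∫ s in x..y, ‖u s‖ < η := by
  have hc : ContinuousOn (fun y => ∫ s in a..y, ‖u s‖) (uIcc a b) :=
    intervalIntegral.continuousOn_primitive_interval' hu.norm left_mem_uIcc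
  rw [uIcc_of_le hab] at hc
  obtain ⟨ε, hε, h⟩ := Metric.continuousWithinAt_iff.1 (hc t ht) (η / 2) (by positivity)
  refine ⟨ε, hε, fun x hx y hy hxy hxt hyt => ?_⟩
  have hi : ∀ y ∈ Icc a b, IntervalIntegrable (fun s => ‖u s‖) volume a y := fun y hy =>
    hu.norm.mono_set (uIcc_subset_uIcc left_mem_uIcc (by rw [uIcc_of_le hab]; exact hy))
  rw [← intervalIntegral.integral_interval_sub_left (hi y hy) (hi x hx)]
  have h1 := h hx hxt
  have h2 := h hy hyt
  rw [Real.dist_eq] at h1 h2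
  have := abs_lt.1 h1
  have := abs_lt.1 h2
  linarith

theorem ae_hasDerivAt_of_integral {E : Type*} [NormedAddCommGroup E] [NormedSpace ℝ E]
    [CompleteSpace E] {g z : ℝ → E} {a b t₀ : ℝ} (hab : a ≤ b) (h₀ : t₀ ∈ Icc a b)
    (hg : IntervalIntegrable g volume a b) {c : E}
    (hz : ∀ t ∈ Icc a b, z t = c + ∫ s in t₀..t, g s) :
    ∀ᵐ t ∂volume.restrict (Icc a b), HasDerivAt z (g t) t := by
  rw [← restrict_Ioo_eq_restrict_Icc, ae_restrict_iff' measurableSet_Ioo]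
  filter_upwards [hg.ae_hasDerivAt_integral] with t ht htI
  have hI : uIcc a b = Icc a b := uIcc_of_le hab
  have h1 := (ht (by rw [hI]; exact Ioo_subset_Icc_self htI) t₀ (by rw [hI]; exact h₀)).const_add c
  refine h1.congr_of_eventuallyEq ?_
  filter_upwards [Ioo_mem_nhds htI.1 htI.2] with s hs using hz s (Ioo_subset_Icc_self hs)

end IntervalInduction

/-! ### Horizontal lifts as solutions of control systems. -/

section HorizontalLift

open Filter Topology

variable {V : Type*} [NormedAddCommGroup V] [InnerProductSpace ℝ V] [FiniteDimensional ℝ V]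
  {EG : Type*} [NormedAddCommGroup EG] [NormedSpace ℝ EG] [FiniteDimensional ℝ EG]
  {G : Type*} [TopologicalSpace G] [ChartedSpace EG G] [Group G] [LieGroup 𝓘(ℝ, EG) ∞ G]
  {EP : Type*} [NormedAddCommGroup EP] [NormedSpace ℝ EP] [FiniteDimensional ℝ EP]
  {P : Type*} [TopologicalSpace P] [ChartedSpace EP P] [MulAction Gᵐᵒᵖ P]

variable (EG G) in
/-- A globally Lipschitz extension of the right translation operators, together with a ball on
which the chart of the group is well behaved. -/
structure ControlCutoff where
  toFun : EG → EG →L[ℝ] EG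
  lip : NNReal
  bound : ℝ
  radius : ℝ
  radius_pos : 0 < radius
  contDiff : ContDiff ℝ ∞ toFun
  lipschitzWith : LipschitzWith lip toFun
  bound_nonneg : 0 ≤ bound
  norm_le : ∀ z, ‖toFun z‖ ≤ bound
  mem_chartDomain : ∀ z ∈ Metric.ball (chartOne G) radius, z ∈ chartDomain (EG := EG) G
  mem_connectedComponent : ∀ z ∈ Metric.ball (chartOne (EG := EG) G) radius,
    chartInv G z ∈ connectedComponent (1 : G)
  eq_chartRight : ∀ z ∈ Metric.ball (chartOne G) radius, toFun z = chartRight G z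
  surjective : ∀ z ∈ Metric.ball (chartOne (EG := EG) G) radius, Function.Surjective (toFun z)
  injective : ∀ z ∈ Metric.ball (chartOne (EG := EG) G) radius, Function.Injective (chartAd G z)

theorem eventually_bijective {E : Type*} [NormedAddCommGroup E] [NormedSpace ℝ E]
    [CompleteSpace E] {f : E → E →L[ℝ] E} {c : E} (hf : ContinuousAt f c)
    (hc : f c = ContinuousLinearMap.id ℝ E) : ∀ᶠ z in 𝓝 c, Function.Bijective (f z) := by
  have h1 : IsUnit (f c) := by rw [hc]; exact isUnit_one
  filter_upwards [hf.preimage_mem_nhds (Units.isOpen.mem_nhds h1)] with z hz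
  obtain ⟨u, hu⟩ := hz
  rw [← hu]
  refine Function.bijective_iff_has_inverse.2 ⟨(↑u⁻¹ : E →L[ℝ] E), fun x => ?_, fun x => ?_⟩
  · exact congrArg (fun A : E →L[ℝ] E => A x) u.inv_mul
  · exact congrArg (fun A : E →L[ℝ] E => A x) u.mul_inv

theorem nonempty_controlCutoff : Nonempty (ControlCutoff EG G) := by
  obtain ⟨R, hR, hRc, hRe⟩ := exists_contDiff_eventuallyEq isOpen_chartDomain
    (contDiffOn_chartRight (G := G) (EG := EG)) chartOne_mem
  obtain ⟨M, hM⟩ := hRc.exists_bound_of_continuous hR.continuous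
  obtain ⟨K, hK⟩ := (hR.of_le (by simp) : ContDiff ℝ 1 R).lipschitzWith_of_hasCompactSupport hRc
    (by simp)
  obtain ⟨r₀, hr₀, h1, h2⟩ := exists_ball_chartInv_mem_connectedComponent (EG := EG) (G := G)
  have h3 := eventually_bijective hR.continuous.continuousAt
    (hRe.self_of_nhds.trans (chartRight_one (G := G) (EG := EG)))
  have h4 := eventually_bijective (exists_contDiffAt_chartAd (G := G) (EG := EG)
    chartOne_mem).continuousAt chartAd_one
  obtain ⟨r, hr, h⟩ := Metric.eventually_nhds_iff_ball.1
    (hRe.and (h3.and (h4.and (Metric.ball_mem_nhds (chartOne (EG := EG) G) hr₀))))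
  exact ⟨⟨R, K, M, r, hr, hR, hK, (norm_nonneg _).trans (hM 0), hM,
    fun z hz => h1 (h z hz).2.2.2, fun z hz => h2 z (h z hz).2.2.2, fun z hz => (h z hz).1,
    fun z hz => (h z hz).2.1.2, fun z hz => (h z hz).2.2.1.1⟩⟩

namespace ControlCutoff

variable (κ : ControlCutoff EG G)

/-- A bound for the size of controls under which solutions stay in the chart. -/
noncomputable def small : ℝ := min (1 / (2 * (κ.lip + 1))) (κ.radius / (2 * (κ.bound + 1)))

theorem small_pos : 0 < κ.small := by
  have := κ.radius_pos
  have := κ.bound_nonneg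
  exact lt_min (by positivity) (by positivity)

theorem lip_mul_lt {η : ℝ} (hη : η ≤ κ.small) : κ.lip * η < 1 := by
  have h1 : η ≤ 1 / (2 * (κ.lip + 1)) := hη.trans (min_le_left _ _)
  have h2 : (0 : ℝ) ≤ κ.lip := κ.lip.2
  rw [le_div_iff₀ (by positivity)] at h1
  rcases le_total η 0 with h | h
  · nlinarith
  · nlinarith

theorem bound_mul_lt {η : ℝ} (hη : η ≤ κ.small) : κ.bound * η < κ.radius := by
  have h1 : η ≤ κ.radius / (2 * (κ.bound + 1)) := hη.trans (min_le_right _ _)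
  have h2 := κ.bound_nonneg
  have h3 := κ.radius_pos
  rw [le_div_iff₀ (by positivity)] at h1
  rcases le_total η 0 with h | h
  · nlinarith
  · nlinarith

theorem exists_solution {u : ℝ → EG} {a b : ℝ} (hab : a ≤ b)
    (hu : IntervalIntegrable u volume a b) (hs : ∫ s in a..b, ‖u s‖ ≤ κ.small) :
    ∃ z : ℝ → EG, Continuous z ∧
      (∀ t ∈ Icc a b, z t = chartOne G + ∫ s in a..t, κ.toFun (z s) (u s)) ∧
      ∀ t ∈ Icc a b, ‖z t - chartOne G‖ ≤ κ.bound * ∫ s in a..b, ‖u s‖ := by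
  obtain ⟨z, hz, hzt⟩ := exists_control_solution κ.lipschitzWith hab (left_mem_Icc.2 hab) hu
    (κ.lip_mul_lt hs) (chartOne G)
  refine ⟨z, hz, hzt, fun t ht => ?_⟩
  have hsub : uIcc a t ⊆ uIcc a b := uIcc_subset_uIcc left_mem_uIcc (by
    rw [uIcc_of_le hab]; exact ht)
  rw [hzt t ht, add_sub_cancel_left]
  calc ‖∫ s in a..t, κ.toFun (z s) (u s)‖ ≤ ∫ s in a..t, κ.bound * ‖u s‖ :=
        intervalIntegral.norm_integral_le_of_norm_le ht.1
          (Eventually.of_forall fun s _ => (κ.toFun (z s)).le_of_opNorm_le (κ.norm_le _) _)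
          ((hu.mono_set hsub).norm.const_mul _)
    _ = κ.bound * ∫ s in a..t, ‖u s‖ := by rw [intervalIntegral.integral_const_mul]
    _ ≤ κ.bound * ∫ s in a..b, ‖u s‖ := by
      refine mul_le_mul_of_nonneg_left ?_ κ.bound_nonneg
      exact intervalIntegral.integral_mono_interval le_rfl ht.1 ht.2
        (Eventually.of_forall fun s => norm_nonneg _) hu.norm

end ControlCutoff

namespace PrincipalConnection

variable [IsManifold 𝓘(ℝ, EP) ∞ P] {B : SmoothPrincipalBundle V (EG := EG) G (EP := EP) P}
  (conn : PrincipalConnection B)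

/-- Horizontal lifts of a curve over an interval. -/
structure IsLiftOn (γ : ℝ → V) (a b : ℝ) (ρ : ℝ → P) : Prop where
  continuousOn : ContinuousOn ρ (Icc a b)
  absolutelyContinuous : ∀ (q : P) (a' b' : ℝ), a ≤ a' → a' ≤ b' → b' ≤ b →
    (∀ t ∈ Icc a' b', ρ t ∈ (chartAt EP q).source) →
      AbsolutelyContinuousOnInterval (fun t => chartAt EP q (ρ t)) a' b'
  proj_eq : ∀ t ∈ Icc a b, B.proj (ρ t) = γ t
  horizontal : ∀ᵐ t ∂volume.restrict (Icc a b), ∃ L : ℝ →L[ℝ] EP,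
    HasMFDerivAt 𝓘(ℝ, ℝ) 𝓘(ℝ, EP) ρ t L ∧ conn.formAt (ρ t) (L 1) = 0

variable {conn}

theorem IsHorizontalLift.isLiftOn {γ : ℝ → V} {p : P} {ρ : ℝ → P}
    (h : conn.IsHorizontalLift γ p ρ) : conn.IsLiftOn γ 0 1 ρ :=
  ⟨h.absolutelyContinuous.1, h.absolutelyContinuous.2, h.proj_eq, h.horizontal⟩

theorem IsLiftOn.isHorizontalLift {γ : ℝ → V} {ρ : ℝ → P} (h : conn.IsLiftOn γ 0 1 ρ) :
    conn.IsHorizontalLift γ (ρ 0) ρ :=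
  ⟨⟨h.continuousOn, h.absolutelyContinuous⟩, rfl, h.proj_eq, h.horizontal⟩

theorem IsLiftOn.mono {γ : ℝ → V} {a b a' b' : ℝ} {ρ : ℝ → P} (h : conn.IsLiftOn γ a b ρ)
    (ha : a ≤ a') (hb : b' ≤ b) : conn.IsLiftOn γ a' b' ρ :=
  ⟨h.continuousOn.mono (Icc_subset_Icc ha hb),
    fun q x y hx hxy hy => h.absolutelyContinuous q x y (ha.trans hx) hxy (hy.trans hb),
    fun t ht => h.proj_eq t (Icc_subset_Icc ha hb ht),
    ae_mono (Measure.restrict_mono (Icc_subset_Icc ha hb) le_rfl) h.horizontal⟩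

/-- Absolute continuity in a chart is checked on both sides of b and glued; horizontality is an
almost everywhere condition, so the corner at b does not matter. -/
theorem IsLiftOn.trans {γ : ℝ → V} {a b c : ℝ} {ρ₁ ρ₂ : ℝ → P} (hab : a ≤ b) (hbc : b ≤ c)
    (h₁ : conn.IsLiftOn γ a b ρ₁) (h₂ : conn.IsLiftOn γ b c ρ₂) (h : ρ₁ b = ρ₂ b) :
    ∃ ρ, conn.IsLiftOn γ a c ρ ∧ ρ a = ρ₁ a ∧ ρ c = ρ₂ c := by
  classical
  let ρ : ℝ → P := fun t => if t ≤ b then ρ₁ t else ρ₂ t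
  have e₁ : ∀ t ≤ b, ρ t = ρ₁ t := fun t ht => if_pos ht
  have e₂ : ∀ t ≥ b, ρ t = ρ₂ t := fun t ht => by
    rcases ht.eq_or_lt with rfl | h'
    · rw [e₁ b le_rfl, h]
    · exact if_neg (not_le.2 h')
  refine ⟨ρ, ⟨?_, ?_, ?_, ?_⟩, e₁ a hab, e₂ c hbc⟩
  · rw [← Icc_union_Icc_eq_Icc hab hbc]
    exact (h₁.continuousOn.congr fun t ht => e₁ t ht.2).union_of_isClosed
      (h₂.continuousOn.congr fun t ht => e₂ t ht.1) isClosed_Icc isClosed_Icc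
  · intro q x y hx hxy hy hs
    have key₁ : ∀ x y, a ≤ x → x ≤ y → y ≤ b → (∀ t ∈ Icc x y, ρ t ∈ (chartAt EP q).source) →
        AbsolutelyContinuousOnInterval (fun t => chartAt EP q (ρ t)) x y := by
      intro x y hx hxy hy hs
      refine (h₁.absolutelyContinuous q x y hx hxy hy fun t ht => ?_).congr fun t ht => ?_
      · rw [← e₁ t (ht.2.trans hy)]; exact hs t ht
      · rw [uIcc_of_le hxy] at ht
        rw [e₁ t (ht.2.trans hy)]
    have key₂ : ∀ x y, b ≤ x → x ≤ y → y ≤ c → (∀ t ∈ Icc x y, ρ t ∈ (chartAt EP q).source) →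
        AbsolutelyContinuousOnInterval (fun t => chartAt EP q (ρ t)) x y := by
      intro x y hx hxy hy hs
      refine (h₂.absolutelyContinuous q x y hx hxy hy fun t ht => ?_).congr fun t ht => ?_
      · rw [← e₂ t (hx.trans ht.1)]; exact hs t ht
      · rw [uIcc_of_le hxy] at ht
        rw [e₂ t (hx.trans ht.1)]
    rcases le_total y b with hyb | hyb
    · exact key₁ x y hx hxy hyb hs
    · rcases le_total b x with hxb | hxb
      · exact key₂ x y hxb hxy hy hs
      · exact (key₁ x b hx hxb le_rfl fun t ht => hs t ⟨ht.1, ht.2.trans hyb⟩).trans hxb hyb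
          (key₂ b y le_rfl hyb hy fun t ht => hs t ⟨hxb.trans ht.1, ht.2⟩)
  · intro t ht
    rcases le_total t b with htb | htb
    · rw [e₁ t htb]; exact h₁.proj_eq t ⟨ht.1, htb⟩
    · rw [e₂ t htb]; exact h₂.proj_eq t ⟨htb, ht.2⟩
  · have a₁ := h₁.horizontal
    have a₂ := h₂.horizontal
    rw [← restrict_Ioo_eq_restrict_Icc, ae_restrict_iff' measurableSet_Ioo] at a₁ a₂ ⊢
    have hne : ∀ᵐ t : ℝ, t ≠ b := by simp [ae_iff]
    filter_upwards [a₁, a₂, hne] with t ht₁ ht₂ htb htI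
    rcases lt_or_gt_of_ne htb with hlt | hgt
    · obtain ⟨L, hL, hL0⟩ := ht₁ ⟨htI.1, hlt⟩
      refine ⟨L, hL.congr_of_eventuallyEq ?_, by rw [e₁ t hlt.le]; exact hL0⟩
      filter_upwards [Iio_mem_nhds hlt] with s hs using e₁ s (le_of_lt hs)
    · obtain ⟨L, hL, hL0⟩ := ht₂ ⟨hgt, htI.2⟩
      refine ⟨L, hL.congr_of_eventuallyEq ?_, by rw [e₂ t hgt.le]; exact hL0⟩
      filter_upwards [Ioi_mem_nhds hgt] with s hs using e₂ s (le_of_lt hs)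

variable (conn)

/-- The control `-A(γ') ` of a curve in a gauge. -/
noncomputable def control (g : B.Gauge) (γ : ℝ → V) (t : ℝ) : EG :=
  -(conn.gaugeForm g (γ t) (deriv γ t))

theorem intervalIntegrable_control (g : B.Gauge) {γ : ℝ → V} {a b : ℝ}
    (hγ : AbsolutelyContinuousOnInterval γ a b) (hd : ∀ t ∈ uIcc a b, γ t ∈ g.dom) :
    IntervalIntegrable (conn.control g γ) volume a b :=
  (hγ.intervalIntegrable_deriv_of_finiteDimensional.continuousOn_clm_apply
    ((conn.contDiffOn_gaugeForm g).continuousOn.comp hγ.continuousOn hd)).neg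

/-- Solutions of the control system in a gauge give horizontal lifts. -/
theorem isLiftOn_param (g : B.Gauge) (κ : ControlCutoff EG G) {γ : ℝ → V} {z : ℝ → EG} {a b : ℝ}
    (hab : a ≤ b) (hγ : AbsolutelyContinuousOnInterval γ a b) (hd : ∀ t ∈ Icc a b, γ t ∈ g.dom)
    (hz : ContinuousOn z (Icc a b)) {c : EG}
    (hzt : ∀ t ∈ Icc a b, z t = c + ∫ s in a..t, κ.toFun (z s) (conn.control g γ s))
    (hzb : ∀ t ∈ Icc a b, z t ∈ Metric.ball (chartOne G) κ.radius)
    {k : G} (hk : k ∈ connectedComponent (1 : G)) :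
    conn.IsLiftOn γ a b fun t => MulOpposite.op k • g.param (γ t, z t) := by
  have hI : uIcc a b = Icc a b := uIcc_of_le hab
  have hmem : ∀ t ∈ Icc a b, (γ t, z t) ∈ g.dom ×ˢ chartDomain (EG := EG) G := fun t ht =>
    ⟨hd t ht, κ.mem_chartDomain _ (hzb t ht)⟩
  have hu := conn.intervalIntegrable_control g hγ (by rwa [hI])
  have hgi := _root_.intervalIntegrable_control κ.lipschitzWith.continuous hu
    (z := z) (by rwa [hI])
  have hzac : AbsolutelyContinuousOnInterval z a b :=
    absolutelyContinuousOnInterval_of_integral hgi left_mem_uIcc (by rwa [hI])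
  have hsm : ContMDiffOn 𝓘(ℝ, V × EG) 𝓘(ℝ, EP) ∞ (fun y => MulOpposite.op k • g.param y)
      (g.dom ×ˢ chartDomain (EG := EG) G) :=
    (B.contMDiff_smul_left k).comp_contMDiffOn g.contMDiffOn_param
  refine ⟨?_, ?_, ?_, ?_⟩
  · have h1 := hγ.continuousOn
    rw [hI] at h1
    exact hsm.continuousOn.comp (h1.prodMk hz) hmem
  · intro q x y hx hxy hy hs
    have hsub : Icc x y ⊆ Icc a b := Icc_subset_Icc hx hy
    have h1 := ((hγ.prodMk hzac).mono (c := x) (d := y) (by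
      rw [uIcc_of_le hxy, hI]; exact hsub))
    refine h1.comp_contDiffOn
      (φ := fun w => chartAt EP q (MulOpposite.op k • g.param w))
      (hsm.continuousOn.isOpen_inter_preimage g.isOpen_prod (chartAt EP q).open_source) ?_ ?_
    · refine ContDiffOn.of_le ?_ (n := ∞) (by simp)
      rw [← contMDiffOn_iff_contDiffOn]
      exact (contMDiffOn_chart (I := 𝓘(ℝ, EP)) (n := ∞) (x := q)).comp
        (hsm.mono inter_subset_left) fun w hw => hw.2
    · intro t ht
      rw [uIcc_of_le hxy] at ht
      exact ⟨hmem t (hsub ht), hs t ht⟩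
  · intro t ht
    have h1 := g.proj_sec _ (hd t ht)
    rw [B.proj_smul hk, SmoothPrincipalBundle.Gauge.param_apply,
      B.proj_smul (κ.mem_connectedComponent _ (hzb t ht)), h1]
  · have hγd := hγ.ae_differentiableAt_of_finiteDimensional
    rw [hI] at hγd
    have hγd' := (ae_restrict_iff' measurableSet_Icc).2 hγd
    filter_upwards [ae_hasDerivAt_of_integral hab (left_mem_Icc.2 hab) hgi hzt, hγd',
      ae_restrict_mem measurableSet_Icc] with t ht1 ht2 ht
    let D : V × EG →L[ℝ] EP := mfderiv 𝓘(ℝ, V × EG) 𝓘(ℝ, EP) g.param (γ t, z t)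
    have hD : HasMFDerivAt 𝓘(ℝ, V × EG) 𝓘(ℝ, EP) g.param (γ t, z t) D :=
      ((g.contMDiffAt_param (hmem t ht).1 (hmem t ht).2).mdifferentiableAt (by simp)).hasMFDerivAt
    let R : EP →L[ℝ] EP := mfderiv 𝓘(ℝ, EP) 𝓘(ℝ, EP)
      (fun q : P => MulOpposite.op k • q) (g.param (γ t, z t))
    have hR : HasMFDerivAt 𝓘(ℝ, EP) 𝓘(ℝ, EP) (fun q : P => MulOpposite.op k • q)
        (g.param (γ t, z t)) R :=
      ((B.contMDiff_smul_left _).contMDiffAt.mdifferentiableAt (by simp)).hasMFDerivAt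
    have hc : HasDerivAt (fun t => (γ t, z t))
        (deriv γ t, κ.toFun (z t) (conn.control g γ t)) t := ht2.hasDerivAt.prodMk ht1
    have h1 := HasMFDerivAt.comp (g := g.param) t hD hc.hasFDerivAt.hasMFDerivAt
    refine ⟨_, HasMFDerivAt.comp t hR h1, ?_⟩
    -- In the parametrization ω is Ad(χ(z)⁻¹) applied to A(γ') + ξ, where ξ is the right-trivialized
    -- fibre velocity. The control ξ = -A(γ') makes it vanish.
    have h2 : conn.formAt (g.param (γ t, z t))
        (D (deriv γ t, κ.toFun (z t) (conn.control g γ t))) = 0 := by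
      have h3 := conn.pullback_param g (hmem t ht).1 (hmem t ht).2 (deriv γ t)
        (conn.control g γ t)
      rw [control, add_neg_cancel, map_zero, ← κ.eq_chartRight _ (hzb t ht)] at h3
      exact h3
    have h4 : conn.formAt (MulOpposite.op k • g.param (γ t, z t))
        (R (D ((1 : ℝ) • (deriv γ t, κ.toFun (z t) (conn.control g γ t))))) = 0 := by
      rw [one_smul, conn.formAt_smul hR, h2, map_zero]
    exact h4

/-- Uniqueness of horizontal lifts, in a gauge. -/
theorem IsLiftOn.eq_param [T2Space P] {conn : PrincipalConnection B} (g : B.Gauge)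
    (κ : ControlCutoff EG G) {γ : ℝ → V}
    {z : ℝ → EG} {ρ : ℝ → P} {a b : ℝ} (hρ : conn.IsLiftOn γ a b ρ)
    (hab : a ≤ b) (hγ : AbsolutelyContinuousOnInterval γ a b) (hd : ∀ t ∈ Icc a b, γ t ∈ g.dom)
    (hz : ContinuousOn z (Icc a b)) {c : EG}
    (hzt : ∀ t ∈ Icc a b, z t = c + ∫ s in a..t, κ.toFun (z s) (conn.control g γ s))
    (hzb : ∀ t ∈ Icc a b, z t ∈ Metric.ball (chartOne G) κ.radius)
    (ha : ρ a = g.param (γ a, z a)) : ∀ t ∈ Icc a b, ρ t = g.param (γ t, z t) := by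
  have hI : uIcc a b = Icc a b := uIcc_of_le hab
  have hγc := hγ.continuousOn
  rw [hI] at hγc
  have hu := conn.intervalIntegrable_control g hγ (by rwa [hI])
  have hgi := _root_.intervalIntegrable_control κ.lipschitzWith.continuous hu
    (z := z) (by rwa [hI])
  have hmem : ∀ t ∈ Icc a b, (γ t, z t) ∈ g.dom ×ˢ chartDomain (EG := EG) G := fun t ht =>
    ⟨hd t ht, κ.mem_chartDomain _ (hzb t ht)⟩
  have hparc : ContinuousOn (fun t => g.param (γ t, z t)) (Icc a b) :=
    g.contMDiffOn_param.continuousOn.comp (hγc.prodMk hz) hmem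
  -- Continuous induction: the set of agreement is closed, and it remains to extend it a little to
  -- the right of each of its points.
  refine IsClosed.Icc_subset_of_forall_mem_nhdsWithin (s := {t | ρ t = g.param (γ t, z t)}) ?_ ha ?_
  · have h1 : IsClosed (Icc a b ∩ {t | ρ t = g.param (γ t, z t)}) :=
      (hρ.continuousOn.prodMk hparc).preimage_isClosed_of_isClosed isClosed_Icc isClosed_diagonal
    rwa [inter_comm] at h1
  rintro t₀ ⟨ht₀, htI⟩
  have ht₀ : ρ t₀ = g.param (γ t₀, z t₀) := ht₀
  have htI' : t₀ ∈ Icc a b := ⟨htI.1, htI.2.le⟩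
  -- a neighbourhood on which the gauge provides coordinates
  let S : Set P := {q | B.proj q ∈ g.dom ∧ g.toGroup q ∈ (extChartAt 𝓘(ℝ, EG) (1 : G)).source ∧
    chartCoord (g.toGroup q) ∈ Metric.ball (chartOne (EG := EG) G) κ.radius}
  have hS : IsOpen S := by
    have h1 : IsOpen (B.proj ⁻¹' g.dom) := g.isOpen_dom.preimage B.contMDiff_proj.continuous
    have h2 : IsOpen ((extChartAt 𝓘(ℝ, EG) (1 : G)).source ∩
        chartCoord ⁻¹' Metric.ball (chartOne (EG := EG) G) κ.radius) :=
      contMDiffOn_chartCoord.continuousOn.isOpen_inter_preimage (isOpen_extChartAt_source _)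
        Metric.isOpen_ball
    exact g.contMDiffOn_toGroup.continuousOn.isOpen_inter_preimage h1 h2
  have hsm : ContMDiffOn 𝓘(ℝ, EP) 𝓘(ℝ, EG) ∞ (fun q => chartCoord (g.toGroup q) : P → EG) S :=
    contMDiffOn_chartCoord.comp (g.contMDiffOn_toGroup.mono fun q hq => hq.1) fun q hq => hq.2.1
  have hSeq : ∀ q ∈ S, q = g.param (B.proj q, chartCoord (g.toGroup q)) := by
    intro q hq
    have h1 : chartInv G (chartCoord (g.toGroup q) : EG) = g.toGroup q := chartInv_chartCoord hq.2.1
    have h2 := κ.mem_connectedComponent _ hq.2.2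
    rw [h1] at h2
    rw [SmoothPrincipalBundle.Gauge.param_apply, h1]
    exact g.eq_smul_sec q hq.1 h2
  have hpar : ∀ x ∈ g.dom, ∀ w ∈ Metric.ball (chartOne (EG := EG) G) κ.radius,
      g.param (x, w) ∈ S ∧ chartCoord (g.toGroup (g.param (x, w))) = w := by
    intro x hx w hw
    have h1 := κ.mem_connectedComponent _ hw
    have h2 : B.proj (g.sec x) ∈ g.dom := by rw [g.proj_sec x hx]; exact hx
    have h3 : g.toGroup (g.param (x, w)) = chartInv G w := by
      rw [SmoothPrincipalBundle.Gauge.param_apply, g.toGroup_smul _ h2 _ h1, g.toGroup_sec x hx,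
        one_mul]
    have h4 : chartCoord (g.toGroup (g.param (x, w))) = w := by
      rw [h3, chartCoord_chartInv (κ.mem_chartDomain _ hw)]
    refine ⟨⟨?_, ?_, by rw [h4]; exact hw⟩, h4⟩
    · rw [SmoothPrincipalBundle.Gauge.param_apply, B.proj_smul h1]; exact h2
    · rw [h3]; exact chartInv_mem_source (κ.mem_chartDomain _ hw)
  let q₀ : P := ρ t₀
  have hq₀ : q₀ ∈ S := by
    change ρ t₀ ∈ S
    rw [ht₀]; exact (hpar _ (hd t₀ htI') _ (hzb t₀ htI')).1
  -- a short interval to the right of `t₀`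
  obtain ⟨ε₁, hε₁, hsmall⟩ := exists_integral_norm_lt (η := κ.small) hab htI' hu κ.small_pos
  have hnear : ∀ᶠ t in 𝓝[Icc a b] t₀, ρ t ∈ S ∩ (chartAt EP q₀).source :=
    (hρ.continuousOn t₀ htI').preimage_mem_nhdsWithin
      ((hS.inter (chartAt EP q₀).open_source).mem_nhds ⟨hq₀, mem_chart_source EP q₀⟩)
  obtain ⟨ε₂, hε₂, hnear⟩ := Metric.mem_nhdsWithin_iff.1 hnear
  let t₁ : ℝ := min b (t₀ + min ε₁ ε₂ / 2)
  have hmin : 0 < min ε₁ ε₂ := lt_min hε₁ hε₂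
  have h01 : t₀ < t₁ := lt_min htI.2 (by linarith)
  have ht₁b : t₁ ≤ b := min_le_left _ _
  have ht₁' : t₁ ≤ t₀ + min ε₁ ε₂ / 2 := min_le_right _ _
  have hsub : Icc t₀ t₁ ⊆ Icc a b := Icc_subset_Icc htI.1 ht₁b
  have hIt : uIcc t₀ t₁ = Icc t₀ t₁ := uIcc_of_le h01.le
  have hsub' : uIcc t₀ t₁ ⊆ uIcc a b := by rw [hIt, hI]; exact hsub
  have habs : ∀ t ∈ Icc t₀ t₁, |t - t₀| < min ε₁ ε₂ := fun t ht => by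
    rw [abs_of_nonneg (by linarith [ht.1])]; linarith [ht.2]
  have hin : ∀ t ∈ Icc t₀ t₁, ρ t ∈ S ∧ ρ t ∈ (chartAt EP q₀).source := fun t ht =>
    hnear ⟨by rw [Metric.mem_ball, Real.dist_eq]; exact (habs t ht).trans_le (min_le_right _ _),
      hsub ht⟩
  have hint1 : ∫ s in t₀..t₁, ‖conn.control g γ s‖ ≤ κ.small :=
    (hsmall t₀ htI' t₁ (hsub (right_mem_Icc.2 h01.le)) h01.le (by simpa using hε₁)
      ((habs t₁ (right_mem_Icc.2 h01.le)).trans_le (min_le_left _ _))).le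
  -- The fibre coordinate of the given lift. It is absolutely continuous and satisfies the same
  -- control system as z, so uniqueness for small controls applies.
  let y : ℝ → EG := fun t => chartCoord (g.toGroup (ρ t))
  have hρy : ∀ t ∈ Icc t₀ t₁, ρ t = g.param (γ t, y t) := fun t ht => by
    have := hSeq _ (hin t ht).1
    rwa [hρ.proj_eq t (hsub ht)] at this
  have hyac : AbsolutelyContinuousOnInterval y t₀ t₁ := by
    have h1 := hρ.absolutelyContinuous q₀ t₀ t₁ htI.1 h01.le ht₁b fun t ht => (hin t ht).2
    have h2 : ContMDiffOn 𝓘(ℝ, EP) 𝓘(ℝ, EP) ∞ (chartAt EP q₀).symm (chartAt EP q₀).target :=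
      contMDiffOn_chart_symm
    have h4 : ContDiffOn ℝ ∞ (fun e => (chartCoord (g.toGroup ((chartAt EP q₀).symm e)) : EG))
        ((chartAt EP q₀).target ∩ (chartAt EP q₀).symm ⁻¹' S) := by
      rw [← contMDiffOn_iff_contDiffOn]
      exact hsm.comp (h2.mono inter_subset_left) fun e he => he.2
    have h3 := h1.comp_contDiffOn
      (h2.continuousOn.isOpen_inter_preimage (chartAt EP q₀).open_target hS)
      (h4.of_le (by simp)) (fun t ht => by
        rw [hIt] at ht
        refine ⟨(chartAt EP q₀).map_source (hin t ht).2, ?_⟩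
        rw [mem_preimage, (chartAt EP q₀).left_inv (hin t ht).2]
        exact (hin t ht).1)
    refine h3.congr fun t ht => ?_
    rw [hIt] at ht
    rw [(chartAt EP q₀).left_inv (hin t ht).2]
  have hyc : ContinuousOn y (Icc t₀ t₁) := by
    have := hyac.continuousOn
    rwa [hIt] at this
  have hyb : ∀ t ∈ Icc t₀ t₁, y t ∈ Metric.ball (chartOne (EG := EG) G) κ.radius := fun t ht =>
    (hin t ht).1.2.2
  have hy' : ∀ᵐ t ∂volume.restrict (Icc t₀ t₁),
      deriv y t = κ.toFun (y t) (conn.control g γ t) := by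
    have e1 := hρ.mono htI.1 ht₁b |>.horizontal
    have e2 := hyac.ae_differentiableAt_of_finiteDimensional
    have e3 := (hγ.mono hsub').ae_differentiableAt_of_finiteDimensional
    rw [← restrict_Ioo_eq_restrict_Icc, ae_restrict_iff' measurableSet_Ioo] at e1 ⊢
    filter_upwards [e1, e2, e3] with t h1 h2 h3 ht
    have htc := Ioo_subset_Icc_self ht
    rw [hIt] at h2 h3
    obtain ⟨L, hL, hL0⟩ := h1 ht
    have hdm := hmem t (hsub htc)
    have hydom := κ.mem_chartDomain _ (hyb t htc)
    let D : V × EG →L[ℝ] EP := mfderiv 𝓘(ℝ, V × EG) 𝓘(ℝ, EP) g.param (γ t, y t)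
    have hD : HasMFDerivAt 𝓘(ℝ, V × EG) 𝓘(ℝ, EP) g.param (γ t, y t) D :=
      ((g.contMDiffAt_param hdm.1 hydom).mdifferentiableAt (by simp)).hasMFDerivAt
    have hc : HasDerivAt (fun t => (γ t, y t)) (deriv γ t, deriv y t) t :=
      (h3 htc).hasDerivAt.prodMk (h2 htc).hasDerivAt
    have h4 := (HasMFDerivAt.comp (g := g.param) t hD
      hc.hasFDerivAt.hasMFDerivAt).congr_of_eventuallyEq (f₁ := ρ) (by
        filter_upwards [Ioo_mem_nhds ht.1 ht.2] with s hs using hρy s (Ioo_subset_Icc_self hs))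
    have h5 : L 1 = D (deriv γ t, deriv y t) := by
      have h6 : L 1 = D ((1 : ℝ) • (deriv γ t, deriv y t)) :=
        congrArg (fun A : ℝ →L[ℝ] EP => A 1) (hasMFDerivAt_unique hL h4)
      rwa [one_smul] at h6
    -- Write the fibre velocity as a right translate of ξ. Horizontality says Ad(χ(y)⁻¹)(A(γ') + ξ)
    -- = 0, and injectivity of the adjoint operator gives ξ = -A(γ').
    obtain ⟨ξ, hξ⟩ := κ.surjective _ (hyb t htc) (deriv y t)
    rw [h5, hρy t htc] at hL0
    have h7 := conn.pullback_param g hdm.1 hydom (deriv γ t) ξ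
    rw [← κ.eq_chartRight _ (hyb t htc), hξ] at h7
    have h8 : chartAd G (y t) (conn.gaugeForm g (γ t) (deriv γ t) + ξ) = 0 := h7.symm.trans hL0
    have h9 := κ.injective _ (hyb t htc) (h8.trans (map_zero _).symm)
    rw [← hξ, control, eq_neg_of_add_eq_zero_right h9]
  have hyt : ∀ t ∈ Icc t₀ t₁, y t = z t₀ + ∫ s in t₀..t, κ.toFun (y s) (conn.control g γ s) := by
    intro t ht
    have hy₀ : y t₀ = z t₀ := by
      change chartCoord (g.toGroup (ρ t₀)) = z t₀
      rw [ht₀]; exact (hpar _ (hd t₀ htI') _ (hzb t₀ htI')).2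
    have h1 := (hyac.mono (c := t₀) (d := t) (by
      rw [uIcc_of_le ht.1, hIt]
      exact Icc_subset_Icc le_rfl ht.2)).integral_deriv_eq_sub_of_finiteDimensional
    rw [← hy₀, ← sub_eq_iff_eq_add', ← h1]
    refine intervalIntegral.integral_congr_ae ?_
    rw [ae_restrict_iff' measurableSet_Icc] at hy'
    filter_upwards [hy'] with s hs hsI
    rw [uIoc_of_le ht.1] at hsI
    exact hs ⟨hsI.1.le, hsI.2.trans ht.2⟩
  have hzt' : ∀ t ∈ Icc t₀ t₁, z t = z t₀ + ∫ s in t₀..t, κ.toFun (z s) (conn.control g γ s) := by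
    intro t ht
    have hi : ∀ t ∈ Icc a b, IntervalIntegrable
        (fun s => κ.toFun (z s) (conn.control g γ s)) volume a t := fun t ht =>
      hgi.mono_set (uIcc_subset_uIcc left_mem_uIcc (by rw [hI]; exact ht))
    rw [hzt t (hsub ht), hzt t₀ htI', add_assoc, intervalIntegral.integral_add_adjacent_intervals
      (hi t₀ htI') ((hi t₀ htI').symm.trans (hi t (hsub ht)))]
  have huniq := control_solution_unique κ.lipschitzWith h01.le (left_mem_Icc.2 h01.le)
    (hu.mono_set hsub') (κ.lip_mul_lt hint1) hyc (hz.mono hsub) hyt hzt'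
  filter_upwards [Ioo_mem_nhdsGT h01] with t ht
  have htc := Ioo_subset_Icc_self ht
  change ρ t = g.param (γ t, z t)
  rw [hρy t htc, huniq t htc]

end PrincipalConnection

end HorizontalLift

/-! ### Existence of horizontal lifts, the radial gauge -/

section RadialGauge

open Filter Topology

variable {V : Type*} [NormedAddCommGroup V] [InnerProductSpace ℝ V] [FiniteDimensional ℝ V]
  {EG : Type*} [NormedAddCommGroup EG] [NormedSpace ℝ EG] [FiniteDimensional ℝ EG]
  {G : Type*} [TopologicalSpace G] [ChartedSpace EG G] [Group G] [LieGroup 𝓘(ℝ, EG) ∞ G]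
  {EP : Type*} [NormedAddCommGroup EP] [NormedSpace ℝ EP] [FiniteDimensional ℝ EP]
  {P : Type*} [TopologicalSpace P] [ChartedSpace EP P] [MulAction Gᵐᵒᵖ P]

theorem ContDiff.absolutelyContinuousOnInterval {E : Type*} [NormedAddCommGroup E]
    [NormedSpace ℝ E] {f : ℝ → E} (hf : ContDiff ℝ ∞ f) (a b : ℝ) :
    AbsolutelyContinuousOnInterval f a b :=
  (LipschitzWith.id.lipschitzOnWith (s := uIcc a b)).absolutelyContinuousOnInterval.comp_contDiffOn
    isOpen_univ (hf.of_le (by simp)).contDiffOn fun _ _ => mem_univ _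

namespace AdaptedBasis

variable {𝔫 : StratifiedLieAlgebra V} {n : ℕ} (Z : AdaptedBasis 𝔫 n)

theorem rayVelocity_zero_right (s : ℝ) : Z.rayVelocity s 0 = 0 := by simp [rayVelocity]

/-- The chain rule applied to δ_t δ_r = δ_{tr}. It makes parallel transport along rays compatible
with dilations. -/
theorem rayVelocity_dilation (t r : ℝ) (x : V) :
    Z.rayVelocity t (Z.dilation r x) = r • Z.rayVelocity (t * r) x := by
  apply Z.basis.ext_elem
  intro i
  rw [repr_rayVelocity, repr_dilation, map_smul, Finsupp.smul_apply, repr_rayVelocity, smul_eq_mul,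
    mul_pow]
  have h := Z.one_le_weight i
  obtain ⟨w, hw⟩ : ∃ w, Z.weight i = w + 1 := ⟨Z.weight i - 1, by omega⟩
  rw [hw, Nat.add_sub_cancel, pow_succ]
  ring

theorem absolutelyContinuous_ray (x : V) (a b : ℝ) :
    AbsolutelyContinuousOnInterval (fun s => Z.dilation s x) a b :=
  ContDiff.absolutelyContinuousOnInterval
    (Z.contDiff_dilation.comp (contDiff_id.prodMk contDiff_const)) a b

end AdaptedBasis

namespace PrincipalConnection

variable [IsManifold 𝓘(ℝ, EP) ∞ P] {B : SmoothPrincipalBundle V (EG := EG) G (EP := EP) P}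
  (conn : PrincipalConnection B)

/-- Horizontal lifts exist along controls that are small. -/
theorem exists_isLiftOn_of_small (g : B.Gauge) (κ : ControlCutoff EG G) {γ : ℝ → V} {a b : ℝ}
    (hab : a ≤ b) (hγ : AbsolutelyContinuousOnInterval γ a b) (hd : ∀ t ∈ Icc a b, γ t ∈ g.dom)
    (hs : ∫ s in a..b, ‖conn.control g γ s‖ ≤ κ.small) :
    ∃ z : ℝ → EG, Continuous z ∧
      (∀ t ∈ Icc a b, z t = chartOne G + ∫ s in a..t, κ.toFun (z s) (conn.control g γ s)) ∧
      (∀ t ∈ Icc a b, ‖z t - chartOne G‖ ≤ κ.bound * ∫ s in a..b, ‖conn.control g γ s‖) ∧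
      (∀ t ∈ Icc a b, z t ∈ Metric.ball (chartOne G) κ.radius) ∧
      ∀ k ∈ connectedComponent (1 : G),
        conn.IsLiftOn γ a b fun t => MulOpposite.op k • g.param (γ t, z t) := by
  obtain ⟨z, hz, hzt, hzn⟩ := κ.exists_solution hab
    (conn.intervalIntegrable_control g hγ (by rwa [uIcc_of_le hab])) hs
  have hzb : ∀ t ∈ Icc a b, z t ∈ Metric.ball (chartOne G) κ.radius := fun t ht => by
    rw [Metric.mem_ball, dist_eq_norm]
    exact (hzn t ht).trans_lt (κ.bound_mul_lt hs)
  exact ⟨z, hz, hzt, hzn, hzb, fun k hk =>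
    conn.isLiftOn_param g κ hab hγ hd hz.continuousOn hzt hzb hk⟩

/-- Absolutely continuous curves have horizontal lifts. -/
theorem exists_isHorizontalLift {γ : ℝ → V} (hγ : AbsolutelyContinuousOnInterval γ 0 1) {p : P}
    (hp : B.proj p = γ 0) : ∃ ρ, conn.IsHorizontalLift γ p ρ := by
  have : IsTopologicalGroup G := topologicalGroup_of_lieGroup 𝓘(ℝ, EG) ∞
  obtain ⟨κ⟩ := nonempty_controlCutoff (EG := EG) (G := G)
  have hI : uIcc (0 : ℝ) 1 = Icc 0 1 := uIcc_of_le zero_le_one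
  have hγc := hγ.continuousOn
  rw [hI] at hγc
  suffices h : ∀ q, B.proj q = γ 0 → ∃ ρ, conn.IsLiftOn γ 0 1 ρ ∧ ρ 0 = q by
    obtain ⟨ρ, hρ, rfl⟩ := h p hp
    exact ⟨ρ, hρ.isHorizontalLift⟩
  -- The outer induction cuts the curve into pieces contained in gauge domains; the starting point
  -- in the fibre is left arbitrary so that pieces can be concatenated.
  refine interval_induction (Q := fun a b => ∀ q, B.proj q = γ a →
    ∃ ρ, conn.IsLiftOn γ a b ρ ∧ ρ a = q) zero_le_one ?_ ?_
  · intro x y z _ hxy hyz _ h1 h2 q hq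
    obtain ⟨ρ₁, hρ₁, h₁⟩ := h1 q hq
    obtain ⟨ρ₂, hρ₂, h₂⟩ := h2 (ρ₁ y) (hρ₁.proj_eq y (right_mem_Icc.2 hxy))
    obtain ⟨ρ, hρ, h₃, -⟩ := hρ₁.trans hxy hyz hρ₂ h₂.symm
    exact ⟨ρ, hρ, h₃.trans h₁⟩
  intro t₀ ht₀
  obtain ⟨U, hU, hxU, hgauge⟩ := B.exists_gauge (γ t₀)
  obtain ⟨ε, hε, hεU⟩ := Metric.mem_nhdsWithin_iff.1
    ((hγc t₀ ht₀).preimage_mem_nhdsWithin (hU.mem_nhds hxU))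
  refine ⟨ε, hε, fun x hx y hy hxy hxt hyt q hq => ?_⟩
  have hsub : Icc x y ⊆ Icc (0 : ℝ) 1 := Icc_subset_Icc hx.1 hy.2
  have hdU : ∀ t ∈ Icc x y, γ t ∈ U := fun t ht => hεU ⟨by
    rw [Metric.mem_ball, Real.dist_eq, abs_lt]
    have := abs_lt.1 hxt
    have := abs_lt.1 hyt
    exact ⟨by linarith [ht.1], by linarith [ht.2]⟩, hsub ht⟩
  obtain ⟨g, rfl, hg⟩ := hgauge q (by rw [hq]; exact hdU x (left_mem_Icc.2 hxy))
  rw [hq] at hg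
  have hγxy : AbsolutelyContinuousOnInterval γ x y := hγ.mono (by
    rw [uIcc_of_le hxy, hI]; exact hsub)
  have hu := conn.intervalIntegrable_control g hγxy (by rwa [uIcc_of_le hxy])
  -- The inner induction cuts further until the controls are small. The end point is required to
  -- stay in the orbit of the section under the identity component, so that the next piece can start
  -- in the same gauge.
  suffices h : ∀ k ∈ connectedComponent (1 : G), ∃ ρ, conn.IsLiftOn γ x y ρ ∧
      ρ x = MulOpposite.op k • g.sec (γ x) ∧
      ∃ k' ∈ connectedComponent (1 : G), ρ y = MulOpposite.op k' • g.sec (γ y) by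
    obtain ⟨ρ, hρ, h1, -⟩ := h 1 mem_connectedComponent
    exact ⟨ρ, hρ, by rw [h1, MulOpposite.op_one, one_smul, hg]⟩
  refine interval_induction (Q := fun a b => ∀ k ∈ connectedComponent (1 : G),
    ∃ ρ, conn.IsLiftOn γ a b ρ ∧ ρ a = MulOpposite.op k • g.sec (γ a) ∧
      ∃ k' ∈ connectedComponent (1 : G), ρ b = MulOpposite.op k' • g.sec (γ b)) hxy ?_ ?_
  · intro x' y' z' _ hxy' hyz' _ h1 h2 k hk
    obtain ⟨ρ₁, hρ₁, h₁, k₁, hk₁, h₁'⟩ := h1 k hk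
    obtain ⟨ρ₂, hρ₂, h₂, k₂, hk₂, h₂'⟩ := h2 k₁ hk₁
    obtain ⟨ρ, hρ, h₃, h₃'⟩ := hρ₁.trans hxy' hyz' hρ₂ (h₁'.trans h₂.symm)
    exact ⟨ρ, hρ, h₃.trans h₁, k₂, hk₂, h₃'.trans h₂'⟩
  · intro t₁ ht₁
    obtain ⟨ε', hε', hsmall⟩ := exists_integral_norm_lt (η := κ.small) hxy ht₁ hu κ.small_pos
    refine ⟨ε', hε', fun a ha b hb hab hat hbt k hk => ?_⟩
    have hsub' : Icc a b ⊆ Icc x y := Icc_subset_Icc ha.1 hb.2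
    obtain ⟨z, -, hzt, -, hzb, hz⟩ := conn.exists_isLiftOn_of_small g κ hab
      (hγxy.mono (by rw [uIcc_of_le hxy, uIcc_of_le hab]; exact hsub'))
      (fun t ht => hdU t (hsub' ht)) (hsmall a ha b hb hab hat hbt).le
    have hza : z a = chartOne G := by
      rw [hzt a (left_mem_Icc.2 hab), intervalIntegral.integral_same, add_zero]
    refine ⟨_, hz k hk, ?_, _, mul_mem_connectedComponent_one
      (κ.mem_connectedComponent _ (hzb b (right_mem_Icc.2 hab))) hk,
      (SmoothPrincipalBundle.op_smul_op_smul _ _ _)⟩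
    rw [hza, g.param_chartOne]

theorem curveLift_spec {γ : ℝ → V} (hγ : AbsolutelyContinuousOnInterval γ 0 1) {p : P}
    (hp : B.proj p = γ 0) : conn.IsHorizontalLift γ p (conn.curveLift γ p) := by
  have h := conn.exists_isHorizontalLift hγ hp
  rw [curveLift, dif_pos h]
  exact h.choose_spec

/-- Holonomies of small loops, in a gauge. -/
theorem holonomy_eq [T2Space P] (g : B.Gauge) (κ : ControlCutoff EG G) {γ : ℝ → V}
    (hγ : AbsolutelyContinuousOnInterval γ 0 1) (hloop : γ 1 = γ 0)
    (hd : ∀ t ∈ Icc (0 : ℝ) 1, γ t ∈ g.dom)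
    (hs : ∫ s in (0 : ℝ)..1, ‖conn.control g γ s‖ ≤ κ.small) :
    ∃ z : ℝ → EG, Continuous z ∧ (∀ t ∈ Icc (0 : ℝ) 1,
      z t = chartOne G + ∫ s in (0 : ℝ)..t, κ.toFun (z s) (conn.control g γ s)) ∧
      (∀ t ∈ Icc (0 : ℝ) 1,
        ‖z t - chartOne G‖ ≤ κ.bound * ∫ s in (0 : ℝ)..1, ‖conn.control g γ s‖) ∧
      conn.holonomy (g.sec (γ 0)) γ = chartInv G (z 1) := by
  obtain ⟨z, hz, hzt, hzn, hzb, -⟩ := conn.exists_isLiftOn_of_small g κ zero_le_one hγ hd hs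
  refine ⟨z, hz, hzt, hzn, ?_⟩
  have h0 : (0 : ℝ) ∈ Icc (0 : ℝ) 1 := by norm_num
  have h1 : (1 : ℝ) ∈ Icc (0 : ℝ) 1 := by norm_num
  have hspec := conn.curveLift_spec hγ (g.proj_sec _ (hd 0 h0))
  have hz0 : z 0 = chartOne G := by
    rw [hzt 0 h0, intervalIntegral.integral_same, add_zero]
  have heq := hspec.isLiftOn.eq_param g κ zero_le_one hγ hd hz.continuousOn hzt hzb
    (by rw [hspec.source, hz0, g.param_chartOne]) 1 h1
  rw [SmoothPrincipalBundle.Gauge.param_apply, hloop] at heq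
  have hex : ∃ a : G, conn.curveLift γ (g.sec (γ 0)) 1 = MulOpposite.op a • g.sec (γ 0) := ⟨_, heq⟩
  rw [holonomy, dif_pos hex]
  -- The holonomy is a chosen group element; freeness of the action makes it unique.
  exact B.smul_left_injective (hex.choose_spec.symm.trans heq)

variable {𝔫 : StratifiedLieAlgebra V} {n : ℕ} (Z : AdaptedBasis 𝔫 n)

/-- The radial gauge: the local connection form vanishes on the generator of the dilations. -/
theorem exists_radial_gauge {p : P} (hp : B.proj p = 0) : ∃ g : B.Gauge, (0 : V) ∈ g.dom ∧
    g.sec 0 = p ∧ ∀ᶠ x in 𝓝 (0 : V), conn.gaugeForm g x (Z.rayVelocity 1 x) = 0 := by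
  obtain ⟨κ⟩ := nonempty_controlCutoff (EG := EG) (G := G)
  obtain ⟨U₀, hU₀, h0U₀, hgauge⟩ := B.exists_gauge 0
  obtain ⟨g₀, rfl, hg₀⟩ := hgauge p (by rwa [hp])
  rw [hp] at hg₀
  obtain ⟨A, hA, -, hAe⟩ := exists_contDiff_eventuallyEq hU₀ (conn.contDiffOn_gaugeForm g₀) h0U₀
  let u : V → ℝ → EG := fun x s => -(A (Z.dilation s x) (Z.rayVelocity s x))
  have hu : ContDiff ℝ ∞ fun p : V × ℝ => u p.1 p.2 :=
    ((hA.comp (Z.contDiff_dilation.comp (contDiff_snd.prodMk contDiff_fst))).clm_apply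
      (Z.contDiff_rayVelocity.comp (contDiff_snd.prodMk contDiff_fst))).neg
  have hu0 : ∀ s, u 0 s = 0 := fun s => by simp [u, Z.rayVelocity_zero_right]
  -- Parallel transport along the ray through x is an equation with parameter x that is trivial at x
  -- = 0. Treating it this way yields smoothness at the origin too, where the rays degenerate.
  obtain ⟨U, hU, hU0, S, hSc, hS0, hSs, hSsmall, hSeq⟩ := exists_contDiffOn_solution
    (X := V) (t₀ := 0) (a := 0) (b := 1) (by norm_num : (0 : ℝ) ∈ Icc (0 : ℝ) 1)
    (f := fun q : V × ℝ × EG => κ.toFun q.2.2 (u q.1 q.2.1))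
    ((κ.contDiff.comp (contDiff_snd.comp contDiff_snd)).clm_apply
      (hu.comp (contDiff_fst.prodMk (contDiff_fst.comp contDiff_snd))))
    (fun s y => by simp [hu0]) (chartOne G)
  have h1 : (1 : ℝ) ∈ Icc (0 : ℝ) 1 := by norm_num
  -- the new gauge
  let U' : Set V := (U ∩ (fun x => S x 1) ⁻¹' Metric.ball (chartOne G) κ.radius) ∩ g₀.dom
  have hU' : IsOpen U' :=
    ((hSs 1 h1).continuousOn.isOpen_inter_preimage hU Metric.isOpen_ball).inter hU₀
  have h0U' : (0 : V) ∈ U' := ⟨⟨hU0, by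
    rw [mem_preimage, hS0]; exact Metric.mem_ball_self κ.radius_pos⟩, h0U₀⟩
  obtain ⟨g, hgdom, hgsec⟩ : ∃ g : B.Gauge, g.dom = U' ∧ ∀ x, g.sec x = g₀.param (x, S x 1) :=
    ⟨g₀.modify hU' inter_subset_right (fun x => chartInv G (S x 1))
      (contMDiffOn_chartInv.comp ((contMDiffOn_iff_contDiffOn.2 (hSs 1 h1)).mono
        fun x hx => hx.1.1) fun x hx => κ.mem_chartDomain _ hx.1.2)
      (fun x hx => κ.mem_connectedComponent _ hx.1.2), rfl, fun _ => rfl⟩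
  refine ⟨g, hgdom ▸ h0U', ?_, ?_⟩
  · rw [hgsec, hS0, g₀.param_chartOne, hg₀]
  -- solutions are compatible with the dilations
  have hbound : ∀ᶠ x in 𝓝 (0 : V), ∀ r ∈ Icc (0 : ℝ) 1, ∀ s ∈ Icc (0 : ℝ) 1,
      ‖u (Z.dilation r x) s‖ ≤ κ.small := by
    have hc : Continuous fun q : V × ℝ × ℝ => u (Z.dilation q.2.1 q.1) q.2.2 :=
      hu.continuous.comp ((Z.contDiff_dilation.continuous.comp
        ((continuous_fst.comp continuous_snd).prodMk continuous_fst)).prodMk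
        (continuous_snd.comp continuous_snd))
    have h2 := (isCompact_Icc.prod isCompact_Icc : IsCompact (Icc (0 : ℝ) 1 ×ˢ Icc (0 : ℝ) 1))
      |>.eventually_forall_of_forall_eventually (x₀ := (0 : V))
        (P := fun x rs => ‖u (Z.dilation rs.1 x) rs.2‖ < κ.small) (by
        intro rs _
        have h3 : ‖u (Z.dilation rs.1 0) rs.2‖ < κ.small := by
          rw [Z.dilation_zero_right, hu0, norm_zero]; exact κ.small_pos
        exact (hc.norm.tendsto (0, rs)).eventually (gt_mem_nhds h3))
    filter_upwards [h2] with x hx r hr s hs using (hx (r, s) ⟨hr, hs⟩).le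
  have hdil0 : ∀ r, Tendsto (fun x => Z.dilation r x) (𝓝 0) (𝓝 0) := fun r => by
    have h2 := ((Z.contDiff_dilation.continuous).comp
      ((continuous_const (y := r)).prodMk continuous_id)).tendsto (0 : V)
    simpa [Function.comp_def, Z.dilation_zero_right] using h2
  have hdilall : ∀ W ∈ 𝓝 (0 : V), ∀ᶠ x in 𝓝 (0 : V), ∀ r ∈ Icc (0 : ℝ) 1,
      Z.dilation r x ∈ W := by
    intro W hW
    have hc : Continuous fun q : V × ℝ => Z.dilation q.2 q.1 :=
      Z.contDiff_dilation.continuous.comp (continuous_snd.prodMk continuous_fst)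
    exact isCompact_Icc.eventually_forall_of_forall_eventually (x₀ := (0 : V)) (by
      intro r _
      refine (hc.tendsto (0, r)).eventually ?_
      change ∀ᶠ y in 𝓝 (Z.dilation r 0), y ∈ W
      rw [Z.dilation_zero_right]
      exact hW)
  -- Transport to time r along the ray of x is transport to time 1 along the ray of δ_r(x). Hence
  -- the new section, evaluated along a ray, is the transported curve.
  have hscale : ∀ᶠ x in 𝓝 (0 : V), ∀ r ∈ Icc (0 : ℝ) 1, S (Z.dilation r x) 1 = S x r := by
    filter_upwards [hbound, hdilall U (hU.mem_nhds hU0)] with x hx hxU r hr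
    have hxU' : x ∈ U := by
      have := hxU 1 h1
      rwa [Z.dilation_one] at this
    have hui : IntervalIntegrable (u (Z.dilation r x)) volume 0 1 :=
      (hu.continuous.comp (continuous_const.prodMk continuous_id)).intervalIntegrable _ _
    have hsm : κ.lip * ∫ s in (0 : ℝ)..1, ‖u (Z.dilation r x) s‖ < 1 := by
      refine κ.lip_mul_lt ?_
      have h2 := intervalIntegral.integral_mono_on zero_le_one hui.norm
        (intervalIntegrable_const (c := κ.small)) fun s hs => hx r hr s hs
      simpa using h2
    have h2 := control_solution_unique κ.lipschitzWith zero_le_one (left_mem_Icc.2 zero_le_one)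
      hui hsm (c := chartOne G) (z := S (Z.dilation r x)) (w := fun t => S x (t * r))
      (hSc _).continuousOn ((hSc x).comp (continuous_id.mul continuous_const)).continuousOn
      (hSeq _ (hxU r hr)) (fun t ht => by
        have htr : t * r ∈ Icc (0 : ℝ) 1 :=
          ⟨mul_nonneg ht.1 hr.1, mul_le_one₀ ht.2 hr.1 hr.2⟩
        have h3 : ∀ s, κ.toFun (S x (s * r)) (u (Z.dilation r x) s) =
            r • (fun s => κ.toFun (S x s) (u x s)) (s * r) := by
          intro s
          simp only [u, Z.dilation_dilation, Z.rayVelocity_dilation, map_smul, map_neg, smul_neg]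
        have h4 := intervalIntegral.smul_integral_comp_mul_right (a := 0) (b := t)
          (fun s => κ.toFun (S x s) (u x s)) r
        rw [zero_mul] at h4
        simp only [h3]
        rw [intervalIntegral.integral_smul, h4]
        exact hSeq x hxU' _ htr) 1 h1
    simpa using h2
  -- the local connection form along the rays
  have hhalf : ∀ᶠ y in 𝓝 (0 : V),
      conn.gaugeForm g (Z.dilation 2⁻¹ y) (Z.rayVelocity 2⁻¹ y) = 0 := by
    filter_upwards [hscale, hdilall U' (hU'.mem_nhds h0U'), hSsmall κ.radius κ.radius_pos,
      hdilall _ hAe, hU.mem_nhds hU0] with y hy hyU' hyr hyA hyU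
    have hh : (2⁻¹ : ℝ) ∈ Ioo (0 : ℝ) 1 := by norm_num
    have hh' := Ioo_subset_Icc_self hh
    have hxU' := hyU' _ hh'
    have hxg : Z.dilation 2⁻¹ y ∈ g.dom := hgdom ▸ hxU'
    have hSx : S y 2⁻¹ ∈ Metric.ball (chartOne G) κ.radius := by
      rw [Metric.mem_ball, dist_eq_norm]; exact hyr _ hh'
    have hSd := κ.mem_chartDomain _ hSx
    have hcS : Continuous fun s => κ.toFun (S y s) (u y s) :=
      (κ.contDiff.continuous.comp (hSc y)).clm_apply
        (hu.continuous.comp (continuous_const.prodMk continuous_id))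
    have hderiv : HasDerivAt (S y) (κ.toFun (S y 2⁻¹) (u y 2⁻¹)) 2⁻¹ := by
      have h2 := (intervalIntegral.integral_hasDerivAt_right (hcS.intervalIntegrable 0 2⁻¹)
        hcS.stronglyMeasurable.stronglyMeasurableAtFilter hcS.continuousAt).const_add
        (chartOne (EG := EG) G)
      refine h2.congr_of_eventuallyEq ?_
      filter_upwards [Ioo_mem_nhds hh.1 hh.2] with s hs using hSeq y hyU s (Ioo_subset_Icc_self hs)
    let D : V × EG →L[ℝ] EP := mfderiv 𝓘(ℝ, V × EG) 𝓘(ℝ, EP) g₀.param ((Z.dilation 2⁻¹ y), S y 2⁻¹)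
    have hD : HasMFDerivAt 𝓘(ℝ, V × EG) 𝓘(ℝ, EP) g₀.param ((Z.dilation 2⁻¹ y), S y 2⁻¹) D :=
      ((g₀.contMDiffAt_param hxU'.2 hSd).mdifferentiableAt (by simp)).hasMFDerivAt
    have hc : HasDerivAt (fun s => (Z.dilation s y, S y s))
        (Z.rayVelocity 2⁻¹ y, κ.toFun (S y 2⁻¹) (u y 2⁻¹)) 2⁻¹ :=
      (Z.hasDerivAt_dilation _ y).prodMk hderiv
    have e1 := HasMFDerivAt.comp (g := g₀.param) (2⁻¹ : ℝ) hD hc.hasFDerivAt.hasMFDerivAt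
    let T : V →L[ℝ] EP := mfderiv 𝓘(ℝ, V) 𝓘(ℝ, EP) g.sec (Z.dilation 2⁻¹ y)
    have hT : HasMFDerivAt 𝓘(ℝ, V) 𝓘(ℝ, EP) g.sec (Z.dilation 2⁻¹ y) T :=
      ((g.contMDiffOn_sec.contMDiffAt (g.isOpen_dom.mem_nhds hxg)).mdifferentiableAt
        (by simp)).hasMFDerivAt
    have e2 := HasMFDerivAt.comp (g := g.sec) (2⁻¹ : ℝ) hT
      (Z.hasDerivAt_dilation 2⁻¹ y).hasFDerivAt.hasMFDerivAt
    have e3 := e2.congr_of_eventuallyEq (f₁ := g₀.param ∘ fun s => (Z.dilation s y, S y s)) (by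
      filter_upwards [Ioo_mem_nhds hh.1 hh.2] with s hs
      simp only [Function.comp_apply, hgsec, hy s (Ioo_subset_Icc_self hs)])
    have e4 : T (Z.rayVelocity 2⁻¹ y) = D (Z.rayVelocity 2⁻¹ y, κ.toFun (S y 2⁻¹) (u y 2⁻¹)) := by
      have e5 : T ((1 : ℝ) • Z.rayVelocity 2⁻¹ y) =
          D ((1 : ℝ) • (Z.rayVelocity 2⁻¹ y, κ.toFun (S y 2⁻¹) (u y 2⁻¹))) :=
        congrArg (fun A : ℝ →L[ℝ] EP => A 1) (hasMFDerivAt_unique e3 e1)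
      rwa [one_smul, one_smul] at e5
    have e6 : conn.gaugeForm g (Z.dilation 2⁻¹ y) (Z.rayVelocity 2⁻¹ y) =
        conn.formAt (g₀.param ((Z.dilation 2⁻¹ y), S y 2⁻¹)) (T (Z.rayVelocity 2⁻¹ y)) := by
      rw [← hy _ hh', ← hgsec]
      rfl
    rw [e6, e4]
    have e7 := conn.pullback_param g₀ hxU'.2 hSd (Z.rayVelocity 2⁻¹ y) (u y 2⁻¹)
    have e8 : conn.gaugeForm g₀ (Z.dilation 2⁻¹ y) (Z.rayVelocity 2⁻¹ y) + u y 2⁻¹ = 0 := by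
      have e9 : A (Z.dilation 2⁻¹ y) = conn.gaugeForm g₀ (Z.dilation 2⁻¹ y) := hyA _ hh'
      rw [← e9]
      exact add_neg_cancel _
    rw [e8, map_zero, ← κ.eq_chartRight _ hSx] at e7
    exact e7
  filter_upwards [(hdil0 2).eventually hhalf] with x hx
  rw [Z.dilation_dilation, Z.rayVelocity_dilation] at hx
  norm_num at hx
  rwa [Z.dilation_one] at hx

/-- In the radial gauge, the section is horizontal along the rays. -/
theorem curveLift_ray [T2Space P] {g : B.Gauge} (h0 : (0 : V) ∈ g.dom)
    (hrad : ∀ᶠ x in 𝓝 (0 : V), conn.gaugeForm g x (Z.rayVelocity 1 x) = 0) (x : V) :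
    ∀ᶠ s in 𝓝[≥] (0 : ℝ),
      conn.curveLift (fun s => Z.dilation s x) (g.sec 0) s = g.sec (Z.dilation s x) := by
  obtain ⟨κ⟩ := nonempty_controlCutoff (EG := EG) (G := G)
  have hray : ContDiff ℝ ∞ fun s => Z.dilation s x :=
    Z.contDiff_dilation.comp (contDiff_id.prodMk contDiff_const)
  have h2 : Tendsto (fun s => Z.dilation s x) (𝓝 0) (𝓝 0) := by
    have := hray.continuous.tendsto 0
    rwa [Z.dilation_zero_left] at this
  obtain ⟨ε, hε, hball⟩ := Metric.eventually_nhds_iff.1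
    (h2.eventually (hrad.and (g.isOpen_dom.mem_nhds h0)))
  have hb0 : 0 < min (ε / 2) 1 := lt_min (by positivity) one_pos
  set b := min (ε / 2) 1 with hb
  have hbI : ∀ s ∈ Icc 0 b, conn.gaugeForm g (Z.dilation s x)
      (Z.rayVelocity 1 (Z.dilation s x)) = 0 ∧ Z.dilation s x ∈ g.dom := fun s hs => by
    refine hball ?_
    rw [Real.dist_eq, sub_zero, abs_of_nonneg hs.1]
    have := hs.2.trans (min_le_left _ _)
    linarith
  have hspec := conn.curveLift_spec (Z.absolutelyContinuous_ray x 0 1)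
    (p := g.sec 0) (by rw [g.proj_sec 0 h0, Z.dilation_zero_left])
  -- For s > 0 the ray velocity is a multiple of E at δ_s(x), where A vanishes. The control is
  -- therefore zero almost everywhere and the constant fibre coordinate solves the system.
  have hcontrol : ∀ s ∈ Ioc 0 b, conn.control g (fun s => Z.dilation s x) s = 0 := by
    intro s hs
    have h3 := (hbI s ⟨hs.1.le, hs.2⟩).1
    rw [Z.rayVelocity_dilation, one_mul, map_smul, smul_eq_zero_iff_right hs.1.ne'] at h3
    rw [control, (Z.hasDerivAt_dilation s x).deriv, h3, neg_zero]
  have h4 := (hspec.isLiftOn.mono le_rfl (min_le_right (ε / 2) 1)).eq_param g κ hb0.le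
    (Z.absolutelyContinuous_ray x 0 b) (fun t ht => (hbI t ht).2)
    (z := fun _ => chartOne G) continuousOn_const (c := chartOne G) (fun t ht => by
      have h5 : ∫ s in (0 : ℝ)..t, κ.toFun (chartOne G)
          (conn.control g (fun s => Z.dilation s x) s) = ∫ s in (0 : ℝ)..t, (0 : EG) := by
        refine intervalIntegral.integral_congr_ae (Eventually.of_forall fun s hs => ?_)
        rw [uIoc_of_le ht.1] at hs
        rw [hcontrol s ⟨hs.1, hs.2.trans ht.2⟩, map_zero]
      rw [h5, intervalIntegral.integral_zero, add_zero])
    (fun t ht => Metric.mem_ball_self κ.radius_pos)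
    (by rw [hspec.source, g.param_chartOne, Z.dilation_zero_left])
  filter_upwards [Icc_mem_nhdsGE hb0] with s hs
  rw [h4 s hs, g.param_chartOne]

end PrincipalConnection

end RadialGauge

/-! ### Covariant derivatives in a gauge -/

section CovariantDerivative

open Filter Topology

variable {V : Type*} [NormedAddCommGroup V] [InnerProductSpace ℝ V] [FiniteDimensional ℝ V]
  {EG : Type*} [NormedAddCommGroup EG] [NormedSpace ℝ EG] [FiniteDimensional ℝ EG]
  {G : Type*} [TopologicalSpace G] [ChartedSpace EG G] [Group G] [LieGroup 𝓘(ℝ, EG) ∞ G]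
  {EP : Type*} [NormedAddCommGroup EP] [NormedSpace ℝ EP] [FiniteDimensional ℝ EP]
  {P : Type*} [TopologicalSpace P] [ChartedSpace EP P] [MulAction Gᵐᵒᵖ P]

namespace SmoothPrincipalBundle.Gauge

variable {B : SmoothPrincipalBundle V (EG := EG) G (EP := EP) P} (g : B.Gauge) {x : V}

/-- The coordinates on the total space given by a gauge, near its section. -/
noncomputable def coord (q : P) : V × EG := (B.proj q, chartCoord (g.toGroup q))

theorem coord_sec (hx : x ∈ g.dom) : g.coord (g.sec x) = (x, chartOne G) := by
  rw [coord, g.proj_sec x hx, g.toGroup_sec x hx, chartCoord_one]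

theorem contMDiffAt_coord (hx : x ∈ g.dom) :
    ContMDiffAt 𝓘(ℝ, EP) 𝓘(ℝ, V × EG) ∞ g.coord (g.sec x) := by
  have h1 : B.proj (g.sec x) ∈ g.dom := by rw [g.proj_sec x hx]; exact hx
  have h2 : ContMDiffAt 𝓘(ℝ, EP) 𝓘(ℝ, EG) ∞ g.toGroup (g.sec x) :=
    g.contMDiffOn_toGroup.contMDiffAt
      ((g.isOpen_dom.preimage B.contMDiff_proj.continuous).mem_nhds h1)
  have h3 : ContMDiffAt 𝓘(ℝ, EG) 𝓘(ℝ, EG) ∞ (chartCoord (G := G) (EG := EG))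
      (g.toGroup (g.sec x)) := contMDiffAt_chartCoord (by
    rw [g.toGroup_sec x hx]; exact mem_extChartAt_source _)
  exact B.contMDiff_proj.contMDiffAt.prodMk_space (ContMDiffAt.comp (g.sec x) h3 h2)

theorem eventually_param_coord (hx : x ∈ g.dom) : ∀ᶠ q in 𝓝 (g.sec x),
    g.param (g.coord q) = q ∧ chartInv G (g.coord q).2 ∈ connectedComponent (1 : G) ∧
      B.proj q ∈ g.dom := by
  obtain ⟨r, hr, -, hball⟩ := exists_ball_chartInv_mem_connectedComponent (G := G) (EG := EG)
  have h1 : B.proj (g.sec x) ∈ g.dom := by rw [g.proj_sec x hx]; exact hx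
  have h2 : ContinuousAt g.toGroup (g.sec x) := (g.contMDiffOn_toGroup.contMDiffAt
    ((g.isOpen_dom.preimage B.contMDiff_proj.continuous).mem_nhds h1)).continuousAt
  have h3 : (extChartAt 𝓘(ℝ, EG) (1 : G)).source ∈ 𝓝 (g.toGroup (g.sec x)) := by
    rw [g.toGroup_sec x hx]; exact extChartAt_source_mem_nhds _
  have h4 : Tendsto (fun q => (g.coord q).2) (𝓝 (g.sec x)) (𝓝 (chartOne G)) := by
    have := (continuous_snd.continuousAt.comp (g.contMDiffAt_coord hx).continuousAt).tendsto
    rwa [Function.comp_apply, g.coord_sec hx] at this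
  filter_upwards [(g.isOpen_dom.preimage B.contMDiff_proj.continuous).mem_nhds h1,
    h2.preimage_mem_nhds h3, h4.eventually (Metric.ball_mem_nhds _ hr)] with q e1 e2 e3
  have e4 := hball _ e3
  have e5 : chartInv G (g.coord q).2 = g.toGroup q := chartInv_chartCoord e2
  refine ⟨?_, e4, e1⟩
  rw [e5] at e4
  exact ((congrArg (fun a => MulOpposite.op a • g.sec (B.proj q)) e5).trans
    (g.eq_smul_sec q e1 e4).symm)

theorem eventually_coord_param (hx : x ∈ g.dom) : ∀ᶠ y in 𝓝 (x, (chartOne G : EG)),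
    g.coord (g.param y) = y := by
  obtain ⟨r, hr, hsub, hball⟩ := exists_ball_chartInv_mem_connectedComponent (G := G) (EG := EG)
  filter_upwards [(g.isOpen_dom.prod Metric.isOpen_ball).mem_nhds
    (⟨hx, Metric.mem_ball_self hr⟩ : (x, (chartOne G : EG)) ∈ g.dom ×ˢ Metric.ball _ r)]
    with ⟨y, z⟩ ⟨hy, hz⟩
  have h1 := hball _ hz
  have h2 := g.proj_sec y hy
  rw [coord, param_apply, B.proj_smul h1, h2, g.toGroup_smul _ (by rw [h2]; exact hy) _ h1,
    g.toGroup_sec y hy, one_mul, chartCoord_chartInv (hsub hz)]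

/-- The frames given by a gauge and its coordinates are inverse to each other. -/
theorem exists_frame (hx : x ∈ g.dom) : ∃ (D : V × EG →L[ℝ] EP) (E : EP →L[ℝ] V × EG),
    HasMFDerivAt 𝓘(ℝ, V × EG) 𝓘(ℝ, EP) g.param (x, chartOne G) D ∧
    HasMFDerivAt 𝓘(ℝ, EP) 𝓘(ℝ, V × EG) g.coord (g.sec x) E ∧
    HasMFDerivAt 𝓘(ℝ, EP) 𝓘(ℝ, V) B.proj (g.sec x)
      ((ContinuousLinearMap.fst ℝ V EG).comp E : EP →L[ℝ] V) ∧
    (∀ w, D (E w) = w) ∧ ∀ y, E (D y) = y := by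
  let D : V × EG →L[ℝ] EP := mfderiv 𝓘(ℝ, V × EG) 𝓘(ℝ, EP) g.param (x, chartOne G)
  have hD : HasMFDerivAt 𝓘(ℝ, V × EG) 𝓘(ℝ, EP) g.param (x, chartOne G) D :=
    ((g.contMDiffAt_param hx chartOne_mem).mdifferentiableAt (by simp)).hasMFDerivAt
  let E : EP →L[ℝ] V × EG := mfderiv 𝓘(ℝ, EP) 𝓘(ℝ, V × EG) g.coord (g.sec x)
  have hE : HasMFDerivAt 𝓘(ℝ, EP) 𝓘(ℝ, V × EG) g.coord (g.sec x) E :=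
    ((g.contMDiffAt_coord hx).mdifferentiableAt (by simp)).hasMFDerivAt
  refine ⟨D, E, hD, hE, HasMFDerivAt.comp (g := Prod.fst) (g.sec x)
    (ContinuousLinearMap.fst ℝ V EG).hasFDerivAt.hasMFDerivAt hE, fun w => ?_, fun y => ?_⟩
  · have hD' : HasMFDerivAt 𝓘(ℝ, V × EG) 𝓘(ℝ, EP) g.param (g.coord (g.sec x)) D := by
      rw [g.coord_sec hx]; exact hD
    have h1 := HasMFDerivAt.comp (g := g.param) (g.sec x) hD' hE
    have h2 := h1.congr_of_eventuallyEq (f₁ := id) (by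
      filter_upwards [g.eventually_param_coord hx] with q hq using hq.1.symm)
    exact congrArg (fun A : EP →L[ℝ] EP => A w) (hasMFDerivAt_unique h2 (hasMFDerivAt_id _))
  · have hE' : HasMFDerivAt 𝓘(ℝ, EP) 𝓘(ℝ, V × EG) g.coord (g.param (x, chartOne G)) E := by
      rw [g.param_chartOne]; exact hE
    have h1 := HasMFDerivAt.comp (f := g.param) ((x, chartOne G) : V × EG) hE' hD
    have h2 := h1.congr_of_eventuallyEq (f₁ := id) (by
      filter_upwards [g.eventually_coord_param hx] with q hq using hq.symm)
    exact congrArg (fun A : V × EG →L[ℝ] V × EG => A y)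
      (hasMFDerivAt_unique h2 (hasMFDerivAt_id _))

end SmoothPrincipalBundle.Gauge

namespace PrincipalConnection

variable [IsManifold 𝓘(ℝ, EP) ∞ P] {B : SmoothPrincipalBundle V (EG := EG) G (EP := EP) P}
  (conn : PrincipalConnection B)

theorem formAt_frame (g : B.Gauge) {x : V} (hx : x ∈ g.dom) {D : V × EG →L[ℝ] EP}
    (hD : HasMFDerivAt 𝓘(ℝ, V × EG) 𝓘(ℝ, EP) g.param (x, chartOne G) D) (v : V) (ζ : EG) :
    conn.formAt (g.sec x) (D (v, ζ)) = conn.gaugeForm g x v + ζ := by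
  have h := conn.pullback_param g hx chartOne_mem v ζ
  rw [chartRight_one, chartAd_one, conn.pullback_eq hD, g.param_chartOne] at h
  exact h

/-- The horizontal lift of a vector, with `T_q P` identified with the model space. -/
noncomputable def liftAt (q : P) (v : V) : EP := conn.vectorLift q v

/-- In the frame of a gauge a horizontal vector is determined by its projection, so the choice in
`vectorLift` is harmless. -/
theorem liftAt_eq {q : P} {T : EP →L[ℝ] V} (hT : HasMFDerivAt 𝓘(ℝ, EP) 𝓘(ℝ, V) B.proj q T)
    {u : EP} (hu : conn.formAt q u = 0) : conn.liftAt q (T u) = u := by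
  obtain ⟨U, -, hU, hg⟩ := B.exists_gauge (B.proj q)
  obtain ⟨g, rfl, hq⟩ := hg q hU
  obtain ⟨D, E, hD, -, hT', hDE, -⟩ := g.exists_frame hU
  rw [hq] at hT'
  have huniq : ∀ w : EP, conn.formAt q w = 0 →
      w = D (T w, -(conn.gaugeForm g (B.proj q) (T w))) := by
    intro w hw
    have h1 : T w = (E w).1 := congrArg (fun A : EP →L[ℝ] V => A w) (hasMFDerivAt_unique hT hT')
    have h2 := conn.formAt_frame g hU hD (E w).1 (E w).2
    rw [hq, Prod.mk.eta, hDE, hw] at h2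
    rw [h1, ← eq_neg_of_add_eq_zero_right h2.symm, Prod.mk.eta, hDE]
  have hex : ∃ w : TangentSpace 𝓘(ℝ, EP) q,
      mfderiv 𝓘(ℝ, EP) 𝓘(ℝ, V) B.proj q w = T u ∧ conn.form q w = 0 :=
    ⟨u, by rw [hT.mfderiv]; rfl, hu⟩
  have h3 : conn.liftAt q (T u) = hex.choose := by rw [liftAt, vectorLift, dif_pos hex]
  have h4 := hex.choose_spec
  have h5 := huniq hex.choose h4.2
  have h6 : T hex.choose = T u :=
    (congrArg (fun A : EP →L[ℝ] V => A hex.choose) hT.mfderiv).symm.trans h4.1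
  rw [h6] at h5
  exact h3.trans (h5.trans (huniq u hu).symm)

theorem liftAt_sec (g : B.Gauge) {x : V} (hx : x ∈ g.dom) {D : V × EG →L[ℝ] EP}
    (hD : HasMFDerivAt 𝓘(ℝ, V × EG) 𝓘(ℝ, EP) g.param (x, chartOne G) D) (v : V) :
    conn.liftAt (g.sec x) v = D (v, -(conn.gaugeForm g x v)) := by
  obtain ⟨D', E, hD', -, hT, -, hED⟩ := g.exists_frame hx
  obtain rfl : D' = D := hasMFDerivAt_unique hD' hD
  have h := conn.liftAt_eq hT (u := D' (v, -(conn.gaugeForm g x v)))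
    (by rw [conn.formAt_frame g hx hD, add_neg_cancel])
  rwa [ContinuousLinearMap.comp_apply, hED] at h

theorem liftAt_spec (q : P) : ∃ T : EP →L[ℝ] V, HasMFDerivAt 𝓘(ℝ, EP) 𝓘(ℝ, V) B.proj q T ∧
    ∀ v, T (conn.liftAt q v) = v ∧ conn.formAt q (conn.liftAt q v) = 0 := by
  obtain ⟨U, -, hU, hg⟩ := B.exists_gauge (B.proj q)
  obtain ⟨g, rfl, hq⟩ := hg q hU
  obtain ⟨D, E, hD, -, hT, -, hED⟩ := g.exists_frame hU
  have h1 := fun v => conn.liftAt_sec g hU hD v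
  have h2 := fun v => conn.formAt_frame g hU hD v (-(conn.gaugeForm g (B.proj q) v))
  rw [hq] at hT h1 h2
  refine ⟨_, hT, fun v => ⟨?_, ?_⟩⟩
  · rw [h1, ContinuousLinearMap.comp_apply, hED, ContinuousLinearMap.coe_fst']
  · rw [h1, h2, add_neg_cancel]

theorem liftAt_smul {a : G} (ha : a ∈ connectedComponent (1 : G)) {q : P} {R : EP →L[ℝ] EP}
    (hR : HasMFDerivAt 𝓘(ℝ, EP) 𝓘(ℝ, EP) (fun q : P => MulOpposite.op a • q) q R) (v : V) :
    conn.liftAt (MulOpposite.op a • q) v = R (conn.liftAt q v) := by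
  obtain ⟨T, hT, hTv⟩ := conn.liftAt_spec q
  obtain ⟨T', hT', -⟩ := conn.liftAt_spec (MulOpposite.op a • q)
  have h1 := HasMFDerivAt.comp (g := B.proj) q hT' hR
  have h2 := h1.congr_of_eventuallyEq (f₁ := B.proj)
    (Eventually.of_forall fun q => (B.proj_smul ha q).symm)
  have h3 : T' (R (conn.liftAt q v)) = v := by
    have h4 : T (conn.liftAt q v) = T' (R (conn.liftAt q v)) :=
      congrArg (fun A : EP →L[ℝ] V => A (conn.liftAt q v)) (hasMFDerivAt_unique hT h2)
    rw [← h4, (hTv v).1]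
  have h5 := conn.liftAt_eq hT' (u := R (conn.liftAt q v))
    (by rw [conn.formAt_smul hR, (hTv v).2, map_zero])
  rwa [h3] at h5

/-- Smooth functions `P → 𝔤` that are equivariant under the identity component. -/
structure IsEquivariantField (B : SmoothPrincipalBundle V (EG := EG) G (EP := EP) P)
    (f : P → EG) : Prop where
  smul : ∀ q : P, ∀ a ∈ connectedComponent (1 : G),
    f (MulOpposite.op a • q) = lieAd a⁻¹ (f q)
  contDiffOn : ∀ g : B.Gauge, ContDiffOn ℝ ∞ (fun x => f (g.sec x)) g.dom

variable (EG G) in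
/-- The derivative at the identity of `z ↦ Ad(χ(z))⁻¹`. -/
noncomputable def adDeriv : EG →L[ℝ] EG →L[ℝ] EG := fderiv ℝ (chartAd G) (chartOne G)

theorem hasFDerivAt_chartAd : HasFDerivAt (chartAd G) (adDeriv EG G) (chartOne G : EG) :=
  ((exists_contDiffAt_chartAd chartOne_mem).differentiableAt (by simp)).hasFDerivAt

/-- Near the section, f(σ(x)χ(z)) = Ad(χ(z)⁻¹) f(σ(x)) by equivariance; this is the product rule for
that expression. -/
theorem IsEquivariantField.hasMFDerivAt {f : P → EG} (hf : IsEquivariantField B f) (g : B.Gauge)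
    {x : V} (hx : x ∈ g.dom) {E : EP →L[ℝ] V × EG}
    (hE : HasMFDerivAt 𝓘(ℝ, EP) 𝓘(ℝ, V × EG) g.coord (g.sec x) E) :
    ∃ L : EP →L[ℝ] EG, HasMFDerivAt 𝓘(ℝ, EP) 𝓘(ℝ, EG) f (g.sec x) L ∧
      ∀ w, L w = fderiv ℝ (fun x => f (g.sec x)) x (E w).1 + adDeriv EG G (E w).2 (f (g.sec x)) := by
  have h1 : HasFDerivAt (fun y : V × EG => f (g.sec y.1))
      ((fderiv ℝ (fun x => f (g.sec x)) x).comp (ContinuousLinearMap.fst ℝ V EG))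
      (x, chartOne G) := by
    have h2 : HasFDerivAt (fun x => f (g.sec x)) (fderiv ℝ (fun x => f (g.sec x)) x) x :=
      (((hf.contDiffOn g).contDiffAt (g.isOpen_dom.mem_nhds hx)).differentiableAt
        (by simp)).hasFDerivAt
    exact HasFDerivAt.comp (g := fun x => f (g.sec x)) (x, (chartOne G : EG)) h2 hasFDerivAt_fst
  have h3 : HasFDerivAt (fun y : V × EG => chartAd G y.2)
      ((adDeriv EG G).comp (ContinuousLinearMap.snd ℝ V EG)) (x, chartOne G) :=
    HasFDerivAt.comp (g := chartAd G) (x, (chartOne G : EG)) hasFDerivAt_chartAd hasFDerivAt_snd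
  have h4 := (h3.clm_apply h1).hasMFDerivAt
  rw [← g.coord_sec hx] at h4
  have h5 := (HasMFDerivAt.comp (g.sec x) h4 hE).congr_of_eventuallyEq (f₁ := f) (by
    filter_upwards [g.eventually_param_coord hx] with q hq
    have e1 := hf.smul (g.sec (g.coord q).1) _ hq.2.1
    exact (congrArg f hq.1).symm.trans e1)
  refine ⟨_, h5, fun w => ?_⟩
  have e2 : (g.coord (g.sec x)).2 = chartOne G := by rw [g.coord_sec hx]
  have e3 : (g.coord (g.sec x)).1 = x := by rw [g.coord_sec hx]
  change chartAd G (g.coord (g.sec x)).2 (fderiv ℝ (fun x => f (g.sec x)) x (E w).1) +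
    adDeriv EG G (E w).2 (f (g.sec (g.coord (g.sec x)).1)) = _
  rw [e2, e3, chartAd_one, ContinuousLinearMap.id_apply]

/-- The horizontal lift of v has gauge coordinates (v, -A(v)). -/
theorem IsEquivariantField.covDeriv_sec {f : P → EG} (hf : IsEquivariantField B f) (g : B.Gauge)
    {x : V} (hx : x ∈ g.dom) (v : V) : conn.covDeriv v f (g.sec x) =
      fderiv ℝ (fun x => f (g.sec x)) x v - adDeriv EG G (conn.gaugeForm g x v) (f (g.sec x)) := by
  obtain ⟨D, E, hD, hE, -, -, hED⟩ := g.exists_frame hx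
  obtain ⟨L, hL, hLw⟩ := hf.hasMFDerivAt g hx hE
  have h1 : conn.covDeriv v f (g.sec x) = L (conn.liftAt (g.sec x) v) := by
    rw [covDeriv, hL.mfderiv]; rfl
  rw [h1, conn.liftAt_sec g hx hD, hLw, hED, map_neg, neg_apply, sub_eq_add_neg]

theorem IsEquivariantField.exists_hasMFDerivAt {f : P → EG} (hf : IsEquivariantField B f) (q : P) :
    ∃ L : EP →L[ℝ] EG, HasMFDerivAt 𝓘(ℝ, EP) 𝓘(ℝ, EG) f q L := by
  obtain ⟨U, -, hU, hg⟩ := B.exists_gauge (B.proj q)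
  obtain ⟨g, rfl, hq⟩ := hg q hU
  obtain ⟨D, E, hD, hE, -, -, -⟩ := g.exists_frame hU
  obtain ⟨L, hL, -⟩ := hf.hasMFDerivAt g hU hE
  rw [hq] at hL
  exact ⟨L, hL⟩

/-- Horizontal lifts are invariant under the action, so the class is stable under covariant
differentiation, which can therefore be iterated. -/
theorem IsEquivariantField.covDeriv {f : P → EG} (hf : IsEquivariantField B f) (v : V) :
    IsEquivariantField B (conn.covDeriv v f) where
  smul q a ha := by
    obtain ⟨L, hL⟩ := hf.exists_hasMFDerivAt q
    obtain ⟨L', hL'⟩ := hf.exists_hasMFDerivAt (MulOpposite.op a • q)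
    let R : EP →L[ℝ] EP := mfderiv 𝓘(ℝ, EP) 𝓘(ℝ, EP) (fun q : P => MulOpposite.op a • q) q
    have hR : HasMFDerivAt 𝓘(ℝ, EP) 𝓘(ℝ, EP) (fun q : P => MulOpposite.op a • q) q R :=
      ((B.contMDiff_smul_left a).contMDiffAt.mdifferentiableAt (by simp)).hasMFDerivAt
    have h1 := HasMFDerivAt.comp (g := f) q hL' hR
    have h2 := HasMFDerivAt.comp (g := lieAd a⁻¹) q
      (lieAd (EG := EG) a⁻¹).hasFDerivAt.hasMFDerivAt hL
    have h3 := h1.congr_of_eventuallyEq (f₁ := lieAd a⁻¹ ∘ f)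
      (Eventually.of_forall fun q => (hf.smul q a ha).symm)
    have h4 : lieAd a⁻¹ (L (conn.liftAt q v)) = L' (R (conn.liftAt q v)) :=
      congrArg (fun A : EP →L[ℝ] EG => A (conn.liftAt q v)) (hasMFDerivAt_unique h2 h3)
    have h5 : conn.covDeriv v f q = L (conn.liftAt q v) := by
      rw [PrincipalConnection.covDeriv, hL.mfderiv]; rfl
    have h6 : conn.covDeriv v f (MulOpposite.op a • q) =
        L' (conn.liftAt (MulOpposite.op a • q) v) := by
      rw [PrincipalConnection.covDeriv, hL'.mfderiv]; rfl
    rw [h5, h6, conn.liftAt_smul ha hR, h4]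
  contDiffOn g := by
    refine ContDiffOn.congr ?_ fun x hx => hf.covDeriv_sec conn g hx v
    refine ContDiffOn.sub ?_ (ContDiffOn.clm_apply
      ((adDeriv EG G).contDiff.comp_contDiffOn ((conn.contDiffOn_gaugeForm g).clm_apply
        contDiffOn_const)) (hf.contDiffOn g))
    exact ((hf.contDiffOn g).fderiv_of_isOpen g.isOpen_dom (by simp)).clm_apply contDiffOn_const

end PrincipalConnection

end CovariantDerivative

/-! ### The curvature in a gauge -/

section Curvature

open Filter Topology

section ExteriorDerivative

variable {E F : Type*} [NormedAddCommGroup E] [NormedSpace ℝ E] [FiniteDimensional ℝ E]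
  [NormedAddCommGroup F] [NormedSpace ℝ F] [FiniteDimensional ℝ F]

theorem DifferentiableAt.alternatingMap_ofSubsingleton {α : E → E →L[ℝ] F} {x : E}
    (h : DifferentiableAt ℝ α x) :
    DifferentiableAt ℝ (fun y => ContinuousAlternatingMap.ofSubsingleton ℝ E F (0 : Fin 1) (α y)) x := by
  let L : (E →L[ℝ] F) →ₗ[ℝ] (E [⋀^Fin 1]→L[ℝ] F) :=
    { toFun := fun f => ContinuousAlternatingMap.ofSubsingleton ℝ E F (0 : Fin 1) f
      map_add' := fun f g => by ext; rfl
      map_smul' := fun c f => by ext; rfl }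
  exact (LinearMap.toContinuousLinearMap L).differentiableAt.comp x h

/-- The exterior derivative of a one-form. -/
theorem extDeriv_ofSubsingleton {α : E → E →L[ℝ] F} {x : E} (h : DifferentiableAt ℝ α x)
    (u v : E) :
    extDeriv (fun y => ContinuousAlternatingMap.ofSubsingleton ℝ E F (0 : Fin 1) (α y)) x ![u, v] =
      fderiv ℝ α x u v - fderiv ℝ α x v u := by
  have h1 : ∀ w w' : E, fderiv ℝ (fun y => α y w) x w' = fderiv ℝ α x w' w := fun w w' => by
    rw [(h.hasFDerivAt.clm_apply (hasFDerivAt_const w x)).fderiv]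
    simp
  rw [extDeriv_apply h.alternatingMap_ofSubsingleton, Fin.sum_univ_two, ← h1, ← h1]
  simp [Fin.removeNth, sub_eq_add_neg]

end ExteriorDerivative

variable {V : Type*} [NormedAddCommGroup V] [InnerProductSpace ℝ V] [FiniteDimensional ℝ V]
  {EG : Type*} [NormedAddCommGroup EG] [NormedSpace ℝ EG] [FiniteDimensional ℝ EG]
  {G : Type*} [TopologicalSpace G] [ChartedSpace EG G] [Group G] [LieGroup 𝓘(ℝ, EG) ∞ G]
  {EP : Type*} [NormedAddCommGroup EP] [NormedSpace ℝ EP] [FiniteDimensional ℝ EP]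
  {P : Type*} [TopologicalSpace P] [ChartedSpace EP P] [MulAction Gᵐᵒᵖ P]

/-- The curvature coefficients are evaluated on horizontal vectors only, where ω vanishes, so this
is the only value of the bracket that matters. -/
theorem lieBr_zero : lieBr G (0 : EG) 0 = 0 := by
  have h : VectorField.mlieBracket 𝓘(ℝ, EG)
      (mulInvariantVectorField (0 : GroupLieAlgebra 𝓘(ℝ, EG) G))
      (mulInvariantVectorField (0 : GroupLieAlgebra 𝓘(ℝ, EG) G)) (1 : G) = 0 := by
    rw [VectorField.mlieBracket_self]; rfl
  exact h

namespace PrincipalConnection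

variable [IsManifold 𝓘(ℝ, EP) ∞ P] {B : SmoothPrincipalBundle V (EG := EG) G (EP := EP) P}
  (conn : PrincipalConnection B)

/-- The curvature at `q`, with `T_q P` identified with the model space. -/
noncomputable def curvAt (q : P) (u v : EP) : EG := conn.curvature q u v

/-- On horizontal vectors, the pullback of the curvature is the exterior derivative of the pullback
of the connection form. -/
theorem curvAt_pullback {E : Type*} [NormedAddCommGroup E] [NormedSpace ℝ E]
    [FiniteDimensional ℝ E] {f : E → P} {U : Set E} (hU : IsOpen U)
    (hf : ContMDiffOn 𝓘(ℝ, E) 𝓘(ℝ, EP) ∞ f U) {y : E} (hy : y ∈ U) {D : E →L[ℝ] EP}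
    (hD : HasMFDerivAt 𝓘(ℝ, E) 𝓘(ℝ, EP) f y D) {u v : E}
    (hu : conn.formAt (f y) (D u) = 0) (hv : conn.formAt (f y) (D v) = 0) :
    conn.curvAt (f y) (D u) (D v) =
      fderiv ℝ (conn.pullback f) y u v - fderiv ℝ (conn.pullback f) y v u := by
  set q := f y with hq
  let ψ := extChartAt 𝓘(ℝ, EP) q
  let F : E → EP := fun z => ψ (f z)
  have hW : IsOpen (U ∩ f ⁻¹' ψ.source) :=
    hf.continuousOn.isOpen_inter_preimage hU (isOpen_extChartAt_source q)
  have hyW : y ∈ U ∩ f ⁻¹' ψ.source := ⟨hy, mem_extChartAt_source q⟩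
  have hψ : ContMDiffOn 𝓘(ℝ, EP) 𝓘(ℝ, EP) ∞ ψ ψ.source := by
    have := contMDiffOn_extChartAt (I := 𝓘(ℝ, EP)) (n := ∞) (x := q)
    rwa [← extChartAt_source 𝓘(ℝ, EP) q] at this
  have hψ' : ContMDiffOn 𝓘(ℝ, EP) 𝓘(ℝ, EP) ∞ ψ.symm ψ.target := contMDiffOn_extChartAt_symm q
  have hF : ContDiffOn ℝ ∞ F (U ∩ f ⁻¹' ψ.source) := by
    rw [← contMDiffOn_iff_contDiffOn]
    exact hψ.comp (hf.mono inter_subset_left) fun z hz => hz.2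
  have hΘ : ContDiffOn ℝ ∞ (conn.formInChart q) ψ.target :=
    conn.contDiffOn_pullback (isOpen_extChartAt_target q) hψ'
  have hΘd : DifferentiableAt ℝ (conn.formInChart q) (F y) :=
    (hΘ.contDiffAt ((isOpen_extChartAt_target q).mem_nhds (mem_extChartAt_target q))).differentiableAt
      (by simp)
  have hpull : ∀ z ∈ U ∩ f ⁻¹' ψ.source,
      conn.pullback f z = (conn.formInChart q (F z)).comp (fderiv ℝ F z) := by
    intro z hz
    have hFz : F z ∈ ψ.target := ψ.map_source hz.2
    have hinv : ψ.symm (F z) = f z := ψ.left_inv hz.2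
    let S : EP →L[ℝ] EP := mfderiv 𝓘(ℝ, EP) 𝓘(ℝ, EP) ψ.symm (F z)
    have hS : HasMFDerivAt 𝓘(ℝ, EP) 𝓘(ℝ, EP) ψ.symm (F z) S :=
      ((hψ'.contMDiffAt ((isOpen_extChartAt_target q).mem_nhds hFz)).mdifferentiableAt
        (by simp)).hasMFDerivAt
    have h1 := HasMFDerivAt.comp (g := ψ.symm) z hS
      ((hF.contDiffAt (hW.mem_nhds hz)).differentiableAt (by simp)).hasFDerivAt.hasMFDerivAt
    have h2 := h1.congr_of_eventuallyEq (f₁ := f) (by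
      filter_upwards [hW.mem_nhds hz] with z' hz' using (ψ.left_inv hz'.2).symm)
    have h3 := conn.pullback_eq (D := S.comp (fderiv ℝ F z)) h2
    rw [← hinv] at h3
    exact h3
  have hDF : fderiv ℝ F y = D := by
    have h : HasFDerivWithinAt F D (Set.range 𝓘(ℝ, E)) y := hD.2
    rw [ModelWithCorners.range_eq_univ, hasFDerivWithinAt_univ] at h
    exact h.fderiv
  have hΘd' : DifferentiableAt ℝ (fun z => ContinuousAlternatingMap.ofSubsingleton ℝ EP EG
      (0 : Fin 1) (conn.formInChart q z)) (F y) := hΘd.alternatingMap_ofSubsingleton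
  -- The exterior derivative commutes with pullback. This transfers the derivative from the
  -- preferred chart at q to an arbitrary parametrization.
  have hext := extDeriv_pullback (r := (∞ : WithTop ℕ∞)) hΘd'
    (hF.contDiffAt (hW.mem_nhds hyW)) (by
      rw [minSmoothness_of_isRCLikeNormedField]; exact WithTop.coe_le_coe.2 le_top)
  have hev : (fun x => (ContinuousAlternatingMap.ofSubsingleton ℝ EP EG (0 : Fin 1)
      (conn.formInChart q (F x))).compContinuousLinearMap (fderiv ℝ F x)) =ᶠ[𝓝 y]
      fun x => ContinuousAlternatingMap.ofSubsingleton ℝ E EG (0 : Fin 1) (conn.pullback f x) := by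
    filter_upwards [hW.mem_nhds hyW] with z hz
    rw [hpull z hz]
    ext
    rfl
  rw [hev.extDeriv_eq, hDF] at hext
  have h1 := congrArg (fun A => A ![u, v]) hext
  simp only [ContinuousAlternatingMap.compContinuousLinearMap_apply] at h1
  rw [extDeriv_ofSubsingleton ((conn.contDiffOn_pullback hU hf).contDiffAt
    (hU.mem_nhds hy) |>.differentiableAt (by simp))] at h1
  have h2 : (fun i => D (![u, v] i)) = ![D u, D v] := by
    funext i; fin_cases i <;> rfl
  have h3 : conn.curvAt q (D u) (D v) =
      extDeriv (fun z => ContinuousAlternatingMap.ofSubsingleton ℝ EP EG (0 : Fin 1)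
        (conn.formInChart q z)) (F y) ![D u, D v] +
        lieBr G (conn.formAt q (D u)) (conn.formAt q (D v)) := rfl
  rw [h3, hu, hv, lieBr_zero, add_zero, h1, ← h2]
  rfl

variable (EG G) in
/-- The vertical part of the connection form in the coordinates given by a gauge. -/
noncomputable def verticalForm (z : EG) : EG →L[ℝ] EG :=
  (chartAd G z).comp (Ring.inverse (chartRight G z))

theorem differentiableAt_verticalForm :
    DifferentiableAt ℝ (verticalForm EG G) (chartOne G) := by
  have h1 : DifferentiableAt ℝ (chartRight (EG := EG) G) (chartOne G) :=
    (contDiffOn_chartRight.contDiffAt chartDomain_mem_nhds).differentiableAt (by simp)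
  have h2 : DifferentiableAt ℝ (Ring.inverse : (EG →L[ℝ] EG) → EG →L[ℝ] EG)
      (chartRight G (chartOne G)) := by
    rw [chartRight_one]
    exact (contDiffAt_ringInverse (𝕜 := ℝ) (n := 1) (1 : (EG →L[ℝ] EG)ˣ)).differentiableAt (by simp)
  exact hasFDerivAt_chartAd.differentiableAt.clm_comp
    (DifferentiableAt.comp (g := Ring.inverse) (chartOne G) h2 h1)

variable (EG G) in
/-- The quadratic term of the curvature in a gauge. -/
noncomputable def curvBilin : EG →L[ℝ] EG →L[ℝ] EG :=
  (adDeriv EG G).flip - adDeriv EG G + fderiv ℝ (verticalForm EG G) (chartOne G) -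
    (fderiv ℝ (verticalForm EG G) (chartOne G)).flip

/-- The identity is needed on a neighbourhood since it gets differentiated. The inverse of the right
translation operator rewrites an arbitrary fibre direction in right-trivialized form. -/
theorem pullback_param_eventually (g : B.Gauge) {x : V} (hx : x ∈ g.dom) (w : V × EG) :
    ∀ᶠ y in 𝓝 (x, (chartOne G : EG)), conn.pullback g.param y w =
      chartAd G y.2 (conn.gaugeForm g y.1 w.1) + verticalForm EG G y.2 w.2 := by
  have h1 : ContinuousAt (chartRight (EG := EG) G) (chartOne G) :=
    (contDiffOn_chartRight.contDiffAt chartDomain_mem_nhds).continuousAt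
  have h2 : ∀ᶠ z in 𝓝 (chartOne G : EG), IsUnit (chartRight G z) := by
    refine h1.eventually ?_
    rw [chartRight_one]
    exact Units.nhds (1 : (EG →L[ℝ] EG)ˣ)
  have h0 : ∀ᶠ y in 𝓝 x, y ∈ g.dom := g.isOpen_dom.mem_nhds hx
  have h3 := h2.and chartDomain_mem_nhds
  rw [nhds_prod_eq]
  filter_upwards [h0.prod_mk h3] with ⟨y, z⟩ ⟨hy, hz, hzd⟩
  have h4 : chartRight G z (Ring.inverse (chartRight G z) w.2) = w.2 :=
    congrArg (fun A : EG →L[ℝ] EG => A w.2) (Ring.mul_inverse_cancel _ hz)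
  have h5 := conn.pullback_param g hy hzd w.1 (Ring.inverse (chartRight G z) w.2)
  rw [h4, Prod.mk.eta, map_add] at h5
  exact h5

theorem fderiv_pullback_param (g : B.Gauge) {x : V} (hx : x ∈ g.dom) (u w : V × EG) :
    fderiv ℝ (conn.pullback g.param) (x, (chartOne G : EG)) u w =
      fderiv ℝ (conn.gaugeForm g) x u.1 w.1 + adDeriv EG G u.2 (conn.gaugeForm g x w.1) +
        fderiv ℝ (verticalForm EG G) (chartOne G) u.2 w.2 := by
  have hd : DifferentiableAt ℝ (conn.pullback g.param) (x, (chartOne G : EG)) :=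
    ((conn.contDiffOn_pullback g.isOpen_prod g.contMDiffOn_param).contDiffAt
      (g.isOpen_prod.mem_nhds ⟨hx, chartOne_mem⟩)).differentiableAt (by simp)
  have h1 : fderiv ℝ (fun y => conn.pullback g.param y w) (x, (chartOne G : EG)) u =
      fderiv ℝ (conn.pullback g.param) (x, (chartOne G : EG)) u w := by
    rw [(hd.hasFDerivAt.clm_apply (hasFDerivAt_const w _)).fderiv]
    simp
  rw [← h1, Filter.EventuallyEq.fderiv_eq (conn.pullback_param_eventually g hx w)]
  have hA : HasFDerivAt (conn.gaugeForm g) (fderiv ℝ (conn.gaugeForm g) x) x :=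
    (((conn.contDiffOn_gaugeForm g).contDiffAt (g.isOpen_dom.mem_nhds hx)).differentiableAt
      (by simp)).hasFDerivAt
  have h2 := HasFDerivAt.comp (g := conn.gaugeForm g) (f := Prod.fst) (x, (chartOne G : EG)) hA hasFDerivAt_fst
  have h3 := HasFDerivAt.comp (g := chartAd G) (f := Prod.snd) (x, (chartOne G : EG)) hasFDerivAt_chartAd
    hasFDerivAt_snd
  have h4 := HasFDerivAt.comp (g := verticalForm EG G) (f := Prod.snd) (x, (chartOne G : EG))
    differentiableAt_verticalForm.hasFDerivAt hasFDerivAt_snd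
  have h5 := (h3.clm_apply (h2.clm_apply (hasFDerivAt_const w.1 _))).add
    (h4.clm_apply (hasFDerivAt_const w.2 _))
  refine (congrArg (fun A : V × EG →L[ℝ] EG => A u) h5.fderiv).trans ?_
  simp [chartAd_one]

variable {𝔫 : StratifiedLieAlgebra V} {n : ℕ} (Z : AdaptedBasis 𝔫 n)

/-- The coefficients of the curvature in a gauge. -/
theorem curvatureCoeff_sec (g : B.Gauge) {x : V} (hx : x ∈ g.dom) (i j : Fin n) :
    conn.curvatureCoeff Z i j (g.sec x) =
      fderiv ℝ (conn.gaugeForm g) x (Z.basis i) (Z.basis j) -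
        fderiv ℝ (conn.gaugeForm g) x (Z.basis j) (Z.basis i) +
        curvBilin EG G (conn.gaugeForm g x (Z.basis i)) (conn.gaugeForm g x (Z.basis j)) := by
  obtain ⟨D, -, hD, -⟩ := g.exists_frame hx
  have hform := fun v => conn.formAt_frame g hx hD v (-(conn.gaugeForm g x v))
  simp only [add_neg_cancel] at hform
  have h1 : conn.curvatureCoeff Z i j (g.sec x) = conn.curvAt (g.sec x)
      (conn.liftAt (g.sec x) (Z.basis i)) (conn.liftAt (g.sec x) (Z.basis j)) := rfl
  have h2 := conn.curvAt_pullback g.isOpen_prod g.contMDiffOn_param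
    (y := (x, (chartOne G : EG))) ⟨hx, chartOne_mem⟩ hD
    (u := (Z.basis i, -(conn.gaugeForm g x (Z.basis i))))
    (v := (Z.basis j, -(conn.gaugeForm g x (Z.basis j))))
    (by rw [g.param_chartOne]; exact hform _) (by rw [g.param_chartOne]; exact hform _)
  rw [g.param_chartOne, conn.fderiv_pullback_param g hx, conn.fderiv_pullback_param g hx] at h2
  -- The gauge coordinates of the horizontal lifts have fibre part -A. Inserting them into the
  -- derivative of the pulled-back form leaves dA plus terms quadratic in A, which `curvBilin`
  -- collects.
  rw [h1, conn.liftAt_sec g hx hD, conn.liftAt_sec g hx hD, h2]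
  simp [curvBilin]
  abel

/-- Composing the parametrization with the action of a changes the pulled-back connection form by
the constant operator Ad(a⁻¹), which commutes with d. -/
theorem curvatureCoeff_smul {a : G} (ha : a ∈ connectedComponent (1 : G)) (q : P) (i j : Fin n) :
    conn.curvatureCoeff Z i j (MulOpposite.op a • q) =
      lieAd a⁻¹ (conn.curvatureCoeff Z i j q) := by
  obtain ⟨U, -, hU, hg⟩ := B.exists_gauge (B.proj q)
  obtain ⟨g, rfl, hq⟩ := hg q hU
  set x := B.proj q
  obtain ⟨D, -, hD, -⟩ := g.exists_frame hU
  have hform := fun v => conn.formAt_frame g hU hD v (-(conn.gaugeForm g x v))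
  have hlift := fun v => conn.liftAt_sec g hU hD v
  simp only [add_neg_cancel] at hform
  have hcq : g.param (x, chartOne G) = q := by rw [g.param_chartOne, hq]
  rw [hq] at hform hlift
  have hR : ∀ q', HasMFDerivAt 𝓘(ℝ, EP) 𝓘(ℝ, EP) (fun q : P => MulOpposite.op a • q) q'
      (mfderiv 𝓘(ℝ, EP) 𝓘(ℝ, EP) (fun q : P => MulOpposite.op a • q) q') := fun q' =>
    ((B.contMDiff_smul_left a).contMDiffAt.mdifferentiableAt (by simp)).hasMFDerivAt
  let R : EP →L[ℝ] EP := mfderiv 𝓘(ℝ, EP) 𝓘(ℝ, EP) (fun q : P => MulOpposite.op a • q) q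
  have hRq : HasMFDerivAt 𝓘(ℝ, EP) 𝓘(ℝ, EP) (fun q : P => MulOpposite.op a • q) q R := hR q
  let f : V × EG → P := fun y => MulOpposite.op a • g.param y
  have hf : ContMDiffOn 𝓘(ℝ, V × EG) 𝓘(ℝ, EP) ∞ f (g.dom ×ˢ chartDomain (EG := EG) G) :=
    (B.contMDiff_smul_left a).comp_contMDiffOn g.contMDiffOn_param
  have hDf : HasMFDerivAt 𝓘(ℝ, V × EG) 𝓘(ℝ, EP) f (x, chartOne G) (R.comp D : V × EG →L[ℝ] EP) := by
    have h := hRq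
    rw [← hcq] at h
    exact HasMFDerivAt.comp (g := fun q : P => MulOpposite.op a • q) _ h hD
  have hfq : f (x, chartOne G) = MulOpposite.op a • q := by rw [← hcq]
  have hpull : conn.pullback f =ᶠ[𝓝 (x, (chartOne G : EG))]
      fun y => (lieAd (EG := EG) a⁻¹).comp (conn.pullback g.param y) := by
    filter_upwards [g.isOpen_prod.mem_nhds (⟨hU, chartOne_mem⟩ :
      (x, (chartOne G : EG)) ∈ g.dom ×ˢ chartDomain G)] with y hy
    let S : V × EG →L[ℝ] EP := mfderiv 𝓘(ℝ, V × EG) 𝓘(ℝ, EP) g.param y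
    have hS : HasMFDerivAt 𝓘(ℝ, V × EG) 𝓘(ℝ, EP) g.param y S :=
      ((g.contMDiffAt_param hy.1 hy.2).mdifferentiableAt (by simp)).hasMFDerivAt
    let R' : EP →L[ℝ] EP := mfderiv 𝓘(ℝ, EP) 𝓘(ℝ, EP) (fun q : P => MulOpposite.op a • q) (g.param y)
    have hR' : HasMFDerivAt 𝓘(ℝ, EP) 𝓘(ℝ, EP) (fun q : P => MulOpposite.op a • q) (g.param y) R' :=
      hR _
    have h1 : HasMFDerivAt 𝓘(ℝ, V × EG) 𝓘(ℝ, EP) f y (R'.comp S : V × EG →L[ℝ] EP) :=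
      HasMFDerivAt.comp (g := fun q : P => MulOpposite.op a • q) y hR' hS
    rw [conn.pullback_eq h1]
    ext w
    · exact conn.formAt_smul hR' (S (w, 0))
    · exact conn.formAt_smul hR' (S (0, w))
  have hd : DifferentiableAt ℝ (conn.pullback g.param) (x, (chartOne G : EG)) :=
    ((conn.contDiffOn_pullback g.isOpen_prod g.contMDiffOn_param).contDiffAt
      (g.isOpen_prod.mem_nhds ⟨hU, chartOne_mem⟩)).differentiableAt (by simp)
  have hfd : ∀ u w, fderiv ℝ (conn.pullback f) (x, (chartOne G : EG)) u w =
      lieAd a⁻¹ (fderiv ℝ (conn.pullback g.param) (x, (chartOne G : EG)) u w) := by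
    intro u w
    rw [hpull.fderiv_eq, ((hasFDerivAt_const (lieAd (EG := EG) a⁻¹) _).clm_comp
      hd.hasFDerivAt).fderiv]
    simp
  have h1 : ∀ q, conn.curvatureCoeff Z i j q = conn.curvAt q
      (conn.liftAt q (Z.basis i)) (conn.liftAt q (Z.basis j)) := fun q => rfl
  have hform' : ∀ v, conn.formAt (f (x, chartOne G)) (R.comp D (v, -(conn.gaugeForm g x v))) = 0 := by
    intro v
    rw [hfq]
    exact (conn.formAt_smul hRq _).trans ((congrArg (lieAd a⁻¹) (hform v)).trans (map_zero _))
  have h2 := conn.curvAt_pullback g.isOpen_prod g.contMDiffOn_param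
    (y := (x, (chartOne G : EG))) ⟨hU, chartOne_mem⟩ hD
    (u := (Z.basis i, -(conn.gaugeForm g x (Z.basis i))))
    (v := (Z.basis j, -(conn.gaugeForm g x (Z.basis j))))
    (by rw [hcq]; exact hform _) (by rw [hcq]; exact hform _)
  have h3 := conn.curvAt_pullback g.isOpen_prod hf
    (y := (x, (chartOne G : EG))) ⟨hU, chartOne_mem⟩ hDf
    (u := (Z.basis i, -(conn.gaugeForm g x (Z.basis i))))
    (v := (Z.basis j, -(conn.gaugeForm g x (Z.basis j)))) (hform' _) (hform' _)
  rw [hcq] at h2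
  rw [hfq, hfd, hfd, ← map_sub, ← h2] at h3
  rw [h1, h1, conn.liftAt_smul ha hRq, conn.liftAt_smul ha hRq, hlift, hlift]
  exact h3

theorem contDiffOn_curvatureCoeff_sec (g : B.Gauge) (i j : Fin n) :
    ContDiffOn ℝ ∞ (fun x => conn.curvatureCoeff Z i j (g.sec x)) g.dom := by
  refine ContDiffOn.congr ?_ fun x hx => conn.curvatureCoeff_sec Z g hx i j
  have h1 := conn.contDiffOn_gaugeForm g
  have h2 := h1.fderiv_of_isOpen (m := ∞) g.isOpen_dom (by simp)
  exact (((h2.clm_apply contDiffOn_const).clm_apply contDiffOn_const).sub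
    ((h2.clm_apply contDiffOn_const).clm_apply contDiffOn_const)).add
    (((curvBilin EG G).contDiff.comp_contDiffOn (h1.clm_apply contDiffOn_const)).clm_apply
      (h1.clm_apply contDiffOn_const))

theorem isEquivariantField_curvatureCoeff (i j : Fin n) :
    IsEquivariantField B (conn.curvatureCoeff Z i j) where
  smul q _ ha := conn.curvatureCoeff_smul Z ha q i j
  contDiffOn g := conn.contDiffOn_curvatureCoeff_sec Z g i j

end PrincipalConnection

end Curvature

/-! ### Connection forms in the radial gauge -/

section RadialForm

open Filter Topology

variable {V : Type*} [NormedAddCommGroup V] [InnerProductSpace ℝ V] [FiniteDimensional ℝ V]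
  {F : Type*} [NormedAddCommGroup F] [NormedSpace ℝ F]

namespace AdaptedBasis

variable {𝔫 : StratifiedLieAlgebra V} {n : ℕ} (Z : AdaptedBasis 𝔫 n)

/-- The weighted box of size `ρ`. -/
def box (ρ : ℝ) : Set V := {x | ∀ i, |Z.basis.repr x i| ≤ ρ ^ Z.weight i}

variable {Z} in
theorem dilation_mem_box {ρ s : ℝ} {x : V} (hx : x ∈ Z.box ρ) (hs : s ∈ Icc (0 : ℝ) 1) :
    Z.dilation s x ∈ Z.box ρ := fun i => by
  rw [Z.repr_dilation, abs_mul, abs_of_nonneg (pow_nonneg hs.1 _)]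
  exact (mul_le_of_le_one_left (abs_nonneg _) (pow_le_one₀ hs.1 hs.2)).trans (hx i)

theorem exists_box_subset {W : Set V} (hW : W ∈ 𝓝 (0 : V)) :
    ∃ ρ₀ ∈ Ioc (0 : ℝ) 1, ∀ ρ ∈ Icc 0 ρ₀, Z.box ρ ⊆ W := by
  let L : V ≃L[ℝ] (Fin n → ℝ) := Z.basis.equivFun.toContinuousLinearEquiv
  have h1 : L.symm ⁻¹' W ∈ 𝓝 (0 : Fin n → ℝ) := by
    refine L.symm.continuous.continuousAt.preimage_mem_nhds ?_
    rwa [map_zero]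
  obtain ⟨r, hr, hball⟩ := Metric.mem_nhds_iff.1 h1
  refine ⟨min (r / 2) 1, ⟨lt_min (by positivity) one_pos, min_le_right _ _⟩, fun ρ hρ x hx => ?_⟩
  have h2 : L x ∈ Metric.ball (0 : Fin n → ℝ) r := by
    rw [mem_ball_zero_iff, pi_norm_lt_iff hr]
    intro i
    have h3 : ρ ^ Z.weight i ≤ ρ := pow_le_of_le_one hρ.1 (hρ.2.trans (min_le_right _ _))
      (by have := Z.one_le_weight i; omega)
    have h4 : ρ ≤ r / 2 := hρ.2.trans (min_le_left _ _)
    have h5 : |Z.basis.repr x i| ≤ ρ ^ Z.weight i := hx i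
    have h6 : ‖L x i‖ = |Z.basis.repr x i| := rfl
    rw [h6]
    linarith
  have h7 := hball h2
  rwa [mem_preimage, L.symm_apply_apply] at h7

/-- A function that is `O(ρ ^ m)` on the boxes of size `ρ`. -/
def IsBigOBox (m : ℕ) (u : V → F) : Prop :=
  ∃ C ≥ 0, ∃ ρ₀ ∈ Ioc (0 : ℝ) 1, ∀ ρ ∈ Icc 0 ρ₀, ∀ x ∈ Z.box ρ, ‖u x‖ ≤ C * ρ ^ m

variable {Z} in
theorem IsBigOBox.vanishesTo {m : ℕ} {u : V → F} (h : Z.IsBigOBox m u) : Z.VanishesTo m u := by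
  obtain ⟨C, hC, ρ₀, hρ₀, hb⟩ := h
  intro x
  -- K is at least 1 and bounds all coordinates, so x lies in the box of size K and δ_s(x) in the
  -- box of size sK.
  let K : ℝ := 1 + ∑ i, |Z.basis.repr x i|
  have hK1 : 1 ≤ K := le_add_of_nonneg_right (Finset.sum_nonneg fun i _ => abs_nonneg _)
  have hK : 0 < K := one_pos.trans_le hK1
  have hxK : ∀ i, |Z.basis.repr x i| ≤ K ^ Z.weight i := fun i => by
    have h1 : |Z.basis.repr x i| ≤ ∑ i, |Z.basis.repr x i| :=
      Finset.single_le_sum (f := fun i => |Z.basis.repr x i|) (fun i _ => abs_nonneg _)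
        (Finset.mem_univ i)
    have h2 : K ≤ K ^ Z.weight i := le_self_pow₀ hK1 (by have := Z.one_le_weight i; omega)
    exact (h1.trans (le_add_of_nonneg_left zero_le_one)).trans h2
  refine Asymptotics.IsBigO.of_bound (C * K ^ m) ?_
  filter_upwards [Ioo_mem_nhdsGT (div_pos hρ₀.1 hK)] with s hs
  have h3 : s * K ∈ Icc 0 ρ₀ := ⟨mul_nonneg hs.1.le hK.le, ((lt_div_iff₀ hK).1 hs.2).le⟩
  refine (hb _ h3 (Z.dilation s x) fun i => ?_).trans (le_of_eq ?_)
  · rw [Z.repr_dilation, abs_mul, abs_of_nonneg (pow_nonneg hs.1.le _), mul_pow]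
    exact mul_le_mul_of_nonneg_left (hxK i) (pow_nonneg hs.1.le _)
  · rw [norm_pow, Real.norm_eq_abs, abs_of_pos hs.1, mul_pow]
    ring

variable {Z} in
theorem VanishesTo.isBigOBox [CompleteSpace F] {m : ℕ} {u : V → F} (hu : ContDiff ℝ ∞ u) (h : Z.VanishesTo m u) :
    Z.IsBigOBox m u := by
  obtain ⟨C, hC, hb⟩ := exists_taylor_remainder_bound (Z := Z) hu m
  refine ⟨C, hC, 1, ⟨one_pos, le_rfl⟩, fun ρ hρ x hx => ?_⟩
  have h1 := hb ρ hρ x hx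
  rwa [Finset.sum_eq_zero (fun j hj => (vanishesTo_iff hu).1 h j (Finset.mem_range.1 hj) x),
    sub_zero] at h1

/-- The integral along the rays that recovers a one-form from its exterior derivative. -/
noncomputable def radialIntegral (c : Fin n → V → F) (w : ℕ) (x : V) : F :=
  ∫ s in (0 : ℝ)..1, ∑ i, ((Z.weight i : ℝ) * Z.basis.repr x i * s ^ (Z.weight i + w - 1)) •
    c i (Z.dilation s x)

variable {Z}

theorem continuous_radialIntegrand {c : Fin n → V → F} (hc : ∀ i, Continuous (c i)) (w : ℕ) :
    Continuous fun p : V × ℝ => ∑ i, ((Z.weight i : ℝ) * Z.basis.repr p.1 i *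
      p.2 ^ (Z.weight i + w - 1)) • c i (Z.dilation p.2 p.1) :=
  continuous_finsetSum _ fun i _ => ((continuous_const.mul
    ((Z.contDiff_repr i).continuous.comp continuous_fst)).mul (continuous_snd.pow _)).smul
    ((hc i).comp (Z.contDiff_dilation.continuous.comp (continuous_snd.prodMk continuous_fst)))

theorem continuous_radialIntegral {c : Fin n → V → F} (hc : ∀ i, Continuous (c i)) (w : ℕ) :
    Continuous (Z.radialIntegral c w) :=
  intervalIntegral.continuous_parametric_intervalIntegral_of_continuous'
    (continuous_radialIntegrand hc w) 0 1

theorem radialIntegral_sub {c d : Fin n → V → F} (hc : ∀ i, Continuous (c i))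
    (hd : ∀ i, Continuous (d i)) (w : ℕ) (x : V) :
    Z.radialIntegral c w x - Z.radialIntegral d w x =
      Z.radialIntegral (fun i y => c i y - d i y) w x := by
  rw [radialIntegral, radialIntegral, ← intervalIntegral.integral_sub]
  · refine intervalIntegral.integral_congr fun s _ => ?_
    simp only [smul_sub, Finset.sum_sub_distrib]
  · exact ((continuous_radialIntegrand hc w).comp
      (continuous_const.prodMk continuous_id)).intervalIntegrable _ _
  · exact ((continuous_radialIntegrand hd w).comp
      (continuous_const.prodMk continuous_id)).intervalIntegrable _ _

/-- Boxes are stable under δ_s for s ≤ 1, and the factor xᵢ supplies the additional power ρ^{wᵢ}. -/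
theorem IsBigOBox.radialIntegral {c : Fin n → V → F} {m : Fin n → ℕ} {q w : ℕ}
    (h : ∀ i, Z.IsBigOBox (m i) (c i)) (hq : ∀ i, q ≤ Z.weight i + m i) :
    Z.IsBigOBox q (Z.radialIntegral c w) := by
  choose C hC ρ₀ hρ₀ hb using h
  obtain ⟨r, hr, hrle⟩ : ∃ r ∈ Ioc (0 : ℝ) 1, ∀ i, r ≤ ρ₀ i := by
    rcases isEmpty_or_nonempty (Fin n) with he | he
    · exact ⟨1, ⟨one_pos, le_rfl⟩, fun i => he.elim i⟩
    · obtain ⟨i, hi⟩ := Finite.exists_min ρ₀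
      exact ⟨ρ₀ i, hρ₀ i, hi⟩
  refine ⟨∑ i, (Z.weight i : ℝ) * C i, Finset.sum_nonneg fun i _ =>
    mul_nonneg (Nat.cast_nonneg _) (hC i), r, hr, fun ρ hρ x hx => ?_⟩
  have hρ1 : ρ ≤ 1 := hρ.2.trans hr.2
  have hbound : ∀ s ∈ uIoc (0 : ℝ) 1, ‖∑ i, ((Z.weight i : ℝ) * Z.basis.repr x i *
      s ^ (Z.weight i + w - 1)) • c i (Z.dilation s x)‖ ≤ (∑ i, (Z.weight i : ℝ) * C i) * ρ ^ q := by
    intro s hs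
    rw [uIoc_of_le zero_le_one] at hs
    have hs' : s ∈ Icc (0 : ℝ) 1 := ⟨hs.1.le, hs.2⟩
    rw [Finset.sum_mul]
    refine norm_sum_le_of_le _ fun i _ => ?_
    have h1 := hb i ρ ⟨hρ.1, hρ.2.trans (hrle i)⟩ _ (dilation_mem_box hx hs')
    have h2 : |Z.basis.repr x i| ≤ ρ ^ Z.weight i := hx i
    have h3 : s ^ (Z.weight i + w - 1) ≤ 1 := pow_le_one₀ hs'.1 hs'.2
    have h4 : 0 ≤ s ^ (Z.weight i + w - 1) := pow_nonneg hs'.1 _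
    rw [norm_smul, norm_mul, norm_mul, Real.norm_natCast, Real.norm_eq_abs, Real.norm_eq_abs,
      abs_of_nonneg h4]
    calc (Z.weight i : ℝ) * |Z.basis.repr x i| * s ^ (Z.weight i + w - 1) *
          ‖c i (Z.dilation s x)‖
        ≤ (Z.weight i : ℝ) * ρ ^ Z.weight i * 1 * (C i * ρ ^ m i) := by
          have := hρ.1
          gcongr
      _ = (Z.weight i : ℝ) * C i * ρ ^ (Z.weight i + m i) := by rw [pow_add]; ring
      _ ≤ (Z.weight i : ℝ) * C i * ρ ^ q :=
          mul_le_mul_of_nonneg_left (pow_le_pow_of_le_one hρ.1 hρ1 (hq i))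
            (mul_nonneg (Nat.cast_nonneg _) (hC i))
  have h5 := intervalIntegral.norm_integral_le_of_norm_le_const hbound
  simpa [AdaptedBasis.radialIntegral] using h5

variable (Z)

/-- The coefficients of `dA + b(A, A)` in the given basis. -/
noncomputable def formCurvature (b : F →L[ℝ] F →L[ℝ] F) (A : V → V →L[ℝ] F) (i j : Fin n) (x : V) :
    F :=
  fderiv ℝ A x (Z.basis i) (Z.basis j) - fderiv ℝ A x (Z.basis j) (Z.basis i) +
    b (A x (Z.basis i)) (A x (Z.basis j))

variable {b : F →L[ℝ] F →L[ℝ] F} {A : V → V →L[ℝ] F}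

theorem contDiff_formCurvature (hA : ContDiff ℝ ∞ A) (i j : Fin n) :
    ContDiff ℝ ∞ (Z.formCurvature b A i j) := by
  have h2 : ContDiff ℝ ∞ (fderiv ℝ A) := hA.fderiv_right (by simp)
  exact (((h2.clm_apply contDiff_const).clm_apply contDiff_const).sub
    ((h2.clm_apply contDiff_const).clm_apply contDiff_const)).add
    ((b.contDiff.comp (hA.clm_apply contDiff_const)).clm_apply (hA.clm_apply contDiff_const))

/-- Differentiating A(E) = 0 along Z_j gives (∂_j A)(E) = -w_j A_j, since E is linear with ∂_j E =
w_j Z_j. Inserted into F(E, Z_j) = ∂_E A_j - (∂_j A)(E) + b(A(E), A_j), it leaves ∂_E A_j + w_j A_j;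
the quadratic term dies because A(E) = 0. -/
theorem radial_derivative (hA : ContDiff ℝ ∞ A)
    (hrad : ∀ᶠ x in 𝓝 (0 : V), A x (Z.rayVelocity 1 x) = 0) (j : Fin n) : ∀ᶠ y in 𝓝 (0 : V),
      fderiv ℝ A y (Z.rayVelocity 1 y) (Z.basis j) + (Z.weight j : ℝ) • A y (Z.basis j) =
        ∑ i, ((Z.weight i : ℝ) * Z.basis.repr y i) • Z.formCurvature b A i j y := by
  let E : V →L[ℝ] V := ∑ i, (Z.weight i : ℝ) • (Z.coordCLM i).smulRight (Z.basis i)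
  have hE : ∀ y, E y = Z.rayVelocity 1 y := fun y => by
    simp [E, rayVelocity, smul_smul]
  have hEj : E (Z.basis j) = (Z.weight j : ℝ) • Z.basis j := by
    apply Z.basis.ext_elem
    intro i
    rw [hE, Z.repr_rayVelocity, map_smul, Finsupp.smul_apply, Z.basis.repr_self]
    rcases eq_or_ne j i with rfl | hij
    · simp
    · simp [hij]
  filter_upwards [hrad.eventually_nhds] with y hy
  have hy0 := hy.self_of_nhds
  have hAd : HasFDerivAt A (fderiv ℝ A y) y := (hA.differentiable (by simp) y).hasFDerivAt
  have h1 := hAd.clm_apply E.hasFDerivAt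
  have h2 : HasFDerivAt (fun x => A x (E x)) (0 : V →L[ℝ] F) y :=
    (hasFDerivAt_const (0 : F) y).congr_of_eventuallyEq (by
      filter_upwards [hy] with x hx
      rw [hE, hx])
  have h3 := congrArg (fun L : V →L[ℝ] F => L (Z.basis j)) (h1.unique h2)
  simp only [add_apply, ContinuousLinearMap.comp_apply, ContinuousLinearMap.flip_apply, zero_apply,
    hEj, map_smul, hE] at h3
  have h4 : Z.rayVelocity 1 y = ∑ i, ((Z.weight i : ℝ) * Z.basis.repr y i) • Z.basis i := by
    simp [rayVelocity]
  have h5 : ∑ i, ((Z.weight i : ℝ) * Z.basis.repr y i) • Z.formCurvature b A i j y =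
      fderiv ℝ A y (Z.rayVelocity 1 y) (Z.basis j) -
        fderiv ℝ A y (Z.basis j) (Z.rayVelocity 1 y) +
        b (A y (Z.rayVelocity 1 y)) (A y (Z.basis j)) := by
    rw [h4]
    simp [formCurvature, smul_add, smul_sub, Finset.sum_add_distrib, Finset.sum_sub_distrib,
      map_sum, sum_apply]
  rw [h5, hy0, map_zero, zero_apply, add_zero, sub_eq_add_neg, ← eq_neg_of_add_eq_zero_left h3]

/-- The radial identity says that the integrand is the s-derivative of s^{w_j} A_j(δ_s x). The
boundary term at s = 0 vanishes as w_j ≥ 1. A box is used as neighbourhood because it contains the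
whole ray. -/
theorem apply_basis_eq_radialIntegral [CompleteSpace F] (hA : ContDiff ℝ ∞ A)
    (hrad : ∀ᶠ x in 𝓝 (0 : V), A x (Z.rayVelocity 1 x) = 0) (j : Fin n) : ∀ᶠ x in 𝓝 (0 : V),
      A x (Z.basis j) = Z.radialIntegral (fun i => Z.formCurvature b A i j) (Z.weight j) x := by
  obtain ⟨ρ₀, hρ₀, hbox⟩ := Z.exists_box_subset (Z.radial_derivative (b := b) hA hrad j)
  have hnhds : Z.box ρ₀ ∈ 𝓝 (0 : V) := by
    have h1 : ∀ i, ∀ᶠ x in 𝓝 (0 : V), |Z.basis.repr x i| ≤ ρ₀ ^ Z.weight i := fun i => by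
      have h2 : Tendsto (fun x => |Z.basis.repr x i|) (𝓝 0) (𝓝 0) := by
        simpa using (Z.contDiff_repr i).continuous.abs.tendsto 0
      exact (h2.eventually (gt_mem_nhds (pow_pos hρ₀.1 _))).mono fun x hx => le_of_lt hx
    exact eventually_all.2 h1
  filter_upwards [hnhds] with x hx
  have hw := Z.one_le_weight j
  have hderiv : ∀ s ∈ uIcc (0 : ℝ) 1, HasDerivAt
      (fun s => s ^ Z.weight j • A (Z.dilation s x) (Z.basis j))
      (∑ i, ((Z.weight i : ℝ) * Z.basis.repr x i * s ^ (Z.weight i + Z.weight j - 1)) •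
        Z.formCurvature b A i j (Z.dilation s x)) s := by
    intro s hs
    rw [uIcc_of_le zero_le_one] at hs
    have h1 := hbox ρ₀ ⟨hρ₀.1.le, le_rfl⟩ (dilation_mem_box hx hs)
    have h2 : HasDerivAt (fun s => A (Z.dilation s x))
        (fderiv ℝ A (Z.dilation s x) (Z.rayVelocity s x)) s :=
      ((hA.differentiable (by simp) _).hasFDerivAt).comp_hasDerivAt s (Z.hasDerivAt_dilation s x)
    have h3 := (hasDerivAt_pow (Z.weight j) s).smul
      (h2.clm_apply (hasDerivAt_const s (Z.basis j)))
    refine HasDerivAt.congr_deriv (f := fun s => s ^ Z.weight j • A (Z.dilation s x) (Z.basis j)) h3 ?_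
    symm
    have h4 : ∑ i, ((Z.weight i : ℝ) * Z.basis.repr x i * s ^ (Z.weight i + Z.weight j - 1)) •
        Z.formCurvature b A i j (Z.dilation s x) = s ^ (Z.weight j - 1) •
        ∑ i, ((Z.weight i : ℝ) * Z.basis.repr (Z.dilation s x) i) •
          Z.formCurvature b A i j (Z.dilation s x) := by
      rw [Finset.smul_sum]
      refine Finset.sum_congr rfl fun i _ => ?_
      rw [smul_smul, Z.repr_dilation,
        show Z.weight i + Z.weight j - 1 = Z.weight i + (Z.weight j - 1) by omega, pow_add]
      congr 1
      ring
    obtain ⟨w, hw'⟩ : ∃ w, Z.weight j = w + 1 := ⟨Z.weight j - 1, by omega⟩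
    rw [h4, ← h1, Z.rayVelocity_dilation, hw', one_mul]
    simp only [map_smul, smul_apply, smul_add, smul_smul, map_zero, add_zero,
      Nat.add_sub_cancel]
    rw [← pow_succ, mul_comm (s ^ w)]
  have hint := intervalIntegral.integral_eq_sub_of_hasDerivAt hderiv
    (((continuous_radialIntegrand (Z := Z) (fun i => (Z.contDiff_formCurvature (b := b) hA i j).continuous)
      (Z.weight j)).comp (continuous_const.prodMk continuous_id)).intervalIntegrable 0 1)
  rw [radialIntegral, hint, one_pow, one_smul, Z.dilation_one, zero_pow (by omega), zero_smul,
    sub_zero]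

/-- In the radial gauge, a connection form vanishes to the order prescribed by its curvature. -/
theorem vanishesTo_apply_basis [CompleteSpace F] (hA : ContDiff ℝ ∞ A)
    (hrad : ∀ᶠ x in 𝓝 (0 : V), A x (Z.rayVelocity 1 x) = 0) {M : ℕ} (j : Fin n)
    (h : ∀ i, Z.VanishesTo (M - (Z.weight i + Z.weight j)) (Z.formCurvature b A i j)) :
    Z.VanishesTo (M - Z.weight j) fun x => A x (Z.basis j) := by
  have h1 : Z.IsBigOBox (M - Z.weight j)
      (Z.radialIntegral (fun i => Z.formCurvature b A i j) (Z.weight j)) :=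
    IsBigOBox.radialIntegral (fun i => (h i).isBigOBox (Z.contDiff_formCurvature hA i j))
      fun i => by omega
  exact h1.vanishesTo.congr (Z.apply_basis_eq_radialIntegral hA hrad j)

/-- The covariant derivative in a gauge. -/
noncomputable def localCovDeriv (a : F →L[ℝ] F →L[ℝ] F) (A : V → V →L[ℝ] F) (v : V) (u : V → F)
    (x : V) : F := fderiv ℝ u x v - a (A x v) (u x)

variable {a : F →L[ℝ] F →L[ℝ] F}

theorem contDiff_localCovDeriv (hA : ContDiff ℝ ∞ A) {u : V → F} (hu : ContDiff ℝ ∞ u) (v : V) :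
    ContDiff ℝ ∞ (localCovDeriv a A v u) :=
  ((hu.fderiv_right (m := ∞) (by simp)).clm_apply contDiff_const).sub
    ((a.contDiff.comp (hA.clm_apply contDiff_const)).clm_apply hu)

theorem contDiff_iterate_localCovDeriv (hA : ContDiff ℝ ∞ A) {u : V → F} (hu : ContDiff ℝ ∞ u)
    (l : List V) : ContDiff ℝ ∞ (l.foldr (localCovDeriv a A) u) := by
  induction l with
  | nil => exact hu
  | cons v l ih => exact contDiff_localCovDeriv hA ih v

/-- Iterated covariant derivatives agree with iterated derivatives up to higher order. -/
theorem vanishesTo_iterate_localCovDeriv (hA : ContDiff ℝ ∞ A) {u : V → F} (hu : ContDiff ℝ ∞ u)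
    {M m : ℕ} (hAM : ∀ j, Z.VanishesTo (M - Z.weight j) fun x => A x (Z.basis j))
    (hum : Z.VanishesTo m u) (l : List (Fin n)) :
    Z.VanishesTo (m - (l.map Z.weight).sum) ((l.map Z.basis).foldr (localCovDeriv a A) u) ∧
    Z.VanishesTo (M + m - (l.map Z.weight).sum) fun x =>
      (l.map Z.basis).foldr (localCovDeriv a A) u x - iterDirDeriv (l.map Z.basis) u x := by
  induction l with
  | nil =>
    refine ⟨by simpa using hum, fun x => ?_⟩
    simp [iterDirDeriv, Asymptotics.isBigO_zero]
  | cons i l ih =>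
    have hs := contDiff_iterate_localCovDeriv (a := a) hA hu (l.map Z.basis)
    have hs' : ContDiff ℝ ∞ (iterDirDeriv (l.map Z.basis) u) := hu.iterDirDeriv _
    have h1 := ih.1.dirDeriv hs i
    have h2 := ih.2.dirDeriv (hs.sub hs') i
    -- The term with A has order (M - wᵢ) + (m - w(l)), which with truncated subtraction is at least
    -- each of the two orders claimed.
    have h3 : Z.VanishesTo ((M - Z.weight i) + (m - (l.map Z.weight).sum)) fun x =>
        (-a) (A x (Z.basis i)) ((l.map Z.basis).foldr (localCovDeriv a A) u x) :=
      VanishesTo.bilin (-a) (hAM i) ih.1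
    have hd := fun x => (hs.differentiable (by simp) x)
    have hd' := fun x => (hs'.differentiable (by simp) x)
    simp only [List.map_cons, List.foldr_cons, List.sum_cons]
    constructor
    · refine ((h1.of_le (m' := m - (Z.weight i + (l.map Z.weight).sum)) (by omega)).add
        (h3.of_le (by omega))).congr (Eventually.of_forall fun x => ?_)
      simp [localCovDeriv, dirDeriv, sub_eq_add_neg]
    · refine ((h2.of_le (m' := M + m - (Z.weight i + (l.map Z.weight).sum)) (by omega)).add
        (h3.of_le (by omega))).congr (Eventually.of_forall fun x => ?_)
      have h4 : fderiv ℝ (fun x => (l.map Z.basis).foldr (localCovDeriv a A) u x -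
          iterDirDeriv (l.map Z.basis) u x) x =
          fderiv ℝ ((l.map Z.basis).foldr (localCovDeriv a A) u) x -
            fderiv ℝ (iterDirDeriv (l.map Z.basis) u) x := fderiv_sub (hd x) (hd' x)
      simp only [dirDeriv, h4, sub_apply, neg_apply]
      simp only [localCovDeriv, iterDirDeriv, List.foldr_cons, dirDeriv]
      abel

theorem iterate_localCovDeriv_apply_zero (hA : ContDiff ℝ ∞ A) {u : V → F} (hu : ContDiff ℝ ∞ u)
    {M m : ℕ} (hAM : ∀ j, Z.VanishesTo (M - Z.weight j) fun x => A x (Z.basis j))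
    (hum : Z.VanishesTo m u) {l : List (Fin n)} (hl : (l.map Z.weight).sum < M + m) :
    (l.map Z.basis).foldr (localCovDeriv a A) u 0 = iterDirDeriv (l.map Z.basis) u 0 :=
  sub_eq_zero.1 ((Z.vanishesTo_iterate_localCovDeriv (a := a) hA hu hAM hum l).2.apply_zero
    (by omega))

end AdaptedBasis

end RadialForm

/-! ### Estimates for horizontal loops -/

section LoopEstimates

open Filter Topology

variable {V : Type*} [NormedAddCommGroup V] [InnerProductSpace ℝ V] [FiniteDimensional ℝ V]
  {F : Type*} [NormedAddCommGroup F] [NormedSpace ℝ F]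
  {𝔫 : StratifiedLieAlgebra V} {n : ℕ} (Z : AdaptedBasis 𝔫 n)

namespace AdaptedBasis

/-- Small horizontal loops stay in a given neighbourhood of the identity. -/
theorem exists_forall_loop_mem (Z : AdaptedBasis 𝔫 n) {W : Set V} (hW : W ∈ 𝓝 (0 : V)) : ∃ ε > 0, ∀ γ,
    𝔫.IsHorizontalLoop γ → 𝔫.length γ < ε → ∀ t ∈ Icc (0 : ℝ) 1, γ t ∈ W := by
  obtain ⟨C, hC, hbox⟩ := Z.exists_ballBox
  obtain ⟨ρ₀, hρ₀, hsub⟩ := Z.exists_box_subset hW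
  have hC0 : 0 < C := one_pos.trans_le hC
  refine ⟨ρ₀ / C, div_pos hρ₀.1 hC0, fun γ hγ hℓ t ht => ?_⟩
  refine hsub (C * 𝔫.length γ) ⟨mul_nonneg hC0.le
    (StratifiedLieAlgebra.IsHorizontalLoop.length_nonneg γ), ?_⟩ ((hbox γ hγ).1 t ht)
  rw [lt_div_iff₀ hC0] at hℓ
  linarith

/-- The integral of a one-form along a horizontal loop, in terms of the vanishing order. -/
theorem exists_integral_norm_le {q : ℕ} (hq : 1 ≤ q) {h : Fin n → V → F}
    (hh : ∀ j, Z.IsBigOBox (q - Z.weight j) (h j)) : ∃ ε > 0, ∃ C ≥ 0, ∀ γ,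
      𝔫.IsHorizontalLoop γ → 𝔫.length γ < ε →
        ∫ t in (0 : ℝ)..1, ‖∑ j, Z.basis.repr (deriv γ t) j • h j (γ t)‖ ≤ C * 𝔫.length γ ^ q := by
  obtain ⟨C₁, hC₁, hbox⟩ := Z.exists_ballBox
  have hC0 : 0 < C₁ := one_pos.trans_le hC₁
  choose C hC ρ₀ hρ₀ hb using hh
  obtain ⟨r, hr, hrle⟩ : ∃ r ∈ Ioc (0 : ℝ) 1, ∀ i, r ≤ ρ₀ i := by
    rcases isEmpty_or_nonempty (Fin n) with he | he
    · exact ⟨1, ⟨one_pos, le_rfl⟩, fun i => he.elim i⟩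
    · obtain ⟨i, hi⟩ := Finite.exists_min ρ₀
      exact ⟨ρ₀ i, hρ₀ i, hi⟩
  refine ⟨r / C₁, div_pos hr.1 hC0, (∑ j, C j) * C₁ ^ q,
    mul_nonneg (Finset.sum_nonneg fun j _ => hC j) (pow_nonneg hC0.le _), fun γ hγ hℓ => ?_⟩
  have hℓ0 : 0 ≤ 𝔫.length γ := StratifiedLieAlgebra.IsHorizontalLoop.length_nonneg γ
  set ρ := C₁ * 𝔫.length γ with hρdef
  have hρ : ρ ∈ Icc 0 r := ⟨mul_nonneg hC0.le hℓ0, by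
    rw [lt_div_iff₀ hC0] at hℓ
    linarith⟩
  have hρ1 : ρ ≤ 1 := hρ.2.trans hr.2
  obtain ⟨h1, h2⟩ := hbox γ hγ
  have h3 : ∀ᵐ t ∂volume.restrict (Ioc (0 : ℝ) 1),
      ‖∑ j, Z.basis.repr (deriv γ t) j • h j (γ t)‖ ≤
        (∑ j, C j) * C₁ * ρ ^ (q - 1) * ‖𝔫.leftTriv (γ t) (deriv γ t)‖ := by
    rw [restrict_Ioc_eq_restrict_Icc]
    filter_upwards [h2, ae_restrict_mem measurableSet_Icc] with t ht htI
    rw [Finset.sum_mul, Finset.sum_mul, Finset.sum_mul]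
    refine norm_sum_le_of_le _ fun j _ => ?_
    have h4 := hb j ρ ⟨hρ.1, hρ.2.trans (hrle j)⟩ (γ t) (h1 t htI)
    -- The velocity contributes w_j - 1 powers and the coefficient q - w_j, together at least q - 1
    -- despite truncation; the last power is the length left over from the integral of the speed.
    have h5 : ρ ^ (Z.weight j - 1) * ρ ^ (q - Z.weight j) ≤ ρ ^ (q - 1) := by
      rw [← pow_add]
      exact pow_le_pow_of_le_one hρ.1 hρ1 (by have := Z.one_le_weight j; omega)
    rw [norm_smul, Real.norm_eq_abs]
    calc |Z.basis.repr (deriv γ t) j| * ‖h j (γ t)‖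
        ≤ (C₁ * ‖𝔫.leftTriv (γ t) (deriv γ t)‖ * ρ ^ (Z.weight j - 1)) *
            (C j * ρ ^ (q - Z.weight j)) :=
          mul_le_mul (ht j) h4 (norm_nonneg _)
            (mul_nonneg (mul_nonneg hC0.le (norm_nonneg _)) (pow_nonneg hρ.1 _))
      _ = (C j * C₁ * ‖𝔫.leftTriv (γ t) (deriv γ t)‖) *
            (ρ ^ (Z.weight j - 1) * ρ ^ (q - Z.weight j)) := by ring
      _ ≤ (C j * C₁ * ‖𝔫.leftTriv (γ t) (deriv γ t)‖) * ρ ^ (q - 1) :=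
          mul_le_mul_of_nonneg_left h5
            (mul_nonneg (mul_nonneg (hC j) hC0.le) (norm_nonneg _))
      _ = _ := by ring
  have h6 := hγ.intervalIntegrable_leftTriv.norm.const_mul ((∑ j, C j) * C₁ * ρ ^ (q - 1))
  calc ∫ t in (0 : ℝ)..1, ‖∑ j, Z.basis.repr (deriv γ t) j • h j (γ t)‖
      ≤ ∫ t in (0 : ℝ)..1, (∑ j, C j) * C₁ * ρ ^ (q - 1) * ‖𝔫.leftTriv (γ t) (deriv γ t)‖ := by
        rw [intervalIntegral.integral_of_le zero_le_one, intervalIntegral.integral_of_le zero_le_one]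
        exact integral_mono_of_nonneg (Eventually.of_forall fun t => norm_nonneg _)
          ((intervalIntegrable_iff_integrableOn_Ioc_of_le zero_le_one).1 h6) h3
    _ = (∑ j, C j) * C₁ * ρ ^ (q - 1) * 𝔫.length γ := by
        rw [intervalIntegral.integral_const_mul]; rfl
    _ = (∑ j, C j) * C₁ ^ q * 𝔫.length γ ^ q := by
        obtain ⟨q', rfl⟩ : ∃ q', q = q' + 1 := ⟨q - 1, by omega⟩
        rw [hρdef, Nat.add_sub_cancel, mul_pow, pow_succ, pow_succ]
        ring

theorem apply_eq_sum {b : V →L[ℝ] F} (v : V) :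
    b v = ∑ j, Z.basis.repr v j • b (Z.basis j) := by
  conv_lhs => rw [← Z.basis.sum_repr v]
  simp only [map_sum, map_smul]

theorem intervalIntegrable_oneForm {h : Fin n → V → F} (hh : ∀ j, Continuous (h j)) {γ : ℝ → V}
    (hγ : 𝔫.IsHorizontalLoop γ) : IntervalIntegrable
      (fun t => ∑ j, Z.basis.repr (deriv γ t) j • h j (γ t)) volume 0 1 := by
  have h1 : ContinuousOn (fun t => ∑ j, (Z.coordCLM j).smulRight (h j (γ t))) (uIcc 0 1) :=
    continuousOn_finsetSum _ fun j _ =>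
      ((ContinuousLinearMap.smulRightL ℝ V F (Z.coordCLM j)).continuous.comp_continuousOn
        ((hh j).comp_continuousOn hγ.absolutelyContinuous.continuousOn))
  refine (hγ.intervalIntegrable_deriv.continuousOn_clm_apply h1).congr fun t _ => ?_
  simp [sum_apply]

/-- A two-form `∑ uᵢ vⱼ cᵢⱼ` integrated over a radial disk. -/
theorem diskIntegral_eq {α : V → V → V → F} {c : Fin n → Fin n → V → F}
    (hc : ∀ i j, Continuous (c i j))
    (hα : ∀ x u v, α x u v = ∑ i, ∑ j, (Z.basis.repr u i * Z.basis.repr v j) • c i j x)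
    {γ : ℝ → V} (hγ : AbsolutelyContinuousOnInterval γ 0 1) :
    Z.diskIntegral α γ = ∫ t in (0 : ℝ)..1, ∑ j, Z.basis.repr (deriv γ t) j •
      Z.radialIntegral (fun i => c i j) (Z.weight j) (γ t) := by
  refine intervalIntegral.integral_congr_ae ?_
  filter_upwards [hγ.ae_differentiableAt_of_finiteDimensional] with t ht htI
  have hd := (ht (uIoc_subset_uIcc htI)).hasDerivAt
  have h1 : ∀ s, deriv (fun t' => Z.dilation s (γ t')) t = Z.dilation s (deriv γ t) := fun s => by
    have := ((Z.dilationCLM s).hasFDerivAt.comp_hasDerivAt t hd).deriv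
    simpa only [Z.dilationCLM_apply, Function.comp_def] using this
  have h2 : ∀ s, α (Z.dilation s (γ t)) (deriv (fun s' => Z.dilation s' (γ t)) s)
      -- The radial direction of the disk gives wᵢ xᵢ s^{wᵢ - 1} and the dilated velocity gives
      -- s^{w_j}: the same kernel as in the formula recovering A from its curvature.
      (deriv (fun t' => Z.dilation s (γ t')) t) = ∑ j, Z.basis.repr (deriv γ t) j •
        ∑ i, ((Z.weight i : ℝ) * Z.basis.repr (γ t) i * s ^ (Z.weight i + Z.weight j - 1)) •
          c i j (Z.dilation s (γ t)) := by
    intro s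
    rw [hα, (Z.hasDerivAt_dilation s (γ t)).deriv, h1, Finset.sum_comm]
    refine Finset.sum_congr rfl fun j _ => ?_
    rw [Finset.smul_sum]
    refine Finset.sum_congr rfl fun i _ => ?_
    have := Z.one_le_weight i
    rw [smul_smul, Z.repr_rayVelocity, Z.repr_dilation,
      show Z.weight i + Z.weight j - 1 = (Z.weight i - 1) + Z.weight j by omega, pow_add]
    congr 1
    ring
  simp only [h2]
  rw [intervalIntegral.integral_finsetSum]
  · refine Finset.sum_congr rfl fun j _ => ?_
    rw [intervalIntegral.integral_smul]
    rfl
  · intro j _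
    exact (((continuous_radialIntegrand (fun i => hc i j) (Z.weight j)).comp
      (continuous_const.prodMk continuous_id)).intervalIntegrable 0 1).smul _

end AdaptedBasis

end LoopEstimates

/-! ### The logarithm of the holonomy of a short loop. -/

section LogarithmOfHolonomy

open Filter Topology

variable {V : Type*} [NormedAddCommGroup V] [InnerProductSpace ℝ V] [FiniteDimensional ℝ V]
  {EG : Type*} [NormedAddCommGroup EG] [NormedSpace ℝ EG] [FiniteDimensional ℝ EG]
  {G : Type*} [TopologicalSpace G] [ChartedSpace EG G] [Group G] [LieGroup 𝓘(ℝ, EG) ∞ G]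
  {EP : Type*} [NormedAddCommGroup EP] [NormedSpace ℝ EP] [FiniteDimensional ℝ EP]
  {P : Type*} [TopologicalSpace P] [ChartedSpace EP P] [MulAction Gᵐᵒᵖ P]

namespace PrincipalConnection

variable [IsManifold 𝓘(ℝ, EP) ∞ P] {B : SmoothPrincipalBundle V (EG := EG) G (EP := EP) P}
  (conn : PrincipalConnection B)

/-- The holonomy of a short loop is the exponential of the integral of the connection form, up to a
quadratic error. -/
theorem exists_holonomy_eq_lieExp [T2Space G] [T2Space P] (g : B.Gauge) :
    ∃ η > 0, ∃ C ≥ 0, ∀ γ : ℝ → V, AbsolutelyContinuousOnInterval γ 0 1 → γ 1 = γ 0 →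
      (∀ t ∈ Icc (0 : ℝ) 1, γ t ∈ g.dom) → ∫ s in (0 : ℝ)..1, ‖conn.control g γ s‖ ≤ η →
      ∃ H : EG, conn.holonomy (g.sec (γ 0)) γ = lieExp G H ∧
        ‖H - ∫ s in (0 : ℝ)..1, conn.control g γ s‖ ≤
          C * (∫ s in (0 : ℝ)..1, ‖conn.control g γ s‖) ^ 2 := by
  obtain ⟨κ⟩ := nonempty_controlCutoff (EG := EG) (G := G)
  obtain ⟨log, K, hlog⟩ := exists_chart_log (EG := EG) (G := G)
  obtain ⟨r, hr, hball⟩ := Metric.eventually_nhds_iff.1 hlog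
  have hb := κ.bound_nonneg
  have hl : (0 : ℝ) ≤ κ.lip := κ.lip.2
  refine ⟨min κ.small (r / (2 * (κ.bound + 1))), lt_min κ.small_pos (by positivity),
    |K| * κ.bound ^ 2 + κ.lip * κ.bound, by positivity, fun γ hγ hloop hd hη => ?_⟩
  set I := ∫ s in (0 : ℝ)..1, ‖conn.control g γ s‖ with hI
  have hI0 : 0 ≤ I := intervalIntegral.integral_nonneg zero_le_one fun _ _ => norm_nonneg _
  obtain ⟨z, hz, hzt, hzn, hhol⟩ := conn.holonomy_eq g κ hγ hloop hd (hη.trans (min_le_left _ _))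
  have h1 : (1 : ℝ) ∈ Icc (0 : ℝ) 1 := by norm_num
  have h2 : I ≤ r / (2 * (κ.bound + 1)) := hη.trans (min_le_right _ _)
  rw [le_div_iff₀ (by positivity)] at h2
  have hzr : dist (z 1) (chartOne G) < r := by
    rw [dist_eq_norm]
    refine (hzn 1 h1).trans_lt ?_
    nlinarith
  obtain ⟨hexp, hquad⟩ := hball hzr
  refine ⟨log (z 1), by rw [hhol, hexp], ?_⟩
  have hκ1 : ∀ u, κ.toFun (chartOne G) u = u := fun u => by
    rw [κ.eq_chartRight _ (Metric.mem_ball_self κ.radius_pos), chartRight_one,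
      ContinuousLinearMap.id_apply]
  have hu := conn.intervalIntegrable_control g hγ (by rwa [uIcc_of_le zero_le_one])
  -- Compare with the constant curve at the identity, where right translation is the identity
  -- operator. The system moves by at most a multiple of the L¹ norm of the control, so freezing the
  -- coefficient costs its square.
  have h3 := norm_integral_control_sub_le κ.lipschitzWith zero_le_one
    (left_mem_Icc.2 zero_le_one) hu hz.continuousOn (w := fun _ => chartOne G)
    continuousOn_const hzn h1
  simp only [hκ1] at h3
  rw [← sub_eq_iff_eq_add'.2 (hzt 1 h1)] at h3
  calc ‖log (z 1) - ∫ s in (0 : ℝ)..1, conn.control g γ s‖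
      = ‖(log (z 1) - (z 1 - chartOne G)) +
          (z 1 - chartOne G - ∫ s in (0 : ℝ)..1, conn.control g γ s)‖ := by
        congr 1; abel
    _ ≤ |K| * (κ.bound * I) ^ 2 + (κ.lip * I) * (κ.bound * I) := by
        refine norm_add_le_of_le (hquad.trans ?_) h3
        exact mul_le_mul (le_abs_self K) (pow_le_pow_left₀ (norm_nonneg _) (hzn 1 h1) 2)
          (by positivity) (abs_nonneg _)
    _ = _ := by ring

end PrincipalConnection

end LogarithmOfHolonomy

/-! ### The weighted Taylor expansion of the curvature -/

section CurvatureTaylor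

open Filter Topology

variable {V : Type*} [NormedAddCommGroup V] [InnerProductSpace ℝ V] [FiniteDimensional ℝ V]
  {EG : Type*} [NormedAddCommGroup EG] [NormedSpace ℝ EG] [FiniteDimensional ℝ EG]
  {G : Type*} [TopologicalSpace G] [ChartedSpace EG G] [Group G] [LieGroup 𝓘(ℝ, EG) ∞ G]
  {EP : Type*} [NormedAddCommGroup EP] [NormedSpace ℝ EP] [FiniteDimensional ℝ EP]
  {P : Type*} [TopologicalSpace P] [ChartedSpace EP P] [MulAction Gᵐᵒᵖ P]
  {𝔫 : StratifiedLieAlgebra V} {n : ℕ} (Z : AdaptedBasis 𝔫 n)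

namespace AdaptedBasis

variable {F : Type*} [NormedAddCommGroup F] [NormedSpace ℝ F]

/-- Exchanging i and j shows that both halves of the antisymmetrized sum agree, which cancels the
factor ½. -/
theorem twoFormComponent_eq {c : Fin n → Fin n → ℕ → V → F}
    (hc : ∀ i j r x, c i j r x = -c j i r x) (m : ℕ) (x u v : V) :
    Z.twoFormComponent c m x u v = ∑ i, ∑ j, if Z.weight i + Z.weight j ≤ m then
      (Z.basis.repr u i * Z.basis.repr v j) • c i j (m - (Z.weight i + Z.weight j)) x else 0 := by
  set S := ∑ i, ∑ j, if Z.weight i + Z.weight j ≤ m then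
    (Z.basis.repr u i * Z.basis.repr v j) • c i j (m - (Z.weight i + Z.weight j)) x else 0 with hS
  have h1 : S = ∑ i, ∑ j, if Z.weight i + Z.weight j ≤ m then
      -((Z.basis.repr u j * Z.basis.repr v i) • c i j (m - (Z.weight i + Z.weight j)) x)
        else 0 := by
    rw [hS, Finset.sum_comm]
    refine Finset.sum_congr rfl fun i _ => Finset.sum_congr rfl fun j _ => ?_
    rw [add_comm (Z.weight j), hc j i, smul_neg]
  have h2 : ∑ i, ∑ j, (if Z.weight i + Z.weight j ≤ m then
      (Z.basis.repr u i * Z.basis.repr v j - Z.basis.repr u j * Z.basis.repr v i) •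
        c i j (m - (Z.weight i + Z.weight j)) x else 0) = S + S := by
    nth_rewrite 2 [h1]
    rw [hS, ← Finset.sum_add_distrib]
    refine Finset.sum_congr rfl fun i _ => ?_
    rw [← Finset.sum_add_distrib]
    refine Finset.sum_congr rfl fun j _ => ?_
    split_ifs
    · rw [sub_smul, sub_eq_add_neg]
    · rw [add_zero]
  rw [twoFormComponent, h2, ← two_smul ℝ S, smul_smul, inv_mul_cancel₀ two_ne_zero, one_smul]

/-- Recovers the coefficients from the two-form, so that vanishing of the components of low weight
passes to the coefficients. -/
theorem twoFormComponent_basis {c : Fin n → Fin n → ℕ → V → F}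
    (hc : ∀ i j r x, c i j r x = -c j i r x) (i j : Fin n) (r : ℕ) (x : V) :
    Z.twoFormComponent c (r + (Z.weight i + Z.weight j)) x (Z.basis i) (Z.basis j) = c i j r x := by
  rw [Z.twoFormComponent_eq hc, Finset.sum_eq_single i, Finset.sum_eq_single j]
  · simp
  · intro b _ hb
    simp [hb.symm]
  · simp
  · intro a _ ha
    refine Finset.sum_eq_zero fun b _ => ?_
    simp [ha.symm]
  · simp

theorem sum_range_ite_sub (h : ℕ → F) (w K : ℕ) :
    ∑ m ∈ Finset.range K, (if w ≤ m then h (m - w) else 0) = ∑ r ∈ Finset.range (K - w), h r := by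
  induction K with
  | zero => simp
  | succ K ih =>
    rw [Finset.sum_range_succ, ih]
    split_ifs with hw
    · rw [Nat.succ_sub hw, Finset.sum_range_succ]
    · rw [add_zero, show K + 1 - w = K - w by omega]

theorem sum_twoFormComponent_eq {c : Fin n → Fin n → ℕ → V → F}
    (hc : ∀ i j r x, c i j r x = -c j i r x) (K : ℕ) (x u v : V) :
    ∑ m ∈ Finset.range K, Z.twoFormComponent c m x u v =
      ∑ i, ∑ j, (Z.basis.repr u i * Z.basis.repr v j) •
        ∑ r ∈ Finset.range (K - (Z.weight i + Z.weight j)), c i j r x := by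
  simp only [Z.twoFormComponent_eq hc]
  rw [Finset.sum_comm]
  refine Finset.sum_congr rfl fun i _ => ?_
  rw [Finset.sum_comm]
  refine Finset.sum_congr rfl fun j _ => ?_
  rw [Finset.smul_sum]
  exact sum_range_ite_sub (fun r => (Z.basis.repr u i * Z.basis.repr v j) • c i j r x) _ K

theorem continuous_taylorComponent {u : V → F} (hu : ContDiff ℝ ∞ u) (m : ℕ) :
    Continuous (Z.taylorComponent u m) := by
  have h : Z.taylorComponent u m = fun x => _ := funext fun x => Z.taylorComponent_eq_sum hu m x
  rw [h]
  exact continuous_finsetSum _ fun j _ => continuous_finsetSum _ fun μ _ =>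
    ((continuous_finsetProd _ fun a _ => (Z.contDiff_repr (μ a)).continuous).div_const _).smul
      continuous_const

end AdaptedBasis

namespace PrincipalConnection

variable [IsManifold 𝓘(ℝ, EP) ∞ P] {B : SmoothPrincipalBundle V (EG := EG) G (EP := EP) P}
  (conn : PrincipalConnection B)

/-- The weighted components are those of the Taylor expansion in the radial gauge. -/
theorem weightedComponent_eq [T2Space P] {g : B.Gauge} (h0 : (0 : V) ∈ g.dom)
    (hrad : ∀ᶠ x in 𝓝 (0 : V), conn.gaugeForm g x (Z.rayVelocity 1 x) = 0) {f : P → EG} {u : V → EG}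
    (hu : ContDiff ℝ ∞ u) (hf : (fun x => f (g.sec x)) =ᶠ[𝓝 0] u) (m : ℕ) (x : V) :
    conn.weightedComponent Z (g.sec 0) f m x = Z.taylorComponent u m x := by
  have hdil : Tendsto (fun s => Z.dilation s x) (𝓝[≥] 0) (𝓝 0) := by
    have h := (Z.hasDerivAt_dilation 0 x).continuousAt.tendsto
    rw [Z.dilation_zero_left] at h
    exact h.mono_left nhdsWithin_le_nhds
  have h1 : (fun s => f (conn.curveLift (fun s' => Z.dilation s' x) (g.sec 0) s)) =ᶠ[𝓝[≥] 0]
      fun s => u (Z.dilation s x) := by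
    filter_upwards [conn.curveLift_ray Z h0 hrad x, hdil.eventually hf] with s hs1 hs2
    rw [hs1, hs2]
  have h2 := h1.filter_mono (nhdsWithin_mono (0 : ℝ) (s := Icc 0 1) (t := Ici 0)
    fun _ h => h.1)
  have h01 : (0 : ℝ) ∈ Icc (0 : ℝ) 1 := by norm_num
  rw [weightedComponent, AdaptedBasis.taylorComponent, h2.iteratedDerivWithin_eq
    (h2.self_of_nhdsWithin h01), iteratedDerivWithin_eq_iteratedDeriv
    (uniqueDiffOn_Icc zero_lt_one)
    ((AdaptedBasis.contDiff_comp_dilation hu x).contDiffAt.of_le (by exact_mod_cast le_top)) h01]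

/-- Besides bilinearity, this is all that is used about the quadratic term; it need not be
identified with the bracket. -/
theorem curvBilin_antisymm (ξ η : EG) : curvBilin EG G ξ η = -curvBilin EG G η ξ := by
  simp [curvBilin]
  abel

/-- The curvature in a gauge, for a globally defined local connection form. -/
theorem curvatureCoeff_sec_eventuallyEq {g : B.Gauge} {x₀ : V} (h0 : x₀ ∈ g.dom) {A : V → V →L[ℝ] EG}
    (hA : A =ᶠ[𝓝 x₀] conn.gaugeForm g) (i j : Fin n) :
    (fun x => conn.curvatureCoeff Z i j (g.sec x)) =ᶠ[𝓝 x₀]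
      Z.formCurvature (curvBilin EG G) A i j := by
  filter_upwards [g.isOpen_dom.mem_nhds h0, hA.eventuallyEq_nhds] with x hx hAx
  rw [conn.curvatureCoeff_sec Z g hx, AdaptedBasis.formCurvature, hAx.fderiv_eq, hAx.self_of_nhds]

theorem IsEquivariantField.iterCovDeriv {f : P → EG} (hf : IsEquivariantField B f) (l : List V) :
    IsEquivariantField B (conn.iterCovDeriv l f) := by
  induction l with
  | nil => exact hf
  | cons v l ih => exact ih.covDeriv conn v

/-- Iterated covariant derivatives in a gauge. -/
theorem iterCovDeriv_sec_eventuallyEq {g : B.Gauge} {x₀ : V} (h0 : x₀ ∈ g.dom)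
    {A : V → V →L[ℝ] EG} (hA : A =ᶠ[𝓝 x₀] conn.gaugeForm g) {f : P → EG}
    (hf : IsEquivariantField B f) {u : V → EG} (hu : (fun x => f (g.sec x)) =ᶠ[𝓝 x₀] u)
    (l : List V) : (fun x => conn.iterCovDeriv l f (g.sec x)) =ᶠ[𝓝 x₀]
      l.foldr (AdaptedBasis.localCovDeriv (adDeriv EG G) A) u := by
  induction l with
  | nil => exact hu
  | cons v l ih =>
    filter_upwards [g.isOpen_dom.mem_nhds h0, hA, ih.eventuallyEq_nhds] with x hx hAx hx'
    have h1 := (hf.iterCovDeriv conn l).covDeriv_sec conn g hx v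
    have h2 : conn.iterCovDeriv (v :: l) f (g.sec x) =
      conn.covDeriv v (conn.iterCovDeriv l f) (g.sec x) := rfl
    have h3 : conn.iterCovDeriv l f (g.sec x) = _ := hx'.self_of_nhds
    rw [h2, h1, hx'.fderiv_eq, h3, ← hAx]
    rfl

/-- If the weight is infinite, M = k + 1 serves; otherwise M is the weight itself. -/
theorem exists_nat_weight {p : P} {k : ℕ} (hk : (k : ℕ∞) < 2 * conn.curvatureWeight Z p) :
    ∃ M : ℕ, k < 2 * M ∧ ∀ j < M, ∀ x u v, conn.curvatureComponent Z p j x u v = 0 := by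
  have h : ∀ j : ℕ, (j : ℕ∞) < conn.curvatureWeight Z p →
      ∀ x u v, conn.curvatureComponent Z p j x u v = 0 := by
    intro j hj
    obtain ⟨m, hm, hjm⟩ := lt_sSup_iff.1 hj
    exact hm j hjm
  rcases eq_or_ne (conn.curvatureWeight Z p) ⊤ with htop | htop
  · exact ⟨k + 1, by omega, fun j _ => h j (by rw [htop]; exact ENat.natCast_lt_top j)⟩
  · obtain ⟨M, hM⟩ := ENat.ne_top_iff_exists.1 htop
    rw [← hM] at hk h
    exact ⟨M, by exact_mod_cast hk, fun j hj => h j (by exact_mod_cast hj)⟩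

/-- The local connection form in the radial gauge at a point over the identity, with its vanishing
order. -/
theorem exists_radial_form [T2Space P] {p : P} (hp : B.proj p = 0) {M : ℕ}
    (hM : ∀ j < M, ∀ x u v, conn.curvatureComponent Z p j x u v = 0) :
    ∃ (g : B.Gauge) (A : V → V →L[ℝ] EG), (0 : V) ∈ g.dom ∧ g.sec 0 = p ∧ ContDiff ℝ ∞ A ∧
      A =ᶠ[𝓝 0] conn.gaugeForm g ∧ (∀ᶠ x in 𝓝 (0 : V), A x (Z.rayVelocity 1 x) = 0) ∧
      (∀ i j m x, conn.weightedComponent Z p (conn.curvatureCoeff Z i j) m x =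
        Z.taylorComponent (Z.formCurvature (curvBilin EG G) A i j) m x) ∧
      (∀ i j m x, conn.weightedComponent Z p (conn.curvatureCoeff Z i j) m x =
        -conn.weightedComponent Z p (conn.curvatureCoeff Z j i) m x) ∧
      (∀ i j, Z.VanishesTo (M - (Z.weight i + Z.weight j))
        (Z.formCurvature (curvBilin EG G) A i j)) ∧
      ∀ j, Z.VanishesTo (M - Z.weight j) fun x => A x (Z.basis j) := by
  obtain ⟨g, h0, rfl, hrad⟩ := conn.exists_radial_gauge Z hp
  obtain ⟨A, hA, -, hAe⟩ := exists_contDiff_eventuallyEq g.isOpen_dom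
    (conn.contDiffOn_gaugeForm g) h0
  have hradA : ∀ᶠ x in 𝓝 (0 : V), A x (Z.rayVelocity 1 x) = 0 := by
    filter_upwards [hrad, hAe] with x hx hx'
    rw [hx', hx]
  have hw : ∀ i j m x, conn.weightedComponent Z (g.sec 0) (conn.curvatureCoeff Z i j) m x =
      Z.taylorComponent (Z.formCurvature (curvBilin EG G) A i j) m x := fun i j m x =>
    conn.weightedComponent_eq Z h0 hrad (Z.contDiff_formCurvature hA i j)
      (conn.curvatureCoeff_sec_eventuallyEq Z h0 hAe i j) m x
  have hanti : ∀ i j m x, conn.weightedComponent Z (g.sec 0) (conn.curvatureCoeff Z i j) m x =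
      -conn.weightedComponent Z (g.sec 0) (conn.curvatureCoeff Z j i) m x := by
    intro i j m x
    have h1 : Z.formCurvature (curvBilin EG G) A i j =
        fun x => -Z.formCurvature (curvBilin EG G) A j i x := by
      funext x
      rw [AdaptedBasis.formCurvature, AdaptedBasis.formCurvature, curvBilin_antisymm]
      abel
    rw [hw, hw, h1, AdaptedBasis.taylorComponent, AdaptedBasis.taylorComponent,
      iteratedDeriv_fun_neg, smul_neg]
  have hvan : ∀ i j, Z.VanishesTo (M - (Z.weight i + Z.weight j))
      (Z.formCurvature (curvBilin EG G) A i j) := by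
    intro i j
    refine (AdaptedBasis.vanishesTo_iff (Z.contDiff_formCurvature hA i j)).2 fun r hr x => ?_
    rw [← hw, ← Z.twoFormComponent_basis hanti i j r x]
    exact hM (r + (Z.weight i + Z.weight j)) (by omega) x _ _
  exact ⟨g, A, h0, rfl, hA, hAe, hradA, hw, hanti, hvan, fun j =>
    Z.vanishesTo_apply_basis hA hradA j fun i => hvan i j⟩

/-- The Taylor polynomial of the curvature consists of its covariant derivatives. -/
theorem curvatureTaylor_eq_covariantTaylor [T2Space P] {p : P} (hp : B.proj p = 0) {k : ℕ}
    (hk : (k : ℕ∞) < 2 * conn.curvatureWeight Z p) :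
    conn.curvatureTaylor Z p k = conn.covariantTaylor Z p k := by
  obtain ⟨M, hkM, hM⟩ := conn.exists_nat_weight Z hk
  obtain ⟨g, A, h0, rfl, hA, hAe, -, hw, -, hvan, hAvan⟩ := conn.exists_radial_form Z hp hM
  funext x u v
  refine Finset.sum_congr rfl fun m hm => ?_
  rw [Finset.mem_range] at hm
  rw [curvatureComponent, AdaptedBasis.twoFormComponent, AdaptedBasis.twoFormComponent]
  congr 1
  refine Finset.sum_congr rfl fun i _ => Finset.sum_congr rfl fun j _ => ?_
  split_ifs with hij
  swap
  · rfl
  rw [hw, Z.taylorComponent_eq_sum (Z.contDiff_formCurvature hA i j), covariantComponent]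
  congr 1
  refine Finset.sum_congr rfl fun d _ => Finset.sum_congr rfl fun μ hμ => ?_
  rw [Finset.mem_filter] at hμ
  congr 1
  have h1 : (List.ofFn fun a => Z.basis (μ a)) = (List.ofFn μ).map Z.basis := by
    rw [List.map_ofFn]; rfl
  have h2 : ((List.ofFn μ).map Z.weight).sum = m - (Z.weight i + Z.weight j) := by
    rw [List.map_ofFn, List.sum_ofFn]; exact hμ.2
  have h3 := (conn.iterCovDeriv_sec_eventuallyEq h0 hAe
    (conn.isEquivariantField_curvatureCoeff Z i j)
    (conn.curvatureCoeff_sec_eventuallyEq Z h0 hAe i j)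
    ((List.ofFn μ).map Z.basis)).self_of_nhds
  rw [h1]
  refine Eq.trans ?_ h3.symm
  -- The word has weight m - (wᵢ + w_j) with m ≤ k < 2M, which is less than M + (M - (wᵢ + w_j)).
  -- This is where the bound 2 m_Ω comes from.
  exact (Z.iterate_localCovDeriv_apply_zero hA (Z.contDiff_formCurvature hA i j) hAvan (hvan i j)
    (by rw [h2]; omega)).symm

/-- The holonomy of short horizontal loops in terms of the Taylor polynomial of the curvature. -/
theorem exists_holonomy_eq_lieExp_taylorFunctional [T2Space G] [T2Space P] {p : P}
    (hp : B.proj p = 0) {k : ℕ} (hk : (k : ℕ∞) < 2 * conn.curvatureWeight Z p) :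
    ∃ ε > (0 : ℝ), ∃ C : ℝ, ∀ γ : ℝ → V, 𝔫.IsHorizontalLoop γ → 𝔫.length γ < ε →
      ∃ R : EG, ‖R‖ ≤ C * 𝔫.length γ ^ (k + 1) ∧
        conn.holonomy p γ = lieExp G (-conn.taylorFunctional Z p k γ + R) := by
  obtain ⟨M, hkM, hM⟩ := conn.exists_nat_weight Z hk
  obtain ⟨g, A, h0, rfl, hA, hAe, hrad, hw, hanti, hvan, hAvan⟩ := conn.exists_radial_form Z hp hM
  have hfs := fun i j => Z.contDiff_formCurvature (b := curvBilin EG G) hA i j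
  -- the Taylor polynomials of the coefficients of the curvature
  let c : Fin n → Fin n → V → EG := fun i j x =>
    ∑ r ∈ Finset.range (k + 1 - (Z.weight i + Z.weight j)),
      conn.weightedComponent Z (g.sec 0) (conn.curvatureCoeff Z i j) r x
  have hcdef : ∀ i j x, c i j x = ∑ r ∈ Finset.range (k + 1 - (Z.weight i + Z.weight j)),
      Z.taylorComponent (Z.formCurvature (curvBilin EG G) A i j) r x := fun i j x =>
    Finset.sum_congr rfl fun r _ => hw i j r x
  have hc : ∀ i j, Continuous (c i j) := fun i j => by
    rw [funext (hcdef i j)]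
    exact continuous_finsetSum _ fun r _ => Z.continuous_taylorComponent (hfs i j) r
  have hα : ∀ x u v, conn.curvatureTaylor Z (g.sec 0) k x u v =
      ∑ i, ∑ j, (Z.basis.repr u i * Z.basis.repr v j) • c i j x := fun x u v =>
    Z.sum_twoFormComponent_eq hanti (k + 1) x u v
  have hrem : ∀ i j, Z.IsBigOBox (k + 1 - (Z.weight i + Z.weight j))
      fun y => Z.formCurvature (curvBilin EG G) A i j y - c i j y := by
    intro i j
    obtain ⟨C, hC, hb⟩ := AdaptedBasis.exists_taylor_remainder_bound (Z := Z) (hfs i j)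
      (k + 1 - (Z.weight i + Z.weight j))
    refine ⟨C, hC, 1, ⟨one_pos, le_rfl⟩, fun ρ hρ x hx => ?_⟩
    change ‖_ - c i j x‖ ≤ _
    rw [hcdef]
    exact hb ρ hρ x hx
  -- Two uses of the loop estimate: A itself with order M, and the one-form built from the Taylor
  -- remainder of the curvature with order k + 1.
  obtain ⟨ε₁, hε₁, C₁, hC₁, hint₁⟩ := Z.exists_integral_norm_le (q := M) (by omega)
    fun j => (hAvan j).isBigOBox (hA.clm_apply contDiff_const)
  obtain ⟨ε₂, hε₂, C₂, hC₂, hint₂⟩ := Z.exists_integral_norm_le (q := k + 1) (by omega)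
    fun j => AdaptedBasis.IsBigOBox.radialIntegral (w := Z.weight j) (q := k + 1 - Z.weight j)
      (fun i => hrem i j) fun i => by omega
  obtain ⟨η, hη, C₃, hC₃, hhol⟩ := conn.exists_holonomy_eq_lieExp g
  have hdom : ∀ᶠ x in 𝓝 (0 : V), x ∈ g.dom := g.isOpen_dom.mem_nhds h0
  obtain ⟨ε₃, hε₃, hloop⟩ := Z.exists_forall_loop_mem (hdom.and (hAe.and
    (eventually_all.2 (Z.apply_basis_eq_radialIntegral (b := curvBilin EG G) hA hrad))))
  -- The bound 1 allows exponents of ℓ to be lowered, and η / (C₁ + 1) ensures C₁ ℓ^M ≤ η, so that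
  -- the logarithm of the holonomy is available.
  refine ⟨min (min ε₁ ε₂) (min (min ε₃ 1) (η / (C₁ + 1))), by positivity, C₃ * C₁ ^ 2 + C₂,
    fun γ hγ hℓ => ?_⟩
  simp only [lt_min_iff] at hℓ
  obtain ⟨⟨hℓ₁, hℓ₂⟩, ⟨hℓ₃, hℓ1⟩, hℓη⟩ := hℓ
  have hℓ0 : 0 ≤ 𝔫.length γ := StratifiedLieAlgebra.IsHorizontalLoop.length_nonneg γ
  have hmem : ∀ t ∈ Icc (0 : ℝ) 1, γ t ∈ g.dom ∧ A (γ t) = conn.gaugeForm g (γ t) ∧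
      ∀ j, A (γ t) (Z.basis j) = Z.radialIntegral
        (fun i => Z.formCurvature (curvBilin EG G) A i j) (Z.weight j) (γ t) := hloop γ hγ hℓ₃
  have hAγ : ∀ t ∈ Icc (0 : ℝ) 1, conn.control g γ t =
      -∑ j, Z.basis.repr (deriv γ t) j • A (γ t) (Z.basis j) := fun t ht => by
    rw [control, ← (hmem t ht).2.1, Z.apply_eq_sum]
  have hnorm : ∫ t in (0 : ℝ)..1, ‖conn.control g γ t‖ ≤ C₁ * 𝔫.length γ ^ M := by
    refine le_of_eq_of_le (intervalIntegral.integral_congr fun t ht => ?_) (hint₁ γ hγ hℓ₁)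
    rw [uIcc_of_le zero_le_one] at ht
    simp only [hAγ t ht, norm_neg]
  have hnorm0 : 0 ≤ ∫ t in (0 : ℝ)..1, ‖conn.control g γ t‖ :=
    intervalIntegral.integral_nonneg zero_le_one fun _ _ => norm_nonneg _
  have hsmall : C₁ * 𝔫.length γ ^ M ≤ η := by
    have h1 : 𝔫.length γ ^ M ≤ 𝔫.length γ := pow_le_of_le_one hℓ0 hℓ1.le (by omega)
    rw [lt_div_iff₀ (by positivity)] at hℓη
    nlinarith
  obtain ⟨H, hH, hHb⟩ := hhol γ hγ.absolutelyContinuous (hγ.target.trans hγ.source.symm)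
    (fun t ht => (hmem t ht).1) (hnorm.trans hsmall)
  rw [hγ.source] at hH
  -- the integral of the connection form against the radial disk
  have hdiff : ‖conn.taylorFunctional Z (g.sec 0) k γ + ∫ t in (0 : ℝ)..1, conn.control g γ t‖ ≤
      C₂ * 𝔫.length γ ^ (k + 1) := by
    have h1 : ∫ t in (0 : ℝ)..1, conn.control g γ t = -∫ t in (0 : ℝ)..1,
        ∑ j, Z.basis.repr (deriv γ t) j • Z.radialIntegral
          (fun i => Z.formCurvature (curvBilin EG G) A i j) (Z.weight j) (γ t) := by
      rw [← intervalIntegral.integral_neg]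
      refine intervalIntegral.integral_congr fun t ht => ?_
      rw [uIcc_of_le zero_le_one] at ht
      simp only [hAγ t ht, (hmem t ht).2.2]
    have hi₁ := Z.intervalIntegrable_oneForm (fun j => AdaptedBasis.continuous_radialIntegral (Z := Z)
      (fun i => hc i j) (Z.weight j)) hγ
    have hi₂ := Z.intervalIntegrable_oneForm (fun j => AdaptedBasis.continuous_radialIntegral (Z := Z)
      (fun i => (hfs i j).continuous) (Z.weight j)) hγ
    -- Both terms are integrals of radial integrals along γ, one of the Taylor polynomial and one of
    -- the full curvature, so only the remainder survives in the difference.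
    rw [taylorFunctional, Z.diskIntegral_eq hc hα hγ.absolutelyContinuous, h1, ← sub_eq_add_neg,
      ← norm_neg, neg_sub, ← intervalIntegral.integral_sub hi₂ hi₁]
    refine (intervalIntegral.norm_integral_le_integral_norm zero_le_one).trans
      (le_of_eq_of_le (intervalIntegral.integral_congr fun t _ => ?_) (hint₂ γ hγ hℓ₂))
    simp only [← Finset.sum_sub_distrib, ← smul_sub]
    congr 1
    refine Finset.sum_congr rfl fun j _ => ?_
    rw [AdaptedBasis.radialIntegral_sub (fun i => (hfs i j).continuous) fun i => hc i j]
  refine ⟨H + conn.taylorFunctional Z (g.sec 0) k γ, ?_, by rw [hH]; congr 1; abel⟩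
  -- The quadratic error has order 2M ≥ k + 1.
  have h2 : (𝔫.length γ ^ M) ^ 2 ≤ 𝔫.length γ ^ (k + 1) := by
    rw [← pow_mul]
    exact pow_le_pow_of_le_one hℓ0 hℓ1.le (by omega)
  calc ‖H + conn.taylorFunctional Z (g.sec 0) k γ‖
      = ‖(H - ∫ t in (0 : ℝ)..1, conn.control g γ t) +
          (conn.taylorFunctional Z (g.sec 0) k γ + ∫ t in (0 : ℝ)..1, conn.control g γ t)‖ := by
        congr 1; abel
    _ ≤ C₃ * (C₁ * 𝔫.length γ ^ M) ^ 2 + C₂ * 𝔫.length γ ^ (k + 1) := by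
        refine norm_add_le_of_le (hHb.trans ?_) hdiff
        gcongr
    _ = C₃ * C₁ ^ 2 * (𝔫.length γ ^ M) ^ 2 + C₂ * 𝔫.length γ ^ (k + 1) := by ring
    _ ≤ C₃ * C₁ ^ 2 * 𝔫.length γ ^ (k + 1) + C₂ * 𝔫.length γ ^ (k + 1) := by gcongr
    _ = _ := by ring

end PrincipalConnection

end CurvatureTaylor

theorem mainTheorem3
    {V : Type*} [NormedAddCommGroup V] [InnerProductSpace ℝ V] [FiniteDimensional ℝ V]
    {EG : Type*} [NormedAddCommGroup EG] [NormedSpace ℝ EG] [FiniteDimensional ℝ EG]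
    {G : Type*} [TopologicalSpace G] [ChartedSpace EG G] [Group G] [LieGroup 𝓘(ℝ, EG) ∞ G]
    [T2Space G]
    {EP : Type*} [NormedAddCommGroup EP] [NormedSpace ℝ EP] [FiniteDimensional ℝ EP]
    {P : Type*} [TopologicalSpace P] [ChartedSpace EP P] [IsManifold 𝓘(ℝ, EP) ∞ P] [T2Space P]
    [MulAction Gᵐᵒᵖ P]
    (𝔫 : StratifiedLieAlgebra V) {n : ℕ} (Z : AdaptedBasis 𝔫 n)
    (B : SmoothPrincipalBundle V (EG := EG) G (EP := EP) P) (conn : PrincipalConnection B)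
    (p : P) (hp : B.proj p = 0) (k : ℕ) (hk : (k : ℕ∞) < 2 * conn.curvatureWeight Z p) :
    conn.curvatureTaylor Z p k = conn.covariantTaylor Z p k ∧
    ∃ ε > (0 : ℝ), ∃ C : ℝ, ∀ γ : ℝ → V, 𝔫.IsHorizontalLoop γ → 𝔫.length γ < ε →
      ∃ R : EG, ‖R‖ ≤ C * 𝔫.length γ ^ (k + 1) ∧
        conn.holonomy p γ = lieExp G (-conn.taylorFunctional Z p k γ + R) :=
  ⟨conn.curvatureTaylor_eq_covariantTaylor Z hp hk,
    conn.exists_holonomy_eq_lieExp_taylorFunctional Z hp hk⟩
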